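/- **Setting.** Let $d\ge 0$, $q\ge 1$, $r\ge 0$ and $L_0\ge 1$ be integers with $10r\le L_0$. For $N=(N_1,\dots,N_d)$ let $\Lambda_N=\prod_j \mathbb Z/N_j$, with one $q$-dimensional qudit at each site. Let $\{\alpha_N\}_{N_j\ge L_0}$ be the obvious family of a translation-invariant QCA of range $r$ in lattice units. That is, $\alpha_N$ is a $*$-automorphism of the algebra of operators on $\Lambda_N$, and there is one local action $\varphi$, the same for all $N$ and all sites, such that $\alpha_N$ maps a single-qudit operator $a$ at $x$ to $\varphi(a)$ placed on the window $x+\{-r,\dots,r\}^d$. Put $\alpha_L=\alpha_{(L,\dots,L)}$, with sites at the points $x/L$ of the torus $T^d=(\mathbb R/\mathbb Z)^d$ (sup metric). Let $\alpha_L(\ell,j)$ be $\alpha_N$ with $N_j=\ell$ and $N_i=L$ for $i\ne j$, regarded as a QCA over the $(d-1)$-torus by forgetting the $j$-th coordinate of the positions. **Circuits.** A circuit of depth $D$ is a product of $D$ rounds, each a product of unitary gates supported on pairwise disjoint sets of sites. It acts by conjugation. Two QCA are *stably* related if they are related after tensoring each with the identity on finitely many ancilla sites of nonzero finite dimension, placed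 anywhere in the control space, and matching the two resulting systems of sites by a bijection that preserves dimensions and positions. A family $\gamma_L$ ($L\ge L_0$) is *stably a finite-depth quantum circuit* if there are $D$ and $\varepsilon(L)$ such that each $\gamma_L$ is stably equal to a circuit of depth $D$ with gates of diameter at most $\varepsilon(L)$, where $\varepsilon(L)\to 0$ as $L\to\infty$. It is so *at the lattice scale* if one can take $\varepsilon(L)=c/L$ for a constant $c$. A family has *finite order* (at the lattice scale) if, for some $k\ge 1$, its elementwise $k$-th power is stably a finite-depth quantum circuit (at the lattice scale). **Coherence.** A QCA has range $R$ if it maps operators supported on any set $J$ of sites to operators supported on the $R$-neighbourhood of $J$. A sequence $(\alpha_i)_{i\ge 0}$ of QCA over a common control space is *coherent* if there are $R>0$ and $c$ such that, with $R_i=R\,2^{-i}$, every $\alpha_i$ has range $R_i$ and is stably joined to $\alpha_{i+1}$ by a continuous path of QCA of range at most $cR_i$. **Theorem.** 1. Suppose that for every $j$ and all sufficiently large $\ell$ the family $\{\alpha_L(\ell,j)\}_{L\ge L_0}$ has finite order. Then there are an integer $\ell_0\ge 1$, a depth $D$ and $\varepsilon(L)\to 0$ such that, for all $L_0\le L\le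 L'$ with $\ell_0\mid L'-L$, the QCA $\alpha_L$ deforms into $\alpha_{L'}$: stably, $\alpha_L$ equals $\alpha_{L'}$ followed by a circuit of depth $D$ with gates of diameter at most $\varepsilon(L)$. Moreover there are $L_0\le S_0<S_1<S_2<\cdots$ such that the subsequence $(\alpha_{S_i})_{i\ge 0}$ is coherent. 2. Suppose that for every $j$ and all sufficiently large $\ell$ the family $\{\alpha_L(\ell,j)\}_{L\ge L_0}$ has finite order at the lattice scale. Then there is an integer $\ell_0\ge1$ such that the deformations in 1 exist with $\varepsilon(L)=c/L$ for a constant $c$, and for every multiple $a\ge L_0$ of $\ell_0$ the subsequence $(\alpha_{a2^i})_{i\ge 0}$ is coherent. -/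

import Mathlib

open Filter Topology

noncomputable section

namespace QCA

/-! ## Operators on finite systems of sites -/

/-- Computational basis of the Hilbert space `⨂ i, ℂ ^ (n i)`. -/
abbrev Config {I : Type} (n : I → ℕ) : Type := ∀ i, Fin (n i)

/-- The algebra of all operators on `⨂ i, ℂ ^ (n i)`. -/
abbrev Op {I : Type} [Fintype I] [DecidableEq I] (n : I → ℕ) : Type :=
  Matrix (Config n) (Config n) ℂ

/-- `*`-automorphisms of the operator algebra. -/
abbrev Aut {I : Type} [Fintype I] [DecidableEq I] (n : I → ℕ) : Type :=
  Op n ≃⋆ₐ[ℂ] Op n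

open Classical in
/-- The operator `B ⊗ 1`, where `B` acts on the sites in `J` and `1` on the other sites. -/
def extend {I : Type} [Fintype I] [DecidableEq I] {n : I → ℕ} (J : Finset I)
    (B : Matrix (∀ i : J, Fin (n i)) (∀ i : J, Fin (n i)) ℂ) : Op n :=
  Matrix.of fun σ τ =>
    if ∀ i, i ∉ J → σ i = τ i then B (fun i => σ i) (fun i => τ i) else 0

/-- `A` is supported on the set of sites `J`. -/
def SupportedOn {I : Type} [Fintype I] [DecidableEq I] {n : I → ℕ} (J : Finset I)
    (A : Op n) : Prop :=
  ∃ B, A = extend J B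

/-- `α` is an `R`-QCA for sites at the positions `pos` in the control space `X`:
an operator supported on `J` is mapped to one supported on the `R`-neighbourhood of `J`. -/
def HasRange {I X : Type} [Fintype I] [DecidableEq I] [PseudoMetricSpace X] {n : I → ℕ}
    (pos : I → X) (R : ℝ) (α : Aut n) : Prop :=
  ∀ (J J' : Finset I), (∀ i, i ∈ J' ↔ ∃ k ∈ J, dist (pos i) (pos k) ≤ R) →
    ∀ A : Op n, SupportedOn J A → SupportedOn J' (α A)

/-- The `k`-th power of an automorphism. -/
def autPow {I : Type} [Fintype I] [DecidableEq I] {n : I → ℕ} (α : Aut n) : ℕ → Aut n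
  | 0 => StarAlgEquiv.refl ℂ (Op n)
  | k + 1 => (autPow α k).trans α

/-! ## Quantum circuits -/

/-- `U` is one round of a quantum circuit: a product of unitary gates, supported on pairwise
disjoint sets of sites, each of diameter at most `ρ`. -/
def IsRound {I X : Type} [Fintype I] [DecidableEq I] [PseudoMetricSpace X] {n : I → ℕ}
    (pos : I → X) (ρ : ℝ) (U : Op n) : Prop :=
  ∃ G : List (Finset I × Op n),
    G.Pairwise (fun g h => Disjoint g.1 h.1) ∧
    (∀ g ∈ G, (∀ i ∈ g.1, ∀ k ∈ g.1, dist (pos i) (pos k) ≤ ρ) ∧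
      g.2 ∈ unitary (Op n) ∧ SupportedOn g.1 g.2) ∧
    U = (G.map Prod.snd).prod

/-- `U` is implemented by a quantum circuit of depth `D` with gates of diameter at most `ρ`. -/
def IsCircuit {I X : Type} [Fintype I] [DecidableEq I] [PseudoMetricSpace X] {n : I → ℕ}
    (pos : I → X) (D : ℕ) (ρ : ℝ) (U : Op n) : Prop :=
  ∃ l : List (Op n), l.length = D ∧ (∀ u ∈ l, IsRound pos ρ u) ∧ U = l.prod

/-- `α ∘ β⁻¹` is conjugation by a quantum circuit of depth `D` with gates of diameter at most
`ρ`. -/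
def CircuitEquiv {I X : Type} [Fintype I] [DecidableEq I] [PseudoMetricSpace X] {n : I → ℕ}
    (pos : I → X) (D : ℕ) (ρ : ℝ) (α β : Aut n) : Prop :=
  ∃ U : Op n, IsCircuit pos D ρ U ∧ ∀ A, α A = U * β A * star U

/-- `α` and `β` are joined by a continuous path of QCA of range at most `R`. -/
def PathEquiv {I X : Type} [Fintype I] [DecidableEq I] [PseudoMetricSpace X] {n : I → ℕ}
    (pos : I → X) (R : ℝ) (α β : Aut n) : Prop :=
  ∃ γ : unitInterval → Aut n,
    (∀ A, Continuous fun t => γ t A) ∧ (∀ t, HasRange pos R (γ t)) ∧ γ 0 = α ∧ γ 1 = β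

/-! ## Stabilization -/

/-- Renaming the basis vectors. -/
def reindex {m k : Type} [Fintype m] [DecidableEq m] [Fintype k] [DecidableEq k] (e : m ≃ k) :
    Matrix m m ℂ ≃⋆ₐ[ℂ] Matrix k k ℂ :=
  StarAlgEquiv.ofAlgEquiv (Matrix.reindexAlgEquiv ℂ ℂ e) fun _ => rfl

/-- The automorphism `id ⊗ α` of `M_k ⊗ M_m = M_k (M_m)`, that is, `α` applied to each block. -/
def blockwise {m : Type} [Fintype m] [DecidableEq m] (k : Type) [Fintype k] [DecidableEq k]
    (α : Matrix m m ℂ ≃⋆ₐ[ℂ] Matrix m m ℂ) :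
    Matrix (k × m) (k × m) ℂ ≃⋆ₐ[ℂ] Matrix (k × m) (k × m) ℂ :=
  StarAlgEquiv.ofAlgEquiv
    (((Matrix.compAlgEquiv k m ℂ ℂ).symm.trans α.toAlgEquiv.mapMatrix).trans
      (Matrix.compAlgEquiv k m ℂ ℂ))
    (by
      intro M
      ext ⟨a, i⟩ ⟨b, j⟩
      exact congrFun (congrFun
        (map_star α (Matrix.of fun i' j' => M (b, i') (a, j'))) i) j)

/-- The basis of the system obtained by adding the ancillas `K`. -/
def configSum {I K : Type} (n : I → ℕ) (m : K → ℕ) :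
    Config m × Config n ≃ Config (Sum.elim n m) :=
  (Equiv.prodComm _ _).trans
    (Equiv.sumPiEquivProdPi fun s : I ⊕ K => Fin (Sum.elim n m s)).symm

/-- The automorphism `α ⊗ Id`, where `Id` acts on additional sites `K` with dimensions `m`. -/
def stabilize {I K : Type} [Fintype I] [DecidableEq I] [Fintype K] [DecidableEq K]
    {n : I → ℕ} (m : K → ℕ) (α : Aut n) : Aut (Sum.elim n m) :=
  ((reindex (configSum n m)).symm.trans (blockwise (Config m) α)).trans
    (reindex (configSum n m))

/-- Transport of an automorphism along a one-to-one correspondence of sites such that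
corresponding sites have the same dimension. -/
def transport {I J : Type} [Fintype I] [DecidableEq I] [Fintype J] [DecidableEq J]
    {n : I → ℕ} {m : J → ℕ} (e : I ≃ J) (h : ∀ i, n i = m (e i)) (α : Aut n) : Aut m :=
  ((reindex (Equiv.piCongr e fun i => finCongr (h i))).symm.trans α).trans
    (reindex (Equiv.piCongr e fun i => finCongr (h i)))

/-- The stable version of a relation `r` between QCA on the same system of sites in `X`, for two
QCA `α`, `β` on possibly different systems: after tensoring with ancillas (of nonzero dimension)
on both sides, the sites of the two systems correspond to each other, with the same dimensions and
positions, and `r` holds between `α ⊗ Id` and the transported `β ⊗ Id`. -/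
def Stably {X : Type}
    (r : ∀ {I : Type} [Fintype I] [DecidableEq I] {n : I → ℕ}, (I → X) → Aut n → Aut n → Prop)
    {I J : Type} [Fintype I] [DecidableEq I] [Fintype J] [DecidableEq J]
    {n : I → ℕ} {m : J → ℕ} (pos : I → X) (pos' : J → X) (α : Aut n) (β : Aut m) : Prop :=
  ∃ (K K' : Type) (_ : Fintype K) (_ : DecidableEq K) (_ : Fintype K') (_ : DecidableEq K')
    (a : K → ℕ) (a' : K' → ℕ) (p : K → X) (p' : K' → X) (e : J ⊕ K' ≃ I ⊕ K)
    (h : ∀ s, Sum.elim m a' s = Sum.elim n a (e s)),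
    (∀ k, 0 < a k) ∧ (∀ k, 0 < a' k) ∧
    (∀ s, Sum.elim pos' p' s = Sum.elim pos p (e s)) ∧
    r (Sum.elim pos p) (stabilize a α) (transport e h (stabilize a' β))

/-- Stable circuit equivalence, by a circuit of depth `D` with gates of diameter at most `ρ`. -/
def StablyCircuitEquiv {X : Type} [PseudoMetricSpace X]
    {I J : Type} [Fintype I] [DecidableEq I] [Fintype J] [DecidableEq J]
    {n : I → ℕ} {m : J → ℕ} (D : ℕ) (ρ : ℝ)
    (pos : I → X) (pos' : J → X) (α : Aut n) (β : Aut m) : Prop :=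
  Stably (fun p α' β' => CircuitEquiv p D ρ α' β') pos pos' α β

/-- Stable `R` path equivalence. -/
def StablyPathEquiv {X : Type} [PseudoMetricSpace X]
    {I J : Type} [Fintype I] [DecidableEq I] [Fintype J] [DecidableEq J]
    {n : I → ℕ} {m : J → ℕ} (R : ℝ)
    (pos : I → X) (pos' : J → X) (α : Aut n) (β : Aut m) : Prop :=
  Stably (fun p α' β' => PathEquiv p R α' β') pos pos' α β

/-- A sequence of QCA `α i` over the control space `X`, of range `R_i = R * 2⁻ⁱ`, is (path)
coherent if for some constant `c` each `α i` is stably `c * R_i` path equivalent to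
`α (i + 1)`. -/
def IsCoherent {X : Type} [PseudoMetricSpace X] {I : ℕ → Type} [∀ i, Fintype (I i)]
    [∀ i, DecidableEq (I i)] {n : ∀ i, I i → ℕ} (pos : ∀ i, I i → X)
    (α : ∀ i, Aut (n i)) : Prop :=
  ∃ R : ℝ, 0 < R ∧ (∀ i, HasRange (pos i) (R / 2 ^ i) (α i)) ∧
    ∃ c : ℝ, ∀ i,
      StablyPathEquiv (c * (R / 2 ^ i)) (pos i) (pos (i + 1)) (α i) (α (i + 1))

/-! ## Translation-invariant QCA on tori -/

/-- The hypercubic lattice with periodic boundary conditions and `N j` sites in direction `j`. -/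
abbrev Site {d : ℕ} (N : Fin d → ℕ+) : Type := ∀ j, ZMod (N j)

/-- One `q`-dimensional qudit at every site. -/
abbrev qudits {d : ℕ} (q : ℕ) (N : Fin d → ℕ+) : Site N → ℕ := fun _ => q

/-- The location of the sites in the `d`-torus `(ℝ/ℤ)^d`, with spacing `1 / N j` in direction
`j`. The torus carries the sup metric. -/
def torusPos {d : ℕ} (N : Fin d → ℕ+) (x : Site N) : Fin d → UnitAddCircle :=
  fun j => ZMod.toAddCircle (x j)

/-- The location of the sites in the `(d-1)`-torus, where coordinate `j` is forgotten. -/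
def reducedPos {d : ℕ} (j : Fin d) (N : Fin d → ℕ+) (x : Site N) :
    {i : Fin d // i ≠ j} → UnitAddCircle :=
  fun i => ZMod.toAddCircle (x i)

/-- The operator that acts as `a` on the qudit at `x` and as `1` elsewhere. -/
def onSite {d q : ℕ} {N : Fin d → ℕ+} (x : Site N) (a : Matrix (Fin q) (Fin q) ℂ) :
    Op (qudits q N) :=
  Matrix.of fun σ τ => if ∀ y, y ≠ x → σ y = τ y then a (σ x) (τ x) else 0

/-- The sites `{-r, …, r}^d` around the origin of the lattice `ℤ^d`. -/
abbrev Window (d r : ℕ) : Type := Fin d → Fin (2 * r + 1)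

/-- The site in the window of radius `r` around `x` with the given relative position. -/
def windowSite {d r : ℕ} {N : Fin d → ℕ+} (x : Site N) (w : Window d r) : Site N :=
  fun j => x j + (((w j : ℕ) : ZMod (N j)) - (r : ZMod (N j)))

open Classical in
/-- The operator that acts as `B` on the window of radius `r` around `x` and as `1` elsewhere. -/
def onWindow {d q r : ℕ} {N : Fin d → ℕ+} (x : Site N)
    (B : Matrix (Window d r → Fin q) (Window d r → Fin q) ℂ) : Op (qudits q N) :=
  Matrix.of fun σ τ =>
    if ∀ y, (∀ w : Window d r, y ≠ windowSite x w) → σ y = τ y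
    then B (fun w => σ (windowSite x w)) (fun w => τ (windowSite x w)) else 0

/-- `α` is the obvious family of a translation-invariant QCA: `α N` is a QCA on the periodic
lattice of size `N 0 × ⋯ × N (d - 1)`, and there is one local action `φ`, the same for all sizes
and for all sites, of range `r` in lattice units, such that `α N` maps a single-qudit operator `a`
at the site `x` to `φ a` placed in the window of radius `r` around `x`. Only the sizes with all
`N j ≥ L₀` matter; for these the range `r / N j` is at most `1 / 10`. -/
def IsObviousFamily {d q : ℕ} (r : ℕ) (L₀ : ℕ+)
    (α : ∀ N : Fin d → ℕ+, Aut (qudits q N)) : Prop :=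
  10 * r ≤ (L₀ : ℕ) ∧
  ∃ φ : Matrix (Fin q) (Fin q) ℂ →
      Matrix (Window d r → Fin q) (Window d r → Fin q) ℂ,
    ∀ N : Fin d → ℕ+, (∀ j, L₀ ≤ N j) →
      ∀ (x : Site N) (a : Matrix (Fin q) (Fin q) ℂ), α N (onSite x a) = onWindow x (φ a)

/-- The lattice with `L` sites in every direction. -/
abbrev cube (d : ℕ) (L : ℕ+) : Fin d → ℕ+ := fun _ => L

/-- The lattice with `ℓ` sites in direction `j` and `L` sites in every other direction. -/
abbrev slab {d : ℕ} (j : Fin d) (ℓ L : ℕ+) : Fin d → ℕ+ := fun i => if i = j then ℓ else L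

/-- Bounds for the gate diameter, as a function of the linear size `L`, that tend to zero. -/
def Vanishing (ε : ℕ+ → ℝ) : Prop := Tendsto ε atTop (𝓝 0)

/-- Bounds for the gate diameter proportional to the lattice spacing `1 / L`. -/
def LatticeScale (ε : ℕ+ → ℝ) : Prop := ∃ c : ℝ, ∀ L : ℕ+, ε L = c / (L : ℕ)

/-- The family of dimensional reductions of `α` to `ℓ` sites in direction `j`, indexed by
`L ≥ L₀`, has finite order modulo finite-depth circuits: for some `k ≥ 1` its `k`-th power is,
after adding ancillas, a family of quantum circuits over the `(d-1)`-torus whose depth is bounded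
and whose gates have diameter at most `ε L`, with `ε` as specified by `P`. -/
def ReductionHasFiniteOrder {d q : ℕ} (P : (ℕ+ → ℝ) → Prop) (L₀ : ℕ+)
    (α : ∀ N : Fin d → ℕ+, Aut (qudits q N)) (j : Fin d) (ℓ : ℕ+) : Prop :=
  ∃ k : ℕ, 1 ≤ k ∧ ∃ (D : ℕ) (ε : ℕ+ → ℝ), P ε ∧ ∀ L : ℕ+, L₀ ≤ L →
    StablyCircuitEquiv D (ε L) (reducedPos j (slab j ℓ L)) (reducedPos j (slab j ℓ L))
      (autPow (α (slab j ℓ L)) k) (StarAlgEquiv.refl ℂ (Op (qudits q (slab j ℓ L))))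

/-- `α_L` deforms into `α_{L'}`, for all `L₀ ≤ L ≤ L'` such that `L' - L` is a multiple of `ℓ₀`,
by stabilization and a quantum circuit of bounded depth with gates of diameter at most `ε L`,
with `ε` as specified by `P`. -/
def DeformsInSteps {d q : ℕ} (P : (ℕ+ → ℝ) → Prop) (L₀ : ℕ+)
    (α : ∀ N : Fin d → ℕ+, Aut (qudits q N)) (ℓ₀ : ℕ+) : Prop :=
  ∃ (D : ℕ) (ε : ℕ+ → ℝ), P ε ∧ ∀ L L' : ℕ+, L₀ ≤ L → L ≤ L' →
    (ℓ₀ : ℕ) ∣ (L' : ℕ) - (L : ℕ) →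
    StablyCircuitEquiv D (ε L) (torusPos (cube d L)) (torusPos (cube d L'))
      (α (cube d L)) (α (cube d L'))

end QCA

end

/-! A translation-invariant QCA is a local rule, and the rule makes sense on every finite set of
sites with an action of `ℤ^d` that has no short periods: freeness for vectors with entries at most
`6 * r` is enough (`exists_qca`). So the lattice may be cut open in one direction and glued together
differently, and the QCA changes only near the cut.

The main tool is `isCirc_reconnect`. Strips of orbits that cross the cut come in two families; one
family is reglued by a permutation `π`, the other by `π⁻¹`. Regluing only the first family changes
the QCA by some local automorphism `V`, about which nothing is known. Exchanging the two families
site by site carries `V` to the automorphism that accounts for the second family. Hence regluing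
both families costs the inverse of a commutator of `V` with a product of disjoint swaps. Such a
commutator is a circuit (`isCirc_commutator`): `V` sends each swap to a local gate, and these gates
commute. The same trick shows that a QCA tensored with the inverse of an isomorphic copy is a
circuit (`rel_of_equiv`).

To lengthen a torus in direction `j`, tori with only `ℓ` layers in that direction are put beside it
and glued in (`rel_insert`). The result is the QCA on the longer torus. Up to a circuit it is the
QCA on the shorter torus tensored with a stack of thin tori, and it remains to see that the stack is
stably a circuit.

This is where finite order is used. By the swap trick, `k` copies of a QCA agree with its `k`-th
power up to a circuit (`triv_copies`). The `k`-th power of the reduction is stably a circuit at one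
size `M` at which the gates are small compared with `M`; such a circuit lifts to every covering
torus (`triv_lift`), with gates of bounded size in lattice units. This treats side lengths divisible
by `M`. For the other lengths, `M` copies in each of two families are reconnected to a torus `M`
times as long (`Stack.wind`).

Only one size `M` is ever used. Therefore reductions with merely vanishing gate size already give
deformations at the lattice scale, and both parts of the theorem follow from
`deformsInSteps_and_isCoherent`. The inserted layers are spread evenly along the torus, so that
after rescaling no site is displaced by more than a constant times `1 / L` (`abs_insVal_sub_le`).

For coherence, each gate of a circuit is contracted to the identity through unitaries with the same
support, up to a phase that conjugation does not see (`IsCircuit.exists_path`). A deformation by a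
circuit thereby becomes a path of QCA of controlled range (`CircuitEquiv.pathEquiv`). -/

noncomputable section

set_option linter.unusedSectionVars false

namespace QCA

/-! ### Product operators and single-site operators -/

section SiteOps

variable {I : Type} [Fintype I] [DecidableEq I] {n : I → ℕ}

/-- The product operator `⨂ i, x i`. -/
def piKron : (∀ i, Matrix (Fin (n i)) (Fin (n i)) ℂ) →* Op n where
  toFun x := Matrix.of fun σ τ => ∏ i, x i (σ i) (τ i)
  map_one' := by
    ext σ τ
    simp only [Matrix.of_apply, Pi.one_apply, Matrix.one_apply, Finset.prod_ite_zero,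
      Finset.prod_const_one, Finset.mem_univ, true_imp_iff, funext_iff]
  map_mul' x y := by
    ext σ τ
    simp only [Matrix.of_apply, Pi.mul_apply, Matrix.mul_apply, Finset.prod_univ_sum,
      Fintype.piFinset_univ, Finset.prod_mul_distrib]

theorem piKron_apply (x : ∀ i, Matrix (Fin (n i)) (Fin (n i)) ℂ) (σ τ : Config n) :
    piKron x σ τ = ∏ i, x i (σ i) (τ i) := rfl

/-- The operator `a` on site `i`, as a homomorphism. -/
def siteOp (i : I) : Matrix (Fin (n i)) (Fin (n i)) ℂ →⋆ₐ[ℂ] Op n where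
  toFun a := piKron (Pi.mulSingle i a)
  map_one' := by simp
  map_mul' a b := by rw [Pi.mulSingle_mul, map_mul]
  map_zero' := by
    ext σ τ
    rw [piKron_apply]
    exact Finset.prod_eq_zero (Finset.mem_univ i) (by simp)
  map_add' a b := by
    ext σ τ
    rw [Matrix.add_apply]
    simp only [piKron_apply]
    rw [← Finset.mul_prod_erase _ _ (Finset.mem_univ i),
      ← Finset.mul_prod_erase _ _ (Finset.mem_univ i),
      ← Finset.mul_prod_erase _ _ (Finset.mem_univ i)]
    simp only [Pi.mulSingle_eq_same, Matrix.add_apply, add_mul]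
    congr 2 <;>
    · refine Finset.prod_congr rfl fun k hk => ?_
      simp [Pi.mulSingle_eq_of_ne (Finset.ne_of_mem_erase hk)]
  commutes' c := by
    ext σ τ
    rw [piKron_apply, ← Finset.mul_prod_erase _ _ (Finset.mem_univ i)]
    rw [Finset.prod_congr rfl (g := fun k => (1 : Matrix (Fin (n k)) (Fin (n k)) ℂ) (σ k) (τ k))]
    · simp only [Pi.mulSingle_eq_same, Matrix.algebraMap_matrix_apply, Matrix.one_apply]
      split_ifs with h1 h2 h2
      · rw [Finset.prod_eq_one]; · simp
        intro k _; simp [h2]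
      · rw [Finset.prod_ite_zero, if_neg]; · simp
        intro h
        exact h2 (funext fun k => if hk : k = i then hk ▸ h1 else h k (by simp [hk]))
      · exact absurd (by rw [h2]) h1
      · simp
    · intro k hk
      simp [Pi.mulSingle_eq_of_ne (Finset.ne_of_mem_erase hk)]
  map_star' a := by
    ext σ τ
    simp only [piKron_apply, Matrix.star_apply, star_prod]
    refine Finset.prod_congr rfl fun k _ => ?_
    by_cases hk : k = i
    · subst hk; simp
    · simp [Pi.mulSingle_eq_of_ne hk, Matrix.one_apply, eq_comm]

theorem siteOp_eq (i : I) (a : Matrix (Fin (n i)) (Fin (n i)) ℂ) :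
    siteOp i a = piKron (Pi.mulSingle i a) := rfl

theorem siteOp_apply (i : I) (a : Matrix (Fin (n i)) (Fin (n i)) ℂ) (σ τ : Config n) :
    siteOp i a σ τ = if ∀ y, y ≠ i → σ y = τ y then a (σ i) (τ i) else 0 := by
  rw [siteOp_eq, piKron_apply, ← Finset.mul_prod_erase _ _ (Finset.mem_univ i)]
  rw [Finset.prod_congr rfl (g := fun k => (1 : Matrix (Fin (n k)) (Fin (n k)) ℂ) (σ k) (τ k))]
  · simp only [Pi.mulSingle_eq_same, Matrix.one_apply, Finset.prod_ite_zero, Finset.mem_erase,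
      Finset.mem_univ, and_true, Finset.prod_const_one, mul_ite, mul_one, mul_zero]
  · intro k hk
    simp [Pi.mulSingle_eq_of_ne (Finset.ne_of_mem_erase hk)]

theorem siteOp_commute {i j : I} (h : i ≠ j) (a : Matrix (Fin (n i)) (Fin (n i)) ℂ)
    (b : Matrix (Fin (n j)) (Fin (n j)) ℂ) : Commute (siteOp i a : Op n) (siteOp j b) := by
  have := Pi.mulSingle_commute (f := fun i => Matrix (Fin (n i)) (Fin (n i)) ℂ) h a b
  exact this.map piKron

/-- Shows that product operators span the algebra; the extensionality and induction principles below
rest on this. -/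
theorem matrix_single_eq_piKron (σ τ : Config n) :
    (Matrix.single σ τ 1 : Op n) = piKron fun i => Matrix.single (σ i) (τ i) 1 := by
  ext σ' τ'
  simp only [piKron_apply, Matrix.single_apply, Finset.prod_ite_zero, Finset.mem_univ,
    true_imp_iff, Finset.prod_const_one, funext_iff, forall_and]

theorem op_eq_sum (A : Op n) :
    A = ∑ σ, ∑ τ, A σ τ • piKron fun i => Matrix.single (σ i) (τ i) 1 := by
  conv_lhs => rw [Matrix.matrix_eq_sum_single A]
  refine Finset.sum_congr rfl fun σ _ => Finset.sum_congr rfl fun τ _ => ?_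
  rw [← matrix_single_eq_piKron, Matrix.smul_single, smul_eq_mul, mul_one]

/-- Linear maps that agree on product operators are equal. -/
theorem linear_ext {V : Type*} [AddCommMonoid V] [Module ℂ V] {F G : Op n →ₗ[ℂ] V}
    (h : ∀ x, F (piKron x) = G (piKron x)) : F = G := by
  ext1 A
  rw [op_eq_sum A]
  simp only [map_sum, map_smul, h]

/-- Homomorphisms that agree on single-site operators are equal. -/
theorem hom_ext {A : Type*} [Semiring A] [Algebra ℂ A] {F G : Op n →ₐ[ℂ] A}
    (h : ∀ i a, F (siteOp i a) = G (siteOp i a)) : F = G := by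
  have key : (F : Op n →* A).comp piKron = (G : Op n →* A).comp piKron := by
    refine MonoidHom.pi_ext fun i a => h i a
  have : F.toLinearMap = G.toLinearMap := linear_ext fun x => DFunLike.congr_fun key x
  exact AlgHom.ext fun A => DFunLike.congr_fun this A

theorem starHom_ext {A : Type*} [Semiring A] [Algebra ℂ A] [Star A] {F G : Op n →⋆ₐ[ℂ] A}
    (h : ∀ i a, F (siteOp i a) = G (siteOp i a)) : F = G := by
  have : F.toAlgHom = G.toAlgHom := hom_ext h
  exact StarAlgHom.ext fun A => DFunLike.congr_fun this A

theorem aut_ext {α β : Aut n} (h : ∀ i a, α (siteOp i a) = β (siteOp i a)) : α = β := by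
  have : α.toStarAlgHom = β.toStarAlgHom := starHom_ext h
  exact StarAlgEquiv.ext fun A => DFunLike.congr_fun this A

/-- The single-site operators generate the algebra. -/
theorem op_induction (S : Subalgebra ℂ (Op n)) (h : ∀ i a, siteOp i a ∈ S) (A : Op n) : A ∈ S := by
  rw [op_eq_sum A]
  refine Subalgebra.sum_mem _ fun σ _ => Subalgebra.sum_mem _ fun τ _ =>
    Subalgebra.smul_mem _ ?_ _
  generalize (fun i => (Matrix.single (σ i) (τ i) 1 : Matrix (Fin (n i)) (Fin (n i)) ℂ)) = x
  -- A product operator is the product of its commuting single-site factors, so it lies in `S`.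
  have : Finset.univ.noncommProd (fun i => Pi.mulSingle i (x i))
      (fun i _ j _ _ => Pi.mulSingle_apply_commute x i j) ∈ S.toSubmonoid.comap piKron :=
    Submonoid.noncommProd_mem _ _ _ _ fun i _ => h i _
  rw [Finset.noncommProd_mulSingle] at this
  exact this

end SiteOps

/-! ### Universal property: commuting homomorphisms on the sites extend to all operators -/

section Lift

variable {I : Type} [Fintype I] [dI : DecidableEq I] {n : I → ℕ}
  {A : Type} [Ring A] [StarRing A] [Algebra ℂ A] [StarModule ℂ A]
  (ψ : ∀ i, Matrix (Fin (n i)) (Fin (n i)) ℂ →⋆ₐ[ℂ] A)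
  (hc : Pairwise fun i j => ∀ a b, Commute (ψ i a) (ψ j b))

/-- The product of commuting images. -/
def liftMonoid : (∀ i, Matrix (Fin (n i)) (Fin (n i)) ℂ) →* A :=
  MonoidHom.noncommPiCoprod (fun i => ((ψ i).toAlgHom.toRingHom.toMonoidHom)) hc

theorem liftMonoid_mulSingle (i : I) (a) : liftMonoid ψ hc (Pi.mulSingle i a) = ψ i a :=
  MonoidHom.noncommPiCoprod_mulSingle (N := fun i => Matrix (Fin (n i)) (Fin (n i)) ℂ)
    (fun i => ((ψ i).toAlgHom.toRingHom.toMonoidHom)) i a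

theorem liftMonoid_update (m : ∀ i, Matrix (Fin (n i)) (Fin (n i)) ℂ) (i : I) (z) :
    liftMonoid ψ hc (Function.update m i z) =
      ψ i z * liftMonoid ψ hc (Function.update m i 1) := by
  have key : Function.update m i z = Pi.mulSingle i z * Function.update m i 1 := by
    ext1 k
    by_cases hk : k = i
    · subst hk; simp
    · simp [hk]
  rw [key, map_mul, liftMonoid_mulSingle]

/-- The product of commuting images, as a multilinear map. -/
def liftMultilinear : MultilinearMap ℂ (fun i => Matrix (Fin (n i)) (Fin (n i)) ℂ) A where
  toFun := liftMonoid ψ hc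
  map_update_add' {inst} m i x y := by
    obtain rfl : inst = dI := Subsingleton.elim _ _
    rw [liftMonoid_update, liftMonoid_update ψ hc m i x, liftMonoid_update ψ hc m i y, map_add,
      add_mul]
  map_update_smul' {inst} m i c x := by
    obtain rfl : inst = dI := Subsingleton.elim _ _
    rw [liftMonoid_update, liftMonoid_update ψ hc m i x, map_smul, smul_mul_assoc]

theorem liftMultilinear_apply (x) : liftMultilinear ψ hc x = liftMonoid ψ hc x := rfl

/-- The linear extension of commuting homomorphisms on the sites. -/
def liftLinear : Op n →ₗ[ℂ] A where
  toFun M := ∑ σ, ∑ τ, M σ τ • liftMultilinear ψ hc fun i => Matrix.single (σ i) (τ i) 1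
  map_add' M N := by simp [add_smul, Finset.sum_add_distrib]
  map_smul' c M := by simp [Finset.smul_sum, mul_smul]

theorem liftLinear_piKron (x : ∀ i, Matrix (Fin (n i)) (Fin (n i)) ℂ) :
    liftLinear ψ hc (piKron x) = liftMultilinear ψ hc x := by
  have hx : x = fun i => ∑ p : Fin (n i) × Fin (n i), x i p.1 p.2 • Matrix.single p.1 p.2 1 := by
    ext1 i
    conv_lhs => rw [Matrix.matrix_eq_sum_single (x i)]
    rw [Fintype.sum_prod_type]
    simp
  -- With every factor expanded in matrix units, the right side becomes the sum over pairs of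
  -- configurations that defines `liftLinear`.
  conv_rhs => rw [hx, MultilinearMap.map_sum]
  have e : (∀ i, Fin (n i) × Fin (n i)) ≃ Config n × Config n := Equiv.arrowProdEquivProdArrow _ _ _
  rw [← (Equiv.arrowProdEquivProdArrow I (fun i => Fin (n i)) (fun i => Fin (n i))).symm.sum_comp,
    Fintype.sum_prod_type]
  simp only [MultilinearMap.map_smul_univ]
  rfl

/-- Both sides are bilinear, so product operators decide. There it is the multiplicativity of
`liftMonoid`, which comes from the commutation hypothesis `hc`. -/
theorem lift_mul (M N : Op n) :
    liftLinear ψ hc (M * N) = liftLinear ψ hc M * liftLinear ψ hc N := by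
  have : (LinearMap.mul ℂ (Op n)).compr₂ (liftLinear ψ hc) =
      (LinearMap.mul ℂ A).compl₁₂ (liftLinear ψ hc) (liftLinear ψ hc) := by
    refine linear_ext fun x => linear_ext fun y => ?_
    simp [← map_mul, liftLinear_piKron, liftMultilinear_apply]
  exact DFunLike.congr_fun (DFunLike.congr_fun this M) N

theorem piKron_star (x : ∀ i, Matrix (Fin (n i)) (Fin (n i)) ℂ) :
    star (piKron x) = piKron (star x) := by
  ext σ τ
  simp [piKron_apply, Matrix.star_apply]

/-- The star reverses the order of the factors, which is harmless because they commute: the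
induction splits off a new factor on the left on one side and on the right on the other. -/
theorem liftMultilinear_star (x) :
    liftMultilinear ψ hc (star x) = star (liftMultilinear ψ hc x) := by
  have key : ∀ s : Finset I, ∀ h1 h2, s.noncommProd (fun i => ψ i (star x i)) h1 =
      star (s.noncommProd (fun i => ψ i (x i)) h2) := by
    intro s
    induction s using Finset.induction_on with
    | empty => intro h1 h2; rw [Finset.noncommProd_empty, Finset.noncommProd_empty, star_one]
    | insert i s hi ih =>
      intro h1 h2
      rw [Finset.noncommProd_insert_of_notMem _ _ _ _ hi,
        Finset.noncommProd_insert_of_notMem' _ _ _ _ hi, star_mul, ih (h1.mono (by simp)) (h2.mono (by simp)), Pi.star_apply,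
        map_star]
  exact key Finset.univ (fun _ _ _ _ h => hc h _ _) (fun _ _ _ _ h => hc h _ _)

/-- Commuting homomorphisms on the sites extend to the algebra of all operators. -/
def liftHom : Op n →⋆ₐ[ℂ] A where
  toFun := liftLinear ψ hc
  map_one' := by rw [← map_one piKron, liftLinear_piKron, liftMultilinear_apply, map_one]
  map_mul' := lift_mul ψ hc
  map_zero' := map_zero _
  map_add' := map_add _
  commutes' c := by
    rw [Algebra.algebraMap_eq_smul_one, map_smul, ← map_one piKron, liftLinear_piKron,
      liftMultilinear_apply, map_one, Algebra.algebraMap_eq_smul_one]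
  map_star' M := by
    have h1 : ∀ (x : ∀ i, Matrix (Fin (n i)) (Fin (n i)) ℂ),
        liftLinear ψ hc (star (piKron x)) = star (liftLinear ψ hc (piKron x)) := by
      intro x
      rw [piKron_star, liftLinear_piKron, liftLinear_piKron, liftMultilinear_star]
    change liftLinear ψ hc (star M) = star (liftLinear ψ hc M)
    rw [op_eq_sum M]
    simp only [star_sum, star_smul, map_sum, map_smul, h1]

theorem liftHom_siteOp (i : I) (a) : liftHom ψ hc (siteOp i a) = ψ i a := by
  change liftLinear ψ hc (piKron _) = _
  rw [liftLinear_piKron, liftMultilinear_apply, liftMonoid_mulSingle]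

end Lift

/-! ### Larger systems: operators `A ⊗ 1` and automorphisms `α ⊗ 1` -/

/-- Transport of matrices along an equality of dimensions. -/
def castM {a b : ℕ} (h : a = b) : Matrix (Fin a) (Fin a) ℂ ≃⋆ₐ[ℂ] Matrix (Fin b) (Fin b) ℂ :=
  reindex (finCongr h)

theorem castM_apply {a b : ℕ} (h : a = b) (x : Matrix (Fin a) (Fin a) ℂ) (s t : Fin b) :
    castM h x s t = x (Fin.cast h.symm s) (Fin.cast h.symm t) := rfl

@[simp] theorem castM_rfl {a : ℕ} (h : a = a) (x : Matrix (Fin a) (Fin a) ℂ) :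
    castM h x = x := rfl

@[simp] theorem castM_castM {a b c : ℕ} (h : a = b) (h' : b = c) (x : Matrix (Fin a) (Fin a) ℂ) :
    castM h' (castM h x) = castM (h.trans h') x := rfl

/-- An injection of sites that preserves dimensions. -/
structure SiteEmb {I Z : Type} (n : I → ℕ) (z : Z → ℕ) where
  toFun : I → Z
  inj : Function.Injective toFun
  dim : ∀ i, n i = z (toFun i)

instance {I Z : Type} (n : I → ℕ) (z : Z → ℕ) : CoeFun (SiteEmb n z) fun _ => I → Z :=
  ⟨SiteEmb.toFun⟩

namespace SiteEmb

variable {I J Z : Type} {n : I → ℕ} {m : J → ℕ} {z : Z → ℕ}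

/-- Composition of injections of sites. -/
def comp (ε : SiteEmb m z) (η : SiteEmb n m) : SiteEmb n z :=
  ⟨fun i => ε (η i), ε.inj.comp η.inj, fun i => (η.dim i).trans (ε.dim (η i))⟩

@[simp] theorem comp_apply (ε : SiteEmb m z) (η : SiteEmb n m) (i : I) :
    ε.comp η i = ε (η i) := rfl

/-- A bijection of sites that preserves dimensions. -/
def ofEquiv (e : I ≃ J) (h : ∀ i, n i = m (e i)) : SiteEmb n m := ⟨e, e.injective, h⟩

@[simp] theorem ofEquiv_apply (e : I ≃ J) (h : ∀ i, n i = m (e i)) (i : I) :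
    ofEquiv e h i = e i := rfl

/-- The inclusion of the left summand. -/
def inl (n : I → ℕ) (m : J → ℕ) : SiteEmb n (Sum.elim n m) :=
  ⟨Sum.inl, Sum.inl_injective, fun _ => rfl⟩

@[simp] theorem inl_apply (n : I → ℕ) (m : J → ℕ) (i : I) : inl n m i = Sum.inl i := rfl

/-- An injection between systems of qudits of constant dimension. -/
def const (q : ℕ) (f : I → J) (hf : Function.Injective f) :
    SiteEmb (fun _ : I => q) (fun _ : J => q) :=
  ⟨f, hf, fun _ => rfl⟩

@[simp] theorem const_apply (q : ℕ) (f : I → J) (hf : Function.Injective f) (i : I) :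
    const q f hf i = f i := rfl

/-- The inclusion of a set of sites. -/
def sub (n : I → ℕ) (J : Finset I) : SiteEmb (fun i : J => n i) n :=
  ⟨Subtype.val, Subtype.val_injective, fun _ => rfl⟩

@[simp] theorem sub_apply (n : I → ℕ) (J : Finset I) (i : J) : sub n J i = i := rfl

@[ext] theorem ext {ε η : SiteEmb n z} (h : ∀ i, ε i = η i) : ε = η := by
  cases ε; cases η; congr; exact funext h

end SiteEmb

section Emb

variable {I J Z : Type} [Fintype I] [DecidableEq I] [Fintype J] [DecidableEq J] [Fintype Z]
  [DecidableEq Z] {n : I → ℕ} {m : J → ℕ} {z : Z → ℕ}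

/-- The operator `A ⊗ 1` on a larger system. -/
def emb (ε : SiteEmb n z) : Op n →⋆ₐ[ℂ] Op z :=
  liftHom (fun i => (siteOp (ε i)).comp (castM (ε.dim i)).toStarAlgHom)
    fun _ _ h _ _ => siteOp_commute (fun e => h (ε.inj e)) _ _

@[simp] theorem emb_siteOp (ε : SiteEmb n z) (i : I) (a) :
    emb ε (siteOp i a) = siteOp (ε i) (castM (ε.dim i) a) :=
  liftHom_siteOp _ _ i a

theorem emb_comp (ε : SiteEmb m z) (η : SiteEmb n m) (A : Op n) :
    emb (ε.comp η) A = emb ε (emb η A) := by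
  have : emb (ε.comp η) = (emb ε).comp (emb η) := starHom_ext fun i a => by simp; rfl
  exact DFunLike.congr_fun this A

theorem emb_commute_siteOp (ε : SiteEmb n z) {y : Z} (hy : ∀ i, ε i ≠ y) (A : Op n) (b) :
    Commute (emb ε A) (siteOp y b) := by
  have h := op_induction ((Subalgebra.centralizer ℂ {siteOp y b}).comap (emb ε).toAlgHom)
    (fun i a => by
      simp only [Subalgebra.mem_comap, Subalgebra.mem_centralizer_iff, Set.mem_singleton_iff,
        forall_eq]
      change siteOp y b * emb ε (siteOp i a) = emb ε (siteOp i a) * siteOp y b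
      rw [emb_siteOp]
      exact (siteOp_commute (hy i).symm _ _).eq) A
  simp only [Subalgebra.mem_comap, Subalgebra.mem_centralizer_iff, Set.mem_singleton_iff,
        forall_eq] at h
  exact h.symm

open Classical in
/-- The factors of a product operator on a larger system. -/
def embFactor (ε : SiteEmb n z) (x : ∀ i, Matrix (Fin (n i)) (Fin (n i)) ℂ) (y : Z) :
    Matrix (Fin (z y)) (Fin (z y)) ℂ :=
  if h : ∃ i, ε i = y then castM ((ε.dim h.choose).trans (congrArg z h.choose_spec)) (x h.choose)
  else 1

theorem embFactor_apply (ε : SiteEmb n z) (x : ∀ i, Matrix (Fin (n i)) (Fin (n i)) ℂ) (i : I) :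
    embFactor ε x (ε i) = castM (ε.dim i) (x i) := by
  have h : ∃ j, ε j = ε i := ⟨i, rfl⟩
  rw [embFactor, dif_pos h]
  have : ∀ j (hj : ε j = ε i), castM ((ε.dim j).trans (congrArg z hj)) (x j)
      = castM (ε.dim i) (x i) := by
    intro j hj
    obtain rfl := ε.inj hj
    rfl
  exact this _ h.choose_spec

theorem embFactor_of_notMem (ε : SiteEmb n z) (x : ∀ i, Matrix (Fin (n i)) (Fin (n i)) ℂ) {y : Z}
    (hy : ∀ i, ε i ≠ y) : embFactor ε x y = 1 := by
  rw [embFactor, dif_neg]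
  rintro ⟨i, hi⟩
  exact hy i hi

/-- `embFactor` as a homomorphism. -/
def embFactorHom (ε : SiteEmb n z) : (∀ i, Matrix (Fin (n i)) (Fin (n i)) ℂ) →*
    (∀ y, Matrix (Fin (z y)) (Fin (z y)) ℂ) where
  toFun := embFactor ε
  map_one' := by
    ext1 y
    by_cases h : ∃ i, ε i = y
    · obtain ⟨i, rfl⟩ := h
      rw [embFactor_apply]; simp
    · rw [embFactor_of_notMem _ _ (by simpa using h)]; rfl
  map_mul' a b := by
    ext1 y
    rw [Pi.mul_apply]
    by_cases h : ∃ i, ε i = y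
    · obtain ⟨i, rfl⟩ := h
      simp only [embFactor_apply, Pi.mul_apply, map_mul]
    · simp only [embFactor_of_notMem ε _ (by simpa using h), mul_one]

theorem emb_piKron (ε : SiteEmb n z) (x : ∀ i, Matrix (Fin (n i)) (Fin (n i)) ℂ) :
    emb ε (piKron x) = piKron (embFactor ε x) := by
  have : ((emb ε).toAlgHom.toRingHom.toMonoidHom).comp piKron
      = piKron.comp (embFactorHom ε) := by
    refine MonoidHom.pi_ext fun i a => ?_
    refine (emb_siteOp ε i a).trans ?_
    change _ = piKron (embFactor ε (Pi.mulSingle i a))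
    rw [siteOp_eq]
    congr 1
    ext1 y
    by_cases h : ∃ j, ε j = y
    · obtain ⟨j, rfl⟩ := h
      rw [embFactor_apply]
      by_cases hj : j = i
      · subst hj; simp
      · rw [Pi.mulSingle_eq_of_ne hj, Pi.mulSingle_eq_of_ne (fun e => hj (ε.inj e)), map_one]
    · rw [embFactor_of_notMem _ _ (by simpa using h), Pi.mulSingle_eq_of_ne]
      rintro rfl
      exact h ⟨i, rfl⟩
  exact DFunLike.congr_fun this x

-- Connects `emb`, defined by a universal property, with the entrywise definitions `extend` and
-- `onWindow`. Both sides are linear in `A`; on a product operator the factors outside the image of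
-- `ε` are identities and contribute the Kronecker deltas.
open Classical in
theorem emb_apply (ε : SiteEmb n z) (A : Op n) (σ τ : Config z) :
    emb ε A σ τ = if ∀ y, (∀ i, ε i ≠ y) → σ y = τ y then
      A (fun i => Fin.cast (ε.dim i).symm (σ (ε i))) (fun i => Fin.cast (ε.dim i).symm (τ (ε i)))
      else 0 := by
  let G : Op n →ₗ[ℂ] ℂ :=
    { toFun := fun A => if ∀ y, (∀ i, ε i ≠ y) → σ y = τ y then
        A (fun i => Fin.cast (ε.dim i).symm (σ (ε i)))
          (fun i => Fin.cast (ε.dim i).symm (τ (ε i))) else 0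
      map_add' := fun A B => by split_ifs <;> simp
      map_smul' := fun c A => by split_ifs <;> simp }
  let F : Op n →ₗ[ℂ] ℂ :=
    { toFun := fun A => emb ε A σ τ
      map_add' := fun A B => by simp
      map_smul' := fun c A => by simp }
  have : F = G := by
    refine linear_ext fun x => ?_
    change emb ε (piKron x) σ τ = ite _ (piKron x _ _) 0
    rw [emb_piKron, piKron_apply, piKron_apply]
    rw [← Finset.prod_filter_mul_prod_filter_not Finset.univ (fun y => ∃ i, ε i = y)]
    have h1 : ∏ y with ∃ i, ε i = y, embFactor ε x y (σ y) (τ y) =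
        ∏ i, x i (Fin.cast (ε.dim i).symm (σ (ε i))) (Fin.cast (ε.dim i).symm (τ (ε i))) := by
      symm
      refine Finset.prod_bij (fun i _ => ε i) (by simp) (fun _ _ _ _ h => ε.inj h)
        (by simp) fun i _ => ?_
      rw [embFactor_apply, castM_apply]
    have h2 : ∏ y with ¬ ∃ i, ε i = y, embFactor ε x y (σ y) (τ y) =
        if ∀ y, (∀ i, ε i ≠ y) → σ y = τ y then 1 else 0 := by
      rw [Finset.prod_congr rfl (g := fun y => if σ y = τ y then (1 : ℂ) else 0)]
      · rw [Finset.prod_ite_zero]; simp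
      · intro y hy
        rw [embFactor_of_notMem, Matrix.one_apply]
        simpa using hy
    rw [h1, h2]
    simp
  exact DFunLike.congr_fun this A

/-- A configuration of the small system is extended by the state `0` on the new sites, which
requires nonzero dimensions. The entries at extended configurations recover the operator. -/
theorem emb_injective [∀ i, NeZero (z i)] (ε : SiteEmb n z) : Function.Injective (emb ε) := by
  classical
  intro A B h
  ext σ τ
  let ext' : Config n → Config z := fun ρ y => if h : ∃ i, ε i = y then
    Fin.cast ((ε.dim h.choose).trans (congrArg z h.choose_spec)) (ρ h.choose) else 0
  have he : ∀ ρ i, Fin.cast (ε.dim i).symm (ext' ρ (ε i)) = ρ i := by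
    intro ρ i
    have h : ∃ j, ε j = ε i := ⟨i, rfl⟩
    simp only [ext', dif_pos h]
    have : ∀ j (hj : ε j = ε i), Fin.cast (ε.dim i).symm
        (Fin.cast ((ε.dim j).trans (congrArg z hj)) (ρ j)) = ρ i := by
      intro j hj
      obtain rfl := ε.inj hj
      rfl
    exact this _ h.choose_spec
  have h' := congrFun (congrFun h (ext' σ)) (ext' τ)
  rw [emb_apply, emb_apply, if_pos, if_pos] at h'
  · simpa only [he] using h'
  all_goals
    intro y hy
    have : ¬ ∃ i, ε i = y := by simpa using hy
    simp [ext', this]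

open Classical in
/-- The action of `α ⊗ 1` on single-site operators. -/
def ambSite (ε : SiteEmb n z) (α : Aut n) (y : Z) :
    Matrix (Fin (z y)) (Fin (z y)) ℂ →⋆ₐ[ℂ] Op z :=
  if h : ∃ i, ε i = y then (((emb ε).comp α.toStarAlgHom).comp (siteOp h.choose)).comp
    (castM ((ε.dim h.choose).trans (congrArg z h.choose_spec)).symm).toStarAlgHom
  else siteOp y

theorem ambSite_apply (ε : SiteEmb n z) (α : Aut n) (i : I) (b) :
    ambSite ε α (ε i) b = emb ε (α (siteOp i (castM (ε.dim i).symm b))) := by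
  have h : ∃ j, ε j = ε i := ⟨i, rfl⟩
  rw [ambSite, dif_pos h]
  have : ∀ j (hj : ε j = ε i), emb ε (α (siteOp j
      (castM ((ε.dim j).trans (congrArg z hj)).symm b))) =
      emb ε (α (siteOp i (castM (ε.dim i).symm b))) := by
    intro j hj
    obtain rfl := ε.inj hj
    rfl
  exact this _ h.choose_spec

theorem ambSite_of_notMem (ε : SiteEmb n z) (α : Aut n) {y : Z} (hy : ∀ i, ε i ≠ y) :
    ambSite ε α y = siteOp y := by
  rw [ambSite, dif_neg]
  rintro ⟨i, hi⟩
  exact hy i hi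

theorem ambSite_commute (ε : SiteEmb n z) (α : Aut n) :
    Pairwise fun y y' => ∀ a b, Commute (ambSite ε α y a) (ambSite ε α y' b) := by
  intro y y' hne a b
  by_cases h : ∃ i, ε i = y <;> by_cases h' : ∃ i, ε i = y'
  · obtain ⟨i, rfl⟩ := h
    obtain ⟨i', rfl⟩ := h'
    rw [ambSite_apply, ambSite_apply]
    exact ((siteOp_commute (fun e => hne (by rw [e])) _ _).map α).map (emb ε)
  · obtain ⟨i, rfl⟩ := h
    rw [ambSite_apply, ambSite_of_notMem _ _ (by simpa using h')]
    exact emb_commute_siteOp _ (by simpa using h') _ _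
  · obtain ⟨i, rfl⟩ := h'
    rw [ambSite_apply, ambSite_of_notMem _ _ (by simpa using h)]
    exact (emb_commute_siteOp _ (by simpa using h) _ _).symm
  · rw [ambSite_of_notMem _ _ (by simpa using h), ambSite_of_notMem _ _ (by simpa using h')]
    exact siteOp_commute hne _ _

/-- The homomorphism `α ⊗ 1`. -/
def ambHom (ε : SiteEmb n z) (α : Aut n) : Op z →⋆ₐ[ℂ] Op z :=
  liftHom (ambSite ε α) (ambSite_commute ε α)

theorem ambHom_siteOp (ε : SiteEmb n z) (α : Aut n) {y : Z} (hy : ∀ i, ε i ≠ y) (b) :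
    ambHom ε α (siteOp y b) = siteOp y b := by
  rw [ambHom, liftHom_siteOp, ambSite_of_notMem _ _ hy]

theorem ambHom_emb (ε : SiteEmb n z) (α : Aut n) (A : Op n) :
    ambHom ε α (emb ε A) = emb ε (α A) := by
  have : (ambHom ε α).comp (emb ε) = (emb ε).comp α.toStarAlgHom := by
    refine starHom_ext fun i a => ?_
    change ambHom ε α (emb ε (siteOp i a)) = emb ε (α (siteOp i a))
    rw [emb_siteOp, ambHom, liftHom_siteOp, ambSite_apply, castM_castM, castM_rfl]
  exact DFunLike.congr_fun this A

/-- Homomorphisms that agree on the embedded operators and on the other sites are equal. -/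
theorem starHom_ext_emb {A : Type*} [Semiring A] [Algebra ℂ A] [Star A] (ε : SiteEmb n z)
    {F G : Op z →⋆ₐ[ℂ] A} (h : ∀ i a, F (emb ε (siteOp i a)) = G (emb ε (siteOp i a)))
    (h' : ∀ y, (∀ i, ε i ≠ y) → ∀ b, F (siteOp y b) = G (siteOp y b)) : F = G := by
  refine starHom_ext fun y b => ?_
  by_cases hy : ∃ i, ε i = y
  · obtain ⟨i, rfl⟩ := hy
    have := h i (castM (ε.dim i).symm b)
    rwa [emb_siteOp, castM_castM, castM_rfl] at this
  · exact h' y (by simpa using hy) b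

theorem ambHom_one (ε : SiteEmb n z) : ambHom ε 1 = StarAlgHom.id ℂ (Op z) :=
  starHom_ext_emb ε (fun i a => by rw [ambHom_emb]; rfl) fun y hy b => ambHom_siteOp ε 1 hy b

theorem ambHom_mul (ε : SiteEmb n z) (α β : Aut n) :
    ambHom ε (α * β) = (ambHom ε α).comp (ambHom ε β) :=
  starHom_ext_emb ε (fun i a => by
    rw [StarAlgHom.comp_apply, ambHom_emb, ambHom_emb, ambHom_emb]; rfl) fun y hy b => by
    rw [StarAlgHom.comp_apply, ambHom_siteOp _ _ hy, ambHom_siteOp _ _ hy, ambHom_siteOp _ _ hy]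

/-- The automorphism `α ⊗ 1`. -/
def amb (ε : SiteEmb n z) : Aut n →* Aut z where
  toFun α := StarAlgEquiv.ofStarAlgHom (ambHom ε α) (ambHom ε α⁻¹)
    (by rw [← ambHom_mul, inv_mul_cancel, ambHom_one])
    (by rw [← ambHom_mul, mul_inv_cancel, ambHom_one])
  map_one' := StarAlgEquiv.ext fun A => DFunLike.congr_fun (ambHom_one ε) A
  map_mul' α β := StarAlgEquiv.ext fun A => DFunLike.congr_fun (ambHom_mul ε α β) A

theorem amb_siteOp (ε : SiteEmb n z) (α : Aut n) {y : Z} (hy : ∀ i, ε i ≠ y) (b) :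
    amb ε α (siteOp y b) = siteOp y b := ambHom_siteOp ε α hy b

theorem amb_emb (ε : SiteEmb n z) (α : Aut n) (A : Op n) :
    amb ε α (emb ε A) = emb ε (α A) := ambHom_emb ε α A

theorem aut_ext_emb (ε : SiteEmb n z) {F G : Aut z}
    (h : ∀ i a, F (emb ε (siteOp i a)) = G (emb ε (siteOp i a)))
    (h' : ∀ y, (∀ i, ε i ≠ y) → ∀ b, F (siteOp y b) = G (siteOp y b)) : F = G := by
  have : F.toStarAlgHom = G.toStarAlgHom := starHom_ext_emb ε h h'
  exact StarAlgEquiv.ext fun A => DFunLike.congr_fun this A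

theorem amb_comp (ε : SiteEmb m z) (η : SiteEmb n m) (α : Aut n) :
    amb (ε.comp η) α = amb ε (amb η α) := by
  refine aut_ext_emb (ε.comp η) (fun i a => ?_) fun y hy b => ?_
  · rw [amb_emb, emb_comp, emb_comp, amb_emb, amb_emb]
  · rw [amb_siteOp _ _ hy]
    by_cases h : ∃ j, ε j = y
    · obtain ⟨j, rfl⟩ := h
      have : siteOp (ε j) b = emb ε (siteOp j (castM (ε.dim j).symm b)) := by simp
      rw [this, amb_emb, amb_siteOp]
      intro i hi
      exact hy i (by rw [SiteEmb.comp_apply, hi])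
    · rw [amb_siteOp _ _ (by simpa using h)]

/-- Automorphisms of disjoint subsystems commute. -/
theorem amb_commute (ε : SiteEmb n z) (η : SiteEmb m z) (h : ∀ i j, ε i ≠ η j) (α : Aut n)
    (β : Aut m) : Commute (amb ε α) (amb η β) := by
  have key : ∀ A, amb η β (emb ε A) = emb ε A := by
    have : (amb η β).toStarAlgHom.comp (emb ε) = emb ε := by
      refine starHom_ext fun i a => ?_
      change amb η β (emb ε (siteOp i a)) = _
      rw [emb_siteOp, amb_siteOp _ _ fun j => (h i j).symm]
    exact fun A => DFunLike.congr_fun this A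
  have key' : ∀ A, amb ε α (emb η A) = emb η A := by
    have : (amb ε α).toStarAlgHom.comp (emb η) = emb η := by
      refine starHom_ext fun i a => ?_
      change amb ε α (emb η (siteOp i a)) = _
      rw [emb_siteOp, amb_siteOp _ _ fun j => h j i]
    exact fun A => DFunLike.congr_fun this A
  refine aut_ext_emb ε (fun i a => ?_) fun y hy b => ?_
  · rw [StarAlgEquiv.mul_apply, StarAlgEquiv.mul_apply, key, amb_emb, key]
  · rw [StarAlgEquiv.mul_apply, StarAlgEquiv.mul_apply, amb_siteOp ε _ hy]
    by_cases h : ∃ j, η j = y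
    · obtain ⟨j, rfl⟩ := h
      have : siteOp (η j) b = emb η (siteOp j (castM (η.dim j).symm b)) := by simp
      rw [this, amb_emb, key']
    · rw [amb_siteOp _ _ (by simpa using h), amb_siteOp ε _ hy]

/-- An injective endomorphism of the algebra of all operators is an automorphism. -/
theorem exists_aut_of_hom [∀ i, NeZero (n i)] (F : Op n →⋆ₐ[ℂ] Op n) :
    ∃ α : Aut n, ∀ A, α A = F A := by
  -- Matrix algebras are simple, so injectivity is automatic; the nonzero dimensions make the
  -- algebra nontrivial. Equality of dimensions then gives surjectivity.
  have inj : Function.Injective F := (F.toAlgHom.toRingHom).injective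
  have bij : Function.Bijective F :=
    ⟨inj, LinearMap.surjective_of_injective (f := F.toAlgHom.toLinearMap) inj⟩
  exact ⟨StarAlgEquiv.ofBijective F bij, fun _ => rfl⟩

end Emb

/-! ### Support as a commutation property -/

section Support

variable {I Z : Type} [Fintype I] [DecidableEq I] [Fintype Z] [DecidableEq Z]
  {n : I → ℕ} {z : Z → ℕ}

/-- `A` commutes with all operators on sites outside `J`. -/
def ActsOn (J : Finset I) (A : Op n) : Prop := ∀ i ∉ J, ∀ a, Commute (siteOp i a) A

theorem ActsOn.mono {J J' : Finset I} (h : J ⊆ J') {A : Op n} (hA : ActsOn J A) : ActsOn J' A :=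
  fun i hi a => hA i (fun hi' => hi (h hi')) a

theorem ActsOn.mul {J : Finset I} {A B : Op n} (hA : ActsOn J A) (hB : ActsOn J B) :
    ActsOn J (A * B) := fun i hi a => (hA i hi a).mul_right (hB i hi a)

theorem ActsOn.star {J : Finset I} {A : Op n} (hA : ActsOn J A) : ActsOn J (star A) := by
  intro i hi a
  have := commute_star_star.2 (hA i hi (Star.star a))
  rwa [map_star, star_star] at this

theorem actsOn_siteOp (i : I) (a) : ActsOn {i} (siteOp i a : Op n) :=
  fun _ hj _ => siteOp_commute (by simpa using hj) _ _

theorem ActsOn.emb {J : Finset I} {A : Op n} (hA : ActsOn J A) (ε : SiteEmb n z) :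
    ActsOn (J.image ε) (emb ε A) := by
  intro y hy b
  by_cases h : ∃ i, ε i = y
  · obtain ⟨i, rfl⟩ := h
    have e : siteOp (ε i) b = QCA.emb ε (siteOp i (castM (ε.dim i).symm b)) := by simp
    rw [e]
    exact (hA i (fun hi => hy (Finset.mem_image_of_mem _ hi)) _).map (QCA.emb ε)
  · exact (emb_commute_siteOp ε (by simpa using h) A b).symm

theorem actsOn_emb (ε : SiteEmb n z) (A : Op n) : ActsOn (Finset.univ.image ε) (emb ε A) :=
  ActsOn.emb (J := Finset.univ) (fun i hi => absurd (Finset.mem_univ i) hi) ε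

theorem siteOp_single_mul (i : I) (s t : Fin (n i)) (A : Op n) (σ τ : Config n) :
    (siteOp i (Matrix.single s t 1) * A) σ τ =
      if σ i = s then A (Function.update σ i t) τ else 0 := by
  rw [Matrix.mul_apply, Finset.sum_eq_single (Function.update σ i t)]
  · rw [siteOp_apply, if_pos (fun y hy => by simp [hy]), Matrix.single_apply]
    simp [eq_comm]
  · intro ρ _ hρ
    rw [siteOp_apply]
    split_ifs with h
    · rw [Matrix.single_apply, if_neg, zero_mul]
      rintro ⟨_, h2⟩
      refine hρ (funext fun y => ?_)
      by_cases hy : y = i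
      · subst hy; simp [h2]
      · simp [hy, h y hy]
    · rw [zero_mul]
  · simp

theorem mul_siteOp_single (i : I) (s t : Fin (n i)) (A : Op n) (σ τ : Config n) :
    (A * siteOp i (Matrix.single s t 1)) σ τ =
      if τ i = t then A σ (Function.update τ i s) else 0 := by
  rw [Matrix.mul_apply, Finset.sum_eq_single (Function.update τ i s)]
  · rw [siteOp_apply, if_pos (fun y hy => by simp [hy]), Matrix.single_apply]
    simp [eq_comm]
  · intro ρ _ hρ
    rw [siteOp_apply]
    split_ifs with h
    · rw [Matrix.single_apply, if_neg, mul_zero]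
      rintro ⟨h1, _⟩
      refine hρ (funext fun y => ?_)
      by_cases hy : y = i
      · subst hy; simp [h1]
      · simp [hy, h y hy]
    · rw [mul_zero]
  · simp

/-- A commutant computation in coordinates. Commuting with the diagonal matrix units at a site
outside `J` makes `A` diagonal there (`h1`), and commuting with the other matrix units makes the
diagonal entries independent of the state (`h2`). So all states outside `J` can be replaced, one
site at a time, by those of a reference configuration `ω` (`h3`). -/
theorem ActsOn.exists_emb {J : Finset I} {A : Op n} (hA : ActsOn J A) :
    ∃ B, A = QCA.emb (SiteEmb.sub n J) B := by
  classical
  rcases isEmpty_or_nonempty (Config n) with hE | ⟨⟨ω⟩⟩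
  · exact ⟨0, Subsingleton.elim _ _⟩
  have h1 : ∀ i ∉ J, ∀ σ τ : Config n, σ i ≠ τ i → A σ τ = 0 := by
    intro i hi σ τ hne
    have := congrFun (congrFun (hA i hi (Matrix.single (σ i) (σ i) 1)).eq σ) τ
    rw [siteOp_single_mul, mul_siteOp_single, if_pos rfl, if_neg hne.symm,
      Function.update_eq_self] at this
    exact this
  have h2 : ∀ i ∉ J, ∀ (σ τ : Config n) (t), σ i = τ i →
      A (Function.update σ i t) (Function.update τ i t) = A σ τ := by
    intro i hi σ τ t he
    have := congrFun (congrFun (hA i hi (Matrix.single (σ i) t 1)).eq σ) (Function.update τ i t)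
    rw [siteOp_single_mul, mul_siteOp_single, if_pos rfl, Function.update_self, if_pos rfl,
      Function.update_idem, he, Function.update_eq_self] at this
    exact this
  have h3 : ∀ (σ τ : Config n), (∀ i, i ∉ J → σ i = τ i) → ∀ T : Finset I, (∀ i ∈ T, i ∉ J) →
      A (T.piecewise ω σ) (T.piecewise ω τ) = A σ τ := by
    intro σ τ hστ T
    induction T using Finset.induction_on with
    | empty => simp
    | insert i T hi ih =>
      intro hT
      rw [Finset.piecewise_insert, Finset.piecewise_insert, h2 i (hT i (by simp)),
        ih fun k hk => hT k (by simp [hk])]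
      simp [hi, hστ i (hT i (by simp))]
  refine ⟨Matrix.of fun σ τ => A (fun i => if h : i ∈ J then σ ⟨i, h⟩ else ω i)
    (fun i => if h : i ∈ J then τ ⟨i, h⟩ else ω i), ?_⟩
  ext σ τ
  rw [emb_apply]
  split_ifs with h
  · have h' : ∀ i, i ∉ J → σ i = τ i := fun i hi => h i (fun k hk => hi (hk ▸ k.2))
    rw [← h3 σ τ h' Jᶜ (by simp)]
    simp only [Matrix.of_apply]
    congr 1 <;>
    · ext1 i
      by_cases hi : i ∈ J <;> simp [hi]
  · push Not at h
    obtain ⟨i, hi, hne⟩ := h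
    exact h1 i (fun hiJ => hi ⟨i, hiJ⟩ rfl) σ τ hne

theorem extend_eq_emb (J : Finset I) (B : Op fun i : J => n i) :
    extend J B = emb (SiteEmb.sub n J) B := by
  classical
  ext σ τ
  rw [emb_apply]
  simp only [extend, Matrix.of_apply]
  refine if_congr ?_ rfl rfl
  refine forall_congr' fun y => ?_
  constructor
  · intro h hy; exact h fun hJ => hy ⟨y, hJ⟩ rfl
  · intro h hy; exact h fun i hi => hy (hi ▸ i.2)

/-- Turns support into commutation with single-site operators, a property that visibly passes to
products, adjoints and images under homomorphisms. -/
theorem supportedOn_iff {J : Finset I} {A : Op n} : SupportedOn J A ↔ ActsOn J A := by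
  constructor
  · rintro ⟨B, rfl⟩
    rw [extend_eq_emb]
    refine (actsOn_emb _ B).mono ?_
    intro i hi
    obtain ⟨k, _, rfl⟩ := Finset.mem_image.1 hi
    exact k.2
  · intro h
    obtain ⟨B, rfl⟩ := h.exists_emb
    exact ⟨B, (extend_eq_emb J B).symm⟩

/-- `emb` as a homomorphism of algebras. -/
def embAlg (ε : SiteEmb n z) : Op n →ₐ[ℂ] Op z := (emb ε).toAlgHom

theorem embAlg_apply (ε : SiteEmb n z) (A : Op n) : embAlg ε A = emb ε A := rfl

/-- An automorphism as a homomorphism of algebras. -/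
def autAlg (α : Aut n) : Op n →ₐ[ℂ] Op n := α.toStarAlgHom.toAlgHom

/-- Homomorphisms that agree on the sites in `J` agree on operators supported on `J`. -/
theorem ActsOn.hom_eq {R : Type*} [Semiring R] [Algebra ℂ R] {J : Finset I} {A : Op n}
    (hA : ActsOn J A) {F G : Op n →ₐ[ℂ] R}
    (h : ∀ i ∈ J, ∀ a, F (siteOp i a) = G (siteOp i a)) : F A = G A := by
  obtain ⟨B, rfl⟩ := hA.exists_emb
  have : F.comp (embAlg (SiteEmb.sub n J)) = G.comp (embAlg (SiteEmb.sub n J)) := by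
    refine hom_ext fun i a => ?_
    rw [AlgHom.comp_apply, AlgHom.comp_apply, embAlg_apply, emb_siteOp]
    exact h _ i.2 _
  exact DFunLike.congr_fun this B

theorem ActsOn.aut_eq {J : Finset I} {A : Op n} (hA : ActsOn J A) {α β : Aut n}
    (h : ∀ i ∈ J, ∀ a, α (siteOp i a) = β (siteOp i a)) : α A = β A :=
  hA.hom_eq (F := autAlg α) (G := autAlg β) h

theorem ActsOn.commute_of {R : Type*} [Semiring R] [Algebra ℂ R] {J : Finset I} {A : Op n}
    (hA : ActsOn J A) {F : Op n →ₐ[ℂ] R} {C : R}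
    (h : ∀ i ∈ J, ∀ a, Commute C (F (siteOp i a))) : Commute C (F A) := by
  obtain ⟨B, rfl⟩ := hA.exists_emb
  have := op_induction ((Subalgebra.centralizer ℂ {C}).comap
    (F.comp (embAlg (SiteEmb.sub n J)))) (fun i a => by
      simp only [Subalgebra.mem_comap, Subalgebra.mem_centralizer_iff, Set.mem_singleton_iff,
        forall_eq]
      rw [AlgHom.comp_apply, embAlg_apply, emb_siteOp]
      exact (h _ i.2 _).eq) B
  simp only [Subalgebra.mem_comap, Subalgebra.mem_centralizer_iff, Set.mem_singleton_iff,
        forall_eq] at this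
  exact this

theorem ActsOn.commute {J J' : Finset I} {A B : Op n} (hA : ActsOn J A) (hB : ActsOn J' B)
    (h : Disjoint J J') : Commute A B :=
  hB.commute_of (F := AlgHom.id ℂ _) fun i hi a =>
    (hA i (fun hJ => Finset.disjoint_left.1 h hJ hi) a).symm

/-- An automorphism spreads operators at most along `N`. -/
theorem ActsOn.map_aut {α : Aut n} {N : I → Finset I}
    (hα : ∀ i a, ActsOn (N i) (α (siteOp i a))) {J : Finset I} {A : Op n} (hA : ActsOn J A) :
    ActsOn (J.biUnion N) (α A) := by
  intro y hy b
  refine hA.commute_of (F := autAlg α) fun i hi a => ?_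
  exact hα i a y (fun h => hy (Finset.mem_biUnion.2 ⟨i, hi, h⟩)) b

/-- The relation `[a, α b] = 0` for distant sites becomes `[α⁻¹ a, b] = 0` after applying `α⁻¹`; so
the inverse spreads along the transposed neighbourhoods. -/
theorem actsOn_inv {α : Aut n} {N N' : I → Finset I}
    (hα : ∀ i a, ActsOn (N i) (α (siteOp i a))) (hN : ∀ i k, i ∈ N k → k ∈ N' i) (i : I) (a) :
    ActsOn (N' i) (α⁻¹ (siteOp i a)) := by
  intro k hk b
  have h1 : Commute (siteOp i a) (α (siteOp k b)) := hα k b i (fun h => hk (hN _ _ h)) a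
  have h2 := h1.map α⁻¹
  have h3 : α⁻¹ (α (siteOp k b)) = siteOp k b := StarAlgEquiv.symm_apply_apply α _
  rw [h3] at h2
  exact h2.symm

end Support

/-! ### The calculus of circuits and of stable circuits -/

section Circuits

variable {I Z X Y : Type} [Fintype I] [DecidableEq I] [Fintype Z] [DecidableEq Z]
  [PseudoMetricSpace X] [PseudoMetricSpace Y] {n : I → ℕ} {z : Z → ℕ}

/-- `γ` is conjugation by a quantum circuit. -/
def IsCirc (pos : I → X) (D : ℕ) (ρ : ℝ) (γ : Aut n) : Prop :=
  ∃ U : Op n, IsCircuit pos D ρ U ∧ ∀ A, γ A = U * A * star U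

theorem IsRound.unitary {pos : I → X} {ρ : ℝ} {U : Op n} (h : IsRound pos ρ U) :
    U ∈ unitary (Op n) := by
  obtain ⟨G, _, hG, rfl⟩ := h
  refine Submonoid.list_prod_mem _ fun u hu => ?_
  obtain ⟨g, hg, rfl⟩ := List.mem_map.1 hu
  exact (hG g hg).2.1

theorem IsCircuit.unitary {pos : I → X} {D : ℕ} {ρ : ℝ} {U : Op n} (h : IsCircuit pos D ρ U) :
    U ∈ unitary (Op n) := by
  obtain ⟨l, _, hl, rfl⟩ := h
  exact Submonoid.list_prod_mem _ fun u hu => (hl u hu).unitary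

theorem IsRound.one (pos : I → X) (ρ : ℝ) : IsRound pos ρ (1 : Op n) :=
  ⟨[], by simp, by simp, by simp⟩

theorem IsRound.repos {pos : I → X} {pos' : I → Y} {ρ ρ' : ℝ} {U : Op n} (h : IsRound pos ρ U)
    (hp : ∀ i k, dist (pos i) (pos k) ≤ ρ → dist (pos' i) (pos' k) ≤ ρ') : IsRound pos' ρ' U := by
  obtain ⟨G, h1, h2, rfl⟩ := h
  exact ⟨G, h1, fun g hg => ⟨fun i hi k hk => hp _ _ ((h2 g hg).1 i hi k hk), (h2 g hg).2⟩, rfl⟩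

theorem IsRound.star {pos : I → X} {ρ : ℝ} {U : Op n} (h : IsRound pos ρ U) :
    IsRound pos ρ (star U) := by
  obtain ⟨G, h1, h2, rfl⟩ := h
  refine ⟨(G.map fun g => (g.1, Star.star g.2)).reverse, ?_, ?_, ?_⟩
  · rw [List.pairwise_reverse, List.pairwise_map]
    exact h1.imp fun h => h.symm
  · intro g hg
    obtain ⟨g, hg', rfl⟩ := List.mem_map.1 (List.mem_reverse.1 hg)
    refine ⟨(h2 g hg').1, Unitary.star_mem (h2 g hg').2.1, ?_⟩
    exact supportedOn_iff.2 (supportedOn_iff.1 (h2 g hg').2.2).star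
  · clear h1 h2
    induction G with
    | nil => simp
    | cons g G ih => simp [ih]

theorem IsRound.emb {pos : I → X} {pos' : Z → X} {ρ : ℝ} {U : Op n} (h : IsRound pos ρ U)
    (ε : SiteEmb n z) (hp : ∀ i, pos' (ε i) = pos i) : IsRound pos' ρ (emb ε U) := by
  obtain ⟨G, h1, h2, rfl⟩ := h
  refine ⟨G.map fun g => (g.1.image ε, QCA.emb ε g.2), ?_, ?_, ?_⟩
  · rw [List.pairwise_map]
    exact h1.imp fun h => (Finset.disjoint_image ε.inj).2 h
  · intro g hg
    obtain ⟨g, hg', rfl⟩ := List.mem_map.1 hg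
    refine ⟨?_, ?_, ?_⟩
    · intro i hi k hk
      obtain ⟨i, hi', rfl⟩ := Finset.mem_image.1 hi
      obtain ⟨k, hk', rfl⟩ := Finset.mem_image.1 hk
      rw [hp, hp]
      exact (h2 g hg').1 i hi' k hk'
    · exact Unitary.map_mem (QCA.emb ε) (h2 g hg').2.1
    · exact supportedOn_iff.2 ((supportedOn_iff.1 (h2 g hg').2.2).emb ε)
  · rw [map_list_prod, List.map_map, List.map_map]
    rfl

theorem IsCircuit.one (pos : I → X) (D : ℕ) (ρ : ℝ) : IsCircuit pos D ρ (1 : Op n) :=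
  ⟨List.replicate D 1, by simp, fun u hu => by
    rw [List.eq_of_mem_replicate hu]; exact IsRound.one pos ρ, by simp⟩

theorem IsCircuit.mul {pos : I → X} {D D' : ℕ} {ρ : ℝ} {U V : Op n} (h : IsCircuit pos D ρ U)
    (h' : IsCircuit pos D' ρ V) : IsCircuit pos (D + D') ρ (U * V) := by
  obtain ⟨l, h1, h2, rfl⟩ := h
  obtain ⟨l', h1', h2', rfl⟩ := h'
  refine ⟨l ++ l', by simp [h1, h1'], fun u hu => ?_, by simp⟩
  rcases List.mem_append.1 hu with h | h
  exacts [h2 u h, h2' u h]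

theorem IsCircuit.repos {pos : I → X} {pos' : I → Y} {D : ℕ} {ρ ρ' : ℝ} {U : Op n}
    (h : IsCircuit pos D ρ U)
    (hp : ∀ i k, dist (pos i) (pos k) ≤ ρ → dist (pos' i) (pos' k) ≤ ρ') :
    IsCircuit pos' D ρ' U := by
  obtain ⟨l, h1, h2, rfl⟩ := h
  exact ⟨l, h1, fun u hu => (h2 u hu).repos hp, rfl⟩

theorem IsCircuit.star {pos : I → X} {D : ℕ} {ρ : ℝ} {U : Op n} (h : IsCircuit pos D ρ U) :
    IsCircuit pos D ρ (star U) := by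
  obtain ⟨l, h1, h2, rfl⟩ := h
  refine ⟨(l.map Star.star).reverse, by simp [h1], fun u hu => ?_, ?_⟩
  · obtain ⟨u, hu', rfl⟩ := List.mem_map.1 (List.mem_reverse.1 hu)
    exact (h2 u hu').star
  · clear h1 h2
    induction l with
    | nil => simp
    | cons g G ih => simp [ih]

theorem IsCircuit.emb {pos : I → X} {pos' : Z → X} {D : ℕ} {ρ : ℝ} {U : Op n}
    (h : IsCircuit pos D ρ U) (ε : SiteEmb n z) (hp : ∀ i, pos' (ε i) = pos i) :
    IsCircuit pos' D ρ (emb ε U) := by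
  obtain ⟨l, h1, h2, rfl⟩ := h
  refine ⟨l.map (QCA.emb ε), by simp [h1], fun u hu => ?_, by rw [map_list_prod]⟩
  obtain ⟨u, hu', rfl⟩ := List.mem_map.1 hu
  exact (h2 u hu').emb ε hp

theorem IsCirc.one (pos : I → X) (D : ℕ) (ρ : ℝ) : IsCirc pos D ρ (1 : Aut n) :=
  ⟨1, IsCircuit.one pos D ρ, fun A => by simp⟩

theorem IsCirc.mul {pos : I → X} {D D' : ℕ} {ρ : ℝ} {α β : Aut n} (h : IsCirc pos D ρ α)
    (h' : IsCirc pos D' ρ β) : IsCirc pos (D + D') ρ (α * β) := by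
  obtain ⟨U, hU, h1⟩ := h
  obtain ⟨V, hV, h2⟩ := h'
  refine ⟨U * V, hU.mul hV, fun A => ?_⟩
  rw [StarAlgEquiv.mul_apply, h1, h2, star_mul]
  simp only [mul_assoc]

theorem IsCirc.repos {pos : I → X} {pos' : I → Y} {D : ℕ} {ρ ρ' : ℝ} {α : Aut n}
    (h : IsCirc pos D ρ α)
    (hp : ∀ i k, dist (pos i) (pos k) ≤ ρ → dist (pos' i) (pos' k) ≤ ρ') :
    IsCirc pos' D ρ' α := by
  obtain ⟨U, hU, h1⟩ := h
  exact ⟨U, hU.repos hp, h1⟩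

theorem IsCirc.mono {pos : I → X} {D D' : ℕ} {ρ ρ' : ℝ} {α : Aut n}
    (h : IsCirc pos D ρ α) (hD : D ≤ D') (hρ : ρ ≤ ρ') : IsCirc pos D' ρ' α := by
  have := (h.repos (pos' := pos) (ρ' := ρ') fun _ _ h => h.trans hρ).mul
    (IsCirc.one pos (D' - D) ρ')
  rwa [mul_one, Nat.add_sub_cancel' hD] at this

theorem IsCirc.inv {pos : I → X} {D : ℕ} {ρ : ℝ} {α : Aut n} (h : IsCirc pos D ρ α) :
    IsCirc pos D ρ α⁻¹ := by
  obtain ⟨U, hU, h1⟩ := h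
  refine ⟨star U, hU.star, fun A => ?_⟩
  have hu := hU.unitary
  have : α (star U * A * U) = A := by
    rw [h1]
    simp only [← mul_assoc, Unitary.mul_star_self_of_mem hu, one_mul]
    rw [mul_assoc, Unitary.mul_star_self_of_mem hu, mul_one]
  rw [star_star]
  nth_rw 1 [← this]
  exact StarAlgEquiv.symm_apply_apply α _

theorem amb_conj (ε : SiteEmb n z) {α : Aut n} {U : Op n} (hU : U ∈ unitary (Op n))
    (h : ∀ A, α A = U * A * star U) (A : Op z) : amb ε α A = emb ε U * A * star (emb ε U) := by
  have hV : emb ε U ∈ unitary (Op z) := Unitary.map_mem (emb ε) hU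
  have : amb ε α = Unitary.conjStarAlgAut ℂ (Op z) ⟨emb ε U, hV⟩ := by
    refine aut_ext_emb ε (fun i a => ?_) fun y hy b => ?_
    · rw [amb_emb, h, Unitary.conjStarAlgAut_apply, map_mul, map_mul, map_star]
    · rw [amb_siteOp _ _ hy, Unitary.conjStarAlgAut_apply]
      change _ = emb ε U * _ * star (emb ε U)
      rw [(emb_commute_siteOp ε hy U b).eq, mul_assoc, Unitary.mul_star_self_of_mem hV, mul_one]
  rw [this, Unitary.conjStarAlgAut_apply]

theorem IsCirc.amb {pos : I → X} {pos' : Z → X} {D : ℕ} {ρ : ℝ} {α : Aut n}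
    (h : IsCirc pos D ρ α) (ε : SiteEmb n z) (hp : ∀ i, pos' (ε i) = pos i) :
    IsCirc pos' D ρ (amb ε α) := by
  obtain ⟨U, hU, h1⟩ := h
  exact ⟨emb ε U, hU.emb ε hp, amb_conj ε hU.unitary h1⟩

/-- `γ` is, after adding ancillas, conjugation by a quantum circuit. -/
def Triv (pos : I → X) (D : ℕ) (ρ : ℝ) (γ : Aut n) : Prop :=
  ∃ (K : Type) (_ : Fintype K) (_ : DecidableEq K) (a : K → ℕ) (p : K → X), (∀ k, 0 < a k) ∧
    IsCirc (Sum.elim pos p) D ρ (QCA.amb (SiteEmb.inl n a) γ)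

theorem IsCirc.triv {pos : I → X} {D : ℕ} {ρ : ℝ} {α : Aut n} (h : IsCirc pos D ρ α) :
    Triv pos D ρ α :=
  ⟨Empty, inferInstance, inferInstance, Empty.elim, Empty.elim, fun k => k.elim,
    h.amb _ fun _ => rfl⟩

theorem Triv.mono {pos : I → X} {D D' : ℕ} {ρ ρ' : ℝ} {α : Aut n}
    (h : Triv pos D ρ α) (hD : D ≤ D') (hρ : ρ ≤ ρ') : Triv pos D' ρ' α := by
  obtain ⟨K, fK, dK, a, p, ha, h⟩ := h
  exact ⟨K, fK, dK, a, p, ha, h.mono hD hρ⟩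

theorem Triv.one (pos : I → X) (D : ℕ) (ρ : ℝ) : Triv pos D ρ (1 : Aut n) :=
  (IsCirc.one pos D ρ).triv

theorem Triv.inv {pos : I → X} {D : ℕ} {ρ : ℝ} {α : Aut n}
    (h : Triv pos D ρ α) : Triv pos D ρ α⁻¹ := by
  obtain ⟨K, fK, dK, a, p, ha, h⟩ := h
  refine ⟨K, fK, dK, a, p, ha, ?_⟩
  rw [map_inv]
  exact h.inv

/-- The two circuits may need different ancillas; both are run on the union of the two ancilla
systems. -/
theorem Triv.mul {pos : I → X} {D D' : ℕ} {ρ : ℝ} {α β : Aut n}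
    (h : Triv pos D ρ α) (h' : Triv pos D' ρ β) : Triv pos (D + D') ρ (α * β) := by
  obtain ⟨K, fK, dK, a, p, ha, h⟩ := h
  obtain ⟨K', fK', dK', a', p', ha', h'⟩ := h'
  refine ⟨K ⊕ K', inferInstance, inferInstance, Sum.elim a a', Sum.elim p p', ?_, ?_⟩
  · rintro (k | k)
    exacts [ha k, ha' k]
  let ε : SiteEmb (Sum.elim n a) (Sum.elim n (Sum.elim a a')) :=
    ⟨Sum.elim Sum.inl fun k => Sum.inr (Sum.inl k), by
      rintro (x | x) (y | y) h <;> simp_all, by rintro (x | x) <;> rfl⟩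
  let η : SiteEmb (Sum.elim n a') (Sum.elim n (Sum.elim a a')) :=
    ⟨Sum.elim Sum.inl fun k => Sum.inr (Sum.inr k), by
      rintro (x | x) (y | y) h <;> simp_all, by rintro (x | x) <;> rfl⟩
  have e1 : QCA.amb (SiteEmb.inl n (Sum.elim a a')) α =
      QCA.amb ε (QCA.amb (SiteEmb.inl n a) α) := by rw [← amb_comp]; rfl
  have e2 : QCA.amb (SiteEmb.inl n (Sum.elim a a')) β =
      QCA.amb η (QCA.amb (SiteEmb.inl n a') β) := by rw [← amb_comp]; rfl
  rw [map_mul, e1, e2]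
  exact (h.amb ε (by rintro (x | x) <;> rfl)).mul (h'.amb η (by rintro (x | x) <;> rfl))

theorem Triv.amb {pos : I → X} {pos' : Z → X} {D : ℕ} {ρ : ℝ} {α : Aut n}
    (h : Triv pos D ρ α) (ε : SiteEmb n z) (hp : ∀ i, pos' (ε i) = pos i) :
    Triv pos' D ρ (amb ε α) := by
  obtain ⟨K, fK, dK, a, p, ha, h⟩ := h
  refine ⟨K, fK, dK, a, p, ha, ?_⟩
  let η : SiteEmb (Sum.elim n a) (Sum.elim z a) :=
    ⟨Sum.map ε id, Sum.map_injective.2 ⟨ε.inj, Function.injective_id⟩, by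
      rintro (x | x); exacts [ε.dim x, rfl]⟩
  have e : QCA.amb (SiteEmb.inl z a) (QCA.amb ε α) = QCA.amb η (QCA.amb (SiteEmb.inl n a) α) := by
    rw [← amb_comp, ← amb_comp]; rfl
  rw [e]
  exact h.amb η (by rintro (x | x); exacts [hp x, rfl])

/-- The sites of the larger system outside the image of `ε` are reinterpreted as ancillas, which is
why their dimensions must be nonzero. -/
theorem Triv.of_amb {pos : I → X} {pos' : Z → X} {D : ℕ} {ρ : ℝ} {α : Aut n}
    (ε : SiteEmb n z) (h : Triv pos' D ρ (QCA.amb ε α)) (hp : ∀ i, pos' (ε i) = pos i)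
    (hz : ∀ y, 0 < z y) : Triv pos D ρ α := by
  classical
  obtain ⟨K, fK, dK, a, p, ha, h⟩ := h
  refine ⟨{y // ¬ ∃ i, ε i = y} ⊕ K, inferInstance, inferInstance,
    Sum.elim (fun y => z y) a, Sum.elim (fun y => pos' y) p, ?_, ?_⟩
  · rintro (k | k)
    exacts [hz _, ha k]
  have hch : ∀ i, ∀ h : ∃ j, ε j = ε i, h.choose = i := fun i h => ε.inj h.choose_spec
  let η : SiteEmb (Sum.elim z a) (Sum.elim n (Sum.elim (fun y : {y // ¬ ∃ i, ε i = y} => z y) a)) :=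
    ⟨Sum.elim (fun y => if h : ∃ i, ε i = y then Sum.inl h.choose else Sum.inr (Sum.inl ⟨y, h⟩))
      (fun k => Sum.inr (Sum.inr k)), by
      rintro (x | x) (y | y) h
      · simp only [Sum.elim_inl] at h
        split_ifs at h with h1 h2 h2
        · rw [← h1.choose_spec, ← h2.choose_spec, Sum.inl_injective h]
        · simpa using h
      · simp only [Sum.elim_inl, Sum.elim_inr] at h
        split_ifs at h; simp at h
      · simp only [Sum.elim_inl, Sum.elim_inr] at h
        split_ifs at h; simp at h
      · simpa using h, by
      rintro (x | x)
      · simp only [Sum.elim_inl]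
        split_ifs with h1
        · simp only [Sum.elim_inl]
          rw [ε.dim, h1.choose_spec]
        · rfl
      · rfl⟩
  have e : SiteEmb.inl n (Sum.elim (fun y : {y // ¬ ∃ i, ε i = y} => z y) a)
      = η.comp ((SiteEmb.inl z a).comp ε) := by
    ext1 i
    have h : ∃ j, ε j = ε i := ⟨i, rfl⟩
    simp only [SiteEmb.inl_apply, SiteEmb.comp_apply, η, Sum.elim_inl, dif_pos h, hch i h]
  rw [e, amb_comp, amb_comp]
  refine h.amb η ?_
  rintro (y | k)
  · simp only [η, Sum.elim_inl]
    split_ifs with h1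
    · simp only [Sum.elim_inl]
      rw [← hp, h1.choose_spec]
    · rfl
  · rfl

end Circuits

/-! ### Commuting overlapping gates arranged in rounds -/

/-- A relation of degree at most `Δ` has a proper colouring with `Δ + 1` colours. -/
theorem exists_coloring {P : Type} [Fintype P] [DecidableEq P] (conf : P → P → Prop)
    [DecidableRel conf] (symm : ∀ p p', conf p p' → conf p' p) (Δ : ℕ)
    (hΔ : ∀ p, (Finset.univ.filter fun p' => conf p p').card ≤ Δ) :
    ∃ col : P → ℕ, (∀ p, col p < Δ + 1) ∧ ∀ p p', p ≠ p' → conf p p' → col p ≠ col p' := by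
  have key : ∀ s : Finset P, ∃ col : P → ℕ, (∀ p, col p < Δ + 1) ∧
      ∀ p ∈ s, ∀ p' ∈ s, p ≠ p' → conf p p' → col p ≠ col p' := by
    intro s
    induction s using Finset.induction_on with
    | empty => exact ⟨fun _ => 0, by simp, by simp⟩
    | insert a s ha ih =>
      obtain ⟨col, h1, h2⟩ := ih
      obtain ⟨c, hc, hc'⟩ : ∃ c ∈ Finset.range (Δ + 1),
          c ∉ (Finset.univ.filter fun p' => conf a p').image col := by
        refine Finset.exists_mem_notMem_of_card_lt_card ?_
        rw [Finset.card_range]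
        exact Nat.lt_succ_of_le (Finset.card_image_le.trans (hΔ a))
      have hc'' : ∀ p, conf a p → col p ≠ c := fun p hp e =>
        hc' (Finset.mem_image.2 ⟨p, by simpa using hp, e⟩)
      refine ⟨Function.update col a c, fun p => ?_, ?_⟩
      · by_cases hp : p = a
        · subst hp; simpa using hc
        · simpa [hp] using h1 p
      · intro p hp p' hp' hne hconf
        rcases Finset.mem_insert.1 hp with rfl | hp1 <;> rcases Finset.mem_insert.1 hp' with rfl | hp2
        · exact absurd rfl hne
        · rw [Function.update_self, Function.update_of_ne hne.symm]
          exact (hc'' _ hconf).symm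
        · rw [Function.update_self, Function.update_of_ne hne]
          exact hc'' _ (symm _ _ hconf)
        · rw [Function.update_of_ne (fun e => ha (by rw [← e]; exact hp1)),
            Function.update_of_ne (fun e => ha (by rw [← e]; exact hp2))]
          exact h2 p hp1 p' hp2 hne hconf
  obtain ⟨col, h1, h2⟩ := key Finset.univ
  exact ⟨col, h1, fun p p' => h2 p (Finset.mem_univ _) p' (Finset.mem_univ _)⟩

section Gates

variable {I X P : Type} [Fintype I] [DecidableEq I] [PseudoMetricSpace X] [Fintype P]
  [DecidableEq P] {n : I → ℕ}

theorem isRound_noncommProd (pos : I → X) (ρ : ℝ) (G : P → Op n) (S : P → Finset I)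
    (hG : ∀ p, G p ∈ unitary (Op n)) (hS : ∀ p, ActsOn (S p) (G p))
    (hρ : ∀ p, ∀ i ∈ S p, ∀ k ∈ S p, dist (pos i) (pos k) ≤ ρ) (s : Finset P)
    (hc : (s : Set P).Pairwise (Function.onFun Commute G))
    (hd : ∀ p ∈ s, ∀ p' ∈ s, p ≠ p' → Disjoint (S p) (S p')) :
    IsRound pos ρ (s.noncommProd G hc) := by
  refine ⟨s.toList.map fun p => (S p, G p), ?_, ?_, ?_⟩
  · rw [List.pairwise_map]
    refine (Finset.nodup_toList s).imp_of_mem fun {a b} ha hb hne => ?_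
    exact hd a (Finset.mem_toList.1 ha) b (Finset.mem_toList.1 hb) hne
  · intro g hg
    obtain ⟨p, _, rfl⟩ := List.mem_map.1 hg
    exact ⟨hρ p, hG p, supportedOn_iff.2 (hS p)⟩
  · have := Finset.noncommProd_toFinset s.toList G (by simpa using hc) (Finset.nodup_toList s)
    rw [List.map_map]
    refine Eq.trans ?_ this
    congr 1
    simp

/-- A product of commuting gates is a circuit whose depth is bounded by the number of gates
that meet a given gate. -/
theorem isCircuit_noncommProd (pos : I → X) (ρ : ℝ) (G : P → Op n) (S : P → Finset I)
    (hG : ∀ p, G p ∈ unitary (Op n)) (hS : ∀ p, ActsOn (S p) (G p))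
    (hρ : ∀ p, ∀ i ∈ S p, ∀ k ∈ S p, dist (pos i) (pos k) ≤ ρ)
    (hc : ((Finset.univ : Finset P) : Set P).Pairwise (Function.onFun Commute G)) (Δ : ℕ)
    (hΔ : ∀ p, (Finset.univ.filter fun p' => ¬ Disjoint (S p) (S p')).card ≤ Δ) :
    IsCircuit pos (Δ + 1) ρ (Finset.univ.noncommProd G hc) := by
  obtain ⟨col, h1, h2⟩ := exists_coloring (fun p p' => ¬ Disjoint (S p) (S p'))
    (fun p p' h h' => h h'.symm) Δ hΔ
  have hc' : ∀ s : Finset P, (s : Set P).Pairwise (Function.onFun Commute G) :=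
    fun s => hc.mono (by simp)
  -- A colour class consists of gates with disjoint supports and is one round. The gates commute, so
  -- they may be grouped by colour.
  have key : ∀ k, IsCircuit pos k ρ ((Finset.univ.filter fun p => col p < k).noncommProd G
      (hc' _)) := by
    intro k
    induction k with
    | zero =>
      have : (Finset.univ.filter fun p => col p < 0) = ∅ := by simp
      simp only [this]
      exact IsCircuit.one pos 0 ρ
    | succ k ih =>
      have e : (Finset.univ.filter fun p => col p < k + 1) =
          (Finset.univ.filter fun p => col p < k) ∪ (Finset.univ.filter fun p => col p = k) := by
        ext p; simp; omega
      have hd : Disjoint (Finset.univ.filter fun p => col p < k)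
          (Finset.univ.filter fun p => col p = k) := by
        rw [Finset.disjoint_filter]; intro p _ h; omega
      have := ih.mul (D' := 1) (V := (Finset.univ.filter fun p => col p = k).noncommProd G (hc' _))
        ⟨[(Finset.univ.filter fun p => col p = k).noncommProd G (hc' _)], rfl, fun u hu => by
          rw [List.mem_singleton] at hu
          rw [hu]
          refine isRound_noncommProd pos ρ G S hG hS hρ _ _ ?_
          intro p hp p' hp' hne
          by_contra h
          exact h2 p p' hne h (by simp at hp hp'; rw [hp, hp']), by simp⟩
      rw [← Finset.noncommProd_union_of_disjoint hd _ (hc' _)] at this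
      simpa only [e] using this
  have := key (Δ + 1)
  have e : (Finset.univ.filter fun p => col p < Δ + 1) = Finset.univ := by
    ext p
    simp only [Finset.mem_filter, Finset.mem_univ, true_and, iff_true]
    exact h1 p
  simpa only [e] using this

end Gates

/-! ### Permutations of sites, and commutators with products of swaps -/

section Perm

variable {X T : Type} [Fintype X] [DecidableEq X] [PseudoMetricSpace T] {q : ℕ}

/-- The operator that permutes the sites. -/
def permOp (q : ℕ) : Equiv.Perm X →* unitary (Op fun _ : X => q) where
  toFun e := ⟨(1 : Op fun _ : X => q).submatrix (fun σ : X → Fin q => σ ∘ e) id, by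
    rw [Unitary.mem_iff]
    constructor
    all_goals
      ext σ τ
      rw [Matrix.mul_apply]
      simp only [Matrix.star_apply, Matrix.submatrix_apply, Matrix.one_apply, id]
    · rw [Finset.sum_eq_single (fun x => (σ : X → Fin q) (e.symm x) : X → Fin q)]
      · have : (fun x => (σ : X → Fin q) (e.symm x) : X → Fin q) ∘ e = σ :=
          funext fun x => congrArg (σ : X → Fin q) (e.symm_apply_apply x)
        rw [this]; simp
      · intro ρ _ hρ
        rw [if_neg, star_zero, zero_mul]
        rintro rfl
        exact hρ (funext fun x => congrArg (ρ : X → Fin q) (e.apply_symm_apply x).symm)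
      · intro h; exact absurd (Finset.mem_univ _) h
    · rw [Finset.sum_eq_single ((σ : X → Fin q) ∘ e)]
      · have : (τ : X → Fin q) ∘ e = (σ : X → Fin q) ∘ e ↔ σ = τ :=
          ⟨fun h => (e.surjective.injective_comp_right h).symm, fun h => h ▸ rfl⟩
        simp [this]
      · intro ρ _ hρ
        rw [if_neg (fun h => hρ h.symm), zero_mul]
      · intro h; exact absurd (Finset.mem_univ _) h⟩
  map_one' := by
    refine Subtype.ext ?_
    change (1 : Op fun _ : X => q).submatrix (fun σ : X → Fin q => σ ∘ (1 : Equiv.Perm X)) id = 1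
    ext σ τ; simp [Matrix.one_apply]
  map_mul' e f := by
    refine Subtype.ext ?_
    change (1 : Op fun _ : X => q).submatrix (fun σ : X → Fin q => σ ∘ (e * f : Equiv.Perm X)) id =
      (1 : Op fun _ : X => q).submatrix (fun σ : X → Fin q => σ ∘ e) id *
      (1 : Op fun _ : X => q).submatrix (fun σ : X → Fin q => σ ∘ f) id
    ext σ τ
    rw [Matrix.mul_apply, Finset.sum_eq_single ((σ : X → Fin q) ∘ e)]
    · simp [Matrix.one_apply]
      rfl
    · intro ρ _ hρ
      rw [Matrix.submatrix_apply, Matrix.one_apply_ne (fun h : (σ : X → Fin q) ∘ e = id ρ => hρ h.symm), zero_mul]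
    · intro h; exact absurd (Finset.mem_univ _) h

theorem permOp_coe (e : Equiv.Perm X) :
    (permOp q e : Op fun _ : X => q) = (1 : Op fun _ : X => q).submatrix (fun σ : X → Fin q => σ ∘ e) id := rfl

/-- The automorphism that permutes the sites. -/
def permAut (q : ℕ) : Equiv.Perm X →* Aut fun _ : X => q :=
  (Unitary.conjStarAlgAut ℂ (Op fun _ : X => q)).comp (permOp q)

theorem permAut_apply (e : Equiv.Perm X) (A : Op fun _ : X => q) :
    permAut q e A = permOp q e * A * star (permOp q e : Op fun _ : X => q) := rfl

theorem permAut_apply_apply (e : Equiv.Perm X) (A : Op fun _ : X => q) (σ τ) :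
    permAut q e A σ τ = A (σ ∘ e) (τ ∘ e) := by
  rw [permAut_apply, permOp_coe, Matrix.mul_apply]
  simp only [Matrix.mul_apply, Matrix.star_apply, Matrix.submatrix_apply, Matrix.one_apply, id,
    ite_mul, one_mul, zero_mul, Finset.sum_ite_eq, Finset.mem_univ, if_true]
  rw [Finset.sum_eq_single (τ ∘ e)]
  · simp
  · intro ρ _ hρ
    rw [if_neg (fun h => hρ h.symm), star_zero, mul_zero]
  · simp

@[simp] theorem permAut_siteOp (e : Equiv.Perm X) (x : X) (a : Matrix (Fin q) (Fin q) ℂ) :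
    permAut q e (siteOp (n := fun _ => q) x a) = siteOp (n := fun _ => q) (e x) a := by
  ext σ τ
  rw [permAut_apply_apply, siteOp_apply, siteOp_apply]
  refine if_congr ?_ rfl rfl
  constructor
  · intro h y hy
    have := h (e.symm y) (fun h => hy (by rw [← h, e.apply_symm_apply]))
    change (σ : X → Fin q) (e (e.symm y)) = (τ : X → Fin q) (e (e.symm y)) at this
    rwa [e.apply_symm_apply] at this
  · intro h y hy
    exact h (e y) (fun h => hy (e.injective h))

/-- Conjugation by the permutation fixes every operator at a fixed site (`permAut_siteOp`), that is,
it commutes with it. -/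
theorem actsOn_permOp (e : Equiv.Perm X) (J : Finset X) (h : ∀ x ∉ J, e x = x) :
    ActsOn J (permOp q e : Op fun _ : X => q) := by
  intro x hx a
  have h1 := permAut_siteOp (q := q) e x a
  rw [h x hx, permAut_apply] at h1
  have hU : star (permOp q e : Op fun _ : X => q) * (permOp q e : Op fun _ : X => q) = 1 :=
    Unitary.coe_star_mul_self _
  generalize (permOp q e : Op fun _ : X => q) = U at h1 hU ⊢
  generalize (siteOp (n := fun _ : X => q) x a) = S at h1 ⊢
  have : S * U = U * S := by
    calc S * U = U * S * star U * U := by rw [h1]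
      _ = U * S := by rw [mul_assoc, hU, mul_one]
  exact this

variable {P W : Type} [Fintype P] [DecidableEq P] [Fintype W]

/-- Breaks an exchange of sites into transpositions, which are going to be the gates. Injectivity of
`Sum.elim u v` says that the pairs are disjoint; `key` follows the partial products on the pairs
already treated and off them. -/
theorem noncommProd_swap (u v : P → X) (huv : Function.Injective (Sum.elim u v)) (τ : Equiv.Perm X)
    (hu : ∀ p, τ (u p) = v p) (hv : ∀ p, τ (v p) = u p)
    (hτ : ∀ x, (∀ p, x ≠ u p) → (∀ p, x ≠ v p) → τ x = x) :
    ∃ hc, τ = Finset.univ.noncommProd (fun p => Equiv.swap (u p) (v p)) hc := by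
  have huu : ∀ p p', p ≠ p' → u p ≠ u p' := fun p p' h e => h (Sum.inl_injective (huv e))
  have hvv : ∀ p p', p ≠ p' → v p ≠ v p' := fun p p' h e => h (Sum.inr_injective (huv e))
  have hne : ∀ p p', u p ≠ v p' := fun p p' e => by
    have := @huv (Sum.inl p) (Sum.inr p') e
    simp at this
  have hc : ((Finset.univ : Finset P) : Set P).Pairwise
      (Function.onFun Commute fun p => Equiv.swap (u p) (v p)) := by
    intro p _ p' _ h
    refine Equiv.Perm.Disjoint.commute fun x => ?_
    by_cases h1 : x = u p
    · right; subst h1; exact Equiv.swap_apply_of_ne_of_ne (huu _ _ h) (hne _ _)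
    by_cases h2 : x = v p
    · right; subst h2; exact Equiv.swap_apply_of_ne_of_ne (hne _ _).symm (hvv _ _ h)
    · left; exact Equiv.swap_apply_of_ne_of_ne h1 h2
  have key : ∀ s : Finset P, ∀ hc', (∀ p ∈ s,
      s.noncommProd (fun p => Equiv.swap (u p) (v p)) hc' (u p) = v p ∧
      s.noncommProd (fun p => Equiv.swap (u p) (v p)) hc' (v p) = u p) ∧
      ∀ x, (∀ p ∈ s, x ≠ u p ∧ x ≠ v p) →
        s.noncommProd (fun p => Equiv.swap (u p) (v p)) hc' x = x := by
    intro s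
    induction s using Finset.induction_on with
    | empty => intro hc'; simp
    | insert a s ha ih =>
      intro hc'
      obtain ⟨ih1, ih2⟩ := ih (hc'.mono (by simp))
      rw [Finset.noncommProd_insert_of_notMem _ _ _ _ ha]
      refine ⟨fun p hp => ?_, fun x hx => ?_⟩
      · rw [Equiv.Perm.mul_apply, Equiv.Perm.mul_apply]
        rcases Finset.mem_insert.1 hp with rfl | hp
        · rw [ih2, ih2]
          · simp
          · exact fun p' hp' => ⟨(hne _ _).symm, hvv _ _ fun e => ha (e ▸ hp')⟩
          · exact fun p' hp' => ⟨huu _ _ fun e => ha (e ▸ hp'), hne _ _⟩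
        · have : p ≠ a := fun e => ha (e ▸ hp)
          rw [(ih1 p hp).1, (ih1 p hp).2,
            Equiv.swap_apply_of_ne_of_ne (hne _ _).symm (hvv _ _ this),
            Equiv.swap_apply_of_ne_of_ne (huu _ _ this) (hne _ _)]
          exact ⟨rfl, rfl⟩
      · rw [Equiv.Perm.mul_apply, ih2 x fun p hp => hx p (by simp [hp])]
        exact Equiv.swap_apply_of_ne_of_ne (hx a (by simp)).1 (hx a (by simp)).2
  refine ⟨hc, Equiv.ext fun x => ?_⟩
  obtain ⟨k1, k2⟩ := key Finset.univ hc
  by_cases h1 : ∃ p, x = u p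
  · obtain ⟨p, rfl⟩ := h1
    rw [hu, (k1 p (Finset.mem_univ _)).1]
  by_cases h2 : ∃ p, x = v p
  · obtain ⟨p, rfl⟩ := h2
    rw [hv, (k1 p (Finset.mem_univ _)).2]
  push Not at h1 h2
  rw [hτ x h1 h2, k2 x fun p _ => ⟨h1 p, h2 p⟩]

/-- The commutator of a local automorphism and a product of disjoint swaps of sites is a
circuit. -/
theorem isCirc_commutator (pos : X → T) (ρ : ℝ) (V : Aut fun _ : X => q) (g : W → Equiv.Perm X)
    (hV : ∀ x a, ActsOn (Finset.univ.image fun w => g w x) (V (siteOp x a)))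
    (u v : P → X) (huv : Function.Injective (Sum.elim u v)) (τ : Equiv.Perm X)
    (hu : ∀ p, τ (u p) = v p) (hv : ∀ p, τ (v p) = u p)
    (hτ : ∀ x, (∀ p, x ≠ u p) → (∀ p, x ≠ v p) → τ x = x)
    (hρ : ∀ p, ∀ x, (x = u p ∨ x = v p) → ∀ y, (y = u p ∨ y = v p) →
      dist (pos x) (pos y) ≤ ρ ∧ ∀ w w', dist (pos (g w x)) (pos (g w' y)) ≤ ρ) :
    IsCirc pos (2 * Fintype.card W ^ 2 + 2) ρ (V * permAut q τ * V⁻¹ * permAut q τ) := by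
  obtain ⟨hc, hprod⟩ := noncommProd_swap u v huv τ hu hv hτ
  have hinj : ∀ p p' x, (x = u p ∨ x = v p) → (x = u p' ∨ x = v p') → p = p' := by
    rintro p p' x (h | h) (h' | h')
    · exact Sum.inl_injective (@huv (Sum.inl p) (Sum.inl p') (h.symm.trans h'))
    · simpa using @huv (Sum.inl p) (Sum.inr p') (h.symm.trans h')
    · simpa using @huv (Sum.inr p) (Sum.inl p') (h.symm.trans h')
    · exact Sum.inr_injective (@huv (Sum.inr p) (Sum.inr p') (h.symm.trans h'))
  let s : P → Op fun _ : X => q := fun p => permOp q (Equiv.swap (u p) (v p))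
  have hs : ∀ p, ActsOn {u p, v p} (s p) := fun p => actsOn_permOp _ _ fun x hx => by
    simp only [Finset.mem_insert, Finset.mem_singleton, not_or] at hx
    exact Equiv.swap_apply_of_ne_of_ne hx.1 hx.2
  have hsc : ((Finset.univ : Finset P) : Set P).Pairwise (Function.onFun Commute s) := by
    intro p hp p' hp' h
    have := (hc hp hp' h).map (permOp q)
    exact this.map (unitary (Op fun _ : X => q)).subtype
  have hsτ : (permOp q τ : Op fun _ : X => q) = Finset.univ.noncommProd s hsc := by
    rw [hprod, Finset.map_noncommProd]
    exact Finset.map_noncommProd _ _ _ (unitary (Op fun _ : X => q)).subtype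
  let G : P → Op fun _ : X => q := fun p => V (s p)
  have hGc : ((Finset.univ : Finset P) : Set P).Pairwise (Function.onFun Commute G) :=
    fun p hp p' hp' h => (hsc hp hp' h).map V
  have hVτ : V (permOp q τ) = Finset.univ.noncommProd G hGc := by
    rw [hsτ, Finset.map_noncommProd]
  have hC1 : IsCircuit pos 1 ρ (permOp q τ : Op fun _ : X => q) := by
    refine ⟨[_], rfl, fun w hw => ?_, (List.prod_singleton).symm⟩
    rw [List.mem_singleton] at hw
    rw [hw, hsτ]
    refine isRound_noncommProd pos ρ s (fun p => {u p, v p}) (fun p => (permOp q _).2) hs ?_ _ _ ?_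
    · intro p i hi k hk
      exact (hρ p i (by simpa using hi) k (by simpa using hk)).1
    · intro p _ p' _ hne
      rw [Finset.disjoint_left]
      intro x hx hx'
      exact hne (hinj p p' x (by simpa using hx) (by simpa using hx'))
  -- `V` sends each swap to a gate on the spread of its pair. These gates overlap, but they commute
  -- because the swaps do.
  have hC2 : IsCircuit pos (2 * Fintype.card W ^ 2 + 1) ρ (V (permOp q τ)) := by
    rw [hVτ]
    let S : P → Finset X := fun p =>
      ({u p, v p} : Finset X).biUnion fun x => Finset.univ.image fun w => g w x
    have hmem : ∀ p y, y ∈ S p ↔ ∃ x, (x = u p ∨ x = v p) ∧ ∃ w, g w x = y := by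
      intro p y
      simp [S]
    refine isCircuit_noncommProd pos ρ G S (fun p => ?_) (fun p => ActsOn.map_aut hV (hs p)) ?_ hGc
      _ ?_
    · exact Unitary.map_mem V (permOp q _).2
    · intro p i hi k hk
      obtain ⟨x, hx, w, rfl⟩ := (hmem _ _).1 hi
      obtain ⟨y, hy, w', rfl⟩ := (hmem _ _).1 hk
      exact (hρ p x hx y hy).2 w w'
    · intro p
      classical
      -- A pair whose gate meets the gate of `p` is determined by a point of the pair `p` and the
      -- two displacements `w`, `w'` that lead to a common site. This leaves at most `2 * card W ^
      -- 2` such pairs.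
      have hex : ∀ p' ∈ Finset.univ.filter (fun p' => ¬ Disjoint (S p) (S p')),
          ∃ c : Bool × W × W, ∃ x', (x' = u p' ∨ x' = v p') ∧
            x' = (g c.2.2).symm (g c.2.1 (if c.1 then u p else v p)) := by
        intro p' hp'
        obtain ⟨y, hy, hy'⟩ := Finset.not_disjoint_iff.1 (Finset.mem_filter.1 hp').2
        obtain ⟨x, hx, w, rfl⟩ := (hmem _ _).1 hy
        obtain ⟨x', hx', w', hw'⟩ := (hmem _ _).1 hy'
        rcases hx with rfl | rfl
        · exact ⟨(true, w, w'), x', hx', by simp [← hw']⟩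
        · exact ⟨(false, w, w'), x', hx', by simp [← hw']⟩
      rcases (Finset.univ.filter fun p' => ¬ Disjoint (S p) (S p')).eq_empty_or_nonempty with h0 | ⟨p0, h0⟩
      · rw [h0]; simp
      have : Nonempty (Bool × W × W) := ⟨(hex p0 h0).choose⟩
      choose! c hc using hex
      have : (Finset.univ.filter fun p' => ¬ Disjoint (S p) (S p')).card ≤
          (Finset.univ : Finset (Bool × W × W)).card := by
        refine Finset.card_le_card_of_injOn c (fun _ _ => Finset.mem_coe.2 (Finset.mem_univ _)) ?_
        intro p1 h1 p2 h2 e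
        obtain ⟨x1, hx1, e1⟩ := hc p1 h1
        obtain ⟨x2, hx2, e2⟩ := hc p2 h2
        rw [← e, ← e1] at e2
        subst e2
        exact hinj _ _ _ hx1 hx2
      refine this.trans (le_of_eq ?_)
      simp [Fintype.card_prod, sq]
  -- `V ∘ Ad U ∘ V⁻¹` is conjugation by `V U`, for `U` the permutation operator.
  refine ⟨V (permOp q τ) * permOp q τ, (hC2.mul hC1).repos fun _ _ h => h, fun A => ?_⟩
  have hVV : ∀ B, V (V⁻¹ B) = B := fun B => StarAlgEquiv.apply_symm_apply V B
  change V (permAut q τ (V⁻¹ (permAut q τ A))) = _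
  rw [permAut_apply _ (V⁻¹ _), map_mul, map_mul, hVV, permAut_apply, map_star, star_mul]
  simp only [mul_assoc]

end Perm

theorem emb_congr {I Z : Type} [Fintype I] [DecidableEq I] [Fintype Z] [DecidableEq Z] {n : I → ℕ}
    {z : Z → ℕ} {ε η : SiteEmb n z} (h : ∀ i, ε i = η i) (A : Op n) : emb ε A = emb η A := by
  rw [SiteEmb.ext h]

section ConstEmb

variable {X Y : Type} [Fintype X] [DecidableEq X] [Fintype Y] [DecidableEq Y] {q : ℕ}

@[simp] theorem emb_const_siteOp (f : X → Y) (hf : Function.Injective f) (x : X) (a) :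
    emb (SiteEmb.const q f hf) (siteOp x a) = siteOp (n := fun _ => q) (f x) a := by
  rw [emb_siteOp, castM_rfl]; rfl

theorem emb_emb_const {W : Type} [Fintype W] [DecidableEq W] (f : X → Y)
    (hf : Function.Injective f) (g : W → X) (hg : Function.Injective g) (h : W → Y)
    (hh : Function.Injective h) (e : ∀ w, f (g w) = h w) (A : Op fun _ : W => q) :
    emb (SiteEmb.const q f hf) (emb (SiteEmb.const q g hg) A) = emb (SiteEmb.const q h hh) A := by
  rw [← emb_comp]
  exact emb_congr (e) _

theorem permAut_emb {W : Type} [Fintype W] [DecidableEq W] (e : Equiv.Perm X) (g : W → X)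
    (hg : Function.Injective g) (A : Op fun _ : W => q) :
    permAut q e (emb (SiteEmb.const q g hg) A) =
      emb (SiteEmb.const q (fun w => e (g w)) (e.injective.comp hg)) A := by
  have : ((permAut q e).toStarAlgHom).comp (emb (SiteEmb.const q g hg)) =
      emb (SiteEmb.const q (fun w => e (g w)) (e.injective.comp hg)) := by
    refine starHom_ext fun w a => ?_
    rw [StarAlgHom.comp_apply, emb_const_siteOp, emb_const_siteOp]
    exact permAut_siteOp e (g w) a
  exact DFunLike.congr_fun this A

end ConstEmb

/-! ### Locally free actions of `ℤ^d` -/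

/-- An action of `ℤ ^ d`. -/
structure Lat (d : ℕ) (X : Type) where
  act : (Fin d → ℤ) → X → X
  act_zero : ∀ x, act 0 x = x
  act_add : ∀ v w x, act (v + w) x = act v (act w x)

/-- The vector from the centre to a point of the window. -/
def offset {d : ℕ} (r : ℕ) (w : Window d r) : Fin d → ℤ := fun j => ((w j : ℕ) : ℤ) - r

/-- The point of the window with a given offset. -/
def ofOffset {d : ℕ} (r : ℕ) (v : Fin d → ℤ) : Window d r :=
  fun j => ⟨min (v j + r).toNat (2 * r), by omega⟩

section Offset

variable {d r : ℕ}

theorem offset_ofOffset {v : Fin d → ℤ} (hv : ∀ j, |v j| ≤ r) : offset r (ofOffset r v) = v := by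
  ext j
  have := abs_le.1 (hv j)
  simp only [offset, ofOffset]
  omega

theorem offset_injective : Function.Injective (offset (d := d) r) := by
  intro w w' h
  ext j
  have := congrFun h j
  simp only [offset] at this
  omega

theorem abs_offset_le (w : Window d r) (j : Fin d) : |offset r w j| ≤ r := by
  have := (w j).2
  rw [abs_le]
  simp only [offset]
  omega

end Offset

namespace Lat

variable {d : ℕ} {X Y : Type}

/-- The bijection given by an element of `ℤ ^ d`. -/
def perm (A : Lat d X) (v : Fin d → ℤ) : Equiv.Perm X where
  toFun := A.act v
  invFun := A.act (-v)
  left_inv x := by rw [← A.act_add, neg_add_cancel, A.act_zero]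
  right_inv x := by rw [← A.act_add, add_neg_cancel, A.act_zero]

@[simp] theorem perm_apply (A : Lat d X) (v : Fin d → ℤ) (x : X) : A.perm v x = A.act v x := rfl

theorem act_neg_act (A : Lat d X) (v : Fin d → ℤ) (x : X) : A.act (-v) (A.act v x) = x :=
  (A.perm v).symm_apply_apply x

/-- No nonzero vector with entries at most `R` has a fixed point. -/
def Free (A : Lat d X) (R : ℕ) : Prop :=
  ∀ (v : Fin d → ℤ) (x : X), (∀ j, |v j| ≤ R) → A.act v x = x → v = 0

theorem Free.mono {A : Lat d X} {R R' : ℕ} (h : A.Free R) (hR : R' ≤ R) : A.Free R' :=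
  fun v x hv => h v x fun j => (hv j).trans (by exact_mod_cast hR)

theorem Free.window_injective {A : Lat d X} {r : ℕ} (h : A.Free (2 * r)) (x : X) :
    Function.Injective fun w : Window d r => A.act (offset r w) x := by
  intro w w' hw
  have : offset r w - offset r w' = 0 := by
    refine h _ (A.act (offset r w') x) (fun j => ?_) ?_
    · have h1 := abs_offset_le w j
      have h2 := abs_offset_le w' j
      rw [abs_le] at *
      simp only [Pi.sub_apply]
      push_cast
      omega
    · rw [← A.act_add, sub_add_cancel]; exact hw
  exact offset_injective (sub_eq_zero.1 this)

/-- The window around a point. -/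
def windowEmb (q : ℕ) {A : Lat d X} {r : ℕ} (h : A.Free (2 * r)) (x : X) :
    SiteEmb (fun _ : Window d r => q) (fun _ : X => q) :=
  SiteEmb.const q (fun w => A.act (offset r w) x) (h.window_injective x)

theorem Free.six {A : Lat d X} {r : ℕ} (h : A.Free (6 * r)) : A.Free (2 * r) :=
  h.mono (by omega)

theorem Free.ball {A : Lat d X} {r : ℕ} (h : A.Free (6 * r)) : A.Free (2 * (3 * r)) :=
  h.mono (by omega)

end Lat

/-! ### The QCA given by a local rule on a space with a locally free action -/

section Rule

variable {d r q : ℕ}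

/-- The inclusion of the window around `v` in the window of three times the radius. -/
def shiftEmb (q : ℕ) (v : Fin d → ℤ) (hv : ∀ j, |v j| ≤ 2 * r) :
    SiteEmb (fun _ : Window d r => q) (fun _ : Window d (3 * r) => q) :=
  SiteEmb.const q (fun w => ofOffset (3 * r) (offset r w + v)) (by
    have key : ∀ (w : Window d r) j, |(offset r w + v) j| ≤ ((3 * r : ℕ) : ℤ) := by
      intro w j
      have h1 := abs_offset_le w j
      have h2 := hv j
      rw [abs_le] at *
      simp only [Pi.add_apply]
      push_cast
      omega
    intro w w' h
    have := congrArg (offset (3 * r)) h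
    simp only [offset_ofOffset (key _)] at this
    exact offset_injective (add_right_cancel this))

/-- A local action such that the images of different sites commute. -/
structure Rule (d r q : ℕ) where
  hom : Matrix (Fin q) (Fin q) ℂ →⋆ₐ[ℂ] Op (fun _ : Window d r => q)
  comm : ∀ v, v ≠ 0 → ∀ (hv : ∀ j, |v j| ≤ 2 * (r : ℤ)) (h0 : ∀ j, |(0 : Fin d → ℤ) j| ≤ 2 * (r : ℤ)),
    ∀ a b, Commute (emb (shiftEmb q 0 h0) (hom a)) (emb (shiftEmb q v hv) (hom b))

variable {X Y : Type} [Fintype X] [DecidableEq X] [Fintype Y] [DecidableEq Y]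

/-- Transfers the commutation relations of a `Rule`, which live on a window of radius `3 * r`, to
any space in which such windows embed; this is the reason for freeness up to `6 * r`. -/
theorem emb_ball_shift {A : Lat d X} (hA : A.Free (6 * r)) (x : X) (v : Fin d → ℤ)
    (hv : ∀ j, |v j| ≤ 2 * (r : ℤ)) (B : Op fun _ : Window d r => q) :
    emb (Lat.windowEmb q hA.ball x) (emb (shiftEmb q v hv) B) =
      emb (Lat.windowEmb q hA.six (A.act v x)) B := by
  refine emb_emb_const _ _ _ _ _ _ (fun w => ?_) B
  rw [offset_ofOffset, A.act_add]
  intro j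
  have h1 := abs_offset_le w j
  have h2 := hv j
  rw [abs_le] at *
  simp only [Pi.add_apply]
  push_cast
  omega

/-- Only commutation of the images of different sites needs proof. If the windows are disjoint it is
clear. If they meet, the sites differ by a vector with entries at most `2 * r`, both windows lie in
a ball of radius `3 * r`, and the rule provides the relation. Bijectivity is automatic. -/
theorem exists_qca [NeZero q] (φ : Rule d r q) {A : Lat d X} (hA : A.Free (6 * r)) :
    ∃ α : Aut fun _ : X => q, ∀ x a,
      α (siteOp x a) = emb (Lat.windowEmb q hA.six x) (φ.hom a) := by
  have h0 : ∀ j, |(0 : Fin d → ℤ) j| ≤ 2 * (r : ℤ) := fun j => by simp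
  have hc : Pairwise fun x y => ∀ a b, Commute
      ((emb (Lat.windowEmb q hA.six x)).comp φ.hom a)
      ((emb (Lat.windowEmb q hA.six y)).comp φ.hom b) := by
    intro x y hxy a b
    rw [StarAlgHom.comp_apply, StarAlgHom.comp_apply]
    by_cases h : ∃ w w' : Window d r, A.act (offset r w) x = A.act (offset r w') y
    · obtain ⟨w, w', h⟩ := h
      have hy : y = A.act (-offset r w' + offset r w) x := by
        rw [A.act_add, h, A.act_neg_act]
      have hv : ∀ j, |(-offset r w' + offset r w) j| ≤ 2 * (r : ℤ) := by
        intro j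
        have h1 := abs_offset_le w j
        have h2 := abs_offset_le w' j
        rw [abs_le] at *
        simp only [Pi.add_apply, Pi.neg_apply]
        omega
      generalize -offset r w' + offset r w = v at hy hv
      subst hy
      have hv0 : v ≠ 0 := by
        rintro rfl
        exact hxy (A.act_zero x).symm
      have := (φ.comm v hv0 hv h0 a b).map (emb (Lat.windowEmb q hA.ball x))
      rw [emb_ball_shift hA, emb_ball_shift hA, A.act_zero] at this
      exact this
    · push Not at h
      refine ActsOn.commute (actsOn_emb _ _) (actsOn_emb _ _) ?_
      rw [Finset.disjoint_left]
      intro z hz hz'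
      obtain ⟨w, _, hw⟩ := Finset.mem_image.1 hz
      obtain ⟨w', _, hw'⟩ := Finset.mem_image.1 hz'
      exact h w w' (hw.trans hw'.symm)
  obtain ⟨α, hα⟩ := exists_aut_of_hom (liftHom (n := fun _ : X => q)
    (fun x => (emb (Lat.windowEmb q hA.six x)).comp φ.hom) hc)
  exact ⟨α, fun x a => by rw [hα, liftHom_siteOp]; rfl⟩

/-- The translation-invariant QCA with a given local action. -/
def qca [NeZero q] (φ : Rule d r q) {A : Lat d X} (hA : A.Free (6 * r)) : Aut fun _ : X => q :=
  (exists_qca φ hA).choose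

variable [NeZero q] (φ : Rule d r q)

theorem qca_siteOp {A : Lat d X} (hA : A.Free (6 * r)) (x : X) (a) :
    qca φ hA (siteOp x a) = emb (Lat.windowEmb q hA.six x) (φ.hom a) :=
  (exists_qca φ hA).choose_spec x a

theorem eq_qca {A : Lat d X} (hA : A.Free (6 * r)) (α : Aut fun _ : X => q)
    (h : ∀ x a, α (siteOp x a) = emb (Lat.windowEmb q hA.six x) (φ.hom a)) : α = qca φ hA :=
  aut_ext fun x a => by rw [h, qca_siteOp]

/-- Locality in the form used for cutting and gluing: the image of an operator at `x` depends on the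
action only through the window around `x`. -/
theorem qca_congr_siteOp {A B : Lat d X} (hA : A.Free (6 * r)) (hB : B.Free (6 * r)) (x : X) (a)
    (h : ∀ w : Window d r, A.act (offset r w) x = B.act (offset r w) x) :
    qca φ hA (siteOp x a) = qca φ hB (siteOp x a) := by
  rw [qca_siteOp, qca_siteOp]
  exact emb_congr (h) _

theorem actsOn_qca {A : Lat d X} (hA : A.Free (6 * r)) (x : X) (a) :
    ActsOn (Finset.univ.image fun w : Window d r => A.perm (offset r w) x)
      (qca φ hA (siteOp x a)) := by
  have := actsOn_emb (Lat.windowEmb q hA.six x) (φ.hom a)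
  rw [← qca_siteOp φ hA] at this
  exact this

theorem actsOn_qca_inv {A : Lat d X} (hA : A.Free (6 * r)) (x : X) (a) :
    ActsOn (Finset.univ.image fun w : Window d r => A.perm (offset r w) x)
      ((qca φ hA)⁻¹ (siteOp x a)) := by
  refine actsOn_inv (α := qca φ hA)
    (N := fun x => Finset.univ.image fun w : Window d r => A.perm (offset r w) x)
    (N' := fun x => Finset.univ.image fun w : Window d r => A.perm (offset r w) x)
    (fun i a => actsOn_qca φ hA i a) (fun i k hik => ?_) x a
  obtain ⟨w, _, hw⟩ := Finset.mem_image.1 hik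
  -- The window is symmetric, so the inverse spreads no further than the QCA itself.
  refine Finset.mem_image.2 ⟨ofOffset r (-offset r w), Finset.mem_univ _, ?_⟩
  rw [Lat.perm_apply, offset_ofOffset, ← hw, Lat.perm_apply, A.act_neg_act]
  intro j
  have := abs_offset_le w j
  simpa using this

/-- Equivariant injections intertwine the QCA. -/
theorem amb_qca_siteOp {A : Lat d X} (hA : A.Free (6 * r)) {B : Lat d Y} (hB : B.Free (6 * r))
    (e : X → Y) (he : Function.Injective e) (h : ∀ v x, e (A.act v x) = B.act v (e x)) (x : X) (a) :
    amb (SiteEmb.const q e he) (qca φ hA) (siteOp (e x) a) = qca φ hB (siteOp (e x) a) := by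
  have e1 := emb_const_siteOp (q := q) e he x a
  rw [← e1, amb_emb, qca_siteOp, e1, qca_siteOp]
  exact emb_emb_const _ _ _ _ _ _ (fun w => h _ _) _

theorem amb_qca_equiv {A : Lat d X} (hA : A.Free (6 * r)) {B : Lat d Y} (hB : B.Free (6 * r))
    (e : X ≃ Y) (h : ∀ v x, e (A.act v x) = B.act v (e x)) :
    amb (SiteEmb.const q e e.injective) (qca φ hA) = qca φ hB := by
  refine aut_ext fun y a => ?_
  obtain ⟨x, rfl⟩ := e.surjective y
  exact amb_qca_siteOp φ hA hB e e.injective h x a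

theorem permAut_conj_qca {A B : Lat d X} (hA : A.Free (6 * r)) (hB : B.Free (6 * r))
    (e : Equiv.Perm X) (h : ∀ v x, e (A.act v x) = B.act v (e x)) :
    permAut q e * qca φ hA * (permAut q e)⁻¹ = qca φ hB := by
  rw [mul_inv_eq_iff_eq_mul]
  refine aut_ext fun x a => ?_
  rw [StarAlgEquiv.mul_apply, StarAlgEquiv.mul_apply, qca_siteOp, permAut_siteOp, qca_siteOp]
  refine (permAut_emb _ _ _ _).trans ?_
  exact emb_congr (fun w => h _ _) _

/-- Two differences of QCA agree if the pairs of actions agree locally. -/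
theorem qca_mul_inv_eq {P Q P' Q' : Lat d X} (hP : P.Free (6 * r)) (hQ : Q.Free (6 * r))
    (hP' : P'.Free (6 * r)) (hQ' : Q'.Free (6 * r))
    (h : ∀ x, ((∀ w : Window d r, P.act (offset r w) x = P'.act (offset r w) x) ∧
        ∀ w : Window d r, Q.act (offset r w) x = Q'.act (offset r w) x) ∨
      ((∀ w : Window d r, P'.act (offset r w) x = Q'.act (offset r w) x) ∧
        ∀ w' w'' w : Window d r,
          P.act (offset r w) (Q.act (offset r w'') (Q'.act (offset r w') x)) =
          Q.act (offset r w) (Q.act (offset r w'') (Q'.act (offset r w') x)))) :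
    qca φ hP * (qca φ hQ)⁻¹ = qca φ hP' * (qca φ hQ')⁻¹ := by
  rw [eq_mul_inv_iff_mul_eq]
  refine aut_ext fun x a => ?_
  rw [StarAlgEquiv.mul_apply, StarAlgEquiv.mul_apply]
  have cancel : ∀ A, (qca φ hQ) ((qca φ hQ)⁻¹ A) = A := fun A =>
    StarAlgEquiv.apply_symm_apply (qca φ hQ) A
  have cancel' : ∀ A, (qca φ hQ)⁻¹ (qca φ hQ A) = A := fun A =>
    StarAlgEquiv.symm_apply_apply (qca φ hQ) A
  rcases h x with ⟨h1, h2⟩ | ⟨h1, h2⟩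
  -- Here `Q'` may be replaced by `Q`, which cancels, and `P` by `P'`.
  · rw [← qca_congr_siteOp φ hQ hQ' x a h2, cancel', qca_congr_siteOp φ hP hP' x a h1]
  -- Here `Q⁻¹ Q'` sends the operator to a region where `P` acts as `Q`; so `P Q⁻¹ Q'` gives the
  -- same as `Q'`, and `Q'` agrees with `P'` at `x`.
  · have hS : ActsOn ((Finset.univ.image fun w : Window d r => Q'.perm (offset r w) x).biUnion
        fun y => Finset.univ.image fun w : Window d r => Q.perm (offset r w) y)
        ((qca φ hQ)⁻¹ (qca φ hQ' (siteOp x a))) :=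
      ActsOn.map_aut (α := (qca φ hQ)⁻¹) (fun i a => actsOn_qca_inv φ hQ i a)
        (actsOn_qca φ hQ' x a)
    rw [hS.aut_eq (β := qca φ hQ), cancel, qca_congr_siteOp φ hP' hQ' x a h1]
    intro y hy b
    obtain ⟨z, hz, hy⟩ := Finset.mem_biUnion.1 hy
    obtain ⟨w', _, rfl⟩ := Finset.mem_image.1 hz
    obtain ⟨w'', _, rfl⟩ := Finset.mem_image.1 hy
    exact qca_congr_siteOp φ hP hQ _ b fun w => h2 w' w'' w

end Rule

/-! ### Displacement estimates for actions -/

namespace Lat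

variable {d : ℕ} {X Y T : Type} [PseudoMetricSpace T]

/-- Unit steps move positions by at most `δ`. -/
def Lip (A : Lat d X) (pos : X → T) (δ : ℝ) : Prop :=
  ∀ j x, dist (pos (A.act (Pi.single j 1) x)) (pos x) ≤ δ

theorem dist_single {A : Lat d X} {pos : X → T} {δ : ℝ} (h : A.Lip pos δ) (j : Fin d) (k : ℤ)
    (x : X) : dist (pos (A.act (Pi.single j k) x)) (pos x) ≤ δ * |(k : ℝ)| := by
  have key : ∀ (k : ℕ) x, dist (pos (A.act (Pi.single j (k : ℤ)) x)) (pos x) ≤ δ * (k : ℝ) := by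
    intro k
    induction k with
    | zero => intro x; simp [A.act_zero]
    | succ k ih =>
      intro x
      have : (Pi.single j ((k + 1 : ℕ) : ℤ) : Fin d → ℤ) = Pi.single j 1 + Pi.single j (k : ℤ) := by
        rw [← Pi.single_add]; push_cast; rw [add_comm]
      rw [this, A.act_add]
      refine (dist_triangle _ (pos (A.act (Pi.single j (k : ℤ)) x)) _).trans ?_
      have := h j (A.act (Pi.single j (k : ℤ)) x)
      have := ih x
      push_cast
      linarith
  rcases Int.eq_nat_or_neg k with ⟨m, rfl | rfl⟩
  · simpa using key m x
  · have := key m (A.act (Pi.single j (-(m : ℤ))) x)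
    rw [← A.act_add, ← Pi.single_add, add_neg_cancel, Pi.single_zero, A.act_zero, dist_comm] at this
    simpa using this

theorem Lip.dist_le {A : Lat d X} {pos : X → T} {δ : ℝ} (h : A.Lip pos δ) (v : Fin d → ℤ) (x : X) :
    dist (pos (A.act v x)) (pos x) ≤ δ * ∑ j, |(v j : ℝ)| := by
  have key : ∀ s : Finset (Fin d), dist (pos (A.act (∑ j ∈ s, Pi.single j (v j)) x)) (pos x) ≤
      δ * ∑ j ∈ s, |(v j : ℝ)| := by
    intro s
    induction s using Finset.induction_on with
    | empty => simp [A.act_zero]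
    | insert a s ha ih =>
      rw [Finset.sum_insert ha, Finset.sum_insert ha, A.act_add]
      refine (dist_triangle _ (pos (A.act (∑ j ∈ s, Pi.single j (v j)) x)) _).trans ?_
      have := dist_single h a (v a) (A.act (∑ j ∈ s, Pi.single j (v j)) x)
      linarith
  have := key Finset.univ
  rwa [Finset.univ_sum_single] at this

theorem Lip.dist_le_of_le {A : Lat d X} {pos : X → T} {δ : ℝ} (h : A.Lip pos δ) (hδ : 0 ≤ δ)
    {r : ℕ} (v : Fin d → ℤ) (hv : ∀ j, |v j| ≤ r) (x : X) :
    dist (pos (A.act v x)) (pos x) ≤ d * r * δ := by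
  refine (h.dist_le v x).trans ?_
  have : ∑ j, |(v j : ℝ)| ≤ ∑ _j : Fin d, (r : ℝ) :=
    Finset.sum_le_sum fun j _ => by exact_mod_cast hv j
  rw [Finset.sum_const, Finset.card_univ, Fintype.card_fin, nsmul_eq_mul] at this
  nlinarith

end Lat

/-! ### Discrete tori, and the rule behind an obvious family -/

section Torus

variable {d : ℕ}

/-- Translations of a discrete torus. -/
def Lat.torus (N : Fin d → ℕ+) : Lat d (Site N) where
  act v x j := x j + (v j : ZMod (N j))
  act_zero x := by ext1 j; simp
  act_add v w x := by ext1 j; simp [add_comm, add_left_comm]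

theorem Lat.torus_act (N : Fin d → ℕ+) (v : Fin d → ℤ) (x : Site N) (j : Fin d) :
    (Lat.torus N).act v x j = x j + (v j : ZMod (N j)) := rfl

theorem Lat.torus_free {N : Fin d → ℕ+} {R : ℕ} (h : ∀ j, R < N j) : (Lat.torus N).Free R := by
  intro v x hv hx
  ext j
  have h1 := congrFun hx j
  rw [Lat.torus_act, add_eq_left, ZMod.intCast_zmod_eq_zero_iff_dvd] at h1
  refine Int.eq_zero_of_abs_lt_dvd h1 ((hv j).trans_lt ?_)
  exact_mod_cast h j

theorem onSite_eq {q : ℕ} {N : Fin d → ℕ+} (x : Site N) (a : Matrix (Fin q) (Fin q) ℂ) :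
    onSite x a = siteOp (n := qudits q N) x a := by
  ext σ τ
  rw [siteOp_apply]
  rfl

theorem onWindow_eq {q r : ℕ} {N : Fin d → ℕ+} (h : (Lat.torus N).Free (2 * r)) (x : Site N)
    (B : Matrix (Window d r → Fin q) (Window d r → Fin q) ℂ) :
    onWindow x B = emb (Lat.windowEmb q h x) B := by
  have e : ∀ w : Window d r, windowSite x w = (Lat.torus N).act (offset r w) x := by
    intro w
    ext1 j
    rw [Lat.torus_act]
    change x j + (((w j : ℕ) : ZMod (N j)) - (r : ZMod (N j))) =
      x j + (((w j : ℕ) - (r : ℤ) : ℤ) : ZMod (N j))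
    push_cast
    rfl
  ext σ τ
  rw [emb_apply]
  refine if_congr ?_ ?_ rfl
  · refine forall_congr' fun y => imp_congr (forall_congr' fun w => ?_) Iff.rfl
    rw [e]
    exact ne_comm
  · rw [show windowSite x = fun w : Window d r => (Lat.torus N).act (offset r w) x from funext e]
    rfl

theorem six_mul_lt {r : ℕ} {L₀ : ℕ+} (h : 10 * r ≤ (L₀ : ℕ)) {L : ℕ+} (hL : L₀ ≤ L) :
    6 * r < (L : ℕ) := by
  have h1 : (L₀ : ℕ) ≤ L := hL
  have := L.pos
  omega

/-- The given `φ` is a bare function. Placing operators in a window of the cube of size `L₀` is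
injective, so `φ` inherits the algebraic structure from `α` on that cube. The commutation relations
come from pairs of different sites; `10 * r ≤ L₀` makes the windows of radius `3 * r` embed. -/
theorem exists_rule {q r : ℕ} (hq : 1 ≤ q) {L₀ : ℕ+}
    {α : ∀ N : Fin d → ℕ+, Aut (qudits q N)} (hα : IsObviousFamily r L₀ α) :
    ∃ (_ : NeZero q) (φ : Rule d r q), ∀ N : Fin d → ℕ+, (∀ j, L₀ ≤ N j) →
      ∀ hF : (Lat.torus N).Free (6 * r), α N = qca φ hF := by
  have : NeZero q := ⟨by omega⟩
  obtain ⟨hr, φ, hφ⟩ := hα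
  have hφ' : ∀ N : Fin d → ℕ+, (∀ j, L₀ ≤ N j) → ∀ (hF : (Lat.torus N).Free (2 * r)) x a,
      α N (siteOp x a) = emb (Lat.windowEmb q hF x) (φ a) := by
    intro N hN hF x a
    rw [← onWindow_eq hF, ← hφ N hN, onSite_eq]
  have hF : (Lat.torus (cube d L₀)).Free (6 * r) := Lat.torus_free fun j => six_mul_lt hr le_rfl
  let x₀ : Site (cube d L₀) := 0
  have h0 := hφ' (cube d L₀) (fun _ => le_rfl) hF.six
  have inj : Function.Injective (emb (Lat.windowEmb q hF.six x₀)) := emb_injective _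
  have hs : ∀ a b, siteOp (n := qudits q (cube d L₀)) x₀ (a * b) =
      siteOp (n := qudits q (cube d L₀)) x₀ a * siteOp (n := qudits q (cube d L₀)) x₀ b :=
    fun a b => map_mul _ _ _
  let Φ : Matrix (Fin q) (Fin q) ℂ →⋆ₐ[ℂ] Op (fun _ : Window d r => q) :=
    { toFun := φ
      map_one' := inj (by rw [← h0, map_one, map_one, map_one])
      map_mul' := fun a b => inj (by rw [← h0, map_mul, map_mul, map_mul, ← h0, ← h0])
      map_zero' := inj (by rw [← h0, map_zero, map_zero, map_zero])
      map_add' := fun a b => inj (by rw [← h0, map_add, map_add, map_add, ← h0, ← h0])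
      commutes' := fun c => inj (by
        rw [← h0, AlgHomClass.commutes, AlgHomClass.commutes, AlgHomClass.commutes])
      map_star' := fun a => inj (by rw [← h0, map_star, map_star, map_star, ← h0]) }
  refine ⟨this, ⟨Φ, ?_⟩, ?_⟩
  · intro v hv0 hv hv' a b
    have inj' : Function.Injective (emb (Lat.windowEmb q hF.ball x₀)) := emb_injective _
    have hne : x₀ ≠ (Lat.torus (cube d L₀)).act v x₀ := fun h =>
      hv0 (hF v x₀ (fun j => (hv j).trans (by push_cast; omega)) h.symm)
    refine Commute.of_map inj' ?_
    rw [emb_ball_shift hF, emb_ball_shift hF, Lat.act_zero]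
    have hc := (siteOp_commute (n := qudits q (cube d L₀)) hne a b).map (α (cube d L₀))
    rw [h0, h0] at hc
    exact hc
  · intro N hN hF
    exact eq_qca _ hF _ fun x a => hφ' N hN hF.six x a

end Torus

/-! ### Stable equivalence of QCA on different spaces -/

section Rel

variable {X Y Z T : Type} [Fintype X] [DecidableEq X] [Fintype Y] [DecidableEq Y] [Fintype Z]
  [DecidableEq Z] [PseudoMetricSpace T] {q : ℕ}

theorem amb_const_comp (f : Y → Z) (hf : Function.Injective f) (g : X → Y)
    (hg : Function.Injective g) (h : X → Z) (hh : Function.Injective h) (e : ∀ x, f (g x) = h x)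
    (α : Aut fun _ : X => q) :
    amb (SiteEmb.const q f hf) (amb (SiteEmb.const q g hg) α) = amb (SiteEmb.const q h hh) α := by
  rw [← amb_comp]
  have : (SiteEmb.const q f hf).comp (SiteEmb.const q g hg) = SiteEmb.const q h hh :=
    SiteEmb.ext e
  rw [this]

/-- The inclusion of the left summand, for qudits of constant dimension. -/
abbrev injl (q : ℕ) (X Y : Type) : SiteEmb (fun _ : X => q) (fun _ : X ⊕ Y => q) :=
  SiteEmb.const q Sum.inl Sum.inl_injective

/-- The inclusion of the right summand, for qudits of constant dimension. -/
abbrev injr (q : ℕ) (X Y : Type) : SiteEmb (fun _ : Y => q) (fun _ : X ⊕ Y => q) :=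
  SiteEmb.const q Sum.inr Sum.inr_injective

/-- The QCA `α ⊗ β⁻¹` is stably a circuit. -/
def Rel (posX : X → T) (posY : Y → T) (D : ℕ) (ρ : ℝ) (α : Aut fun _ : X => q)
    (β : Aut fun _ : Y => q) : Prop :=
  Triv (Sum.elim posX posY) D ρ (amb (injl q X Y) α * (amb (injr q X Y) β)⁻¹)

variable {posX : X → T} {posY : Y → T} {posZ : Z → T} {D D' : ℕ} {ρ ρ' : ℝ}
  {α : Aut fun _ : X => q} {β : Aut fun _ : Y => q} {γ : Aut fun _ : Z => q}

theorem Rel.mono (h : Rel posX posY D ρ α β) (hD : D ≤ D') (hρ : ρ ≤ ρ') :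
    Rel posX posY D' ρ' α β := Triv.mono h hD hρ

theorem Rel.symm (h : Rel posX posY D ρ α β) : Rel posY posX D ρ β α := by
  have h1 := (Triv.inv h).amb (pos' := Sum.elim posY posX)
    (SiteEmb.const q Sum.swap (Equiv.sumComm X Y).injective) (by rintro (x | x) <;> rfl)
  have e1 := amb_const_comp (q := q) Sum.swap (Equiv.sumComm X Y).injective Sum.inr
    Sum.inr_injective Sum.inl Sum.inl_injective (fun _ => rfl) β
  have e2 := amb_const_comp (q := q) Sum.swap (Equiv.sumComm X Y).injective Sum.inl
    Sum.inl_injective Sum.inr Sum.inr_injective (fun _ => rfl) α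
  rw [mul_inv_rev, inv_inv, map_mul, map_inv, e1, e2] at h1
  exact h1

/-- On the disjoint union of the three systems, `α ⊗ β⁻¹` times `β ⊗ γ⁻¹` is `α ⊗ γ⁻¹`, with the
middle system left over as ancillas. -/
theorem Rel.trans [NeZero q] (h : Rel posX posY D ρ α β) (h' : Rel posY posZ D' ρ β γ) :
    Rel posX posZ (D + D') ρ α γ := by
  have inj1 : Function.Injective (Sum.elim Sum.inl (Sum.inr ∘ Sum.inl) : X ⊕ Y → X ⊕ (Y ⊕ Z)) := by
    rintro (x | x) (y | y) h <;> simp_all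
  have inj2 : Function.Injective (Sum.elim Sum.inl (Sum.inr ∘ Sum.inr) : X ⊕ Z → X ⊕ (Y ⊕ Z)) := by
    rintro (x | x) (y | y) h <;> simp_all
  have hY : Function.Injective (fun y => Sum.inr (Sum.inl y) : Y → X ⊕ (Y ⊕ Z)) := fun y y' h => by
    simpa using h
  have hZ : Function.Injective (fun y => Sum.inr (Sum.inr y) : Z → X ⊕ (Y ⊕ Z)) := fun y y' h => by
    simpa using h
  let pos : X ⊕ (Y ⊕ Z) → T := Sum.elim posX (Sum.elim posY posZ)
  have h1 := Triv.amb (pos' := pos) h (SiteEmb.const q _ inj1) (by rintro (x | x) <;> rfl)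
  have h2 := Triv.amb (pos' := pos) h' (SiteEmb.const q Sum.inr Sum.inr_injective)
    (by rintro (x | x) <;> rfl)
  have e1 := amb_const_comp (q := q) _ inj1 Sum.inl Sum.inl_injective Sum.inl Sum.inl_injective
    (fun _ => rfl) α
  have e2 := amb_const_comp (q := q) _ inj1 Sum.inr Sum.inr_injective _ hY (fun _ => rfl) β
  have e3 := amb_const_comp (q := q) (Sum.inr (α := X)) Sum.inr_injective Sum.inl
    Sum.inl_injective _ hY (fun _ => rfl) β
  have e4 := amb_const_comp (q := q) (Sum.inr (α := X)) Sum.inr_injective Sum.inr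
    Sum.inr_injective _ hZ (fun _ => rfl) γ
  have e5 := amb_const_comp (q := q) _ inj2 Sum.inl Sum.inl_injective Sum.inl Sum.inl_injective
    (fun _ => rfl) α
  have e6 := amb_const_comp (q := q) _ inj2 Sum.inr Sum.inr_injective _ hZ (fun _ => rfl) γ
  rw [map_mul, map_inv, e1, e2] at h1
  rw [map_mul, map_inv, e3, e4] at h2
  have h3 := h1.mul h2
  rw [← mul_assoc, inv_mul_cancel_right] at h3
  refine Triv.of_amb (pos' := pos) (SiteEmb.const q _ inj2) ?_ (by rintro (x | x) <;> rfl)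
    fun _ => NeZero.pos q
  rw [map_mul, map_inv, e5, e6]
  exact h3

theorem permAut_conj_amb (e : Equiv.Perm Y) (f : X → Y) (hf : Function.Injective f)
    (α : Aut fun _ : X => q) :
    permAut q e * amb (SiteEmb.const q f hf) α * (permAut q e)⁻¹ =
      amb (SiteEmb.const q (fun x => e (f x)) (e.injective.comp hf)) α := by
  rw [mul_inv_eq_iff_eq_mul]
  refine aut_ext_emb (SiteEmb.const q f hf) (fun i a => ?_) fun y hy b => ?_
  · rw [StarAlgEquiv.mul_apply, StarAlgEquiv.mul_apply, amb_emb, permAut_emb, permAut_emb, amb_emb]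
  · rw [StarAlgEquiv.mul_apply, StarAlgEquiv.mul_apply, amb_siteOp _ _ hy, permAut_siteOp,
      amb_siteOp]
    intro i hi
    exact hy i (e.injective hi)

theorem amb_emb_of_disjoint {W : Type} [Fintype W] [DecidableEq W] {n : X → ℕ} {m : Y → ℕ}
    {z : W → ℕ} (ε : SiteEmb n z) (η : SiteEmb m z)
    (h : ∀ i j, ε i ≠ η j) (β : Aut m) (A : Op n) : amb η β (emb ε A) = emb ε A := by
  have : (amb η β).toStarAlgHom.comp (emb ε) = emb ε := by
    refine starHom_ext fun i a => ?_
    rw [StarAlgHom.comp_apply, emb_siteOp]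
    exact amb_siteOp η β (fun j e => h i j e.symm) _
  exact DFunLike.congr_fun this A

end Rel

/-! ### The swap trick, and copies in place of powers -/

section Swap

variable {d r q : ℕ} [NeZero q] (φ : Rule d r q)
variable {X Y T : Type} [Fintype X] [DecidableEq X] [Fintype Y] [DecidableEq Y]
  [PseudoMetricSpace T]

/-- The depth of the circuit that exchanges a QCA with an isomorphic one. -/
def swapDepth (d r : ℕ) : ℕ := 2 * Fintype.card (Window d r) ^ 2 + 2

/-- Let `τ` exchange the two systems along `e`, and let `V` be the first QCA tensored with the
identity. Conjugating `V` by `τ` gives the second QCA, so the QCA to be treated is `V τ V⁻¹ τ`. Its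
gates join pairs at distance at most `ρ`, and each end is displaced by at most `d * r * δ`. -/
theorem rel_of_equiv {A : Lat d X} (hA : A.Free (6 * r)) {B : Lat d Y} (hB : B.Free (6 * r))
    (e : X ≃ Y) (he : ∀ v x, e (A.act v x) = B.act v (e x)) {posX : X → T} {posY : Y → T}
    {δ ρ : ℝ} (hδ : 0 ≤ δ) (hρ : 0 ≤ ρ) (hX : A.Lip posX δ)
    (hXY : ∀ x, dist (posX x) (posY (e x)) ≤ ρ) :
    Rel posX posY (swapDepth d r) (ρ + 2 * (d * r) * δ) (qca φ hA) (qca φ hB) := by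
  let τ : Equiv.Perm (X ⊕ Y) :=
    { toFun := Sum.elim (fun x => Sum.inr (e x)) (fun y => Sum.inl (e.symm y))
      invFun := Sum.elim (fun x => Sum.inr (e x)) (fun y => Sum.inl (e.symm y))
      left_inv := by rintro (x | x) <;> simp
      right_inv := by rintro (x | x) <;> simp }
  have hττ : (permAut q τ)⁻¹ = permAut q τ := by rw [← map_inv]; rfl
  have e1 : permAut q τ * amb (injl q X Y) (qca φ hA) * (permAut q τ)⁻¹ =
      amb (injr q X Y) (qca φ hB) := by
    rw [permAut_conj_amb, ← amb_qca_equiv φ hA hB e he]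
    exact (amb_const_comp (q := q) Sum.inr Sum.inr_injective e e.injective (fun x => τ (Sum.inl x))
      (τ.injective.comp Sum.inl_injective) (fun _ => rfl) (qca φ hA)).symm
  have key := isCirc_commutator (q := q) (Sum.elim posX posY) (ρ + 2 * (d * r) * δ)
    (amb (injl q X Y) (qca φ hA))
    (fun w : Window d r => Equiv.sumCongr (A.perm (offset r w)) (Equiv.refl Y)) ?_
    (P := X) Sum.inl (fun x => Sum.inr (e x)) ?_ τ (fun _ => rfl) (fun x => ?_) ?_ ?_
  · refine IsCirc.triv ?_
    have e2 : amb (injl q X Y) (qca φ hA) * (amb (injr q X Y) (qca φ hB))⁻¹ =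
        amb (injl q X Y) (qca φ hA) * permAut q τ * (amb (injl q X Y) (qca φ hA))⁻¹ *
          permAut q τ := by
      rw [← e1, mul_inv_rev, inv_inv, mul_inv_rev, ← mul_assoc, ← mul_assoc, hττ]
    rw [e2]
    exact key
  · rintro (x | y) a
    · have := (actsOn_qca φ hA x a).emb (injl q X Y)
      rw [← amb_emb, emb_const_siteOp, Finset.image_image] at this
      exact this
    · rw [amb_siteOp]
      · refine (actsOn_siteOp _ _).mono ?_
        simp only [Finset.singleton_subset_iff, Finset.mem_image, Finset.mem_univ, true_and]
        exact ⟨fun _ => 0, rfl⟩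
      · intro i h; cases h
  · rintro (x | x) (y | y) h <;> simp_all
  · change Sum.inl (e.symm (e x)) = _
    rw [e.symm_apply_apply]
  · rintro (x | y) h h'
    · exact absurd rfl (h x)
    · exact absurd (by simp) (h' (e.symm y))
  · have hs : ∀ (w : Window d r) (z : X ⊕ Y),
        dist (Sum.elim posX posY (Equiv.sumCongr (A.perm (offset r w)) (Equiv.refl Y) z))
          (Sum.elim posX posY z) ≤ d * r * δ := by
      rintro w (z | z)
      · exact hX.dist_le_of_le hδ _ (abs_offset_le w) z
      · simp only [Equiv.sumCongr_apply, Sum.map_inr, Sum.elim_inr, Equiv.refl_apply, dist_self]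
        positivity
    have h0 : ∀ p x, (x = Sum.inl p ∨ x = Sum.inr (e p)) → ∀ y, (y = Sum.inl p ∨ y = Sum.inr (e p)) →
        dist (Sum.elim posX posY x) (Sum.elim posX posY y) ≤ ρ := by
      rintro p x (rfl | rfl) y (rfl | rfl)
      · simpa using hρ
      · exact hXY p
      · rw [dist_comm]; exact hXY p
      · simpa using hρ
    intro p x hx y hy
    have h1 := h0 p x hx y hy
    have hdr : 0 ≤ d * r * δ := by positivity
    refine ⟨by linarith, fun w w' => ?_⟩
    have h2 := hs w x
    have h3 := hs w' y
    have := dist_triangle4 (Sum.elim posX posY (Equiv.sumCongr (A.perm (offset r w)) (Equiv.refl Y) x))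
      (Sum.elim posX posY x) (Sum.elim posX posY y)
      (Sum.elim posX posY (Equiv.sumCongr (A.perm (offset r w')) (Equiv.refl Y) y))
    rw [dist_comm (Sum.elim posX posY y)] at this
    linarith

/-- Several copies of an action. -/
def Lat.copies (Q : Type) (A : Lat d X) : Lat d (Q × X) where
  act v x := (x.1, A.act v x.2)
  act_zero x := by rw [A.act_zero]
  act_add v w x := by rw [A.act_add]

theorem Lat.Free.copies {A : Lat d X} {R : ℕ} (hA : A.Free R) (Q : Type) :
    (A.copies Q).Free R := fun v x hv h => hA v x.2 hv (congrArg Prod.snd h)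

/-- If the `k`-th power of a QCA is stably a circuit, then so are `k` copies of it. -/
theorem triv_copies {A : Lat d X} (hA : A.Free (6 * r)) {k : ℕ} (hk : 0 < k)
    {pos : Fin k × X → T} {δ ρ : ℝ} (hδ : 0 ≤ δ) (hρ : 0 ≤ ρ) (hX : (A.copies (Fin k)).Lip pos δ)
    (hpos : ∀ i i' x, dist (pos (i, x)) (pos (i', x)) ≤ ρ) {D : ℕ}
    (h : Triv (fun x => pos (⟨0, hk⟩, x)) D (ρ + 2 * (d * r) * δ) (qca φ hA ^ k)) :
    Triv pos (k * swapDepth d r + D) (ρ + 2 * (d * r) * δ) (qca φ (hA.copies (Fin k))) := by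
  have hinj : ∀ i : Fin k, Function.Injective fun x : X => (i, x) := fun i x y h => by
    simpa using h
  let ι : Fin k → SiteEmb (fun _ : X => q) (fun _ : Fin k × X => q) := fun i =>
    SiteEmb.const q (fun x => (i, x)) (hinj i)
  let α : Fin k → Aut fun _ : Fin k × X => q := fun i => amb (ι i) (qca φ hA)
  have hcomm : ∀ i i', Commute (α i) (α i') := by
    intro i i'
    by_cases e : i = i'
    · subst e; exact Commute.refl _
    · exact amb_commute _ _ (fun x y h => e (congrArg Prod.fst h)) _ _
  -- Moving the QCA from copy `0` to copy `i` is a case of the swap trick.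
  have hT : ∀ i, Triv pos (swapDepth d r) (ρ + 2 * (d * r) * δ) (α i * (α ⟨0, hk⟩)⁻¹) := by
    intro i
    by_cases e : i = ⟨0, hk⟩
    · rw [e, mul_inv_cancel]
      exact Triv.one _ _ _
    · have h1 : Rel (fun x => pos (i, x)) (fun x => pos (⟨0, hk⟩, x)) (swapDepth d r)
          (ρ + 2 * (d * r) * δ) (qca φ hA) (qca φ hA) :=
        rel_of_equiv φ hA hA (Equiv.refl X) (fun _ _ => rfl) hδ hρ (fun j x => hX j (i, x))
          fun x => hpos _ _ x
      have inj : Function.Injective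
          (Sum.elim (fun x => (i, x)) (fun x => (⟨0, hk⟩, x)) : X ⊕ X → Fin k × X) := by
        rintro (x | x) (y | y) h
        · simpa using h
        · exact absurd (congrArg Prod.fst h) e
        · exact absurd (congrArg Prod.fst h).symm e
        · simpa using h
      have h2 := Triv.amb (pos' := pos) h1 (SiteEmb.const q _ inj) (by rintro (x | x) <;> rfl)
      have e1 := amb_const_comp (q := q) _ inj Sum.inl Sum.inl_injective _ (hinj i)
        (fun _ => rfl) (qca φ hA)
      have e2 := amb_const_comp (q := q) _ inj Sum.inr Sum.inr_injective _ (hinj ⟨0, hk⟩)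
        (fun _ => rfl) (qca φ hA)
      rw [map_mul, map_inv, e1, e2] at h2
      exact h2
  -- `β` is the product of the QCA on the copies in `s`. Since the factors commute, each one can be
  -- traded for a factor on copy `0` at the cost of one swap circuit.
  have key : ∀ s : Finset (Fin k), ∃ β : Aut fun _ : Fin k × X => q,
      Triv pos (s.card * swapDepth d r) (ρ + 2 * (d * r) * δ) (β * (α ⟨0, hk⟩ ^ s.card)⁻¹) ∧
      (∀ i ∈ s, ∀ x a, β (siteOp (i, x) a) = emb (ι i) (qca φ hA (siteOp x a))) ∧
      (∀ i ∉ s, ∀ x a, β (siteOp (i, x) a) = siteOp (i, x) a) ∧ ∀ i, Commute β (α i) := by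
    intro s
    induction s using Finset.induction_on with
    | empty => exact ⟨1, by simpa using Triv.one _ _ _, by simp, fun _ _ _ _ => rfl,
        fun i => Commute.one_left _⟩
    | insert i s hi ih =>
      obtain ⟨β, h1, h2, h3, h4⟩ := ih
      refine ⟨α i * β, ?_, ?_, ?_, fun i' => (hcomm i i').mul_left (h4 i')⟩
      · rw [Finset.card_insert_of_notMem hi]
        have e : α i * β * (α ⟨0, hk⟩ ^ (s.card + 1))⁻¹ =
            (α i * (α ⟨0, hk⟩)⁻¹) * (β * (α ⟨0, hk⟩ ^ s.card)⁻¹) := by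
          rw [pow_succ', mul_inv_rev, mul_assoc, mul_assoc]
          congr 1
          rw [← mul_assoc, ← mul_assoc]
          have c1 : Commute (α ⟨0, hk⟩)⁻¹ (β * (α ⟨0, hk⟩ ^ s.card)⁻¹) :=
            ((h4 _).symm.inv_left).mul_right (((Commute.refl _).pow_right _).inv_left.inv_right)
          rw [mul_assoc (α ⟨0, hk⟩)⁻¹]
          exact c1.eq.symm
        rw [e, add_one_mul, add_comm]
        exact (hT i).mul h1
      · intro i' hi' x a
        rw [StarAlgEquiv.mul_apply]
        rcases Finset.mem_insert.1 hi' with rfl | hi''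
        · rw [h3 _ hi]
          have : siteOp (n := fun _ : Fin k × X => q) (i', x) a = emb (ι i') (siteOp x a) :=
            (emb_const_siteOp _ _ _ _).symm
          rw [this]
          exact amb_emb _ _ _
        · rw [h2 _ hi'']
          refine amb_emb_of_disjoint _ _ (fun x y h => ?_) _ _
          have e : i' = i := congrArg Prod.fst h
          exact hi (e ▸ hi'')
      · intro i' hi' x a
        rw [Finset.mem_insert, not_or] at hi'
        rw [StarAlgEquiv.mul_apply, h3 _ hi'.2]
        exact amb_siteOp _ _ (fun y h => hi'.1 (congrArg Prod.fst h).symm) _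
  obtain ⟨β, h1, h2, -, -⟩ := key Finset.univ
  have e : β = qca φ (hA.copies (Fin k)) := by
    refine eq_qca φ _ _ ?_
    rintro ⟨i, x⟩ a
    rw [h2 i (Finset.mem_univ _), qca_siteOp]
    exact emb_emb_const _ _ _ _ _ _ (fun w => rfl) _
  rw [Finset.card_univ, Fintype.card_fin] at h1
  -- All copies together differ by circuits from the `k`-th power on copy `0`, which is stably a
  -- circuit by hypothesis.
  have h3 := h1.mul (h.amb (ι ⟨0, hk⟩) fun _ => rfl)
  rw [map_pow, inv_mul_cancel_right, e] at h3
  exact h3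

end Swap

/-! ### Cutting orbits into strips and gluing them anew -/

section PermLemmas

variable {B : Type}

/-- No nonzero power with exponent at most `R` has a fixed point. -/
def PermFree (f : Equiv.Perm B) (R : ℕ) : Prop :=
  ∀ (k : ℤ) (b : B), |k| ≤ R → (f ^ k) b = b → k = 0

theorem zpow_succ_apply (g : Equiv.Perm B) (k : ℤ) (b : B) : (g ^ (k + 1)) b = g ((g ^ k) b) := by
  rw [add_comm, zpow_one_add, Equiv.Perm.mul_apply]

theorem zpow_zpow_apply (g : Equiv.Perm B) (k m : ℤ) (b : B) :
    (g ^ k) ((g ^ m) b) = (g ^ (k + m)) b := by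
  rw [zpow_add, Equiv.Perm.mul_apply]

/-- Permutations that agree off `D` have the same powers along an orbit that avoids `D`. -/
theorem zpow_eq_of_agree {g g' : Equiv.Perm B} {D : Set B} (h : ∀ b ∉ D, g b = g' b) {r : ℕ} {b : B}
    (hb : ∀ k : ℤ, |k| ≤ r → (g ^ k) b ∉ D) (k : ℤ) (hk : |k| ≤ r) : (g ^ k) b = (g' ^ k) b := by
  have up : ∀ m : ℕ, m ≤ r → (g ^ (m : ℤ)) b = (g' ^ (m : ℤ)) b := by
    intro m
    induction m with
    | zero => intro _; simp
    | succ m ih =>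
      intro hm
      push_cast
      rw [zpow_succ_apply, zpow_succ_apply, ← ih (by omega)]
      exact h _ (hb _ (by rw [abs_le]; omega))
  have down : ∀ m : ℕ, m ≤ r → (g ^ (-(m : ℤ))) b = (g' ^ (-(m : ℤ))) b := by
    intro m
    induction m with
    | zero => intro _; simp
    | succ m ih =>
      intro hm
      apply g'.injective
      rw [← h _ (hb _ (by rw [abs_le]; push_cast; omega)), ← zpow_succ_apply, ← zpow_succ_apply]
      have : -((m + 1 : ℕ) : ℤ) + 1 = -(m : ℤ) := by push_cast; ring
      rw [this]
      exact ih (by omega)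
  rw [abs_le] at hk
  rcases Int.eq_nat_or_neg k with ⟨m, rfl | rfl⟩
  · exact up m (by omega)
  · exact down m (by omega)

end PermLemmas

/-- Disjoint segments of orbits of a permutation. -/
structure Strips {B : Type} (f : Equiv.Perm B) (E : Type) (h : ℕ) where
  c : Bool → E → ℤ → B
  step : ∀ s e t, f (c s e t) = c s e (t + 1)
  inj : ∀ {s e t s' e' t'}, -(h : ℤ) ≤ t → t < h → -(h : ℤ) ≤ t' → t' < h →
    c s e t = c s' e' t' → s = s' ∧ e = e' ∧ t = t'

namespace Strips

variable {B E : Type} {f : Equiv.Perm B} {h : ℕ} (S : Strips f E h)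

/-- The points at time `t`. -/
def lev (t : ℤ) : Set B := {b | ∃ s e, S.c s e t = b}

theorem mem_lev (s e t) : S.c s e t ∈ S.lev t := ⟨s, e, rfl⟩

theorem lev_unique {t t' : ℤ} {b : B} (h1 : -(h : ℤ) ≤ t) (h2 : t < h) (h1' : -(h : ℤ) ≤ t')
    (h2' : t' < h) (hb : b ∈ S.lev t) (hb' : b ∈ S.lev t') : t = t' := by
  obtain ⟨s, e, rfl⟩ := hb
  obtain ⟨s', e', hb'⟩ := hb'
  exact (S.inj h1 h2 h1' h2' hb'.symm).2.2

/-- `g` moves the points at time `t` to those at time `t + 1`. -/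
def Lvl (g : Equiv.Perm B) : Prop :=
  ∀ t : ℤ, -(h : ℤ) ≤ t → t + 1 < h → ∀ b, b ∈ S.lev t ↔ g b ∈ S.lev (t + 1)

/-- `g` preserves the set of points at time `t`. -/
def Pres (g : Equiv.Perm B) : Prop :=
  ∀ t : ℤ, -(h : ℤ) ≤ t → t < h → ∀ b, b ∈ S.lev t ↔ g b ∈ S.lev t

variable {S}

theorem Lvl.pres_mul {g τ : Equiv.Perm B} (hg : S.Lvl g) (hτ : S.Pres τ) : S.Lvl (τ * g) :=
  fun t h1 h2 b => (hg t h1 h2 b).trans (hτ (t + 1) (by omega) h2 (g b))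

theorem Lvl.mul_pres {g τ : Equiv.Perm B} (hg : S.Lvl g) (hτ : S.Pres τ) : S.Lvl (g * τ) :=
  fun t h1 h2 b => (hτ t h1 (by omega) b).trans (hg t h1 h2 (τ b))

theorem lvl_self : S.Lvl f := by
  intro t _ _ b
  constructor
  · rintro ⟨s, e, rfl⟩
    rw [S.step]
    exact S.mem_lev _ _ _
  · rintro ⟨s, e, hb⟩
    rw [← S.step] at hb
    exact ⟨s, e, f.injective hb⟩

theorem Lvl.zpow_mem {g : Equiv.Perm B} (hg : S.Lvl g) {t k : ℤ} {b : B} (hb : b ∈ S.lev t)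
    (h1 : -(h : ℤ) ≤ t) (h2 : t < h) (h3 : -(h : ℤ) ≤ t + k) (h4 : t + k < h) :
    (g ^ k) b ∈ S.lev (t + k) := by
  have up : ∀ m : ℕ, t + m < h → (g ^ (m : ℤ)) b ∈ S.lev (t + m) := by
    intro m
    induction m with
    | zero => intro _; simpa using hb
    | succ m ih =>
      intro hm
      push_cast at hm ⊢
      rw [zpow_succ_apply, ← add_assoc]
      exact (hg _ (by omega) (by omega) _).1 (ih (by omega))
  have down : ∀ m : ℕ, -(h : ℤ) ≤ t - m → (g ^ (-(m : ℤ))) b ∈ S.lev (t - m) := by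
    intro m
    induction m with
    | zero => intro _; simpa using hb
    | succ m ih =>
      intro hm
      refine (hg _ hm (by push_cast; omega) _).2 ?_
      rw [← zpow_succ_apply]
      have e1 : -((m + 1 : ℕ) : ℤ) + 1 = -(m : ℤ) := by push_cast; ring
      have e2 : t - ((m + 1 : ℕ) : ℤ) + 1 = t - (m : ℤ) := by push_cast; ring
      rw [e1, e2]
      exact ih (by push_cast at hm; omega)
  rcases Int.eq_nat_or_neg k with ⟨m, rfl | rfl⟩
  · exact up m h4
  · exact down m (by omega)

/-- An orbit segment of `g` that avoids time `-1` is one of `f`. An orbit that meets time `-1`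
advances there by one level per step, and within `R` steps it stays inside the strips, so it cannot
return. -/
theorem Lvl.permFree {g : Equiv.Perm B} (hg : S.Lvl g) {R : ℕ} (hf : PermFree f R)
    (hR : R + 2 ≤ h) (hgf : ∀ b ∉ S.lev (-1), g b = f b) : PermFree g R := by
  intro k b hk hb
  by_cases hD : ∀ m : ℤ, |m| ≤ R → (g ^ m) b ∉ S.lev (-1)
  · rw [zpow_eq_of_agree hgf hD k hk] at hb
    exact hf k b hk hb
  · push Not at hD
    obtain ⟨m, _, hm⟩ := hD
    have h1 : (g ^ k) ((g ^ m) b) = (g ^ m) b := by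
      rw [zpow_zpow_apply, add_comm, ← zpow_zpow_apply, hb]
    rw [abs_le] at hk
    have h2 := hg.zpow_mem (k := k) hm (by omega) (by omega) (by omega) (by omega)
    rw [h1] at h2
    have := S.lev_unique (by omega) (by omega) (by omega) (by omega) hm h2
    omega

variable (S)

/-- The points at time `0`. -/
def embZero (hh : 0 < h) : Bool × E ↪ B :=
  ⟨fun x => S.c x.1 x.2 0, fun x y hxy => by
    obtain ⟨h1, h2, _⟩ := S.inj (by omega) (by omega) (by omega) (by omega) hxy
    exact Prod.ext h1 h2⟩

/-- The permutation of the points at time `0`. -/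
def glue (hh : 0 < h) (G : Bool → Equiv.Perm E) : Equiv.Perm B :=
  Equiv.Perm.viaEmbedding (Equiv.prodShear (Equiv.refl Bool) G) (S.embZero hh)

theorem glue_c (hh : 0 < h) (G : Bool → Equiv.Perm E) (s e) :
    S.glue hh G (S.c s e 0) = S.c s (G s e) 0 :=
  Equiv.Perm.viaEmbedding_apply _ (S.embZero hh) (s, e)

theorem glue_of_notMem (hh : 0 < h) (G : Bool → Equiv.Perm E) {b : B} (hb : b ∉ S.lev 0) :
    S.glue hh G b = b := by
  refine Equiv.Perm.viaEmbedding_apply_of_notMem _ _ _ ?_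
  rintro ⟨⟨s, e⟩, rfl⟩
  exact hb (S.mem_lev s e 0)

theorem glue_mem (hh : 0 < h) (G : Bool → Equiv.Perm E) (b : B) :
    b ∈ S.lev 0 ↔ S.glue hh G b ∈ S.lev 0 := by
  constructor
  · rintro ⟨s, e, rfl⟩
    rw [glue_c]
    exact S.mem_lev _ _ _
  · intro hb
    by_contra h'
    rw [S.glue_of_notMem hh G h'] at hb
    exact h' hb

theorem pres_glue (hh : 0 < h) (G : Bool → Equiv.Perm E) : S.Pres (S.glue hh G) := by
  intro t h1 h2 b
  by_cases hb : b ∈ S.lev 0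
  · have hb' := (S.glue_mem hh G b).1 hb
    constructor
    · intro hbt
      rwa [S.lev_unique h1 h2 (by omega) (by omega) hbt hb]
    · intro hbt
      rwa [S.lev_unique h1 h2 (by omega) (by omega) hbt hb']
  · rw [S.glue_of_notMem hh G hb]

/-- The permutation obtained by cutting the strips at time `0` and gluing them by `G`. -/
def reglue (hh : 0 < h) (G : Bool → Equiv.Perm E) : Equiv.Perm B := S.glue hh G * f

theorem reglue_of_notMem (hh : 0 < h) (G : Bool → Equiv.Perm E) {b : B} (hb : b ∉ S.lev (-1)) :
    S.reglue hh G b = f b := by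
  refine S.glue_of_notMem hh G fun h' => hb ?_
  rw [S.lvl_self (-1) (by omega) (by omega)]
  exact h'

theorem lvl_reglue (hh : 0 < h) (G : Bool → Equiv.Perm E) : S.Lvl (S.reglue hh G) :=
  S.lvl_self.pres_mul (S.pres_glue hh G)

theorem reglue_c (hh : 0 < h) (G : Bool → Equiv.Perm E) (s e) {t : ℤ} (h1 : -(h : ℤ) ≤ t)
    (h2 : t + 1 < h) :
    S.reglue hh G (S.c s e t) = S.c s (if t = -1 then G s e else e) (t + 1) := by
  split_ifs with ht
  · subst ht
    change S.glue hh G (f (S.c s e (-1))) = _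
    rw [S.step, neg_add_cancel, glue_c]
  · rw [reglue_of_notMem, S.step]
    intro h'
    exact ht (S.lev_unique h1 (by omega) (by omega) (by omega) (S.mem_lev s e t) h')

/-- All points of the strips. -/
def embAll : Bool × E × Set.Ico (-(h : ℤ)) h ↪ B :=
  ⟨fun x => S.c x.1 x.2.1 x.2.2, fun x y hxy => by
    obtain ⟨h1, h2, h3⟩ := S.inj x.2.2.2.1 x.2.2.2.2 y.2.2.2.1 y.2.2.2.2 hxy
    exact Prod.ext h1 (Prod.ext h2 (Subtype.ext h3))⟩

/-- The index of the strip that is exchanged with a given one. -/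
def partner (π : Equiv.Perm E) (s : Bool) (e : E) (t : ℤ) : E :=
  if t < 0 then e else if s then π e else π⁻¹ e

theorem partner_partner (π : Equiv.Perm E) (s : Bool) (e : E) (t : ℤ) :
    partner π (!s) (partner π s e t) t = e := by
  unfold partner
  split_ifs <;> simp_all

/-- The permutation that exchanges the strips. -/
def exch (π : Equiv.Perm E) : Equiv.Perm B :=
  Equiv.Perm.viaEmbedding
    (⟨fun x => (!x.1, partner π x.1 x.2.1 x.2.2, x.2.2),
      fun x => (!x.1, partner π x.1 x.2.1 x.2.2, x.2.2),
      fun x => by simp [partner_partner], fun x => by simp [partner_partner]⟩ :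
      Equiv.Perm (Bool × E × Set.Ico (-(h : ℤ)) h)) S.embAll

theorem exch_c (π : Equiv.Perm E) (s e) {t : ℤ} (h1 : -(h : ℤ) ≤ t) (h2 : t < h) :
    S.exch π (S.c s e t) = S.c (!s) (partner π s e t) t :=
  Equiv.Perm.viaEmbedding_apply _ S.embAll (s, e, ⟨t, h1, h2⟩)

theorem exch_of_notMem (π : Equiv.Perm E) {b : B}
    (hb : ∀ t : ℤ, -(h : ℤ) ≤ t → t < h → b ∉ S.lev t) : S.exch π b = b := by
  refine Equiv.Perm.viaEmbedding_apply_of_notMem _ _ _ ?_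
  rintro ⟨⟨s, e, t⟩, rfl⟩
  exact hb t t.2.1 t.2.2 (S.mem_lev s e t)

theorem exch_exch (π : Equiv.Perm E) (b : B) : S.exch π (S.exch π b) = b := by
  by_cases hb : ∀ t : ℤ, -(h : ℤ) ≤ t → t < h → b ∉ S.lev t
  · rw [S.exch_of_notMem π hb, S.exch_of_notMem π hb]
  · push Not at hb
    obtain ⟨t, h1, h2, s, e, rfl⟩ := hb
    rw [S.exch_c π s e h1 h2, S.exch_c π _ _ h1 h2, Bool.not_not, partner_partner]

theorem pres_exch (π : Equiv.Perm E) : S.Pres (S.exch π) := by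
  have key : ∀ t : ℤ, -(h : ℤ) ≤ t → t < h → ∀ b, b ∈ S.lev t → S.exch π b ∈ S.lev t := by
    rintro t h1 h2 _ ⟨s, e, rfl⟩
    rw [S.exch_c π s e h1 h2]
    exact S.mem_lev _ _ _
  intro t h1 h2 b
  refine ⟨key t h1 h2 b, fun hb => ?_⟩
  have := key t h1 h2 _ hb
  rwa [exch_exch] at this

/-- The gluing of the strips with label `false` only. -/
def half (π : Equiv.Perm E) : Bool → Equiv.Perm E := fun s => if s then 1 else π

/-- The gluing of the strips in opposite ways. -/
def full (π : Equiv.Perm E) : Bool → Equiv.Perm E := fun s => if s then π⁻¹ else π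

/-- The exchange relabels the strips only from time `0` on. Conjugation by it therefore glues
straight strips at time `0`, by `π` for label `false` and by `π⁻¹` for label `true`. -/
theorem exch_conj_self (hh : 0 < h) (π : Equiv.Perm E) {t : ℤ} (h1 : -(h : ℤ) ≤ t) (h2 : t + 1 < h)
    {b : B} (hb : b ∈ S.lev t) :
    (S.exch π * f * S.exch π) b = S.reglue hh (full π) b := by
  obtain ⟨s, e, rfl⟩ := hb
  rw [Equiv.Perm.mul_apply, Equiv.Perm.mul_apply, S.exch_c π s e h1 (by omega), S.step,
    S.exch_c π _ _ (by omega) h2, S.reglue_c hh _ s e h1 h2, Bool.not_not]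
  congr 1
  unfold partner full
  rcases lt_trichotomy t (-1) with ht | ht | ht
  · simp only [show t < 0 by omega, show t + 1 < 0 by omega, show t ≠ -1 by omega, if_false, if_true]
  · subst ht; cases s <;> simp
  · simp only [show ¬ t < 0 by omega, show ¬ t + 1 < 0 by omega, show t ≠ -1 by omega, if_false]
    cases s <;> simp

/-- In the interior of the strips, half gluing is invariant under the exchange: the relabelling
undoes the twist of one family and transfers it to the other. This makes it the right reference
between straight and full gluing. -/
theorem exch_conj_half (hh : 0 < h) (π : Equiv.Perm E) {t : ℤ} (h1 : -(h : ℤ) ≤ t) (h2 : t + 1 < h)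
    {b : B} (hb : b ∈ S.lev t) :
    (S.exch π * S.reglue hh (half π) * S.exch π) b = S.reglue hh (half π) b := by
  obtain ⟨s, e, rfl⟩ := hb
  rw [Equiv.Perm.mul_apply, Equiv.Perm.mul_apply, S.exch_c π s e h1 (by omega),
    S.reglue_c hh _ _ _ h1 h2,
    S.exch_c π _ _ (by omega) h2, S.reglue_c hh _ s e h1 h2, Bool.not_not]
  congr 1
  unfold partner half
  rcases lt_trichotomy t (-1) with ht | ht | ht
  · simp only [show t < 0 by omega, show t + 1 < 0 by omega, show t ≠ -1 by omega, if_false, if_true]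
  · subst ht; cases s <;> simp
  · simp only [show ¬ t < 0 by omega, show ¬ t + 1 < 0 by omega, show t ≠ -1 by omega, if_false]
    cases s <;> simp

end Strips

namespace Lat

variable {d : ℕ} {B Y : Type}

/-- The action on a product where direction `i` acts by a permutation of the first factor. -/
def prodPerm (f : Equiv.Perm B) (i : Fin d) (C : Lat d Y) : Lat d (B × Y) where
  act v x := ((f ^ v i) x.1, C.act v x.2)
  act_zero x := by simp [C.act_zero]
  act_add v w x := by rw [C.act_add, Pi.add_apply, zpow_add, Equiv.Perm.mul_apply]

theorem prodPerm_act (f : Equiv.Perm B) (i : Fin d) (C : Lat d Y) (v) (x : B × Y) :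
    (prodPerm f i C).act v x = ((f ^ v i) x.1, C.act v x.2) := rfl

theorem prodPerm_free {f : Equiv.Perm B} {R : ℕ} (hf : PermFree f R) {i : Fin d} {C : Lat d Y}
    (hC : ∀ (v : Fin d → ℤ) y, v i = 0 → (∀ j, |v j| ≤ R) → C.act v y = y → v = 0) :
    (prodPerm f i C).Free R := by
  intro v x hv h
  have h1 := hf (v i) x.1 (hv i) (congrArg Prod.fst h)
  exact hC v x.2 h1 hv (congrArg Prod.snd h)

end Lat

/-! ### Reconnecting strips changes the QCA by a circuit -/

section Reconnect

variable {d r q : ℕ} [NeZero q] (φ : Rule d r q)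
variable {B E Y T : Type} [Fintype B] [DecidableEq B] [Fintype E] [DecidableEq E]
  [Fintype Y] [DecidableEq Y] [PseudoMetricSpace T] {f : Equiv.Perm B} {h : ℕ}

/-- Near the cut, conjugated straight strips are fully glued and conjugated half-glued strips are
half glued. Away from the cut `P` and `Q` agree with each other, and so do `P'` and `Q'`. What the
exchange spoils at the far ends of the strips is common to `P` and `Q` and drops out of the
quotient. -/
theorem qca_exch_eq (S : Strips f E h) (hh : 6 * r + 6 ≤ h) (h0 : 0 < h) (π : Equiv.Perm E)
    {i : Fin d} {C : Lat d Y}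
    (hP : (Lat.prodPerm (S.exch π * f * S.exch π) i C).Free (6 * r))
    (hQ : (Lat.prodPerm (S.exch π * S.reglue h0 (Strips.half π) * S.exch π) i C).Free (6 * r))
    (hP' : (Lat.prodPerm (S.reglue h0 (Strips.full π)) i C).Free (6 * r))
    (hQ' : (Lat.prodPerm (S.reglue h0 (Strips.half π)) i C).Free (6 * r)) :
    qca φ hP * (qca φ hQ)⁻¹ = qca φ hP' * (qca φ hQ')⁻¹ := by
  have lP : S.Lvl (S.exch π * f * S.exch π) :=
    (S.lvl_self.pres_mul (S.pres_exch π)).mul_pres (S.pres_exch π)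
  have lQ' : S.Lvl (S.reglue h0 (Strips.half π)) := S.lvl_reglue h0 _
  have lP' : S.Lvl (S.reglue h0 (Strips.full π)) := S.lvl_reglue h0 _
  have lQ : S.Lvl (S.exch π * S.reglue h0 (Strips.half π) * S.exch π) :=
    (lQ'.pres_mul (S.pres_exch π)).mul_pres (S.pres_exch π)
  have aPP : ∀ b ∉ {b | ∃ t : ℤ, -(h : ℤ) ≤ t ∧ t + 1 < h ∧ b ∈ S.lev t}ᶜ,
      (S.exch π * f * S.exch π) b = S.reglue h0 (Strips.full π) b := by
    intro b hb
    obtain ⟨t, h1, h2, hb⟩ := not_not.1 hb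
    exact S.exch_conj_self h0 π h1 h2 hb
  have aQQ : ∀ b ∉ {b | ∃ t : ℤ, -(h : ℤ) ≤ t ∧ t + 1 < h ∧ b ∈ S.lev t}ᶜ,
      (S.exch π * S.reglue h0 (Strips.half π) * S.exch π) b = S.reglue h0 (Strips.half π) b := by
    intro b hb
    obtain ⟨t, h1, h2, hb⟩ := not_not.1 hb
    exact S.exch_conj_half h0 π h1 h2 hb
  have aPQ' : ∀ b ∉ S.lev (-1), S.reglue h0 (Strips.full π) b = S.reglue h0 (Strips.half π) b :=
    fun b hb => by rw [S.reglue_of_notMem h0 _ hb, S.reglue_of_notMem h0 _ hb]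
  have aQP : ∀ b ∉ S.lev (-1), (S.exch π * S.reglue h0 (Strips.half π) * S.exch π) b =
      (S.exch π * f * S.exch π) b := by
    intro b hb
    rw [S.pres_exch π (-1) (by omega) (by omega)] at hb
    simp only [Equiv.Perm.mul_apply]
    rw [S.reglue_of_notMem h0 _ hb]
  have hoff : ∀ w : Window d r, |offset r w i| ≤ r := fun w => abs_offset_le w i
  refine qca_mul_inv_eq φ hP hQ hP' hQ' ?_
  rintro ⟨b, y⟩
  -- Three windows of radius `r` are composed in `qca_mul_inv_eq`, hence `3 * r`; strips of
  -- half-length `6 * r + 6` leave room on both sides.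
  by_cases hb : ∃ t : ℤ, |t + 1| ≤ 3 * r ∧ b ∈ S.lev t
  · left
    obtain ⟨t, ht, hb⟩ := hb
    rw [abs_le] at ht
    have gen : ∀ g : Equiv.Perm B, S.Lvl g → ∀ k : ℤ, |k| ≤ r →
        (g ^ k) b ∉ {b | ∃ t : ℤ, -(h : ℤ) ≤ t ∧ t + 1 < h ∧ b ∈ S.lev t}ᶜ := by
      intro g hg k hk
      rw [abs_le] at hk
      exact not_not.2 ⟨t + k, by omega, by omega,
        hg.zpow_mem hb (by omega) (by omega) (by omega) (by omega)⟩
    constructor <;> intro w <;> simp only [Lat.prodPerm_act]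
    · rw [zpow_eq_of_agree aPP (gen _ lP) _ (hoff w)]
    · rw [zpow_eq_of_agree aQQ (gen _ lQ) _ (hoff w)]
  · right
    push Not at hb
    constructor
    · intro w
      simp only [Lat.prodPerm_act]
      rw [zpow_eq_of_agree aPQ' (r := r) ?_ _ (hoff w)]
      intro k hk hmem
      rw [abs_le] at hk
      have := lP'.zpow_mem (k := -k) hmem (by omega) (by omega) (by omega) (by omega)
      rw [zpow_zpow_apply, neg_add_cancel, zpow_zero, Equiv.Perm.one_apply] at this
      exact hb _ (by rw [abs_le]; omega) this
    · intro w' w'' w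
      simp only [Lat.prodPerm_act]
      rw [← zpow_eq_of_agree aQP (r := r) ?_ _ (hoff w)]
      intro k hk hmem
      have h1 := hoff w'
      have h2 := hoff w''
      rw [abs_le] at hk h1 h2
      rw [zpow_zpow_apply] at hmem
      have := lQ.zpow_mem (k := -(k + offset r w'' i)) hmem (by omega) (by omega) (by omega)
        (by omega)
      rw [zpow_zpow_apply, neg_add_cancel, zpow_zero, Equiv.Perm.one_apply] at this
      have := lQ'.zpow_mem (k := -offset r w' i) this (by omega) (by omega) (by omega)
        (by omega)
      rw [zpow_zpow_apply, neg_add_cancel, zpow_zero, Equiv.Perm.one_apply] at this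
      exact hb _ (by rw [abs_le]; omega) this

theorem Lat.Free.conj {X : Type} {A A' : Lat d X} {R : ℕ} (hA : A.Free R) (e : Equiv.Perm X)
    (he : ∀ v x, e (A.act v x) = A'.act v (e x)) : A'.Free R := by
  intro v x hv hx
  refine hA v (e.symm x) hv (e.injective ?_)
  rw [he, e.apply_symm_apply, hx]

/-- With `V = a * b⁻¹`, the hypothesis says `t V t⁻¹ = c * b⁻¹`, and `c * a⁻¹ = (c * b⁻¹) * (b *
a⁻¹) = t V t V⁻¹`. -/
theorem mul_inv_eq_commutator_inv {G : Type*} [Group G] {a b c t : G} (ht : t⁻¹ = t)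
    (h : t * a * t⁻¹ * (t * b * t⁻¹)⁻¹ = c * b⁻¹) :
    c * a⁻¹ = (a * b⁻¹ * t * (a * b⁻¹)⁻¹ * t)⁻¹ := by
  have e1 : c * a⁻¹ = c * b⁻¹ * (b * a⁻¹) := by group
  rw [e1, ← h]
  simp only [mul_inv_rev, inv_inv, ht, mul_assoc]
  congr 1
  have : t * (t * (b⁻¹ * (t * (b * a⁻¹)))) = b⁻¹ * (t * (b * a⁻¹)) := by
    nth_rw 1 [← ht]
    rw [inv_mul_cancel_left]
  rw [this]

/-- The depth of the circuit that reconnects strips. -/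
def reconnectDepth (d r : ℕ) : ℕ := 2 * Fintype.card (Window d r × Window d r) ^ 2 + 2

/-- Cutting strips that are close to each other and gluing them in opposite ways changes a QCA
by a circuit. -/
theorem isCirc_reconnect (S : Strips f E h) (hh : 6 * r + 6 ≤ h) (h0 : 0 < h) (π : Equiv.Perm E)
    {i : Fin d} {C : Lat d Y}
    (hC : ∀ (v : Fin d → ℤ) y, v i = 0 → (∀ j, |v j| ≤ (6 * r : ℕ)) → C.act v y = y → v = 0)
    (hCi : ∀ k y, C.act (Pi.single i k) y = y) (hf : PermFree f (6 * r))
    {pos : B × Y → T} {δ ρ : ℝ} (hδ : 0 ≤ δ) (hρ : 0 ≤ ρ)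
    (hpos : (Lat.prodPerm f i C).Lip pos δ)
    (hclose : ∀ s s' e e' y, (e' = e ∨ e' = π e ∨ e = π e') →
      dist (pos (S.c s e 0, y)) (pos (S.c s' e' 0, y)) ≤ ρ)
    (hF : (Lat.prodPerm f i C).Free (6 * r))
    (hF' : (Lat.prodPerm (S.reglue h0 (Strips.full π)) i C).Free (6 * r)) :
    IsCirc pos (reconnectDepth d r) ((2 * h + 1 + 4 * (d * r)) * (δ + ρ))
      (qca φ hF' * (qca φ hF)⁻¹) := by
  have fr1 : PermFree (S.reglue h0 (Strips.half π)) (6 * r) :=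
    (S.lvl_reglue h0 _).permFree hf (by omega) fun b hb => S.reglue_of_notMem h0 _ hb
  have hF1 : (Lat.prodPerm (S.reglue h0 (Strips.half π)) i C).Free (6 * r) :=
    Lat.prodPerm_free fr1 hC
  let τ : Equiv.Perm (B × Y) := Equiv.prodCongr (S.exch π) (Equiv.refl Y)
  have hττ : (permAut q τ)⁻¹ = permAut q τ := by
    have : τ * τ = 1 := Equiv.ext fun x => Prod.ext (S.exch_exch π x.1) rfl
    rw [inv_eq_iff_mul_eq_one, ← map_mul, this, map_one]
  have conj : ∀ g : Equiv.Perm B, ∀ v x, τ ((Lat.prodPerm g i C).act v x) =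
      (Lat.prodPerm (S.exch π * g * S.exch π) i C).act v (τ x) := by
    intro g v x
    have e1 : S.exch π * g * S.exch π = S.exch π * g * (S.exch π)⁻¹ := by
      have : (S.exch π)⁻¹ = S.exch π := by
        rw [inv_eq_iff_mul_eq_one]
        exact Equiv.ext fun b => S.exch_exch π b
      rw [this]
    rw [e1]
    refine Prod.ext ?_ rfl
    change S.exch π ((g ^ v i) x.1) = ((S.exch π * g * (S.exch π)⁻¹) ^ v i) (S.exch π x.1)
    rw [conj_zpow]
    simp
  have hP := hF.conj τ (conj f)
  have hQ := hF1.conj τ (conj _)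
  have e1 := permAut_conj_qca φ hF hP τ (conj f)
  have e2 := permAut_conj_qca φ hF1 hQ τ (conj _)
  have e3 := qca_exch_eq φ S hh h0 π hP hQ hF' hF1
  -- `V` is the cost of regluing one family only. The full regluing is the inverse of its commutator
  -- with the exchange of sites `τ`.
  set V := qca φ hF * (qca φ hF1)⁻¹ with hV
  have e4 : qca φ hF' * (qca φ hF)⁻¹ = (V * permAut q τ * V⁻¹ * permAut q τ)⁻¹ := by
    rw [← e1, ← e2] at e3
    exact mul_inv_eq_commutator_inv hττ e3
  rw [e4]
  refine IsCirc.inv ?_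
  -- A step of the half-glued permutation is a step of `f` followed, at the cut, by a jump between
  -- strips at distance at most `ρ`.
  have hpos1 : (Lat.prodPerm (S.reglue h0 (Strips.half π)) i C).Lip pos (δ + ρ) := by
    rintro j ⟨b, y⟩
    by_cases hj : j = i
    · subst hj
      have h1 := hpos j (b, y)
      rw [Lat.prodPerm_act, Pi.single_eq_same, hCi, zpow_one] at h1 ⊢
      refine (dist_triangle _ (pos (f b, y)) _).trans ?_
      rw [add_comm]
      refine add_le_add h1 ?_
      by_cases hb : b ∈ S.lev (-1)
      · obtain ⟨s, e, rfl⟩ := hb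
        change dist (pos (S.reglue h0 _ (S.c s e (-1)), y)) (pos (f (S.c s e (-1)), y)) ≤ ρ
        rw [S.reglue_c h0 _ _ _ (by omega) (by omega), S.step, if_pos rfl, neg_add_cancel]
        refine hclose _ _ _ _ _ ?_
        cases s
        · right; right; rfl
        · left; rfl
      · change dist (pos (S.reglue h0 _ b, y)) _ ≤ ρ
        rw [S.reglue_of_notMem h0 _ hb, dist_self]
        exact hρ
    · have h1 := hpos j (b, y)
      rw [Lat.prodPerm_act, Pi.single_eq_of_ne (fun e => hj e.symm), zpow_zero] at h1 ⊢
      linarith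
  have hstrip : ∀ s e t y, -(h : ℤ) ≤ t → t < h →
      dist (pos (S.c s e t, y)) (pos (S.c s e 0, y)) ≤ h * δ := by
    intro s e t y h1 h2
    have ht : (f ^ t) (S.c s e 0) = S.c s e t := by
      have up : ∀ m : ℕ, ∀ t, (f ^ (m : ℤ)) (S.c s e t) = S.c s e (t + m) := by
        intro m
        induction m with
        | zero => intro t; simp
        | succ m ih => intro t; push_cast; rw [zpow_succ_apply, ih, S.step, add_assoc]
      rcases Int.eq_nat_or_neg t with ⟨m, rfl | rfl⟩
      · rw [up, zero_add]
      · rw [zpow_neg, Equiv.Perm.inv_eq_iff_eq, up, neg_add_cancel]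
    have h3 := Lat.dist_single hpos i t (S.c s e 0, y)
    rw [Lat.prodPerm_act, Pi.single_eq_same, hCi, ht] at h3
    refine h3.trans ?_
    rw [mul_comm]
    refine mul_le_mul_of_nonneg_right ?_ hδ
    have : |t| ≤ (h : ℤ) := by rw [abs_le]; omega
    exact_mod_cast this
  -- `V` involves two actions, so its spread is indexed by pairs of windows; the swapped pairs are
  -- indexed by the points of the strips with label `false`.
  have key := isCirc_commutator (q := q) pos ((2 * h + 1 + 4 * (d * r)) * (δ + ρ)) V
    (fun w : Window d r × Window d r => (Lat.prodPerm f i C).perm (offset r w.1) *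
      (Lat.prodPerm (S.reglue h0 (Strips.half π)) i C).perm (offset r w.2)) ?_
    (P := (E × Set.Ico (-(h : ℤ)) h) × Y) (fun p => (S.c false p.1.1 p.1.2, p.2))
    (fun p => (S.c true (Strips.partner π false p.1.1 p.1.2) p.1.2, p.2)) ?_ τ ?_ ?_ ?_ ?_
  · exact key
  · intro x a
    have := ActsOn.map_aut (α := qca φ hF) (fun x a => actsOn_qca φ hF x a)
      (actsOn_qca_inv φ hF1 x a)
    refine ActsOn.mono ?_ this
    intro y hy
    obtain ⟨z, hz, hy⟩ := Finset.mem_biUnion.1 hy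
    obtain ⟨w, _, rfl⟩ := Finset.mem_image.1 hz
    obtain ⟨w', _, rfl⟩ := Finset.mem_image.1 hy
    exact Finset.mem_image.2 ⟨(w', w), Finset.mem_univ _, rfl⟩
  · have inj := S.embAll.injective
    rintro (⟨⟨e, t⟩, y⟩ | ⟨⟨e, t⟩, y⟩) (⟨⟨e', t'⟩, y'⟩ | ⟨⟨e', t'⟩, y'⟩) hxy <;>
      obtain ⟨hxy, hy⟩ := Prod.ext_iff.1 hxy <;>
      dsimp only [Sum.elim_inl, Sum.elim_inr] at hxy hy <;>
      obtain ⟨h1, h2, h3⟩ := S.inj t.2.1 t.2.2 t'.2.1 t'.2.2 hxy <;>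
      obtain rfl := Subtype.ext h3 <;> subst hy
    · subst h2; rfl
    · cases h1
    · cases h1
    · have := congrArg (fun e => Strips.partner π true e t) h2
      have e1 := Strips.partner_partner π false e t
      have e2 := Strips.partner_partner π false e' t
      rw [Bool.not_false] at e1 e2
      rw [e1, e2] at this
      rw [this]
  · rintro ⟨⟨e, t⟩, y⟩
    exact Prod.ext (S.exch_c π false e t.2.1 t.2.2) rfl
  · rintro ⟨⟨e, t⟩, y⟩
    refine Prod.ext ((S.exch_c π true _ t.2.1 t.2.2).trans ?_) rfl
    have e1 := Strips.partner_partner π false e t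
    rw [Bool.not_false] at e1
    rw [e1]; rfl
  · rintro ⟨b, y⟩ h1 h2
    refine Prod.ext (S.exch_of_notMem π fun t ht ht' hb => ?_) rfl
    obtain ⟨s, e, rfl⟩ := hb
    cases s
    · exact h1 ((e, ⟨t, ht, ht'⟩), y) rfl
    · refine h2 ((Strips.partner π true e t, ⟨t, ht, ht'⟩), y) (Prod.ext ?_ rfl)
      have e1 := Strips.partner_partner π true e t
      rw [Bool.not_true] at e1
      change S.c true e t = S.c true (Strips.partner π false (Strips.partner π true e t) t) t
      rw [e1]
  · have hη : 0 ≤ δ + ρ := by linarith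
    have hdr : (0 : ℝ) ≤ d * r := by positivity
    have h0' : (0 : ℝ) ≤ h := by positivity
    -- Partners are compared by going along one strip to time `0`, across, and back along the other:
    -- at most `h * δ + ρ + h * δ`.
    have hx : ∀ p : (E × Set.Ico (-(h : ℤ)) h) × Y, ∀ x, (x = (S.c false p.1.1 p.1.2, p.2) ∨
        x = (S.c true (Strips.partner π false p.1.1 p.1.2) p.1.2, p.2)) → ∀ y,
        (y = (S.c false p.1.1 p.1.2, p.2) ∨
        y = (S.c true (Strips.partner π false p.1.1 p.1.2) p.1.2, p.2)) →
        dist (pos x) (pos y) ≤ (2 * h + 1) * (δ + ρ) := by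
      rintro ⟨⟨e, t⟩, z⟩
      have main : ∀ s s' e e' , (e' = e ∨ e' = π e ∨ e = π e') →
          dist (pos (S.c s e t, z)) (pos (S.c s' e' t, z)) ≤ (2 * h + 1) * (δ + ρ) := by
        intro s s' e e' he
        have h1 := hstrip s e t z t.2.1 t.2.2
        have h2 := hstrip s' e' t z t.2.1 t.2.2
        have h3 := hclose s s' e e' z he
        have h4 := dist_triangle4 (pos (S.c s e t, z)) (pos (S.c s e 0, z)) (pos (S.c s' e' 0, z))
          (pos (S.c s' e' t, z))
        rw [dist_comm (pos (S.c s' e' 0, z))] at h4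
        have : 0 ≤ h * ρ := by positivity
        nlinarith
      have hp : (Strips.partner π false e t = e ∨ Strips.partner π false e t = π e ∨
          e = π (Strips.partner π false e t)) := by
        unfold Strips.partner
        split_ifs with h1 h2
        · left; rfl
        · cases h2
        · right; right; simp
      rintro x (rfl | rfl) y (rfl | rfl)
      · exact main _ _ _ _ (Or.inl rfl)
      · exact main _ _ _ _ hp
      · refine main _ _ _ _ ?_
        rcases hp with h | h | h
        · left; exact h.symm
        · right; right; exact h
        · right; left; exact h
      · exact main _ _ _ _ (Or.inl rfl)
    intro p x hxp y hyp
    have h1 := hx p x hxp y hyp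
    have hm : 0 ≤ d * r * (δ + ρ) := by positivity
    refine ⟨by nlinarith, fun w w' => ?_⟩
    have mv : ∀ (w : Window d r × Window d r) x, dist (pos (((Lat.prodPerm f i C).perm (offset r w.1) *
      (Lat.prodPerm (S.reglue h0 (Strips.half π)) i C).perm (offset r w.2)) x)) (pos x) ≤
        2 * (d * r * (δ + ρ)) := by
      intro w x
      have h1 := hpos1.dist_le_of_le hη _ (abs_offset_le w.2) x
      have h2 := hpos.dist_le_of_le hδ _ (abs_offset_le w.1)
        ((Lat.prodPerm (S.reglue h0 (Strips.half π)) i C).act (offset r w.2) x)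
      refine (dist_triangle _ (pos ((Lat.prodPerm (S.reglue h0 (Strips.half π)) i C).act
        (offset r w.2) x)) _).trans ?_
      have : d * r * δ ≤ d * r * (δ + ρ) := by
        refine mul_le_mul_of_nonneg_left ?_ hdr; linarith
      refine (add_le_add h2 h1).trans ?_
      linarith
    have h2 := mv w x
    have h3 := mv w' y
    have h4 := dist_triangle4 (pos (((Lat.prodPerm f i C).perm (offset r w.1) *
      (Lat.prodPerm (S.reglue h0 (Strips.half π)) i C).perm (offset r w.2)) x)) (pos x) (pos y)
      (pos (((Lat.prodPerm f i C).perm (offset r w'.1) *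
      (Lat.prodPerm (S.reglue h0 (Strips.half π)) i C).perm (offset r w'.2)) y))
    rw [dist_comm (pos y)] at h4
    nlinarith

end Reconnect

/-! ### Lifting circuits to coverings -/

/-- A covering space in the large: points of the base that are close to the image of a point of
the covering space are lifted by a section. -/
structure Cover (Bs Θ : Type) where
  dd : Bs → Bs → ℕ
  dd_self : ∀ b, dd b b = 0
  dd_comm : ∀ b b', dd b b' = dd b' b
  dd_triangle : ∀ b b' b'', dd b b'' ≤ dd b b' + dd b' b''
  rad : ℕ
  p : Θ → Bs
  s : Θ → Bs → Θ
  p_s : ∀ θ b, p (s θ b) = b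
  s_self : ∀ θ, s θ (p θ) = θ
  s_s : ∀ θ b b', dd (p θ) b + dd b b' ≤ rad → s (s θ b) b' = s θ b'

section RoundAction

variable {I X : Type} [Fintype I] [DecidableEq I] {n : I → ℕ}

theorem conj_prod_of_notMem (G : List (Finset I × Op n))
    (hG : ∀ g ∈ G, g.2 ∈ unitary (Op n) ∧ ActsOn g.1 g.2) (i : I) (hi : ∀ g ∈ G, i ∉ g.1) (a) :
    (G.map Prod.snd).prod * siteOp i a * star (G.map Prod.snd).prod = siteOp i a := by
  have hc : Commute (siteOp i a) (G.map Prod.snd).prod := by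
    refine Commute.list_prod_right _ _ fun u hu => ?_
    obtain ⟨g, hg, rfl⟩ := List.mem_map.1 hu
    exact (hG g hg).2 i (hi g hg) a
  have hU : (G.map Prod.snd).prod ∈ unitary (Op n) := Submonoid.list_prod_mem _ fun u hu => by
    obtain ⟨g, hg, rfl⟩ := List.mem_map.1 hu
    exact (hG g hg).1
  rw [← hc.eq, mul_assoc, Unitary.mul_star_self_of_mem hU, mul_one]

theorem conj_prod_of_mem (G : List (Finset I × Op n))
    (hd : G.Pairwise fun g h => Disjoint g.1 h.1)
    (hG : ∀ g ∈ G, g.2 ∈ unitary (Op n) ∧ ActsOn g.1 g.2) {g : Finset I × Op n} (hg : g ∈ G) (i : I)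
    (hi : i ∈ g.1) (a) :
    (G.map Prod.snd).prod * siteOp i a * star (G.map Prod.snd).prod =
      g.2 * siteOp i a * star g.2 := by
  induction G with
  | nil => simp at hg
  | cons g' G ih =>
    rw [List.pairwise_cons] at hd
    have hG' : ∀ g ∈ G, g.2 ∈ unitary (Op n) ∧ ActsOn g.1 g.2 :=
      fun g hg => hG g (List.mem_cons_of_mem _ hg)
    have hU : (G.map Prod.snd).prod ∈ unitary (Op n) := Submonoid.list_prod_mem _ fun u hu => by
      obtain ⟨g, hg, rfl⟩ := List.mem_map.1 hu
      exact (hG' g hg).1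
    rw [List.map_cons, List.prod_cons, star_mul]
    have e : g'.2 * (G.map Prod.snd).prod * siteOp i a *
        (star (G.map Prod.snd).prod * star g'.2) =
        g'.2 * ((G.map Prod.snd).prod * siteOp i a * star (G.map Prod.snd).prod) * star g'.2 := by
      simp only [mul_assoc]
    rw [e]
    rcases List.mem_cons.1 hg with rfl | hg
    · rw [conj_prod_of_notMem G hG' i fun h hh hi' =>
        Finset.disjoint_left.1 (hd.1 h hh) hi hi']
    · rw [ih hd.2 hG' hg]
      have hg'U := (hG g' (by simp)).1
      have hc : Commute (g.2 * siteOp i a * star g.2) g'.2 := by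
        have h1 : ActsOn g.1 (g.2 * siteOp i a * star g.2) :=
          (((hG' g hg).2).mul ((actsOn_siteOp i a).mono (by simpa using hi))).mul (hG' g hg).2.star
        exact h1.commute (hG g' (by simp)).2 (hd.1 g hg).symm
      rw [← hc.eq, mul_assoc, Unitary.mul_star_self_of_mem hg'U, mul_one]

end RoundAction

namespace Cover

variable {Bs Θ I X T : Type} [Fintype I] [DecidableEq I] [Fintype Θ] [DecidableEq Θ]
  [DecidableEq Bs] [PseudoMetricSpace X] [PseudoMetricSpace T] (C : Cover Bs Θ) (loc : I → Bs)
  {n : I → ℕ}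

/-- The lifted sites. -/
abbrev Lift : Type := {x : I × Θ // C.p x.2 = loc x.1}

/-- The dimensions of the lifted sites. -/
abbrev liftDim (n : I → ℕ) : C.Lift loc → ℕ := fun x => n x.1.1

/-- The section through a point of the covering space. -/
def sec (n : I → ℕ) (θ : Θ) : SiteEmb n (C.liftDim loc n) where
  toFun i := ⟨(i, C.s θ (loc i)), C.p_s _ _⟩
  inj i k h := congrArg (fun x : C.Lift loc => x.1.1) h
  dim _ := rfl

variable {loc} in
theorem sec_self (x : C.Lift loc) : C.sec loc n x.1.2 x.1.1 = x := by
  refine Subtype.ext (Prod.ext rfl ?_)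
  change C.s x.1.2 (loc x.1.1) = x.1.2
  rw [← x.2, C.s_self]

/-- Two sections through points of the same fibre that meet within half the radius coincide; this
separates the different lifts of one gate. -/
theorem s_inj {θ θ' : Θ} {b : Bs} (h : C.p θ = C.p θ') (hb : 2 * C.dd (C.p θ) b ≤ C.rad)
    (e : C.s θ b = C.s θ' b) : θ = θ' := by
  rw [← C.s_self θ, ← C.s_self θ', ← C.s_s θ b, ← C.s_s θ' b, e, h]
  · rw [C.dd_comm b, ← h]; omega
  · rw [C.dd_comm b]; omega

/-- The section through a nearby point agrees with the original one on the support of `A`, so it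
does not matter which of the two is used to lift `A`. -/
theorem emb_sec_s (θ : Θ) (b : Bs) {J : Finset I} {A : Op n} (hA : ActsOn J A)
    (h : ∀ i ∈ J, C.dd (C.p θ) b + C.dd b (loc i) ≤ C.rad) :
    emb (C.sec loc n (C.s θ b)) A = emb (C.sec loc n θ) A := by
  refine hA.hom_eq (F := embAlg _) (G := embAlg _) fun i hi a => ?_
  rw [embAlg_apply, embAlg_apply, emb_siteOp, emb_siteOp]
  have : C.sec loc n (C.s θ b) i = C.sec loc n θ i :=
    Subtype.ext (Prod.ext rfl (C.s_s θ b (loc i) (h i hi)))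
  have key : ∀ (x y : C.Lift loc) (h : x = y) (hx : n i = C.liftDim loc n x)
      (hy : n i = C.liftDim loc n y), siteOp (n := C.liftDim loc n) x (castM hx a) =
        siteOp (n := C.liftDim loc n) y (castM hy a) := by
    rintro x _ rfl _ _; rfl
  exact key _ _ this _ _

/-- The automorphism `γ'` of the lifted system is near each section a lift of `γ`, which spreads
operators by at most `m`. -/
def Inter (m R : ℕ) (γ : Aut n) (γ' : Aut (C.liftDim loc n)) : Prop :=
  (∀ i a, ActsOn (Finset.univ.filter fun k => C.dd (loc k) (loc i) ≤ m) (γ (siteOp i a))) ∧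
  ∀ θ i a, C.dd (C.p θ) (loc i) ≤ R →
    γ' (emb (C.sec loc n θ) (siteOp i a)) = emb (C.sec loc n θ) (γ (siteOp i a))

variable {C loc} {m m' R R' : ℕ} {γ δ : Aut n} {γ' δ' : Aut (C.liftDim loc n)}

theorem Inter.apply (h : C.Inter loc m R γ γ') (θ : Θ) {J : Finset I} {A : Op n} (hA : ActsOn J A)
    (hJ : ∀ i ∈ J, C.dd (C.p θ) (loc i) ≤ R) :
    γ' (emb (C.sec loc n θ) A) = emb (C.sec loc n θ) (γ A) :=
  hA.hom_eq (F := (autAlg γ').comp (embAlg _)) (G := (embAlg _).comp (autAlg γ))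
    fun i hi a => h.2 θ i a (hJ i hi)

theorem Inter.mul (h : C.Inter loc m R γ γ') (h' : C.Inter loc m' R' δ δ') (hR : R' + m' ≤ R) :
    C.Inter loc (m + m') R' (γ * δ) (γ' * δ') := by
  refine ⟨fun i a => ?_, fun θ i a hi => ?_⟩
  · refine (ActsOn.map_aut h.1 (h'.1 i a)).mono fun k hk => ?_
    obtain ⟨l, hl, hk⟩ := Finset.mem_biUnion.1 hk
    simp only [Finset.mem_filter, Finset.mem_univ, true_and] at hl hk ⊢
    have := C.dd_triangle (loc k) (loc l) (loc i)
    omega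
  · rw [StarAlgEquiv.mul_apply, StarAlgEquiv.mul_apply, h'.2 θ i a hi]
    refine h.apply θ (h'.1 i a) fun k hk => ?_
    simp only [Finset.mem_filter, Finset.mem_univ, true_and] at hk
    have := C.dd_triangle (C.p θ) (loc i) (loc k)
    rw [C.dd_comm (loc k)] at hk
    omega

theorem Inter.one (R : ℕ) : C.Inter loc 0 R (1 : Aut n) 1 := by
  refine ⟨fun i a => (actsOn_siteOp i a).mono ?_, fun _ _ _ _ => rfl⟩
  simp [C.dd_self]

theorem Inter.pow (k : ℕ) (h : ∀ R, R + m ≤ R' → C.Inter loc m R γ γ') (hR : R + k * m ≤ R') :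
    C.Inter loc (k * m) R (γ ^ k) (γ' ^ k) := by
  induction k generalizing R with
  | zero => simpa using Inter.one R
  | succ k ih =>
    rw [pow_succ, pow_succ, add_one_mul]
    rw [add_one_mul] at hR
    exact (ih (R := R + m) (by omega)).mul (h R (by omega)) le_rfl

/-- Every lifted site lies on its own section at distance `0`, so a lift is determined by what it
does along sections. This identifies the lifted circuit with the power of the QCA on the covering.
-/
theorem Inter.unique (h : C.Inter loc m R γ γ') (h' : C.Inter loc m' R' γ δ') : γ' = δ' := by
  refine aut_ext fun x a => ?_
  have e : siteOp x a = emb (C.sec loc n x.1.2) (siteOp x.1.1 a) := by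
    rw [emb_siteOp]
    have key : ∀ (y : C.Lift loc) (h : x = y) (hy : n x.1.1 = C.liftDim loc n y),
        siteOp (n := C.liftDim loc n) x a = siteOp (n := C.liftDim loc n) y (castM hy a) := by
      rintro y rfl _; rw [castM_rfl]
    exact key _ (C.sec_self x).symm _
  have e2 : C.dd (C.p x.1.2) (loc x.1.1) = 0 := by rw [x.2, C.dd_self]
  rw [e, h.2 _ _ _ (by omega), h'.2 _ _ _ (by omega)]

variable (C loc)

open Classical in
/-- The lifts of a gate. -/
def liftGate (g : Finset I × Op n) : List (Finset (C.Lift loc) × Op (C.liftDim loc n)) :=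
  if h : g.1.Nonempty then
    (Finset.univ.filter fun θ => C.p θ = loc h.choose).toList.map fun θ =>
      (g.1.image (C.sec loc n θ), emb (C.sec loc n θ) g.2)
  -- A gate with empty support is a phase and drops out of the conjugation.
  else []

variable {C loc}

theorem mem_liftGate {g : Finset I × Op n} {x} (hx : x ∈ C.liftGate loc g) :
    ∃ θ, ∃ i₀ ∈ g.1, C.p θ = loc i₀ ∧
      x = (g.1.image (C.sec loc n θ), emb (C.sec loc n θ) g.2) := by
  unfold liftGate at hx
  split_ifs at hx with h
  · obtain ⟨θ, hθ, rfl⟩ := List.mem_map.1 hx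
    exact ⟨θ, h.choose, h.choose_spec, by simpa using hθ, rfl⟩
  · simp at hx

theorem exists_mem_liftGate {g : Finset I × Op n} (h : g.1.Nonempty) :
    ∃ i₀ ∈ g.1, ∀ θ, C.p θ = loc i₀ →
      (g.1.image (C.sec loc n θ), emb (C.sec loc n θ) g.2) ∈ C.liftGate loc g := by
  refine ⟨h.choose, h.choose_spec, fun θ hθ => ?_⟩
  rw [liftGate, dif_pos h]
  exact List.mem_map.2 ⟨θ, by simpa using hθ, rfl⟩

/-- A gate is lifted once for each point over a chosen site of its support; the radius keeps these
lifts disjoint. An operator on a section meets at most one lift of the gate at its site, and that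
lift lies on the same section, where the computation is the one in the base. -/
theorem exists_lift_round {pos : I → X} {ρ ρ' : ℝ} {m : ℕ}
    (hm : ∀ i k, dist (pos i) (pos k) ≤ ρ → C.dd (loc i) (loc k) ≤ m) {pos' : C.Lift loc → T}
    (hρ : ∀ θ i k, C.dd (C.p θ) (loc i) ≤ m → C.dd (C.p θ) (loc k) ≤ m →
      dist (pos' (C.sec loc n θ i)) (pos' (C.sec loc n θ k)) ≤ ρ')
    (hrad : 2 * m ≤ C.rad) {U : Op n} (hU : IsRound pos ρ U) :
    ∃ U', IsRound pos' ρ' U' ∧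
      (∀ i a, ActsOn (Finset.univ.filter fun k => C.dd (loc k) (loc i) ≤ m)
        (U * siteOp i a * star U)) ∧
      ∀ R, R + 2 * m ≤ C.rad → ∀ θ i a, C.dd (C.p θ) (loc i) ≤ R →
        U' * emb (C.sec loc n θ) (siteOp i a) * star U' =
          emb (C.sec loc n θ) (U * siteOp i a * star U) := by
  obtain ⟨G, hd, hG, rfl⟩ := hU
  have hG2 : ∀ g ∈ G, g.2 ∈ unitary (Op n) ∧ ActsOn g.1 g.2 := fun g hg =>
    ⟨(hG g hg).2.1, supportedOn_iff.1 (hG g hg).2.2⟩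
  have hdd : ∀ g ∈ G, ∀ i ∈ g.1, ∀ k ∈ g.1, C.dd (loc i) (loc k) ≤ m := fun g hg i hi k hk =>
    hm _ _ ((hG g hg).1 i hi k hk)
  let G' := G.flatMap (C.liftGate loc)
  have hG'2 : ∀ g ∈ G', g.2 ∈ unitary (Op (C.liftDim loc n)) ∧ ActsOn g.1 g.2 := by
    intro x hx
    obtain ⟨g, hg, hx⟩ := List.mem_flatMap.1 hx
    obtain ⟨θ, i₀, _, _, rfl⟩ := mem_liftGate hx
    exact ⟨Unitary.map_mem _ (hG2 g hg).1, (hG2 g hg).2.emb _⟩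
  have hd' : G'.Pairwise fun g h => Disjoint g.1 h.1 := by
    rw [List.pairwise_flatMap]
    refine ⟨fun g hg => ?_, hd.imp fun {g g'} hgg x hx y hy => ?_⟩
    · unfold liftGate
      split_ifs with h
      · rw [List.pairwise_map]
        refine (Finset.nodup_toList _).imp_of_mem fun {θ θ'} hθ hθ' hne => ?_
        simp only [Finset.mem_toList, Finset.mem_filter, Finset.mem_univ, true_and] at hθ hθ'
        rw [Finset.disjoint_left]
        intro x hx hx'
        obtain ⟨i, hi, rfl⟩ := Finset.mem_image.1 hx
        obtain ⟨k, hk, e⟩ := Finset.mem_image.1 hx'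
        have e1 : k = i := congrArg (fun x : C.Lift loc => x.1.1) e
        subst e1
        have e2 : C.s θ' (loc k) = C.s θ (loc k) := congrArg (fun x : C.Lift loc => x.1.2) e
        refine hne (C.s_inj (b := loc k) (hθ.trans hθ'.symm) ?_ e2.symm)
        rw [hθ]
        have := hdd g hg _ h.choose_spec k hi
        omega
      · exact List.Pairwise.nil
    · obtain ⟨θ, _, _, _, rfl⟩ := mem_liftGate hx
      obtain ⟨θ', _, _, _, rfl⟩ := mem_liftGate hy
      rw [Finset.disjoint_left]
      intro x hx hx'
      obtain ⟨i, hi, rfl⟩ := Finset.mem_image.1 hx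
      obtain ⟨k, hk, e⟩ := Finset.mem_image.1 hx'
      have e1 : k = i := congrArg (fun x : C.Lift loc => x.1.1) e
      subst e1
      exact Finset.disjoint_left.1 hgg hi hk
  refine ⟨(G'.map Prod.snd).prod, ⟨G', hd', fun x hx => ⟨?_, (hG'2 x hx).1,
    supportedOn_iff.2 (hG'2 x hx).2⟩, rfl⟩, fun i a => ?_, fun R hR θ i a hi => ?_⟩
  · obtain ⟨g, hg, hx⟩ := List.mem_flatMap.1 hx
    obtain ⟨θ, i₀, hi₀, hθ, rfl⟩ := mem_liftGate hx
    intro y hy z hz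
    obtain ⟨i, hi, rfl⟩ := Finset.mem_image.1 hy
    obtain ⟨k, hk, rfl⟩ := Finset.mem_image.1 hz
    refine hρ _ _ _ ?_ ?_
    · rw [hθ]; exact hdd g hg _ hi₀ _ hi
    · rw [hθ]; exact hdd g hg _ hi₀ _ hk
  · by_cases hg : ∃ g ∈ G, i ∈ g.1
    · obtain ⟨g, hg, hig⟩ := hg
      rw [conj_prod_of_mem G hd hG2 hg i hig]
      refine ActsOn.mono (J := g.1) (fun k hk => ?_)
        (((hG2 g hg).2.mul ((actsOn_siteOp i a).mono (by simpa using hig))).mul (hG2 g hg).2.star)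
      simpa using hdd g hg k hk i hig
    · push Not at hg
      rw [conj_prod_of_notMem G hG2 i hg]
      refine (actsOn_siteOp i a).mono ?_
      simp [C.dd_self]
  · by_cases hg : ∃ g ∈ G, i ∈ g.1
    · obtain ⟨g, hg, hig⟩ := hg
      obtain ⟨i₀, hi₀, hmem⟩ := exists_mem_liftGate (C := C) (loc := loc) (g := g) ⟨i, hig⟩
      have hm' := hmem (C.s θ (loc i₀)) (C.p_s _ _)
      have d1 := hdd g hg i hig i₀ hi₀
      have d2 := C.dd_triangle (C.p θ) (loc i) (loc i₀)
      have e1 : ∀ (A : Op n), ActsOn g.1 A →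
          emb (C.sec loc n (C.s θ (loc i₀))) A = emb (C.sec loc n θ) A := fun A hA =>
        C.emb_sec_s loc θ (loc i₀) hA fun k hk => by
          have := hdd g hg i₀ hi₀ k hk
          omega
      have hA : ActsOn g.1 (siteOp i a : Op n) := (actsOn_siteOp i a).mono (by simpa using hig)
      rw [conj_prod_of_mem G hd hG2 hg i hig, ← e1 _ hA, emb_siteOp,
        conj_prod_of_mem G' hd' hG'2 (List.mem_flatMap.2 ⟨g, hg, hm'⟩) _
          (Finset.mem_image_of_mem _ hig), ← emb_siteOp, e1 _ hA]
      dsimp only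
      rw [e1 _ (hG2 g hg).2, map_mul, map_mul, map_star]
    · push Not at hg
      rw [conj_prod_of_notMem G hG2 i hg, emb_siteOp]
      refine conj_prod_of_notMem G' hG'2 _ (fun x hx hmem => ?_) _
      obtain ⟨g, hgG, hx⟩ := List.mem_flatMap.1 hx
      obtain ⟨θ', _, _, _, rfl⟩ := mem_liftGate hx
      obtain ⟨k, hk, e⟩ := Finset.mem_image.1 hmem
      have e1 : k = i := congrArg (fun x : C.Lift loc => x.1.1) e
      exact hg g hgG (e1 ▸ hk)

/-- Circuits with gates that are small compared to the injectivity radius can be lifted. -/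
theorem exists_lift_circ {pos : I → X} {ρ ρ' : ℝ} {m D : ℕ}
    (hm : ∀ i k, dist (pos i) (pos k) ≤ ρ → C.dd (loc i) (loc k) ≤ m) {pos' : C.Lift loc → T}
    (hρ : ∀ θ i k, C.dd (C.p θ) (loc i) ≤ m → C.dd (C.p θ) (loc k) ≤ m →
      dist (pos' (C.sec loc n θ i)) (pos' (C.sec loc n θ k)) ≤ ρ')
    (hrad : (D + 2) * m ≤ C.rad) (hγ : IsCirc pos D ρ γ) :
    ∃ γ', IsCirc pos' D ρ' γ' ∧ C.Inter loc (D * m) 0 γ γ' := by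
  obtain ⟨U, ⟨l, rfl, hl, rfl⟩, hγ⟩ := hγ
  -- Each further round spreads operators by `m`, so the range of validity shrinks by `m` per round.
  have key : ∀ l : List (Op n), (∀ u ∈ l, IsRound pos ρ u) → 2 * m ≤ C.rad → ∃ l' : List (Op (C.liftDim loc n)),
      l'.length = l.length ∧ (∀ u ∈ l', IsRound pos' ρ' u) ∧
      ∀ (γ : Aut n) (γ' : Aut (C.liftDim loc n)), (∀ A, γ A = l.prod * A * star l.prod) →
        (∀ A, γ' A = l'.prod * A * star l'.prod) →
        ∀ R, R + (l.length + 2) * m ≤ C.rad → C.Inter loc (l.length * m) R γ γ' := by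
    intro l
    induction l with
    | nil =>
      intro _ _
      refine ⟨[], rfl, by simp, fun γ γ' h h' R _ => ?_⟩
      have e1 : γ = 1 := StarAlgEquiv.ext fun A => by rw [h]; simp
      have e2 : γ' = 1 := StarAlgEquiv.ext fun A => by rw [h']; simp
      rw [e1, e2]
      simpa using Inter.one R
    | cons u l ih =>
      intro hl h2
      obtain ⟨l', hlen, hl', hi⟩ := ih (fun v hv => hl v (List.mem_cons_of_mem _ hv)) h2
      obtain ⟨u', hu', hs, hR'⟩ := exists_lift_round hm hρ h2 (hl u (by simp))
      refine ⟨u' :: l', by simp [hlen], ?_, ?_⟩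
      · intro v hv
        rcases List.mem_cons.1 hv with rfl | hv
        exacts [hu', hl' v hv]
      · intro γ γ' h h' R hR
        have hlU : l.prod ∈ unitary (Op n) := Submonoid.list_prod_mem _ fun v hv =>
          (hl v (List.mem_cons_of_mem _ hv)).unitary
        have hlU' : l'.prod ∈ unitary (Op (C.liftDim loc n)) := Submonoid.list_prod_mem _
          fun v hv => (hl' v hv).unitary
        let γ₁ : Aut n := Unitary.conjStarAlgAut ℂ _ ⟨u, (hl u (by simp)).unitary⟩
        let γ₂ : Aut n := Unitary.conjStarAlgAut ℂ _ ⟨l.prod, hlU⟩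
        let γ₁' : Aut (C.liftDim loc n) := Unitary.conjStarAlgAut ℂ _ ⟨u', hu'.unitary⟩
        let γ₂' : Aut (C.liftDim loc n) := Unitary.conjStarAlgAut ℂ _ ⟨l'.prod, hlU'⟩
        have e1 : γ = γ₁ * γ₂ := StarAlgEquiv.ext fun A => by
          rw [h, List.prod_cons, star_mul]
          change _ = u * (l.prod * A * star l.prod) * star u
          simp only [mul_assoc]
        have e2 : γ' = γ₁' * γ₂' := StarAlgEquiv.ext fun A => by
          rw [h', List.prod_cons, star_mul]
          change _ = u' * (l'.prod * A * star l'.prod) * star u'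
          simp only [mul_assoc]
        rw [List.length_cons] at hR ⊢
        have hmul : (l.length + 1 + 2) * m = (l.length + 2) * m + m := by ring
        have hmul2 : (l.length + 2) * m = l.length * m + 2 * m := by ring
        have i1 : C.Inter loc m (R + l.length * m) γ₁ γ₁' :=
          ⟨hs, fun θ i a hi => hR' (R + l.length * m) (by omega) θ i a hi⟩
        have i2 : C.Inter loc (l.length * m) R γ₂ γ₂' :=
          hi γ₂ γ₂' (fun _ => rfl) (fun _ => rfl) R (by omega)
        rw [e1, e2, add_one_mul, add_comm (l.length * m)]
        exact i1.mul i2 le_rfl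
  have h2 : 2 * m ≤ C.rad := le_trans (Nat.mul_le_mul_right m (by omega)) hrad
  obtain ⟨l', hlen, hl', hi⟩ := key l hl h2
  have hlU' : l'.prod ∈ unitary (Op (C.liftDim loc n)) := Submonoid.list_prod_mem _
    fun v hv => (hl' v hv).unitary
  exact ⟨Unitary.conjStarAlgAut ℂ _ ⟨l'.prod, hlU'⟩, ⟨l'.prod, ⟨l', hlen, hl', rfl⟩, fun _ => rfl⟩,
    hi γ _ hγ (fun _ => rfl) 0 (by omega)⟩

end Cover

/-! ### Representatives of least absolute value and distances on the circle -/

section ZModLemmas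

theorem valMinAbs_intCast {n : ℕ} [NeZero n] {z : ℤ} (hz : 2 * z.natAbs < n) :
    ((z : ZMod n)).valMinAbs = z := by
  rw [ZMod.valMinAbs_spec]
  refine ⟨rfl, ?_⟩
  rw [Set.mem_Ioc]
  omega

theorem valMinAbs_sub_add {n : ℕ} [NeZero n] (a b c : ZMod n)
    (h : 2 * ((b - a).valMinAbs.natAbs + (c - b).valMinAbs.natAbs) < n) :
    (c - a).valMinAbs = (b - a).valMinAbs + (c - b).valMinAbs := by
  have : c - a = (((b - a).valMinAbs + (c - b).valMinAbs : ℤ) : ZMod n) := by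
    push_cast
    simp
  rw [this, valMinAbs_intCast]
  omega

theorem castHom_injective_of_eq {a b : ℕ} (e : a = b) (h : b ∣ a) :
    Function.Injective (ZMod.castHom h (ZMod b)) := by
  subst e
  exact ZMod.castHom_injective _

theorem norm_toAddCircle {n : ℕ} [NeZero n] (z : ZMod n) :
    ‖ZMod.toAddCircle z‖ = (z.valMinAbs.natAbs : ℝ) / n := by
  have h1 : ZMod.toAddCircle z = (((z.valMinAbs : ℝ) / n : ℝ) : UnitAddCircle) := by
    rw [← ZMod.toAddCircle_intCast, ZMod.coe_valMinAbs]
  have hn : (0 : ℝ) < n := by exact_mod_cast NeZero.pos n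
  rw [h1, (AddCircle.norm_coe_eq_abs_iff (p := 1) one_ne_zero).2, abs_div, abs_of_pos hn,
    Nat.cast_natAbs, Int.cast_abs]
  rw [abs_div, abs_of_pos hn, abs_one, div_le_div_iff₀ hn two_pos, ← Int.cast_abs, ← Nat.cast_natAbs]
  have := ZMod.natAbs_valMinAbs_le z
  have h2 : z.valMinAbs.natAbs * 2 ≤ n := by omega
  rw [one_mul]
  exact_mod_cast h2

theorem exists_toAddCircle_near (n : ℕ) [NeZero n] (x : UnitAddCircle) :
    ∃ z : ZMod n, dist x (ZMod.toAddCircle z) ≤ 1 / n := by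
  obtain ⟨y, rfl⟩ := QuotientAddGroup.mk_surjective x
  have hn : (0 : ℝ) < n := by exact_mod_cast NeZero.pos n
  refine ⟨(⌊y * n⌋ : ℤ), ?_⟩
  rw [ZMod.toAddCircle_intCast, dist_eq_norm]
  change ‖((y - (⌊y * n⌋ : ℝ) / n : ℝ) : UnitAddCircle)‖ ≤ _
  refine (QuotientAddGroup.norm_mk_le_norm).trans ?_
  have h1 := Int.floor_le (y * n)
  have h2 := (Int.lt_floor_add_one (y * n)).le
  rw [Real.norm_eq_abs, abs_le]
  constructor
  · have : (0 : ℝ) ≤ y - (⌊y * n⌋ : ℝ) / n := by rw [sub_nonneg, div_le_iff₀ hn]; exact h1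
    have h0 : (0 : ℝ) ≤ 1 / n := by positivity
    linarith
  · rw [sub_le_iff_le_add, ← add_div, le_div_iff₀ hn]
    linarith

end ZModLemmas

/-! ### Tori covering a thin torus in the long directions -/

section TorusCover

variable {d : ℕ} (j : Fin d) (ℓ M : ℕ+) (n : Fin d → ℕ+)

/-- A covering torus. -/
abbrev covN : Fin d → ℕ+ := fun i => slab j ℓ M i * n i

/-- The covering map between tori. -/
def covMap (t : Site (covN j ℓ M n)) : Site (slab j ℓ M) :=
  fun i => ZMod.castHom (Dvd.intro _ (PNat.mul_coe _ _).symm) (ZMod (slab j ℓ M i)) (t i)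

theorem covMap_add_int (t : Site (covN j ℓ M n)) (v : Fin d → ℤ) :
    covMap j ℓ M n (fun i => t i + (v i : ZMod (covN j ℓ M n i))) =
      fun i => covMap j ℓ M n t i + (v i : ZMod (slab j ℓ M i)) := by
  ext1 i
  simp only [covMap]
  rw [map_add, map_intCast]

/-- The sup distance in the directions other than `j`. -/
def redDist (b b' : Site (slab j ℓ M)) : ℕ :=
  Finset.univ.sup fun i : Fin d => if i = j then 0 else (b i - b' i).valMinAbs.natAbs

theorem redDist_le {b b' : Site (slab j ℓ M)} {m : ℕ} :
    redDist j ℓ M b b' ≤ m ↔ ∀ i, i ≠ j → (b i - b' i).valMinAbs.natAbs ≤ m := by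
  rw [redDist, Finset.sup_le_iff]
  constructor
  · intro h i hi
    simpa [hi] using h i (Finset.mem_univ _)
  · intro h i _
    split_ifs with hi
    · exact Nat.zero_le _
    · exact h i hi

theorem redDist_self (b : Site (slab j ℓ M)) : redDist j ℓ M b b = 0 := by
  rw [← Nat.le_zero, redDist_le]
  intro i _
  rw [sub_self, ZMod.valMinAbs_zero]
  rfl

theorem redDist_comm (b b' : Site (slab j ℓ M)) : redDist j ℓ M b b' = redDist j ℓ M b' b := by
  unfold redDist
  refine Finset.sup_congr rfl fun i _ => ?_
  rw [← ZMod.natAbs_valMinAbs_neg, neg_sub]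

theorem redDist_triangle (b b' b'' : Site (slab j ℓ M)) :
    redDist j ℓ M b b'' ≤ redDist j ℓ M b b' + redDist j ℓ M b' b'' := by
  rw [redDist_le]
  intro i hi
  have h1 := (redDist_le j ℓ M).1 (le_refl (redDist j ℓ M b b')) i hi
  have h2 := (redDist_le j ℓ M).1 (le_refl (redDist j ℓ M b' b'')) i hi
  have := (ZMod.natAbs_valMinAbs_add_le (b i - b' i) (b' i - b'' i)).trans (Int.natAbs_add_le _ _)
  rw [sub_add_sub_cancel] at this
  omega

variable {j n} in
theorem covMap_eq_at (hn : n j = 1) {t t' : Site (covN j ℓ M n)}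
    (h : covMap j ℓ M n t j = covMap j ℓ M n t' j) : t j = t' j :=
  castHom_injective_of_eq (by rw [covN, hn, mul_one]) _ h

/-- The section of the covering of tori. -/
def covSec (t : Site (covN j ℓ M n)) (b : Site (slab j ℓ M)) : Site (covN j ℓ M n) :=
  fun i => t i + (((b i - covMap j ℓ M n t i).valMinAbs : ℤ) : ZMod (covN j ℓ M n i))

theorem covMap_covSec (t : Site (covN j ℓ M n)) (b : Site (slab j ℓ M)) :
    covMap j ℓ M n (covSec j ℓ M n t b) = b := by
  unfold covSec
  rw [covMap_add_int]
  ext1 i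
  rw [ZMod.coe_valMinAbs, add_sub_cancel]

variable {j n} in
/-- The covering of a torus by copies of a larger torus. -/
def torusCover (hn : n j = 1) (Q : Type) :
    Cover (Site (slab j ℓ M)) (Q × Site (covN j ℓ M n)) where
  dd := redDist j ℓ M
  dd_self := redDist_self j ℓ M
  dd_comm := redDist_comm j ℓ M
  dd_triangle := redDist_triangle j ℓ M
  -- Displacements of total size at most `(M - 1) / 2` are their own least representatives modulo
  -- `M`, and so they add without wrapping around.
  rad := ((M : ℕ) - 1) / 2
  p x := covMap j ℓ M n x.2
  s x b := (x.1, covSec j ℓ M n x.2 b)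
  p_s x b := covMap_covSec j ℓ M n x.2 b
  s_self x := by
    refine Prod.ext rfl (funext fun i => ?_)
    simp only [covSec]
    rw [sub_self, ZMod.valMinAbs_zero, Int.cast_zero, add_zero]
  s_s x b b' h := by
    refine Prod.ext rfl (funext fun i => ?_)
    -- In direction `j` the covering is one-to-one since `n j = 1`. So `redDist` may ignore this
    -- direction, just as the positions of the reduced QCA do.
    by_cases hi : i = j
    · subst hi
      refine covMap_eq_at ℓ M hn ?_
      rw [covMap_covSec, covMap_covSec]
    · change covSec j ℓ M n (covSec j ℓ M n x.2 b) b' i = covSec j ℓ M n x.2 b' i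
      rw [covSec, covMap_covSec]
      simp only [covSec]
      rw [add_assoc, ← Int.cast_add]
      congr 2
      refine (valMinAbs_sub_add _ _ _ ?_).symm
      have h1 := (redDist_le j ℓ M).1 (le_refl (redDist j ℓ M (covMap j ℓ M n x.2) b)) i hi
      have h2 := (redDist_le j ℓ M).1 (le_refl (redDist j ℓ M b b')) i hi
      rw [← ZMod.natAbs_valMinAbs_neg, neg_sub] at h1 h2
      have h3 : (slab j ℓ M i : ℕ) = M := by simp [slab, hi]
      have := M.pos
      refine lt_of_lt_of_eq ?_ h3.symm
      omega

end TorusCover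

/-! ### From one thin torus to its coverings -/

section LiftTriv

variable {d r q : ℕ} [NeZero q] (φ : Rule d r q)
variable {j : Fin d} (ℓ M : ℕ+) {n : Fin d → ℕ+}
variable {Q K T : Type} [Fintype Q] [DecidableEq Q] [Fintype K] [DecidableEq K]
  [PseudoMetricSpace T]

theorem covSec_act (hn : n j = 1) (t : Site (covN j ℓ M n)) (v : Fin d → ℤ)
    (hv : ∀ i, |v i| ≤ (((M : ℕ) - 1) / 2 : ℕ)) :
    covSec j ℓ M n t ((Lat.torus (slab j ℓ M)).act v (covMap j ℓ M n t)) =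
      (Lat.torus (covN j ℓ M n)).act v t := by
  funext i
  by_cases hi : i = j
  · subst hi
    refine covMap_eq_at ℓ M hn ?_
    rw [covMap_covSec]
    have := congrFun (covMap_add_int i ℓ M n t v) i
    exact this.symm
  · simp only [covSec, Lat.torus_act]
    rw [add_sub_cancel_left, valMinAbs_intCast]
    have h3 : (slab j ℓ M i : ℕ) = M := by simp [slab, hi]
    refine lt_of_lt_of_eq ?_ h3.symm
    have := abs_le.1 (hv i)
    have := M.pos
    omega

theorem redDist_act_le (x : Site (slab j ℓ M)) (v : Fin d → ℤ) {R : ℕ} (hv : ∀ i, |v i| ≤ R) :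
    redDist j ℓ M ((Lat.torus (slab j ℓ M)).act v x) x ≤ R := by
  rw [redDist_le]
  intro i _
  rw [Lat.torus_act, add_sub_cancel_left]
  have := ZMod.natAbs_min_of_le_div_two (slab j ℓ M i) ((v i : ZMod (slab j ℓ M i))).valMinAbs (v i)
    (ZMod.coe_valMinAbs _) (ZMod.natAbs_valMinAbs_le _)
  have := abs_le.1 (hv i)
  omega

theorem emb_inl_siteOp {I J : Type} [Fintype I] [DecidableEq I] [Fintype J] [DecidableEq J]
    (n : I → ℕ) (m : J → ℕ) (i : I) (b) :
    emb (SiteEmb.inl n m) (siteOp i b) = siteOp (n := Sum.elim n m) (Sum.inl i) b := by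
  rw [emb_siteOp]
  exact congrArg _ (castM_rfl rfl b)

variable (Q) in
/-- The sites of the lattice among the lifted sites. -/
def coverEmb (hn : n j = 1) (q : ℕ) (a : K → ℕ) (locK : K → Site (slab j ℓ M)) :
    SiteEmb (fun _ : Q × Site (covN j ℓ M n) => q)
      ((torusCover ℓ M hn Q).liftDim (Sum.elim id locK) (Sum.elim (qudits q (slab j ℓ M)) a)) where
  toFun x := ⟨(Sum.inl (covMap j ℓ M n x.2), x), rfl⟩
  inj _ _ h := congrArg (fun z : (torusCover ℓ M hn Q).Lift (Sum.elim id locK) => z.1.2) h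
  dim _ := rfl

/-- Short translations lift along sections (`covSec_act`), so the same rule upstairs lifts the QCA
downstairs. The ancillas are lifted too and are left alone on both levels. -/
theorem inter_qca (hn : n j = 1) (hF : (Lat.torus (slab j ℓ M)).Free (6 * r))
    (hF' : (Lat.torus (covN j ℓ M n)).Free (6 * r)) (a : K → ℕ) (locK : K → Site (slab j ℓ M))
    (R : ℕ) (hR : R + r ≤ (torusCover ℓ M hn Q).rad) :
    (torusCover ℓ M hn Q).Inter (Sum.elim id locK) r R
      (amb (SiteEmb.inl (qudits q (slab j ℓ M)) a) (qca φ hF))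
      (amb (coverEmb ℓ M Q hn q a locK) (qca φ (hF'.copies Q))) := by
  have e1 : ∀ (x : Site (slab j ℓ M)) (b : Matrix
      (Fin (Sum.elim (qudits q (slab j ℓ M)) a (Sum.inl x)))
      (Fin (Sum.elim (qudits q (slab j ℓ M)) a (Sum.inl x))) ℂ),
      siteOp (n := Sum.elim (qudits q (slab j ℓ M)) a) (Sum.inl x) b =
      emb (SiteEmb.inl (qudits q (slab j ℓ M)) a)
        (siteOp (n := qudits q (slab j ℓ M)) x b) := fun x b =>
    (emb_inl_siteOp (qudits q (slab j ℓ M)) a x b).symm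
  constructor
  · rintro (x | k) b
    · rw [e1, amb_emb]
      refine ((actsOn_qca φ hF x b).emb _).mono fun y hy => ?_
      obtain ⟨z, hz, rfl⟩ := Finset.mem_image.1 hy
      obtain ⟨w, _, rfl⟩ := Finset.mem_image.1 hz
      simp only [Finset.mem_filter, Finset.mem_univ, true_and]
      exact redDist_act_le ℓ M x _ (abs_offset_le w)
    · rw [amb_siteOp _ _ (fun x h => by cases h)]
      refine (actsOn_siteOp _ _).mono ?_
      simp only [Finset.singleton_subset_iff, Finset.mem_filter, Finset.mem_univ, true_and]
      exact (redDist_self j ℓ M _).le.trans (Nat.zero_le _)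
  · rintro θ (x | k) b hx
    · have hν : Function.Injective fun y => (torusCover ℓ M hn Q).s θ y := fun y y' h => by
        have := congrArg (torusCover ℓ M hn Q).p h
        simp only [(torusCover ℓ M hn Q).p_s] at this
        exact this
      have e2 : ∀ A, emb ((torusCover ℓ M hn Q).sec (Sum.elim id locK)
          (Sum.elim (qudits q (slab j ℓ M)) a) θ) (emb (SiteEmb.inl (qudits q (slab j ℓ M)) a) A) =
          emb (coverEmb ℓ M Q hn q a locK) (emb (SiteEmb.const q _ hν) A) := fun A => by
        rw [← emb_comp, ← emb_comp]
        refine emb_congr (fun y => ?_) A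
        exact Subtype.ext (Prod.ext (congrArg Sum.inl ((torusCover ℓ M hn Q).p_s θ y).symm) rfl)
      have e3 : emb (SiteEmb.const q _ hν) (siteOp (n := qudits q (slab j ℓ M)) x b) =
          siteOp (n := fun _ => q) ((torusCover ℓ M hn Q).s θ x) b := emb_const_siteOp _ hν x b
      rw [e1, amb_emb, e2, e2, amb_emb, e3]
      refine congrArg _ ((qca_siteOp φ (hF'.copies Q) _ b).trans (Eq.trans ?_
        (congrArg _ (qca_siteOp φ hF x b).symm)))
      refine (emb_emb_const _ _ _ _ _ _ (fun w => ?_) _).symm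
      have hs := (torusCover ℓ M hn Q).s_s θ x ((Lat.torus (slab j ℓ M)).act (offset r w) x) (by
        have h1 := redDist_act_le ℓ M x _ (abs_offset_le w)
        rw [redDist_comm] at h1
        change redDist j ℓ M _ _ ≤ R at hx
        exact le_trans (add_le_add hx h1) hR)
      have hp := (torusCover ℓ M hn Q).p_s θ x
      refine hs.symm.trans (Prod.ext rfl ?_)
      change covSec j ℓ M n _ _ = (Lat.torus (covN j ℓ M n)).act (offset r w) _
      rw [← covSec_act ℓ M hn _ _ fun i => (abs_offset_le w i).trans ?_]
      · congr 2
        exact hp.symm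
      · have : r ≤ (torusCover ℓ M hn Q).rad := by omega
        exact_mod_cast this
    · rw [amb_siteOp (SiteEmb.inl _ _) _ (fun x h => by cases h), emb_siteOp, amb_siteOp]
      intro y h
      have : (Sum.inl _ : Site (slab j ℓ M) ⊕ K) = Sum.inr k := congrArg (fun z => z.1.1) h
      cases this

/-- Circuits on a torus give circuits on its coverings. -/
theorem triv_lift (hn : n j = 1) (hF : (Lat.torus (slab j ℓ M)).Free (6 * r))
    (hF' : (Lat.torus (covN j ℓ M n)).Free (6 * r)) {D k m : ℕ} {ε : ℝ}
    (h : Triv (reducedPos j (slab j ℓ M)) D ε (qca φ hF ^ k)) (hε : ε * M + 2 ≤ m)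
    (hD : (D + 2) * m ≤ ((M : ℕ) - 1) / 2) (hk : k * r ≤ ((M : ℕ) - 1) / 2)
    {pos : Q × Site (covN j ℓ M n) → T} {δ : ℝ} (hδ : 0 ≤ δ)
    (hpos : ((Lat.torus (covN j ℓ M n)).copies Q).Lip pos δ) :
    Triv pos D (2 * (d * (m + ℓ) * δ)) (qca φ (hF'.copies Q) ^ k) := by
  obtain ⟨K, fK, dK, a, p, ha, h⟩ := h
  have hM : (0 : ℝ) < M := by exact_mod_cast M.pos
  have hsl : ∀ i, i ≠ j → (slab j ℓ M i : ℕ) = M := fun i hi => by simp [slab, hi]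
  -- Ancillas may sit anywhere; each is assigned a lattice point within `1 / M`. Its coordinate `j`
  -- is irrelevant and set to `0`.
  choose near hnear using fun (κ : K) (i : {i : Fin d // i ≠ j}) =>
    exists_toAddCircle_near (slab j ℓ M i) (p κ i)
  let locK : K → Site (slab j ℓ M) := fun κ i => if hi : i = j then 0 else near κ ⟨i, hi⟩
  have hloc : ∀ (x : Site (slab j ℓ M) ⊕ K) (i : {i : Fin d // i ≠ j}),
      dist (Sum.elim (reducedPos j (slab j ℓ M)) p x i)
        (ZMod.toAddCircle (Sum.elim id locK x i)) ≤ 1 / M := by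
    rintro (x | κ) i
    · change dist (ZMod.toAddCircle (x i)) (ZMod.toAddCircle (x i)) ≤ _
      rw [dist_self]; positivity
    · have h1 := hnear κ i
      have h2 : locK κ i = near κ i := dif_neg i.2
      change dist (p κ i) (ZMod.toAddCircle (locK κ i)) ≤ _
      rw [h2]
      refine h1.trans (le_of_eq ?_)
      rw [hsl i i.2]
  -- Rounding both ends to lattice points costs at most two steps, hence the `2` in `hε`.
  have hm : ∀ x y, dist (Sum.elim (reducedPos j (slab j ℓ M)) p x)
      (Sum.elim (reducedPos j (slab j ℓ M)) p y) ≤ ε →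
      (torusCover ℓ M hn Q).dd (Sum.elim id locK x) (Sum.elim id locK y) ≤ m := by
    intro x y hxy
    refine (redDist_le j ℓ M).2 fun i hi => ?_
    have h1 : dist (Sum.elim (reducedPos j (slab j ℓ M)) p x ⟨i, hi⟩)
        (ZMod.toAddCircle (Sum.elim id locK x i)) ≤ 1 / M := hloc x ⟨i, hi⟩
    have h2 : dist (Sum.elim (reducedPos j (slab j ℓ M)) p y ⟨i, hi⟩)
        (ZMod.toAddCircle (Sum.elim id locK y i)) ≤ 1 / M := hloc y ⟨i, hi⟩
    have h3 : dist (Sum.elim (reducedPos j (slab j ℓ M)) p x ⟨i, hi⟩)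
        (Sum.elim (reducedPos j (slab j ℓ M)) p y ⟨i, hi⟩) ≤ ε :=
      (dist_le_pi_dist _ _ (⟨i, hi⟩ : {i : Fin d // i ≠ j})).trans hxy
    have h4 := dist_triangle4 (ZMod.toAddCircle (Sum.elim id locK x i))
      (Sum.elim (reducedPos j (slab j ℓ M)) p x ⟨i, hi⟩)
      (Sum.elim (reducedPos j (slab j ℓ M)) p y ⟨i, hi⟩)
      (ZMod.toAddCircle (Sum.elim id locK y i))
    rw [dist_comm (ZMod.toAddCircle (Sum.elim id locK x i))
      (Sum.elim (reducedPos j (slab j ℓ M)) p x ⟨i, hi⟩)] at h4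
    have h5 : dist (ZMod.toAddCircle (Sum.elim id locK x i))
        (ZMod.toAddCircle (Sum.elim id locK y i)) ≤ ε + 2 / M := by
      have : (2 : ℝ) / M = 1 / M + 1 / M := by ring
      linarith
    rw [dist_eq_norm, ← map_sub, norm_toAddCircle] at h5
    have h6 : ((slab j ℓ M i : ℕ) : ℝ) = M := by exact_mod_cast hsl i hi
    rw [div_le_iff₀ (h6 ▸ hM)] at h5
    have h7 : (ε + 2 / M) * ((slab j ℓ M i : ℕ) : ℝ) = ε * M + 2 := by
      rw [h6, add_mul, div_mul_cancel₀ _ hM.ne']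
    rw [h7] at h5
    exact_mod_cast h5.trans hε
  let pos' : (torusCover ℓ M hn Q).Lift (Sum.elim id locK) → T := fun x => pos x.1.2
  -- Along a section a point moves by at most `m` steps in the long directions and by at most `ℓ`
  -- steps in direction `j`, in which gates of the reduced QCA may wrap around.
  have hsec : ∀ θ b, redDist j ℓ M (covMap j ℓ M n θ.2) b ≤ m →
      dist (pos ((torusCover ℓ M hn Q).s θ b)) (pos θ) ≤ d * (m + ℓ) * δ := by
    intro θ b hb
    have h1 := hpos.dist_le_of_le hδ (r := m + ℓ)
      (fun i => (b i - covMap j ℓ M n θ.2 i).valMinAbs) (fun i => ?_) θ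
    · refine le_trans h1 (le_of_eq ?_)
      push_cast
      ring
    · by_cases hi : i = j
      · have := ZMod.natAbs_valMinAbs_le (b i - covMap j ℓ M n θ.2 i)
        have h2 : (slab j ℓ M i : ℕ) = ℓ := by simp [slab, hi]
        have h3 : (slab j ℓ M i : ℕ) / 2 ≤ ℓ := by omega
        rw [Int.abs_eq_natAbs]
        have h4 : (b i - covMap j ℓ M n θ.2 i).valMinAbs.natAbs ≤ m + ℓ := by omega
        exact Int.ofNat_le.2 h4
      · rw [redDist_comm] at hb
        have := (redDist_le j ℓ M).1 hb i hi
        rw [Int.abs_eq_natAbs]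
        have h4 : (b i - covMap j ℓ M n θ.2 i).valMinAbs.natAbs ≤ m + ℓ := by omega
        exact Int.ofNat_le.2 h4
  obtain ⟨γ', h1, h2⟩ := Cover.exists_lift_circ (C := torusCover ℓ M hn Q)
    (loc := Sum.elim id locK) (pos' := pos') (ρ' := 2 * (d * (m + ℓ) * δ)) hm
    (fun θ x y hx hy => by
      have h1 := hsec θ _ hx
      have h2 := hsec θ _ hy
      rw [dist_comm] at h2
      refine (dist_triangle _ (pos θ) _).trans ?_
      rw [two_mul]
      exact add_le_add h1 (by rw [dist_comm] at h2 ⊢; exact h2)) hD h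
  have h3 := Cover.Inter.pow k (R := 0) (inter_qca φ ℓ M hn hF hF' a locK (Q := Q))
    (by rw [zero_add]; exact hk)
  rw [map_pow] at h2
  rw [Cover.Inter.unique h2 h3, ← map_pow] at h1
  -- The lifted ancillas are ordinary ancillas for the covering torus.
  refine Triv.of_amb _ h1.triv (fun _ => rfl) ?_
  rintro ⟨⟨x | κ, θ⟩, _⟩
  · exact NeZero.pos q
  · exact ha κ

end LiftTriv

/-! ### Transport along equivariant bijections -/

section Transfer

variable {d r q : ℕ} [NeZero q] (φ : Rule d r q)
variable {X Y T : Type} [Fintype X] [DecidableEq X] [Fintype Y] [DecidableEq Y]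
  [PseudoMetricSpace T]

theorem triv_of_equiv {A : Lat d X} (hA : A.Free (6 * r)) {B : Lat d Y} (hB : B.Free (6 * r))
    (e : X ≃ Y) (he : ∀ v x, e (A.act v x) = B.act v (e x)) {posX : X → T} {posY : Y → T}
    (hp : ∀ x, posY (e x) = posX x) {D : ℕ} {ρ : ℝ} (h : Triv posX D ρ (qca φ hA)) :
    Triv posY D ρ (qca φ hB) := by
  have h1 := h.amb (pos' := posY) (SiteEmb.const q e e.injective) hp
  rwa [amb_qca_equiv φ hA hB e he] at h1

theorem Lat.Lip.comp {A : Lat d X} {B : Lat d Y} {pos : Y → T} {δ : ℝ} (h : B.Lip pos δ)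
    (e : X → Y) (he : ∀ v x, e (A.act v x) = B.act v (e x)) : A.Lip (fun x => pos (e x)) δ := by
  intro j x
  change dist (pos (e (A.act (Pi.single j 1) x))) _ ≤ δ
  rw [he]
  exact h j (e x)

theorem equiv_symm_act {A : Lat d X} {B : Lat d Y} (e : X ≃ Y)
    (he : ∀ v x, e (A.act v x) = B.act v (e x)) (v y) :
    e.symm (B.act v y) = A.act v (e.symm y) := by
  rw [Equiv.symm_apply_eq, he, e.apply_symm_apply]

theorem lip_reglue {B E : Type} {f : Equiv.Perm B} {h : ℕ} (S : Strips f E h) (h0 : 0 < h)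
    (G : Bool → Equiv.Perm E) {i : Fin d} {C : Lat d Y} {pos : B × Y → T} {δ ρ : ℝ}
    (hρ : 0 ≤ ρ) (hpos : (Lat.prodPerm f i C).Lip pos δ)
    (hclose : ∀ s e y, dist (pos (S.c s (G s e) 0, y)) (pos (S.c s e 0, y)) ≤ ρ) :
    (Lat.prodPerm (S.reglue h0 G) i C).Lip pos (ρ + δ) := by
  rintro l ⟨b, y⟩
  have h1 := hpos l (b, y)
  rw [Lat.prodPerm_act] at h1 ⊢
  by_cases hl : i = l
  · subst hl
    rw [Pi.single_eq_same, zpow_one] at h1 ⊢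
    refine (dist_triangle _ (pos (f b, C.act (Pi.single i 1) y)) _).trans (add_le_add ?_ h1)
    change dist (pos (S.glue h0 G (f b), _)) _ ≤ _
    by_cases hb : f b ∈ S.lev 0
    · obtain ⟨s, e, hb⟩ := hb
      change dist (pos (S.glue h0 G (f b), C.act (Pi.single i 1) y)) (pos (f b, _)) ≤ _
      rw [← hb, S.glue_c]
      exact hclose s e _
    · change dist (pos (S.glue h0 G (f b), C.act (Pi.single i 1) y)) (pos (f b, _)) ≤ _
      rw [S.glue_of_notMem h0 G hb, dist_self]
      exact hρ
  · rw [Pi.single_eq_of_ne hl, zpow_zero] at h1 ⊢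
    exact h1.trans (le_add_of_nonneg_left hρ)

end Transfer

/-! ### Splitting one coordinate off a torus -/

section Split

/-- The translation of the second factor by one. -/
def shiftPerm (E : Type) (n : ℕ) : Equiv.Perm (E × ZMod n) :=
  Equiv.prodCongr (Equiv.refl E) (Equiv.addRight 1)

theorem shiftPerm_apply (E : Type) (n : ℕ) (x : E × ZMod n) :
    shiftPerm E n x = (x.1, x.2 + 1) := rfl

theorem shiftPerm_zpow (E : Type) (n : ℕ) (k : ℤ) (x : E × ZMod n) :
    (shiftPerm E n ^ k) x = (x.1, x.2 + k) := by
  induction k using Int.induction_on with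
  | zero => simp
  | succ m ih =>
    rw [zpow_succ_apply, ih, shiftPerm_apply]
    push_cast
    rw [add_assoc]
  | pred m ih =>
    apply (shiftPerm E n).injective
    rw [← zpow_succ_apply, sub_add_cancel, ih, shiftPerm_apply]
    push_cast
    refine Prod.ext rfl ?_
    change _ = x.2 + (-(m : ZMod n) - 1) + 1
    ring

theorem intCast_zmod_eq_zero {n : ℕ} {k : ℤ} (hk : k.natAbs < n) (h : (k : ZMod n) = 0) : k = 0 := by
  rw [ZMod.intCast_zmod_eq_zero_iff_dvd] at h
  exact Int.eq_zero_of_abs_lt_dvd h (by rw [Int.abs_eq_natAbs]; omega)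

theorem shiftPerm_free (E : Type) {n R : ℕ} (h : R < n) : PermFree (shiftPerm E n) R := by
  intro k x hk hx
  rw [shiftPerm_zpow] at hx
  have h1 : (k : ZMod n) = 0 := by simpa using congrArg Prod.snd hx
  refine intCast_zmod_eq_zero ?_ h1
  have := abs_le.1 hk
  omega

variable {d : ℕ} (i : Fin d) (N : Fin d → ℕ+)

/-- The coordinates in the other directions. -/
abbrev Rest : Type := ∀ l : {l : Fin d // l ≠ i}, ZMod (N l)

instance : DecidableEq (Rest i N) := inferInstance

/-- The translations in the other directions. -/
def restLat : Lat d (Rest i N) where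
  act v y := fun l => y l + (v l : ZMod (N l))
  act_zero y := by funext l; simp
  act_add v w y := by funext l; simp only [Pi.add_apply, Int.cast_add]; ring

theorem restLat_single (k : ℤ) (y : Rest i N) : (restLat i N).act (Pi.single i k) y = y := by
  funext l
  change y l + ((Pi.single i k : Fin d → ℤ) l : ZMod (N l)) = y l
  rw [Pi.single_eq_of_ne l.2]
  simp

theorem restLat_free {R : ℕ} (h : ∀ l, l ≠ i → R < N l) (v : Fin d → ℤ) (y : Rest i N)
    (hi : v i = 0) (hv : ∀ j, |v j| ≤ R) (e : (restLat i N).act v y = y) : v = 0 := by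
  funext l
  by_cases hl : l = i
  · subst hl; exact hi
  · have h1 : y ⟨l, hl⟩ + ((v l : ℤ) : ZMod (N l)) = y ⟨l, hl⟩ := congrFun e ⟨l, hl⟩
    refine intCast_zmod_eq_zero (n := N l) ?_ (by simpa using h1)
    have := abs_le.1 (hv l)
    have := h l hl
    omega

theorem ringEquivCongr_congr {a b : ℕ} (h : a = b) (h' : b = a) (x : ZMod a) :
    ZMod.ringEquivCongr h' (ZMod.ringEquivCongr h x) = x := by
  subst h
  simp [ZMod.ringEquivCongr_refl]

variable {i N} {N' : Fin d → ℕ+} {n : ℕ}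

/-- The sites of several copies of a torus, with the coordinate in one direction split off. -/
def splitEquiv (Q : Type) (hn : (N' i : ℕ) = n) (hN : ∀ l, l ≠ i → N' l = N l) :
    Q × Site N' ≃ (Q × ZMod n) × Rest i N where
  toFun x := ((x.1, ZMod.ringEquivCongr hn (x.2 i)),
    fun l => ZMod.ringEquivCongr (congrArg PNat.val (hN l l.2)) (x.2 l))
  invFun x := (x.1.1, fun l => if h : l = i then
      ZMod.ringEquivCongr (by rw [h, hn]) x.1.2
    else ZMod.ringEquivCongr (congrArg PNat.val (hN l h)).symm (x.2 ⟨l, h⟩))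
  left_inv x := by
    refine Prod.ext rfl (funext fun l => ?_)
    by_cases h : l = i
    · subst h
      subst hn
      simp [ZMod.ringEquivCongr_refl]
    · simp only [h, dif_neg, not_false_eq_true]
      exact ringEquivCongr_congr _ _ _
  right_inv x := by
    refine Prod.ext (Prod.ext rfl ?_) (funext fun l => ?_)
    · subst hn
      simp [ZMod.ringEquivCongr_refl]
    · simp only [l.2, dif_neg, not_false_eq_true]
      exact ringEquivCongr_congr _ _ _

theorem splitEquiv_act (Q : Type) (hn : (N' i : ℕ) = n) (hN : ∀ l, l ≠ i → N' l = N l) (v) (x) :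
    splitEquiv Q hn hN (((Lat.torus N').copies Q).act v x) =
      (Lat.prodPerm (shiftPerm Q n) i (restLat i N)).act v (splitEquiv Q hn hN x) := by
  rw [Lat.prodPerm_act, shiftPerm_zpow]
  refine Prod.ext (Prod.ext rfl ?_) (funext fun l => ?_)
  · change ZMod.ringEquivCongr hn (x.2 i + (v i : ZMod (N' i))) = _
    rw [map_add, map_intCast]
    rfl
  · change ZMod.ringEquivCongr _ (x.2 l + (v l : ZMod (N' l))) = _
    rw [map_add, map_intCast]
    rfl

end Split

/-! ### Winding several cycles into one long cycle -/

section Wind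

/-- A sequence of cycles of length `n`, glued to a single cycle in one of two directions. -/
def windEquiv {M n m : ℕ} [NeZero M] [NeZero n] [NeZero m] (hm : m = M * n) :
    Bool → ZMod M × ZMod n ≃ ZMod m := fun s =>
  Equiv.ofBijective (fun x => (((if s then -x.1 else x.1).val * n + x.2.val : ℕ) : ZMod m)) (by
    rw [Fintype.bijective_iff_injective_and_card]
    constructor
    · rintro ⟨μ, t⟩ ⟨μ', t'⟩ h
      have hlt : ∀ (a : ZMod M) (b : ZMod n), a.val * n + b.val < m := fun a b => by
        have h1 := ZMod.val_lt a
        have h2 := ZMod.val_lt b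
        rw [hm]
        calc a.val * n + b.val < a.val * n + n := by omega
          _ = (a.val + 1) * n := by ring
          _ ≤ M * n := Nat.mul_le_mul_right _ h1
      have h1 := congrArg ZMod.val h
      simp only at h1
      rw [ZMod.val_natCast_of_lt (hlt _ _), ZMod.val_natCast_of_lt (hlt _ _)] at h1
      have h2 : t.val = t'.val := by
        have := congrArg (· % n) h1
        simpa [Nat.mul_add_mod', Nat.mod_eq_of_lt (ZMod.val_lt _)] using this
      rw [h2, Nat.add_right_cancel_iff] at h1
      have h3 := ZMod.val_injective _ (Nat.eq_of_mul_eq_mul_right (NeZero.pos n) h1)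
      refine Prod.ext ?_ (ZMod.val_injective _ h2)
      cases s
      · exact h3
      · simpa using h3
    · simp [ZMod.card, hm])

variable {M n m : ℕ} [NeZero M] [NeZero n] [NeZero m] (hm : m = M * n)

theorem windEquiv_apply (s : Bool) (μ : ZMod M) (t : ZMod n) :
    windEquiv hm s (μ, t) = (((if s then -μ else μ).val * n + t.val : ℕ) : ZMod m) := rfl

theorem zmod_val_add_one {n : ℕ} [NeZero n] {t : ZMod n} (h : t ≠ -1) : (t + 1).val = t.val + 1 := by
  rcases n with _ | n
  · exact absurd rfl (NeZero.ne 0)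
  have h1 := ZMod.val_lt t
  rcases Nat.lt_or_ge t.val n with h2 | h2
  · have h3 : (1 : ZMod (n + 1)).val = 1 := ZMod.val_one'' (by omega)
    rw [ZMod.val_add_of_lt (by rw [h3]; omega), h3]
  · refine absurd ?_ h
    refine ZMod.val_injective _ ?_
    rw [ZMod.val_neg_one]
    omega

theorem windEquiv_add_one (s : Bool) (μ : ZMod M) {t : ZMod n} (ht : t ≠ -1) :
    windEquiv hm s (μ, t + 1) = windEquiv hm s (μ, t) + 1 := by
  rw [windEquiv_apply, windEquiv_apply, zmod_val_add_one ht]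
  push_cast
  ring

theorem zmod_val_neg_one_add {n : ℕ} [NeZero n] : (-1 : ZMod n).val + 1 = n := by
  rcases n with _ | n
  · exact absurd rfl (NeZero.ne 0)
  rw [ZMod.val_neg_one]

/-- The last point of cycle `μ` is followed by the first point of the next or of the previous cycle,
depending on the direction; after the last of the `M` cycles the position wraps around because `m =
M * n`. -/
theorem windEquiv_step (s : Bool) (μ : ZMod M) :
    windEquiv hm s (if s then μ - 1 else μ + 1, 0) = windEquiv hm s (μ, (-1 : ZMod n)) + 1 := by
  have key : ∀ a : ZMod M, (((a + 1).val * n : ℕ) : ZMod m) = (((a.val + 1) * n : ℕ) : ZMod m) := by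
    intro a
    by_cases ha : a = -1
    · subst ha
      rw [neg_add_cancel, ZMod.val_zero, zmod_val_neg_one_add, ← hm]
      simp
    · rw [zmod_val_add_one ha]
  have h2 : ∀ a : ZMod M, ((a.val * n + (-1 : ZMod n).val : ℕ) : ZMod m) + 1 =
      (((a + 1).val * n + (0 : ZMod n).val : ℕ) : ZMod m) := by
    intro a
    rw [ZMod.val_zero, add_zero, key]
    have h3 := zmod_val_neg_one_add (n := n)
    have h4 : a.val * n + (-1 : ZMod n).val + 1 = (a.val + 1) * n := by
      rw [add_assoc, h3]; ring
    rw [← h4]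
    push_cast
    ring
  rw [windEquiv_apply, windEquiv_apply, h2]
  cases s
  · simp
  · simp only [if_true]
    rw [neg_sub, sub_eq_neg_add, add_comm]

end Wind

theorem zpow_semiconj {B B' : Type} {g : Equiv.Perm B} {g' : Equiv.Perm B'} (e : B → B')
    (h : ∀ b, e (g b) = g' (e b)) (k : ℤ) (b : B) : e ((g ^ k) b) = (g' ^ k) (e b) := by
  induction k using Int.induction_on with
  | zero => simp
  | succ m ih => rw [zpow_succ_apply, zpow_succ_apply, h, ih]
  | pred m ih =>
    apply g'.injective
    rw [← zpow_succ_apply, ← h, ← zpow_succ_apply, sub_add_cancel, ih]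

theorem prodPerm_semiconj {d : ℕ} {B B' Y : Type} {g : Equiv.Perm B} {g' : Equiv.Perm B'}
    (e : B ≃ B') (h : ∀ b, e (g b) = g' (e b)) {i : Fin d} {C : Lat d Y} (v) (x : B × Y) :
    Equiv.prodCongr e (Equiv.refl Y) ((Lat.prodPerm g i C).act v x) =
      (Lat.prodPerm g' i C).act v (Equiv.prodCongr e (Equiv.refl Y) x) :=
  Prod.ext (zpow_semiconj e h (v i) x.1) rfl

/-! ### Stacks of tori -/

section Stack

variable {d r q : ℕ} [NeZero q] (φ : Rule d r q) (T : Type) [PseudoMetricSpace T]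

/-- The QCA on several copies of a torus, with a number of copies that is a multiple of the
cardinality of `κ`, is stably a circuit, provided that these copies are close to each other. -/
def Stack (N : Fin d → ℕ+) (κ : Type) [Fintype κ] [DecidableEq κ] (D : ℕ) (C : ℝ) : Prop :=
  ∀ (hF : (Lat.torus N).Free (6 * r)) (Q : Type) [Fintype Q] [DecidableEq Q]
    (pos : (Q × κ) × Site N → T) (δ : ℝ), 0 ≤ δ → ((Lat.torus N).copies (Q × κ)).Lip pos δ →
    (∀ s k k' x, dist (pos ((s, k), x)) (pos ((s, k'), x)) ≤ δ) →
    Triv pos D (C * δ) (qca φ (hF.copies (Q × κ)))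

/-- Short segments of cycles. -/
def windStrips (Q κ : Type) (M : ℕ) {n h : ℕ} (hn : 2 * h ≤ n) :
    Strips (shiftPerm (Q × Bool × ZMod M × κ) n) (Q × κ × ZMod M) h where
  c s e t := ((e.1, s, e.2.2, e.2.1), (t : ZMod n))
  step s e t := Prod.ext rfl (by rw [shiftPerm_apply]; push_cast; rfl)
  inj := by
    rintro s ⟨x, k, μ⟩ t s' ⟨x', k', μ'⟩ t' h1 h2 h1' h2' he
    simp only [Prod.mk.injEq] at he
    obtain ⟨⟨rfl, rfl, rfl, rfl⟩, ht⟩ := he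
    refine ⟨rfl, rfl, ?_⟩
    have h3 : ((t - t' : ℤ) : ZMod n) = 0 := by rw [Int.cast_sub, ht, sub_self]
    have := intCast_zmod_eq_zero (by omega) h3
    omega

/-- The cyclic permutation of the strips. -/
def windPerm (Q κ : Type) (M : ℕ) : Equiv.Perm (Q × κ × ZMod M) :=
  Equiv.prodCongr (Equiv.refl Q) (Equiv.prodCongr (Equiv.refl κ) (Equiv.addRight 1))

/-- Reconnecting `M` cycles of length `n` gives one of length `M * n`. -/
def windAll (Q κ : Type) {M n m : ℕ} [NeZero M] [NeZero n] [NeZero m] (hm : m = M * n) :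
    (Q × Bool × ZMod M × κ) × ZMod n ≃ ((Q × Bool) × κ) × ZMod m where
  toFun b := (((b.1.1, b.1.2.1), b.1.2.2.2), windEquiv hm b.1.2.1 (b.1.2.2.1, b.2))
  invFun b := ((b.1.1.1, b.1.1.2, ((windEquiv hm b.1.1.2).symm b.2).1, b.1.2),
    ((windEquiv hm b.1.1.2).symm b.2).2)
  left_inv b := by simp
  right_inv b := by simp

/-- Full gluing raises `μ` for label `false` and lowers it for label `true`. These are the two
directions of `windEquiv`, so each family becomes one long cycle. -/
theorem windAll_reglue (Q κ : Type) {M n m h : ℕ} [NeZero M] [NeZero n] [NeZero m]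
    (hm : m = M * n) (hn : 2 * h ≤ n) (h0 : 1 < h) (b) :
    windAll Q κ hm ((windStrips Q κ M hn).reglue (by omega) (Strips.full (windPerm Q κ M)) b) =
      shiftPerm _ m (windAll Q κ hm b) := by
  obtain ⟨⟨x, s, μ, k⟩, t⟩ := b
  rw [shiftPerm_apply]
  by_cases ht : t = -1
  · have h1 : ((x, s, μ, k), t) = (windStrips Q κ M hn).c s (x, k, μ) (-1) := by
      rw [ht]
      exact Prod.ext rfl (by change _ = ((-1 : ℤ) : ZMod n); push_cast; rfl)
    rw [h1, Strips.reglue_c _ _ _ _ _ (by omega) (by omega), if_pos rfl, ← h1, ht]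
    refine Prod.ext ?_ ?_
    · cases s <;> rfl
    · refine Eq.trans ?_ (windEquiv_step hm s μ)
      cases s
      · change windEquiv hm false (μ + 1, ((-1 + 1 : ℤ) : ZMod n)) = _
        simp
      · change windEquiv hm true (μ + -1, ((-1 + 1 : ℤ) : ZMod n)) = _
        simp [sub_eq_add_neg]
  · rw [Strips.reglue_of_notMem, shiftPerm_apply]
    · exact Prod.ext rfl (windEquiv_add_one hm s μ ht)
    · rintro ⟨s', e', he⟩
      refine ht ?_
      refine (congrArg Prod.snd he).symm.trans ?_
      change ((-1 : ℤ) : ZMod n) = -1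
      push_cast
      rfl

variable {φ T} {κ : Type} [Fintype κ] [DecidableEq κ] {N N' : Fin d → ℕ+} {D : ℕ} {C : ℝ}

/-- Two families of `M` copies are reconnected in opposite directions into two tori `M` times as
long, to which the hypothesis applies with `Q × Bool` in place of `Q`. Regluing at most doubles the
step bound `δ`; this explains both factors `2` in the constant. -/
theorem Stack.wind {i : Fin d} {M : ℕ} [NeZero M] (hi : (N' i : ℕ) = M * N i)
    (hN : ∀ l, l ≠ i → N' l = N l) (hh : 2 * (6 * r + 6) ≤ N i) (hfr : ∀ l, 6 * r < N l)
    (hS : Stack φ T N' κ D C) :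
    Stack φ T N (Bool × ZMod M × κ) (reconnectDepth d r + D)
      (2 * (2 * (6 * r + 6 : ℕ) + 1 + 4 * (d * r)) + 2 * |C|) := by
  intro hF Q _ _ pos δ hδ hpos hclose
  have hm : M * (N i : ℕ) = M * N i := rfl
  have : NeZero (M * (N i : ℕ)) := ⟨Nat.mul_ne_zero (NeZero.ne M) (N i).ne_zero⟩
  have hF' : (Lat.torus N').Free (6 * r) := Lat.torus_free fun l => by
    by_cases hl : l = i
    · subst hl
      rw [hi]
      exact (hfr l).trans_le (Nat.le_mul_of_pos_left _ (NeZero.pos M))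
    · rw [hN l hl]; exact hfr l
  let eN := splitEquiv (N := N) (Q × Bool × ZMod M × κ) (rfl : (N i : ℕ) = N i) fun _ _ => rfl
  let eM := splitEquiv ((Q × Bool) × κ) hi hN
  have heN := splitEquiv_act (N := N) (Q × Bool × ZMod M × κ) (rfl : (N i : ℕ) = N i) fun _ _ => rfl
  have heM := splitEquiv_act ((Q × Bool) × κ) hi hN
  let S := windStrips Q κ M hh
  let π := windPerm Q κ M
  let F := windAll Q κ hm
  let F' := Equiv.prodCongr F (Equiv.refl (Rest i N))
  have h0 : 0 < 6 * r + 6 := by omega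
  let g := S.reglue h0 (Strips.full π)
  have hFg : ∀ b, F (g b) = shiftPerm _ _ (F b) := windAll_reglue Q κ hm hh (by omega)
  let pos1 : ((Q × Bool × ZMod M × κ) × ZMod (N i)) × Rest i N → T := fun x => pos (eN.symm x)
  have hpos1 : (Lat.prodPerm (shiftPerm _ (N i : ℕ)) i (restLat i N)).Lip pos1 δ :=
    hpos.comp eN.symm (equiv_symm_act eN heN)
  have hcl : ∀ s s' e e' t y, e'.1 = e.1 → dist (pos1 (S.c s e t, y)) (pos1 (S.c s' e' t, y)) ≤ δ := by
    rintro s s' ⟨x, k, μ⟩ ⟨x', k', μ'⟩ t y rfl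
    exact hclose _ _ _ _
  have hfree : PermFree (shiftPerm (Q × Bool × ZMod M × κ) (N i)) (6 * r) :=
    shiftPerm_free _ (hfr i)
  have hC := restLat_free i N (R := 6 * r) fun l _ => hfr l
  have hP : (Lat.prodPerm (shiftPerm (Q × Bool × ZMod M × κ) (N i)) i (restLat i N)).Free (6 * r) :=
    Lat.prodPerm_free hfree hC
  have hP' : (Lat.prodPerm g i (restLat i N)).Free (6 * r) := Lat.prodPerm_free
    ((S.lvl_reglue h0 _).permFree hfree (by omega) fun b hb => S.reglue_of_notMem h0 _ hb) hC
  have hcirc := isCirc_reconnect φ S le_rfl h0 π hC (restLat_single i N) hfree hδ hδ hpos1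
    (fun s s' e e' y he => hcl s s' e e' 0 y (by
      rcases he with rfl | rfl | rfl <;> rfl)) hP hP'
  have hlip := lip_reglue S h0 (Strips.full π) hδ hpos1
    fun s e y => hcl s s _ e 0 y (by cases s <;> rfl)
  let pos' : ((Q × Bool) × κ) × Site N' → T := fun x => pos1 (F'.symm (eM x))
  have he' : ∀ v x, F'.symm (eM (((Lat.torus N').copies ((Q × Bool) × κ)).act v x)) =
      (Lat.prodPerm g i (restLat i N)).act v (F'.symm (eM x)) := fun v x => by
    rw [heM]
    exact equiv_symm_act F' (prodPerm_semiconj F hFg) v (eM x)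
  have h1 := hS hF' (Q × Bool) pos' (δ + δ) (by linarith)
    (hlip.comp (fun x => F'.symm (eM x)) he')
    (fun s k k' x => by
      refine le_trans ?_ (le_add_of_nonneg_left hδ)
      exact hclose _ _ _ _)
  have h2 : Triv pos1 D (C * (δ + δ)) (qca φ hP') :=
    triv_of_equiv φ (hF'.copies _) hP' (eM.trans F'.symm) he' (fun x => rfl) h1
  have h3 : Triv pos1 (reconnectDepth d r + D)
      ((2 * (2 * (6 * r + 6 : ℕ) + 1 + 4 * (d * r)) + 2 * |C|) * δ) (qca φ hP) := by
    have hC' : C * δ ≤ |C| * δ := mul_le_mul_of_nonneg_right (le_abs_self C) hδ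
    have hC0 : 0 ≤ |C| * δ := by positivity
    have hc : 0 ≤ (2 * ((6 * r + 6 : ℕ) : ℝ) + 1 + 4 * (d * r)) * δ := by positivity
    have := (hcirc.inv.triv.mono le_rfl (ρ' := (2 * (2 * (6 * r + 6 : ℕ) + 1 + 4 * (d * r)) +
      2 * |C|) * δ) (by linarith)).mul (h2.mono le_rfl (by linarith))
    rwa [mul_inv_rev, inv_inv, inv_mul_cancel_right] at this
  exact triv_of_equiv φ hP (hF.copies _) eN.symm (equiv_symm_act eN heN) (fun x => rfl) h3

end Stack

/-! ### Stacks of thin tori of arbitrary size are stably circuits -/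

section SlabStack

variable {d r q : ℕ} [NeZero q] (φ : Rule d r q) (T : Type) [PseudoMetricSpace T]
variable {j : Fin d} {ℓ : ℕ+}

theorem free_slab (hℓ : 6 * r < ℓ) {L : ℕ+} (hL : 6 * r < L) :
    (Lat.torus (slab j ℓ L)).Free (6 * r) := Lat.torus_free fun i => by
  by_cases hi : i = j
  · simpa [slab, hi] using hℓ
  · simpa [slab, hi] using hL

/-- The power of the reduction is stably a circuit with small gates. -/
def ReductionTriv (j : Fin d) (ℓ : ℕ+) : Prop :=
  ∃ k : ℕ, 0 < k ∧ ∃ (D : ℕ) (ε : ℕ+ → ℝ), Vanishing ε ∧ ∃ L₀ : ℕ+, ∀ L, L₀ ≤ L →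
    ∀ hF : (Lat.torus (slab j ℓ L)).Free (6 * r),
      Triv (reducedPos j (slab j ℓ L)) D (ε L) (qca φ hF ^ k)

/-- The only place where the reductions enter. One size `M` suffices, and lifting keeps gate sizes
bounded in lattice units; here a merely vanishing gate size turns into a multiple of the spacing
`δ`. -/
theorem exists_stack_cover (hℓ : 6 * r < ℓ) (h : ReductionTriv φ j ℓ) :
    ∃ k : ℕ, 0 < k ∧ ∃ (D : ℕ) (C : ℝ) (M : ℕ+), ∀ n : Fin d → ℕ+, n j = 1 →
      Stack φ T (covN j ℓ M n) (Fin k) D C := by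
  obtain ⟨k, hk, D, ε, hε, L₀, h⟩ := h
  have hD : (0 : ℝ) < 1 / (8 * (D + 2)) := by positivity
  -- The gates must be so small that the light cone of all `D` rounds fits into the injectivity
  -- radius of a torus of length `M`. The summands of the lower bound also absorb rounding, the
  -- spread `k * r` of the power, and the freeness condition.
  obtain ⟨M, hM1, hM2⟩ := ((hε.eventually (gt_mem_nhds hD)).and
    (eventually_ge_atTop (max L₀ ⟨24 * (D + 2) + 2 * (k * r) + 10 + 6 * r, by omega⟩))).exists
  have hM3 : L₀ ≤ M := (le_max_left _ _).trans hM2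
  have hM4 : 24 * (D + 2) + 2 * (k * r) + 10 + 6 * r ≤ (M : ℕ) := (le_max_right L₀ _).trans hM2
  have hF := free_slab (r := r) (j := j) hℓ (L := M) (by omega)
  have h := h M hM3 hF
  -- A bound on the gate size in lattice steps: two steps for placing the ancillas and one for
  -- rounding the quotient down.
  let m : ℕ := M / (8 * (D + 2)) + 3
  have hDD : 0 < 8 * (D + 2) := by omega
  have hm1 : ε M * M + 2 ≤ m := by
    have hM0 : (0 : ℝ) < M := by exact_mod_cast M.pos
    have h1 : ε M * M ≤ M / (8 * (D + 2) : ℕ) := by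
      have := mul_le_mul_of_nonneg_right hM1.le hM0.le
      push_cast
      rw [div_mul_eq_mul_div, one_mul] at this
      exact this
    have h2 : ((M : ℕ) : ℝ) / (8 * (D + 2) : ℕ) ≤ ((M : ℕ) / (8 * (D + 2)) : ℕ) + 1 :=
      (Nat.lt_floor_add_one _).le.trans (by rw [Nat.floor_div_eq_div])
    have h3 : (m : ℝ) = ((M : ℕ) / (8 * (D + 2)) : ℕ) + 3 := by simp [m]
    rw [h3]
    linarith
  have hm2 : (D + 2) * m ≤ ((M : ℕ) - 1) / 2 := by
    have h1 := Nat.div_mul_le_self (M : ℕ) (8 * (D + 2))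
    have h2 : 8 * ((D + 2) * m) = M / (8 * (D + 2)) * (8 * (D + 2)) + 24 * (D + 2) := by
      simp only [m]; ring
    omega
  have hkr : k * r ≤ ((M : ℕ) - 1) / 2 := by omega
  refine ⟨k, hk, k * swapDepth d r + D, 1 + 2 * (d * (m + ℓ)) + 2 * (d * r), M, fun n hn => ?_⟩
  intro hF' Q _ _ pos δ hδ hpos hclose
  let e : Fin k × (Q × Site (covN j ℓ M n)) ≃ (Q × Fin k) × Site (covN j ℓ M n) :=
    { toFun := fun x => ((x.2.1, x.1), x.2.2)
      invFun := fun x => (x.1.2, (x.1.1, x.2))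
      left_inv := fun _ => rfl
      right_inv := fun _ => rfl }
  refine triv_of_equiv φ ((hF'.copies Q).copies (Fin k)) (hF'.copies (Q × Fin k)) e
    (fun _ _ => rfl) (posX := fun x => pos (e x)) (fun _ => rfl) ?_
  have hpos' : (((Lat.torus (covN j ℓ M n)).copies Q).copies (Fin k)).Lip (fun x => pos (e x)) δ :=
    hpos.comp e fun _ _ => rfl
  have h1 := triv_lift φ ℓ M hn hF hF' h hm1 hm2 hkr hδ
    (pos := fun x => pos (e (⟨0, hk⟩, x))) fun l x => hpos' l (⟨0, hk⟩, x)
  have hml : 0 ≤ (d : ℝ) * (m + ℓ) * δ := by positivity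
  have hdr : 0 ≤ (d : ℝ) * r * δ := by positivity
  have h2 := triv_copies φ (hF'.copies Q) hk (ρ := δ + 2 * (d * (m + ℓ) * δ)) hδ (by linarith)
    hpos' (fun i i' x => (hclose x.1 i i' x.2).trans (by linarith))
    (h1.mono le_rfl (by linarith))
  exact h2.mono le_rfl (by linarith)

/-- Coverings give the lengths divisible by `M`. `Stack.wind` removes the divisibility, one
direction at a time, by passing to the torus `M` times as long in that direction; the number of
copies in a group is multiplied by `2 * M` each time. -/
theorem exists_stack_slab (hℓ : 6 * r < ℓ) (h : ReductionTriv φ j ℓ) :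
    ∃ (κ : Type) (_ : Fintype κ) (_ : DecidableEq κ) (_ : Nonempty κ) (D : ℕ) (C : ℝ) (T₀ : ℕ),
      ∀ N : Fin d → ℕ+, N j = ℓ → (∀ i, i ≠ j → T₀ ≤ N i) → Stack φ T N κ D C := by
  obtain ⟨k, hk, D, C, M, hM⟩ := exists_stack_cover φ T hℓ h
  -- `s` contains the directions in which divisibility by `M` is no longer required.
  have key : ∀ s : Finset (Fin d), ∃ (κ : Type) (_ : Fintype κ) (_ : DecidableEq κ)
      (_ : Nonempty κ) (D : ℕ) (C : ℝ) (T₀ : ℕ), ∀ N : Fin d → ℕ+, N j = ℓ →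
      (∀ i, i ≠ j → T₀ ≤ N i) → (∀ i, i ≠ j → i ∉ s → (M : ℕ) ∣ N i) → Stack φ T N κ D C := by
    intro s
    induction s using Finset.induction_on with
    | empty =>
      refine ⟨Fin k, inferInstance, inferInstance, ⟨⟨0, hk⟩⟩, D, C, 0, fun N hNj _ hN => ?_⟩
      have : ∃ n : Fin d → ℕ+, n j = 1 ∧ N = covN j ℓ M n := by
        have h1 : ∀ i, i ≠ j → ∃ c, N i = M * c := fun i hi =>
          PNat.dvd_iff.2 (hN i hi (by simp))
        choose c hc using h1
        refine ⟨fun i => if hi : i = j then 1 else c i hi, by simp, funext fun i => ?_⟩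
        by_cases hi : i = j
        · subst hi; simp [covN, slab, hNj]
        · simp [covN, slab, hi, hc i hi]
      obtain ⟨n, hn, rfl⟩ := this
      exact hM n hn
    | insert i s _ ih =>
      obtain ⟨κ, _, _, _, D', C', T₀, ih⟩ := ih
      by_cases hij : i = j
      · refine ⟨κ, inferInstance, inferInstance, inferInstance, D', C', T₀, fun N hNj hNT hN =>
          ih N hNj hNT fun l hl hls => hN l hl ?_⟩
        rw [Finset.mem_insert, not_or]
        exact ⟨fun e => hl (e.trans hij), hls⟩
      · refine ⟨Bool × ZMod M × κ, inferInstance, inferInstance, inferInstance,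
          reconnectDepth d r + D', 2 * (2 * (6 * r + 6 : ℕ) + 1 + 4 * (d * r)) + 2 * |C'|,
          max T₀ (2 * (6 * r + 6)), fun N hNj hNT hN => ?_⟩
        refine Stack.wind (i := i) (M := M) (N' := Function.update N i (M * N i)) (by simp)
          (fun l hl => Function.update_of_ne hl _ _) ((le_max_right _ _).trans (hNT i hij)) ?_
          (ih _ ?_ ?_ ?_)
        · intro l
          by_cases hl : l = j
          · rw [hl, hNj]; exact hℓ
          · have := hNT l hl
            omega
        · rw [Function.update_of_ne (Ne.symm hij), hNj]
        · intro l hl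
          have h1 : N l ≤ Function.update N i (M * N i) l := by
            by_cases hli : l = i
            · subst hli
              rw [Function.update_self]
              exact PNat.le_of_dvd (Dvd.intro_left _ rfl)
            · rw [Function.update_of_ne hli]
          exact ((le_max_left _ _).trans (hNT l hl)).trans h1
        · intro l hl hls
          by_cases hli : l = i
          · subst hli
            rw [Function.update_self, PNat.mul_coe]
            exact Dvd.intro _ rfl
          · rw [Function.update_of_ne hli]
            refine hN l hl ?_
            rw [Finset.mem_insert, not_or]
            exact ⟨hli, hls⟩
  obtain ⟨κ, i1, i2, i3, D', C', T₀, h⟩ := key Finset.univ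
  exact ⟨κ, i1, i2, i3, D', C', T₀, fun N hNj hNT => h N hNj hNT fun i _ hi => by simp at hi⟩

end SlabStack

/-! ### Inserting short cycles into a long one -/

/-- The places where cycles are inserted. -/
def cutPoint (h : ℕ) (s : Bool) (p : ℕ) : ℕ := 4 * (h * p) + if s then 3 * h else h

section Insertion

variable (L P h ℓ : ℕ) (m : ℕ → ℕ)

/-- The cycles to be inserted. -/
abbrev Loops : Type := Σ p : Fin P, Bool × Fin (m p)

/-- A cycle of length `L` and additional cycles of length `ℓ`. -/
abbrev Strands : Type := (Unit × ZMod L) ⊕ (Loops P m × ZMod ℓ)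

/-- The translation of all the cycles. -/
def strandPerm : Equiv.Perm (Strands L P ℓ m) :=
  Equiv.sumCongr (shiftPerm Unit L) (shiftPerm (Loops P m) ℓ)

theorem strandPerm_zpow_inl (k : ℤ) (x) :
    (strandPerm L P ℓ m ^ k) (Sum.inl x) = Sum.inl ((shiftPerm Unit L ^ k) x) :=
  (zpow_semiconj Sum.inl (fun _ => rfl) k x).symm

theorem strandPerm_zpow_inr (k : ℤ) (x) :
    (strandPerm L P ℓ m ^ k) (Sum.inr x) = Sum.inr ((shiftPerm (Loops P m) ℓ ^ k) x) :=
  (zpow_semiconj Sum.inr (fun _ => rfl) k x).symm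

theorem strandPerm_free {R : ℕ} (hL : R < L) (hℓ : R < ℓ) : PermFree (strandPerm L P ℓ m) R := by
  rintro k (x | x) hk e
  · rw [strandPerm_zpow_inl] at e
    exact shiftPerm_free Unit hL k x hk (Sum.inl_injective e)
  · rw [strandPerm_zpow_inr] at e
    exact shiftPerm_free _ hℓ k x hk (Sum.inr_injective e)

variable {L P h ℓ m}

/-- The segments of the cycles that are cut and glued. -/
def insertPoint (L P h ℓ : ℕ) (m : ℕ → ℕ) (s : Bool) (e : Σ p : Fin P, Fin (m p + 1)) (t : ℤ) :
    Strands L P ℓ m :=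
  Fin.cases (motive := fun _ => Strands L P ℓ m)
    (Sum.inl ((), ((cutPoint h s e.1 + t : ℤ) : ZMod L)))
    (fun i => Sum.inr (⟨e.1, s, i⟩, (t : ZMod ℓ))) e.2

theorem insertPoint_zero (s : Bool) (p : Fin P) (t : ℤ) :
    insertPoint L P h ℓ m s ⟨p, 0⟩ t = Sum.inl ((), ((cutPoint h s p + t : ℤ) : ZMod L)) := rfl

theorem insertPoint_succ (s : Bool) (p : Fin P) (i : Fin (m p)) (t : ℤ) :
    insertPoint L P h ℓ m s ⟨p, i.succ⟩ t = Sum.inr (⟨p, s, i⟩, (t : ZMod ℓ)) := rfl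

theorem cutPoint_bounds (h : ℕ) (s : Bool) (p : ℕ) :
    4 * (h * p) + h ≤ cutPoint h s p ∧ cutPoint h s p ≤ 4 * (h * p) + 3 * h := by
  cases s
  · simp only [cutPoint]; constructor <;> simp; omega
  · simp only [cutPoint]; constructor <;> simp; omega

theorem cutPoint_lt (hL : 4 * (h * P) ≤ L) (s : Bool) (p : Fin P) :
    cutPoint h s p + h ≤ L := by
  have h1 := (cutPoint_bounds h s p).2
  have h2 : h * (p + 1) ≤ h * P := Nat.mul_le_mul_left _ p.2
  rw [mul_add, mul_one] at h2
  omega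

/-- Each place occupies `4 * h` points, with cuts at `h` and `3 * h`; hence the segments of
half-length `h` around different cuts are disjoint. -/
theorem cutPoint_inj {s s' : Bool} {p p' : ℕ} {t t' : ℤ} (h1 : -(h : ℤ) ≤ t) (h2 : t < h)
    (h1' : -(h : ℤ) ≤ t') (h2' : t' < h) (e : (cutPoint h s p : ℤ) + t = cutPoint h s' p' + t') :
    s = s' ∧ p = p' ∧ t = t' := by
  have b1 := cutPoint_bounds h s p
  have b2 := cutPoint_bounds h s' p'
  have key : ∀ {p p' : ℕ}, p < p' → h * p + h ≤ h * p' := fun {p p'} hp => by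
    have := Nat.mul_le_mul_left h (Nat.succ_le_of_lt hp)
    rwa [Nat.succ_eq_add_one, mul_add, mul_one] at this
  have hp : p = p' := by
    rcases lt_trichotomy p p' with hp | hp | hp
    · have := key hp; omega
    · exact hp
    · have := key hp; omega
  subst hp
  cases s <;> cases s' <;> simp only [cutPoint] at e <;> simp at e ⊢ <;> omega

/-- The segments of the cycles that are cut and glued. -/
def insertStrips (hL : 4 * (h * P) ≤ L) (hℓ : 2 * h ≤ ℓ) :
    Strips (strandPerm L P ℓ m) (Σ p : Fin P, Fin (m p + 1)) h where
  c := insertPoint L P h ℓ m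
  step := by
    rintro s ⟨p, e⟩ t
    refine Fin.cases ?_ (fun i => ?_) e
    · rw [insertPoint_zero, insertPoint_zero]
      refine congrArg Sum.inl (Prod.ext rfl ?_)
      change _ + (1 : ZMod L) = _
      push_cast
      ring
    · rw [insertPoint_succ, insertPoint_succ]
      refine congrArg Sum.inr (Prod.ext rfl ?_)
      change _ + (1 : ZMod ℓ) = _
      push_cast
      ring
  inj := by
    rintro s ⟨p, e⟩ t s' ⟨p', e'⟩ t' h1 h2 h1' h2' he
    revert he
    refine Fin.cases ?_ (fun i => ?_) e <;> refine Fin.cases ?_ (fun i' => ?_) e' <;> intro he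
    · rw [insertPoint_zero, insertPoint_zero] at he
      have h3 := congrArg Prod.snd (Sum.inl_injective he)
      have b1 := cutPoint_bounds h s p
      have b2 := cutPoint_bounds h s' p'
      have c1 := cutPoint_lt hL s p
      have c2 := cutPoint_lt hL s' p'
      have h4 : (((cutPoint h s p + t) - (cutPoint h s' p' + t') : ℤ) : ZMod L) = 0 := by
        rw [Int.cast_sub, sub_eq_zero]; exact h3
      have h5 := intCast_zmod_eq_zero (by omega) h4
      obtain ⟨rfl, hp, rfl⟩ := cutPoint_inj h1 h2 h1' h2' (sub_eq_zero.1 h5)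
      obtain rfl := Fin.ext hp
      exact ⟨rfl, rfl, rfl⟩
    · cases he
    · cases he
    · rw [insertPoint_succ, insertPoint_succ] at he
      have h3 := congrArg Prod.snd (Sum.inr_injective he)
      have h4 := congrArg Prod.fst (Sum.inr_injective he)
      have h5 : ((t - t' : ℤ) : ZMod ℓ) = 0 := by
        rw [Int.cast_sub, sub_eq_zero]; exact h3
      have h6 := intCast_zmod_eq_zero (by omega) h5
      simp only [Sigma.mk.injEq] at h4
      obtain ⟨rfl, h4⟩ := h4
      simp only [heq_eq_eq, Prod.mk.injEq] at h4
      obtain ⟨rfl, rfl⟩ := h4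
      exact ⟨rfl, rfl, by omega⟩

/-- The cyclic permutation of the cycles at each place. -/
def insertPerm (P : ℕ) (m : ℕ → ℕ) : Equiv.Perm (Σ p : Fin P, Fin (m p + 1)) :=
  Equiv.sigmaCongrRight fun _ => Equiv.addRight 1

/-- The number of cycles inserted up to a point. -/
def insNum (P h : ℕ) (m : ℕ → ℕ) (t : ℕ) : ℕ :=
  ∑ p ∈ Finset.range P, ∑ s : Bool, if cutPoint h s p ≤ t then m p else 0

theorem insNum_zero (h0 : 0 < h) : insNum P h m 0 = 0 := by
  refine Finset.sum_eq_zero fun p _ => Finset.sum_eq_zero fun s _ => if_neg ?_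
  have := (cutPoint_bounds h s p).1
  omega

theorem insNum_top (hL : 4 * (h * P) ≤ L) (h0 : 0 < h) :
    insNum P h m (L - 1) = 2 * ∑ p ∈ Finset.range P, m p := by
  rw [Finset.mul_sum]
  refine Finset.sum_congr rfl fun p hp => ?_
  have h1 : ∀ s, (if cutPoint h s p ≤ L - 1 then m p else 0) = m p := fun s => if_pos (by
    have := cutPoint_lt hL s ⟨p, Finset.mem_range.1 hp⟩
    simp only at this
    omega)
  simp [h1, two_mul]

theorem insNum_cut (h0 : 0 < h) (s : Bool) (p : Fin P) :
    insNum P h m (cutPoint h s p) = insNum P h m (cutPoint h s p - 1) + m p := by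
  have h1 : ∀ s' p', (if cutPoint h s' p' ≤ cutPoint h s p then m p' else 0) =
      (if cutPoint h s' p' ≤ cutPoint h s p - 1 then m p' else 0) +
        if p' = p then (if s' = s then m p' else 0) else 0 := by
    intro s' p'
    have b := (cutPoint_bounds h s p).1
    by_cases e : cutPoint h s' p' = cutPoint h s p
    · obtain ⟨rfl, rfl, _⟩ := cutPoint_inj (h := h) (s := s') (s' := s) (p := p')
        (p' := p) (t := 0) (t' := 0) (by omega) (by omega)
        (by omega) (by omega) (by rw [e])
      rw [if_pos le_rfl, if_neg (by omega), if_pos rfl, if_pos rfl, zero_add]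
    · have h2 : (if p' = (p : ℕ) then (if s' = s then m p' else 0) else 0) = 0 := by
        split_ifs with a b
        · exact absurd (by rw [a, b]) e
        · rfl
        · rfl
      rw [h2, add_zero]
      congr 1
      exact propext (by omega)
  unfold insNum
  simp only [h1, Finset.sum_add_distrib]
  congr 1
  rw [Finset.sum_eq_single_of_mem (p : ℕ) (Finset.mem_range.2 p.2)]
  · simp
  · intro b _ hb
    simp [hb]

theorem insNum_succ {t : ℕ} (ht : ∀ s (p : Fin P), cutPoint h s p ≠ t + 1) :
    insNum P h m (t + 1) = insNum P h m t := by
  refine Finset.sum_congr rfl fun p hp => Finset.sum_congr rfl fun s _ => ?_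
  have := ht s ⟨p, Finset.mem_range.1 hp⟩
  simp only at this
  congr 1
  exact propext (by omega)

/-- The position of a point along the long cycle. -/
def insVal (L P h ℓ : ℕ) (m : ℕ → ℕ) : Strands L P ℓ m → ℕ :=
  Sum.elim (fun x => x.2.val + ℓ * insNum P h m x.2.val)
    (fun x => cutPoint h x.1.2.1 x.1.1 + ℓ * (insNum P h m (cutPoint h x.1.2.1 x.1.1 - 1) +
      if x.1.2.1 then m x.1.1 - 1 - x.1.2.2 else x.1.2.2) + x.2.val)

/-- The rank of a cycle among those inserted at the same place. -/
def insRank (m : ℕ) (s : Bool) (e : Fin (m + 1)) : ℕ :=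
  if s then m - e else if e = 0 then m else e - 1

/-- The rank of the successor of a cycle. -/
def insRankNext (m : ℕ) (s : Bool) (e : Fin (m + 1)) : ℕ :=
  if e = 0 then 0 else if s then m + 1 - e else e

/-- At a cut with label `false` the main cycle, with index `0`, runs through the inserted cycles in
increasing order, at a cut with label `true` in decreasing order, and then continues. The rank of
the strand after the cut matches `insRankNext` of the strand before it. -/
theorem insRank_next (m : ℕ) (e : Fin (m + 1)) :
    insRank m false (e + 1) = insRankNext m false e ∧
      insRank m true e = insRankNext m true (e + 1) := by
  have h1 := Fin.val_add_one e
  have h2 := e.2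
  constructor
  · simp only [insRank, insRankNext, Bool.false_eq_true, if_false]
    by_cases he : e = Fin.last m
    · subst he
      rw [Fin.last_add_one, if_pos rfl]
      split_ifs with h3
      · have := congrArg Fin.val h3
        simpa using this
      · simp
    · rw [if_neg he] at h1
      have h3 : e + 1 ≠ 0 := fun h => by rw [h] at h1; simp at h1
      rw [if_neg h3, h1]
      split_ifs with h4
      · rw [h4]; simp
      · simp
  · simp only [insRank, insRankNext, if_true]
    by_cases he : e = Fin.last m
    · subst he
      rw [Fin.last_add_one, if_pos rfl]
      simp
    · rw [if_neg he] at h1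
      have h3 : e + 1 ≠ 0 := fun h => by rw [h] at h1; simp at h1
      rw [if_neg h3, h1]
      omega

variable [NeZero L] [NeZero ℓ]

theorem insVal_zero (hL : 4 * (h * P) ≤ L) (h0 : 0 < h) (s : Bool) (p : Fin P)
    (e : Fin (m p + 1)) :
    insVal L P h ℓ m (insertPoint L P h ℓ m s ⟨p, e⟩ 0) =
      cutPoint h s p + ℓ * (insNum P h m (cutPoint h s p - 1) + insRank (m p) s e) := by
  have c1 := cutPoint_lt hL s p
  refine Fin.cases ?_ (fun i => ?_) e
  · rw [insertPoint_zero, add_zero, Int.cast_natCast]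
    simp only [insVal, Sum.elim_inl]
    rw [ZMod.val_natCast_of_lt (by omega), insNum_cut h0]
    simp [insRank]
  · rw [insertPoint_succ]
    simp only [insVal, Sum.elim_inr, Int.cast_zero, ZMod.val_zero, add_zero, insRank,
      Fin.succ_ne_zero, if_false, Fin.val_succ]
    congr 3
    split_ifs <;> omega

theorem insVal_neg_one (hL : 4 * (h * P) ≤ L) (h0 : 0 < h) (s : Bool) (p : Fin P)
    (e : Fin (m p + 1)) :
    insVal L P h ℓ m (insertPoint L P h ℓ m s ⟨p, e⟩ (-1)) + 1 =
      cutPoint h s p + ℓ * (insNum P h m (cutPoint h s p - 1) + insRankNext (m p) s e) := by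
  have c1 := cutPoint_lt hL s p
  have b1 := (cutPoint_bounds h s p).1
  refine Fin.cases ?_ (fun i => ?_) e
  · rw [insertPoint_zero]
    have h1 : (((cutPoint h s p : ℤ) + -1 : ℤ) : ZMod L) = ((cutPoint h s p - 1 : ℕ) : ZMod L) := by
      rw [Nat.cast_sub (by omega)]
      push_cast
      ring
    rw [h1]
    simp only [insVal, Sum.elim_inl]
    rw [ZMod.val_natCast_of_lt (by omega)]
    simp only [insRankNext, if_true, add_zero]
    omega
  · rw [insertPoint_succ]
    have h2 := zmod_val_neg_one_add (n := ℓ)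
    have h3 : insRankNext (m p) s i.succ =
        (if s then m p - 1 - i else (i : ℕ)) + 1 := by
      have := i.2
      simp only [insRankNext, Fin.succ_ne_zero, if_false, Fin.val_succ]
      split_ifs <;> omega
    simp only [insVal, Sum.elim_inr, Int.cast_neg, Int.cast_one]
    rw [h3, add_assoc, h2]
    ring

/-- `insVal` numbers the points in the order in which the reglued permutation visits them. The cases
are a cut, where the ranks match; a point of the main cycle away from the cuts, where the number of
insertions stays constant; the end of the main cycle; and the inside of an inserted cycle. -/
theorem insVal_reglue (hL : 4 * (h * P) ≤ L) (hℓ : 2 * h ≤ ℓ) (h0 : 1 < h) {L' : ℕ}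
    (hL' : L' = L + 2 * ℓ * ∑ p ∈ Finset.range P, m p) (b : Strands L P ℓ m) :
    ((insVal L P h ℓ m ((insertStrips hL hℓ).reglue (by omega)
      (Strips.full (insertPerm P m)) b) : ℕ) : ZMod L') =
      ((insVal L P h ℓ m b : ℕ) : ZMod L') + 1 := by
  by_cases hb : b ∈ (insertStrips (m := m) hL hℓ).lev (-1)
  · obtain ⟨s, ⟨p, e⟩, rfl⟩ := hb
    rw [Strips.reglue_c _ _ _ _ _ (by omega) (by omega), if_pos rfl]
    refine Eq.trans ?_ (Nat.cast_succ _)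
    congr 1
    change insVal L P h ℓ m (insertPoint L P h ℓ m s _ (-1 + 1)) =
      insVal L P h ℓ m (insertPoint L P h ℓ m s ⟨p, e⟩ (-1)) + 1
    rw [insVal_neg_one hL (by omega), neg_add_cancel]
    cases s
    · refine (insVal_zero hL (by omega) _ _ _).trans ?_
      rw [← (insRank_next (m p) e).1]
      rfl
    · refine (insVal_zero hL (by omega) _ _ _).trans ?_
      have := (insRank_next (m p) (e + -1)).2
      rw [neg_add_cancel_right] at this
      rw [← this]
      rfl
  · rw [Strips.reglue_of_notMem _ _ _ hb]
    rcases b with ⟨⟨⟩, t⟩ | ⟨⟨p, s, i⟩, u⟩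
    · change ((insVal L P h ℓ m (Sum.inl ((), t + 1)) : ℕ) : ZMod L') = _
      simp only [insVal, Sum.elim_inl]
      -- At the last point of the main cycle all insertions have been counted, so the next value is
      -- `L'`, which is `0` modulo `L'`.
      by_cases ht : t = -1
      · subst ht
        have h2 := zmod_val_neg_one_add (n := L)
        have h3 : (-1 : ZMod L).val = L - 1 := by omega
        rw [neg_add_cancel, ZMod.val_zero, insNum_zero (by omega), h3, insNum_top hL (by omega)]
        have h4 : L - 1 + ℓ * (2 * ∑ p ∈ Finset.range P, m p) + 1 = L' := by
          rw [hL']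
          have : ℓ * (2 * ∑ p ∈ Finset.range P, m p) = 2 * ℓ * ∑ p ∈ Finset.range P, m p := by ring
          omega
        rw [← Nat.cast_succ, Nat.succ_eq_add_one, h4]
        simp
      · rw [zmod_val_add_one ht, insNum_succ]
        · push_cast; ring
        · intro s p hs
          refine hb ⟨s, ⟨p, 0⟩, ?_⟩
          change Sum.inl ((), (((cutPoint h s p : ℤ) + -1 : ℤ) : ZMod L)) = _
          rw [hs]
          refine congrArg Sum.inl (Prod.ext rfl ?_)
          push_cast
          simp
    · change ((insVal L P h ℓ m (Sum.inr (⟨p, s, i⟩, u + 1)) : ℕ) : ZMod L') = _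
      simp only [insVal, Sum.elim_inr]
      rw [zmod_val_add_one, ← Nat.cast_succ]
      · congr 1
      · rintro rfl
        refine hb ⟨s, ⟨p, i.succ⟩, ?_⟩
        refine (insertPoint_succ (h := h) s p i (-1)).trans ?_
        rw [Int.cast_neg, Int.cast_one]

/-- The long cycle. -/
def insertEquiv (hL : 4 * (h * P) ≤ L) (hℓ : 2 * h ≤ ℓ) (h0 : 1 < h) {L' : ℕ} [NeZero L']
    (hL' : L' = L + 2 * ℓ * ∑ p ∈ Finset.range P, m p) : Strands L P ℓ m ≃ Unit × ZMod L' :=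
  Equiv.ofBijective (fun b => ((), ((insVal L P h ℓ m b : ℕ) : ZMod L'))) (by
    rw [Fintype.bijective_iff_surjective_and_card]
    constructor
    · rintro ⟨⟨⟩, z⟩
      obtain ⟨k, rfl⟩ := ZMod.intCast_surjective z
      -- Each step raises the value by one, so the orbit of the origin reaches every residue.
      -- Counting points then gives injectivity.
      let g := (insertStrips (m := m) hL hℓ).reglue (by omega) (Strips.full (insertPerm P m))
      have h1 := zpow_semiconj (g := g) (g' := shiftPerm Unit L')
        (fun b => (((), ((insVal L P h ℓ m b : ℕ) : ZMod L')) : Unit × ZMod L'))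
        (fun b => Prod.ext rfl (insVal_reglue hL hℓ h0 hL' b)) k (Sum.inl ((), 0))
      refine ⟨_, h1.trans ?_⟩
      rw [shiftPerm_zpow]
      simp [insVal, insNum_zero (show 0 < h by omega)]
    · rw [Fintype.card_sum, Fintype.card_prod, Fintype.card_prod, Fintype.card_prod, ZMod.card,
        ZMod.card, ZMod.card, Fintype.card_sigma, hL', Finset.sum_range]
      simp only [Fintype.card_unit, one_mul, Fintype.card_prod, Fintype.card_bool,
        Fintype.card_fin, ← Finset.mul_sum]
      ring)

end Insertion

/-! ### Even distribution of the inserted cycles -/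

section Share

/-- The number of cycles inserted at each place, if `K * s` of them are distributed evenly. -/
def share (K s P p : ℕ) : ℕ := ((p + 1) * s / P - p * s / P) * K

theorem sum_share (K s P n : ℕ) : ∑ p ∈ Finset.range n, share K s P p = n * s / P * K := by
  induction n with
  | zero => simp
  | succ n ih =>
    rw [Finset.sum_range_succ, ih, share, ← add_mul]
    congr 1
    exact Nat.add_sub_cancel' (Nat.div_le_div_right (Nat.mul_le_mul_right _ (Nat.le_succ n)))

variable {P h L : ℕ} {m : ℕ → ℕ}

theorem le_insNum {t n : ℕ} (hn : n ≤ P) (ht : 4 * (h * n) ≤ t) :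
    2 * ∑ p ∈ Finset.range n, m p ≤ insNum P h m t := by
  rw [Finset.mul_sum]
  refine le_trans (Finset.sum_le_sum fun p hp => ?_) (Finset.sum_le_sum_of_subset
    (Finset.range_subset_range.2 hn))
  have h1 : ∀ s, (if cutPoint h s p ≤ t then m p else 0) = m p := fun s => if_pos (by
    have h2 := (cutPoint_bounds h s p).2
    have h3 : h * (p + 1) ≤ h * n := Nat.mul_le_mul_left _ (Finset.mem_range.1 hp)
    rw [mul_add, mul_one] at h3
    omega)
  simp [h1, two_mul]

theorem insNum_le {t n : ℕ} (h0 : 0 < h) (ht : t ≤ 4 * (h * n)) :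
    insNum P h m t ≤ 2 * ∑ p ∈ Finset.range n, m p := by
  rw [Finset.mul_sum]
  refine le_trans (Finset.sum_le_sum_of_ne_zero fun p _ hp => ?_)
    (Finset.sum_le_sum (f := fun p => ∑ s : Bool, if cutPoint h s p ≤ t then m p else 0)
      fun p _ => ?_)
  · by_contra hpn
    refine hp (Finset.sum_eq_zero fun s _ => if_neg ?_)
    have h2 := (cutPoint_bounds h s p).1
    have h3 : h * n ≤ h * p := Nat.mul_le_mul_left _ (by simpa using hpn)
    omega
  · refine (Finset.sum_le_card_nsmul _ _ (m p) fun s _ => ?_).trans (by simp)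
    split_ifs <;> omega

/-- The number of cycles inserted up to `t` differs from the proportional share only by rounding to
whole places and whole groups. So insertion is nearly a uniform dilation, and the relative position
changes by `O(1 / L)` with a constant that does not depend on the amount `s` inserted. -/
theorem abs_insVal_sub_le {L P h ℓ K s t : ℕ} (h0 : 0 < h) (hP : P = L / (4 * h)) (hP0 : 0 < P)
    (ht : t < L) :
    |((t + ℓ * insNum P h (share K s P) t : ℕ) : ℝ) / (L + 2 * ℓ * (s * K) : ℕ) - t / L| ≤
      (12 * h + 2 * ℓ * K : ℕ) / L := by
  have hL1 : 4 * h * P ≤ L := by rw [hP]; exact Nat.mul_div_le _ _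
  have hL2 : L ≤ 4 * h * P + 4 * h := by
    have := Nat.div_add_mod L (4 * h)
    have := Nat.mod_lt L (show 0 < 4 * h by omega)
    rw [hP]; omega
  let p := t / (4 * h)
  have hp1 : 4 * h * p ≤ t := Nat.mul_div_le _ _
  have hp2 : t ≤ 4 * h * p + 4 * h := by
    have := Nat.div_add_mod t (4 * h)
    have := Nat.mod_lt t (show 0 < 4 * h by omega)
    simp only [p]; omega
  have hpP : p ≤ P := by rw [hP]; exact Nat.div_le_div_right ht.le
  have n1 : 2 * (p * s / P * K) ≤ insNum P h (share K s P) t := by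
    rw [← sum_share]
    exact le_insNum hpP (by rw [← mul_assoc]; exact hp1)
  have n2 : insNum P h (share K s P) t ≤ 2 * ((p + 1) * s / P * K) := by
    rw [← sum_share]
    exact insNum_le h0 (by rw [← mul_assoc, mul_add]; omega)
  generalize insNum P h (share K s P) t = n at n1 n2 ⊢
  have hP' : (0 : ℝ) < P := by exact_mod_cast hP0
  have hL' : (0 : ℝ) < L := by exact_mod_cast (by omega : 0 < L)
  have d1 : ((p * s : ℕ) : ℝ) / P ≤ (p * s / P : ℕ) + 1 :=
    (Nat.lt_floor_add_one _).le.trans (by rw [Nat.floor_div_eq_div])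
  have d2 : (((p + 1) * s / P : ℕ) : ℝ) ≤ (((p + 1) * s : ℕ) : ℝ) / P := Nat.cast_div_le
  have n1' : (2 * ((p * s / P : ℕ) * K) : ℝ) ≤ n := by exact_mod_cast n1
  have n2' : (n : ℝ) ≤ 2 * (((p + 1) * s / P : ℕ) * K) := by exact_mod_cast n2
  rw [div_le_iff₀ hP'] at d1
  rw [le_div_iff₀ hP'] at d2
  push_cast at d1 d2 ⊢
  have x0 : (0 : ℝ) ≤ (p * s / P : ℕ) := Nat.cast_nonneg _
  have y0 : (0 : ℝ) ≤ ((p + 1) * s / P : ℕ) := Nat.cast_nonneg _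
  generalize (((p * s / P : ℕ) : ℝ)) = x at d1 n1' x0
  generalize ((((p + 1) * s / P : ℕ) : ℝ)) = y at d2 n2' y0
  have r1 : (4 * h * P : ℝ) ≤ L := by exact_mod_cast hL1
  have r2 : (L : ℝ) ≤ 4 * h * P + 4 * h := by exact_mod_cast hL2
  have r3 : (4 * h * p : ℝ) ≤ t := by exact_mod_cast hp1
  have r4 : (t : ℝ) ≤ 4 * h * p + 4 * h := by exact_mod_cast hp2
  have r5 : (p : ℝ) ≤ P := by exact_mod_cast hpP
  have r6 : (1 : ℝ) ≤ P := by exact_mod_cast hP0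
  have z1 : (0 : ℝ) ≤ s := Nat.cast_nonneg _
  have z3 : (0 : ℝ) ≤ ℓ := Nat.cast_nonneg _
  have z4 : (0 : ℝ) ≤ h := Nat.cast_nonneg _
  generalize (L : ℝ) = L, (P : ℝ) = P, (p : ℝ) = p, (s : ℝ) = s, (t : ℝ) = t, (h : ℝ) = h,
    (ℓ : ℝ) = ℓ, (n : ℝ) = n at *
  have hK : (0 : ℝ) ≤ K := Nat.cast_nonneg _
  generalize (K : ℝ) = K at *
  -- `y` and `x` are the rounded numbers of groups at the end and at the start of the place
  -- containing `t`; `y1` and `x1` compare them with the proportional value `s * t / L`.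
  have y1 : y * L ≤ s * (t + 12 * h) := by
    have hy : y ≤ 2 * s := by
      refine le_of_mul_le_mul_right ?_ hP'
      calc y * P ≤ (p + 1) * s := d2
        _ ≤ (P + P) * s := mul_le_mul_of_nonneg_right (by linarith) z1
        _ = 2 * s * P := by ring
    calc y * L ≤ y * (4 * h * P + 4 * h) := mul_le_mul_of_nonneg_left r2 y0
      _ = 4 * h * (y * P) + 4 * h * y := by ring
      _ ≤ 4 * h * ((p + 1) * s) + 4 * h * (2 * s) := by gcongr
      _ = s * (4 * h * p + 12 * h) := by ring
      _ ≤ s * (t + 12 * h) := mul_le_mul_of_nonneg_left (by linarith) z1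
  have x1 : s * (t - 4 * h) - L ≤ x * L := by
    have : s * (t - 4 * h) ≤ (x + 1) * L :=
      calc s * (t - 4 * h) ≤ s * (4 * h * p) := mul_le_mul_of_nonneg_left (by linarith) z1
        _ = 4 * h * (p * s) := by ring
        _ ≤ 4 * h * ((x + 1) * P) := by gcongr
        _ = (x + 1) * (4 * h * P) := by ring
        _ ≤ (x + 1) * L := mul_le_mul_of_nonneg_left r1 (by linarith)
    linarith
  obtain ⟨A, hA⟩ : ∃ A, A = 2 * ℓ * K := ⟨_, rfl⟩
  have hA0 : 0 ≤ A := hA ▸ by positivity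
  have hZ : L + 2 * ℓ * (s * K) = L + A * s := by rw [hA]; ring
  have up : ℓ * n * L ≤ A * (s * (t + 12 * h)) :=
    calc ℓ * n * L ≤ ℓ * (2 * (y * K)) * L := by gcongr
      _ = A * (y * L) := by rw [hA]; ring
      _ ≤ _ := mul_le_mul_of_nonneg_left y1 hA0
  have lo : A * (s * (t - 4 * h) - L) ≤ ℓ * n * L :=
    calc A * (s * (t - 4 * h) - L) ≤ A * (x * L) := mul_le_mul_of_nonneg_left x1 hA0
      _ = ℓ * (2 * (x * K)) * L := by rw [hA]; ring
      _ ≤ _ := by gcongr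
  rw [hZ, ← hA]
  have hAs : 0 ≤ A * s := by positivity
  have hZ0 : 0 < L + A * s := by linarith
  have e1 : (t + ℓ * n) * L - (L + A * s) * t = ℓ * n * L - A * (s * t) := by ring
  rw [div_sub_div _ _ hZ0.ne' hL'.ne', abs_div, abs_of_pos (mul_pos hZ0 hL'),
    div_le_div_iff₀ (mul_pos hZ0 hL') hL', ← mul_assoc, e1]
  refine mul_le_mul_of_nonneg_right ?_ hL'.le
  have w1 : A * s * (12 * h) ≤ (L + A * s) * (12 * h) :=
    mul_le_mul_of_nonneg_right (by linarith) (by positivity)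
  have w2 : L * A ≤ (L + A * s) * A := mul_le_mul_of_nonneg_right (by linarith) hA0
  have w3 : 0 ≤ (L + A * s) * A := by positivity
  have w4 : 0 ≤ A * s * h := by positivity
  rw [abs_le]
  constructor
  · linarith
  · linarith

end Share

/-! ### Disjoint unions of invariant pieces -/

section Decompose

variable {d r q : ℕ} [NeZero q] (φ : Rule d r q)
variable {X X₁ X₂ T : Type} [Fintype X] [DecidableEq X] [Fintype X₁] [DecidableEq X₁]
  [Fintype X₂] [DecidableEq X₂] [PseudoMetricSpace T]

theorem qca_eq_mul {A : Lat d X} (hA : A.Free (6 * r)) {A₁ : Lat d X₁} (hA₁ : A₁.Free (6 * r))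
    {A₂ : Lat d X₂} (hA₂ : A₂.Free (6 * r)) (e₁ : X₁ → X) (h₁ : Function.Injective e₁)
    (he₁ : ∀ v x, e₁ (A₁.act v x) = A.act v (e₁ x)) (e₂ : X₂ → X) (h₂ : Function.Injective e₂)
    (he₂ : ∀ v x, e₂ (A₂.act v x) = A.act v (e₂ x)) (hd : ∀ x y, e₁ x ≠ e₂ y)
    (hc : ∀ z, (∃ x, e₁ x = z) ∨ ∃ y, e₂ y = z) :
    qca φ hA = amb (SiteEmb.const q e₁ h₁) (qca φ hA₁) * amb (SiteEmb.const q e₂ h₂) (qca φ hA₂) := by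
  have hcomm : Commute (amb (SiteEmb.const q e₁ h₁) (qca φ hA₁))
      (amb (SiteEmb.const q e₂ h₂) (qca φ hA₂)) := amb_commute _ _ hd _ _
  refine aut_ext fun z a => ?_
  rcases hc z with ⟨x, rfl⟩ | ⟨y, rfl⟩
  · rw [StarAlgEquiv.mul_apply, amb_siteOp (SiteEmb.const q e₂ h₂) _ (fun y e => hd x y e.symm)]
    exact (amb_qca_siteOp φ hA₁ hA e₁ h₁ he₁ x a).symm
  · rw [hcomm.eq, StarAlgEquiv.mul_apply, amb_siteOp (SiteEmb.const q e₁ h₁) _ (fun x e => hd x y e)]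
    exact (amb_qca_siteOp φ hA₂ hA e₂ h₂ he₂ y a).symm

/-- The relation of `α` with itself moves `α` from its place inside the larger system to a separate
copy. -/
theorem rel_of_mul_inv {Z : Type} [Fintype Z] [DecidableEq Z] {posZ : Z → T} {posX : X → T}
    {D D' : ℕ} {ρ : ℝ} (f : X → Z) (hf : Function.Injective f) {β : Aut fun _ : Z => q}
    {α : Aut fun _ : X => q} (hp : ∀ x, posZ (f x) = posX x)
    (h : Triv posZ D ρ (β * (amb (SiteEmb.const q f hf) α)⁻¹)) (h' : Rel posX posX D' ρ α α) :
    Rel posZ posX (D + D') ρ β α := by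
  have inj : Function.Injective (Sum.map f id : X ⊕ X → Z ⊕ X) :=
    Sum.map_injective.2 ⟨hf, Function.injective_id⟩
  have hfl : Function.Injective fun x => (Sum.inl (f x) : Z ⊕ X) := fun x y e =>
    hf (Sum.inl_injective e)
  have h1 := Triv.amb (pos' := Sum.elim posZ posX) h' (SiteEmb.const q _ inj)
    (by rintro (x | x); exacts [hp x, rfl])
  have h2 := Triv.amb (pos' := Sum.elim posZ posX) h (injl q Z X) fun _ => rfl
  have e1 := amb_const_comp (q := q) _ inj Sum.inl Sum.inl_injective _ hfl (fun _ => rfl) α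
  have e2 := amb_const_comp (q := q) _ inj Sum.inr Sum.inr_injective Sum.inr Sum.inr_injective
    (fun _ => rfl) α
  have e3 := amb_const_comp (q := q) (Sum.inl : Z → Z ⊕ X) Sum.inl_injective f hf _ hfl
    (fun _ => rfl) α
  rw [map_mul, map_inv, e1, e2] at h1
  rw [map_mul, map_inv, e3] at h2
  have h3 := h2.mul h1
  rwa [← mul_assoc, inv_mul_cancel_right] at h3

end Decompose

/-! ### Positions before and after the insertion -/

section Positions

theorem dist_toAddCircle_le {n n' : ℕ} [NeZero n] [NeZero n'] (a b : ℤ) :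
    dist (ZMod.toAddCircle (a : ZMod n)) (ZMod.toAddCircle (b : ZMod n')) ≤
      |(a : ℝ) / n - b / n'| := by
  rw [ZMod.toAddCircle_intCast, ZMod.toAddCircle_intCast, dist_eq_norm, ← AddCircle.coe_sub]
  exact QuotientAddGroup.norm_mk_le_norm

theorem toAddCircle_congr {a b : ℕ} [NeZero a] [NeZero b] (h : a = b) (x : ZMod a) :
    ZMod.toAddCircle (ZMod.ringEquivCongr h x) = ZMod.toAddCircle x := by
  subst h
  simp [ZMod.ringEquivCongr_refl]

variable {d : ℕ} {B : Type} (j : Fin d) (N : Fin d → ℕ+)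

/-- The position in the torus, given the coordinate in one direction. -/
def mixPos (θ : B → UnitAddCircle) (x : B × Rest j N) : Fin d → UnitAddCircle := fun l =>
  if h : l = j then θ x.1 else ZMod.toAddCircle (x.2 ⟨l, h⟩)

variable {j N}

theorem dist_mixPos_le {B' : Type} {θ : B → UnitAddCircle} {θ' : B' → UnitAddCircle} {b : B}
    {b' : B'} {y y' : Rest j N} {ρ : ℝ} (h : dist (θ b) (θ' b') ≤ ρ)
    (hy : ∀ l, dist (ZMod.toAddCircle (y l)) (ZMod.toAddCircle (y' l)) ≤ ρ) :
    dist (mixPos j N θ (b, y)) (mixPos j N θ' (b', y')) ≤ ρ := by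
  rw [dist_pi_le_iff (dist_nonneg.trans h)]
  intro l
  by_cases hl : l = j
  · have e1 : mixPos j N θ (b, y) l = θ b := dif_pos hl
    have e2 : mixPos j N θ' (b', y') l = θ' b' := dif_pos hl
    rw [e1, e2]
    exact h
  · have e1 : mixPos j N θ (b, y) l = ZMod.toAddCircle (y ⟨l, hl⟩) := dif_neg hl
    have e2 : mixPos j N θ' (b', y') l = ZMod.toAddCircle (y' ⟨l, hl⟩) := dif_neg hl
    rw [e1, e2]
    exact hy ⟨l, hl⟩

theorem dist_toAddCircle_add_one {n : ℕ} [NeZero n] (z : ZMod n) :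
    dist (ZMod.toAddCircle (z + 1)) (ZMod.toAddCircle z) ≤ 1 / n := by
  obtain ⟨k, rfl⟩ := ZMod.intCast_surjective z
  have h := dist_toAddCircle_le (n := n) (n' := n) (k + 1) k
  rw [Int.cast_add, Int.cast_one] at h
  refine h.trans (le_of_eq ?_)
  rw [← sub_div, Int.cast_add, Int.cast_one, add_sub_cancel_left, abs_of_nonneg (by positivity)]

theorem lip_mixPos {f : Equiv.Perm B} {θ : B → UnitAddCircle} {δ : ℝ}
    (hθ : ∀ b, dist (θ (f b)) (θ b) ≤ δ) (hδ : ∀ l, 1 / ((N l : ℕ) : ℝ) ≤ δ) :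
    (Lat.prodPerm f j (restLat j N)).Lip (mixPos j N θ) δ := by
  rintro l ⟨b, y⟩
  have h0 : 0 ≤ δ := le_trans (by positivity) (hδ l)
  rw [Lat.prodPerm_act]
  by_cases hl : j = l
  · subst hl
    rw [Pi.single_eq_same, zpow_one, restLat_single]
    exact dist_mixPos_le (hθ b) fun l => by rw [dist_self]; exact h0
  · rw [Pi.single_eq_of_ne hl, zpow_zero]
    refine dist_mixPos_le (by rw [Equiv.Perm.one_apply, dist_self]; exact h0) fun l' => ?_
    change dist (ZMod.toAddCircle (y l' + ((Pi.single l 1 : Fin d → ℤ) l' : ZMod (N l')))) _ ≤ _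
    by_cases hl' : (l' : Fin d) = l
    · have e : (Pi.single l 1 : Fin d → ℤ) l' = 1 := by rw [hl', Pi.single_eq_same]
      rw [e, Int.cast_one]
      exact (dist_toAddCircle_add_one _).trans (hδ _)
    · rw [Pi.single_eq_of_ne hl', Int.cast_zero, add_zero, dist_self]
      exact h0

theorem torusPos_split {N' : Fin d → ℕ+} {n : ℕ} [NeZero n] (hn : (N' j : ℕ) = n)
    (hN : ∀ l, l ≠ j → N' l = N l) (x : Site N') :
    mixPos j N (fun b : Unit × ZMod n => ZMod.toAddCircle b.2) (splitEquiv Unit hn hN ((), x)) =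
      torusPos N' x := by
  funext l
  by_cases hl : l = j
  · subst hl
    simp only [mixPos, dif_pos]
    exact toAddCircle_congr hn (x l)
  · simp only [mixPos, hl, dif_neg, not_false_eq_true]
    exact toAddCircle_congr _ (x l)

variable {L P h ℓ : ℕ} {m : ℕ → ℕ} [NeZero L]

/-- The positions of the points of the strands. -/
def strandPos (L P h ℓ : ℕ) (m : ℕ → ℕ) [NeZero L] : Strands L P ℓ m → UnitAddCircle :=
  Sum.elim (fun x => ZMod.toAddCircle x.2)
    (fun x => ZMod.toAddCircle (((4 * (h * x.1.1) : ℕ) : ℤ) : ZMod L))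

theorem dist_strandPos_perm (b) :
    dist (strandPos L P h ℓ m (strandPerm L P ℓ m b)) (strandPos L P h ℓ m b) ≤ 1 / L := by
  rcases b with ⟨⟨⟩, t⟩ | ⟨x, u⟩
  · exact dist_toAddCircle_add_one t
  · change dist (strandPos L P h ℓ m (Sum.inr (x, u + 1))) _ ≤ _
    simp only [strandPos, Sum.elim_inr, dist_self]
    positivity

theorem strandPos_insertPoint (s : Bool) (p : Fin P) (e : Fin (m p + 1)) :
    ∃ a : ℤ, strandPos L P h ℓ m (insertPoint L P h ℓ m s ⟨p, e⟩ 0) =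
      ZMod.toAddCircle (a : ZMod L) ∧ 4 * (h * p : ℕ) ≤ a ∧ a ≤ 4 * (h * p : ℕ) + 3 * h := by
  refine Fin.cases ?_ (fun i => ?_) e
  · have := cutPoint_bounds h s p
    exact ⟨cutPoint h s p + 0, rfl, by omega, by omega⟩
  · exact ⟨((4 * (h * p) : ℕ) : ℤ), rfl, by push_cast; omega, by push_cast; omega⟩

theorem dist_strandPos_insertPoint (s s' : Bool) (p : Fin P) (e e' : Fin (m p + 1)) :
    dist (strandPos L P h ℓ m (insertPoint L P h ℓ m s ⟨p, e⟩ 0))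
      (strandPos L P h ℓ m (insertPoint L P h ℓ m s' ⟨p, e'⟩ 0)) ≤ 3 * h * (1 / L) := by
  obtain ⟨a, ha, h1, h2⟩ := strandPos_insertPoint (L := L) (h := h) (ℓ := ℓ) s p e
  obtain ⟨b, hb, h3, h4⟩ := strandPos_insertPoint (L := L) (h := h) (ℓ := ℓ) s' p e'
  rw [ha, hb]
  refine (dist_toAddCircle_le a b).trans ?_
  have hL : (0 : ℝ) < L := by exact_mod_cast NeZero.pos L
  rw [← sub_div, abs_div, abs_of_pos hL, mul_one_div]
  gcongr
  have h5 : |a - b| ≤ 3 * h := by rw [abs_le]; omega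
  exact_mod_cast h5

/-- On the main cycle this is `abs_insVal_sub_le`. A point of an inserted cycle is squeezed between
the neighbours of its cut on the main cycle, and the extra `3 * h` is the distance of the cut from
the start of its place, where the whole inserted cycle is located. -/
theorem dist_strandPos_insVal [NeZero ℓ] {K s L' : ℕ} [NeZero L'] (h0 : 0 < h)
    (hP : P = L / (4 * h)) (hP0 : 0 < P) (hL' : L' = L + 2 * ℓ * (s * K))
    (b : Strands L P ℓ (share K s P)) :
    dist (strandPos L P h ℓ (share K s P) b)
      (ZMod.toAddCircle ((insVal L P h ℓ (share K s P) b : ℕ) : ZMod L')) ≤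
        (15 * h + 2 * ℓ * K : ℕ) * (1 / L) := by
  have hL : (0 : ℝ) < L := by exact_mod_cast NeZero.pos L
  have hLP : 4 * (h * P) ≤ L := by rw [← mul_assoc, hP]; exact Nat.mul_div_le _ _
  rcases b with ⟨⟨⟩, t⟩ | ⟨⟨p, σ, i⟩, u⟩
  · have h1 := abs_insVal_sub_le (ℓ := ℓ) (K := K) (s := s) h0 hP hP0 (ZMod.val_lt t)
    rw [← hL', abs_sub_comm] at h1
    have h2 := dist_toAddCircle_le (n := L) (n' := L') (t.val : ℤ)
      ((t.val + ℓ * insNum P h (share K s P) t.val : ℕ) : ℤ)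
    have e : ((t.val : ℤ) : ZMod L) = t := by rw [Int.cast_natCast, ZMod.natCast_zmod_val]
    rw [e, Int.cast_natCast, Int.cast_natCast, Int.cast_natCast] at h2
    refine le_trans h2 (le_trans h1 ?_)
    rw [mul_one_div]
    gcongr
    omega
  · have c1 := cutPoint_lt hLP σ p
    have c2 := cutPoint_bounds h σ p
    have h1 := abs_insVal_sub_le (ℓ := ℓ) (K := K) (s := s) (t := cutPoint h σ p) h0 hP hP0 (by omega)
    have h2 := abs_insVal_sub_le (ℓ := ℓ) (K := K) (s := s) (t := cutPoint h σ p - 1) h0 hP hP0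
      (by omega)
    rw [← hL'] at h1 h2
    have h3 : insVal L P h ℓ (share K s P) (Sum.inr (⟨p, σ, i⟩, u)) ≤
        cutPoint h σ p + ℓ * insNum P h (share K s P) (cutPoint h σ p) := by
      simp only [insVal, Sum.elim_inr]
      rw [insNum_cut h0, add_assoc]
      have hu := ZMod.val_lt u
      have hi : (if σ then share K s P p - 1 - i else (i : ℕ)) + 1 ≤ share K s P p := by
        have := i.2
        split_ifs <;> omega
      have := Nat.mul_le_mul_left ℓ (Nat.add_le_add_left hi
        (insNum P h (share K s P) (cutPoint h σ p - 1)))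
      rw [← add_assoc, mul_add ℓ _ 1] at this
      omega
    have h4 : cutPoint h σ p - 1 + ℓ * insNum P h (share K s P) (cutPoint h σ p - 1) ≤
        insVal L P h ℓ (share K s P) (Sum.inr (⟨p, σ, i⟩, u)) := by
      simp only [insVal, Sum.elim_inr]
      rw [mul_add]
      omega
    generalize insVal L P h ℓ (share K s P) (Sum.inr (⟨p, σ, i⟩, u)) = v at h3 h4 ⊢
    have hL'0 : (0 : ℝ) < L' := by exact_mod_cast NeZero.pos L'
    have h5 := dist_toAddCircle_le (n := L) (n' := L') ((4 * (h * p) : ℕ) : ℤ) (v : ℤ)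
    rw [Int.cast_natCast (n := v)] at h5
    refine le_trans h5 ?_
    have g3 : (v : ℝ) / L' ≤ (cutPoint h σ p + ℓ * insNum P h (share K s P) (cutPoint h σ p) : ℕ) / L' := by
      gcongr
    have g4 : ((cutPoint h σ p - 1 + ℓ * insNum P h (share K s P) (cutPoint h σ p - 1) : ℕ) : ℝ) / L'
        ≤ (v : ℝ) / L' := by
      gcongr
    have g1 : ((cutPoint h σ p : ℕ) : ℝ) / L ≤ ((4 * (h * p) : ℕ) : ℝ) / L + 3 * h / L := by
      rw [← add_div]
      gcongr
      exact_mod_cast c2.2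
    have g2 : ((4 * (h * p) : ℕ) : ℝ) / L ≤ ((cutPoint h σ p - 1 : ℕ) : ℝ) / L := by
      gcongr
      omega
    have g5 : ((15 * h + 2 * ℓ * K : ℕ) : ℝ) * (1 / L) = (12 * h + 2 * ℓ * K : ℕ) / L + 3 * h / L := by
      rw [mul_one_div, ← add_div]
      push_cast
      ring
    have g6 : (0 : ℝ) ≤ 3 * h / L := by positivity
    rw [g5, Int.cast_natCast, Int.cast_natCast]
    rw [abs_le] at h1 h2 ⊢
    constructor <;> linarith [h1.1, h1.2, h2.1, h2.2]

end Positions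

/-! ### Lengthening a torus in one direction -/

section Insert

/-- The inserted cycles, in groups of `card κ`. -/
def loopsEquiv (P s : ℕ) (κ : Type) [Fintype κ] :
    Loops P (share (Fintype.card κ) s P) ≃
      (Σ p : Fin P, Bool × Fin ((p + 1) * s / P - p * s / P)) × κ where
  toFun x := (⟨x.1, x.2.1, (finProdFinEquiv.symm x.2.2).1⟩,
    (Fintype.equivFin κ).symm (finProdFinEquiv.symm x.2.2).2)
  invFun y := ⟨y.1.1, y.1.2.1, finProdFinEquiv (y.1.2.2, Fintype.equivFin κ y.2)⟩
  left_inv := by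
    rintro ⟨p, b, i⟩
    simp only [Equiv.apply_symm_apply, Prod.mk.eta]
    exact congrArg (fun i => (⟨p, b, i⟩ : Loops P (share (Fintype.card κ) s P)))
      (finProdFinEquiv.apply_symm_apply i)
  right_inv := by
    rintro ⟨⟨p, b, i⟩, k⟩
    simp only [Equiv.symm_apply_apply]

variable {d r q : ℕ} [NeZero q] {φ : Rule d r q} {j : Fin d} {κ : Type} [Fintype κ]
  [DecidableEq κ] {N N' : Fin d → ℕ+}

instance {L P ℓ : ℕ} {m : ℕ → ℕ} : DecidableEq (Strands L P ℓ m) := inferInstance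

theorem torus_free_of_eq {ℓ R : ℕ} {N' : Fin d → ℕ+} (hℓ : R < ℓ) (hN : ∀ l, R < N l)
    (h : ∀ l, l ≠ j → N' l = N l) (hj : (N' j : ℕ) = ℓ) : (Lat.torus N').Free R :=
  Lat.torus_free fun l => by
    by_cases hl : l = j
    · rw [hl, hj]; exact hℓ
    · rw [h l hl]; exact hN l

/-- Inserting layers in one direction changes the QCA by a circuit. -/
theorem rel_insert {ℓ : ℕ+} {D s h : ℕ} {C : ℝ} (hh : h = 6 * r + 6)
    (hN : ∀ l, l ≠ j → N' l = N l)
    (hj : (N' j : ℕ) = N j + 2 * ℓ * (s * Fintype.card κ))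
    (hS : Stack φ (Fin d → UnitAddCircle) (Function.update N j ℓ) κ D C)
    (hL : 4 * h ≤ N j) (hℓ : 2 * h ≤ ℓ) (hfr : ∀ l, 6 * r < N l)
    {δ : ℝ} (hδ : ∀ l, 1 / ((N l : ℕ) : ℝ) ≤ δ) (hF : (Lat.torus N).Free (6 * r))
    (hF' : (Lat.torus N').Free (6 * r)) :
    Rel (torusPos N') (torusPos N) (swapDepth d r + (reconnectDepth d r + D + swapDepth d r))
      (((2 * h + 1 + 4 * (d * r)) * (1 + 3 * h) + |C| + (15 * h + 2 * ℓ * Fintype.card κ : ℕ) +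
        2 * (d * r) * (3 * h + 1) + 2 * (d * r)) * δ) (qca φ hF') (qca φ hF) := by
  have hδ0 : 0 ≤ δ := le_trans (by positivity) (hδ j)
  let K := Fintype.card κ
  -- As many places as fit, so that the insertions are spread over the entire cycle.
  let P := (N j : ℕ) / (4 * h)
  have hP0 : 0 < P := Nat.div_pos hL (by omega)
  have hLP : 4 * (h * P) ≤ N j := by rw [← mul_assoc]; exact Nat.mul_div_le _ _
  let m := share K s P
  have hL' : (N' j : ℕ) = N j + 2 * ℓ * ∑ p ∈ Finset.range P, m p := by
    rw [hj, sum_share, Nat.mul_div_cancel_left _ hP0]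
  let f := strandPerm (N j) P ℓ m
  have h0 : 0 < h := by omega
  let S : Strips f (Σ p : Fin P, Fin (m p + 1)) h := insertStrips hLP hℓ
  let π := insertPerm P m
  let g := S.reglue h0 (Strips.full π)
  let F := insertEquiv (m := m) hLP hℓ (show 1 < h by omega) hL'
  have hFg : ∀ b, F (g b) = shiftPerm Unit _ (F b) := fun b =>
    Prod.ext rfl (insVal_reglue hLP hℓ (by omega) hL' b)
  let θ : Strands (N j) P ℓ m → UnitAddCircle := strandPos (N j) P h ℓ m
  let pos := mixPos j N θ
  have hfree : PermFree f (6 * r) := strandPerm_free _ _ _ _ (hfr j) (by omega)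
  have hC := restLat_free j N (R := 6 * r) fun l _ => hfr l
  have hP : (Lat.prodPerm f j (restLat j N)).Free (6 * r) := Lat.prodPerm_free hfree hC
  have hP' : (Lat.prodPerm g j (restLat j N)).Free (6 * r) := Lat.prodPerm_free
    ((S.lvl_reglue h0 _).permFree hfree (by omega) fun b hb => S.reglue_of_notMem h0 _ hb) hC
  have hpos : (Lat.prodPerm f j (restLat j N)).Lip pos δ :=
    lip_mixPos (fun b => (dist_strandPos_perm b).trans (hδ j)) hδ
  have h3 : 0 ≤ 3 * (h : ℝ) * δ := by positivity
  have hcl : ∀ s s' p e e' y, dist (pos (S.c s ⟨p, e⟩ 0, y)) (pos (S.c s' ⟨p, e'⟩ 0, y)) ≤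
      3 * h * δ := fun s s' p e e' y => dist_mixPos_le
    ((dist_strandPos_insertPoint s s' p e e').trans (by gcongr; exact hδ j))
    fun l => by rw [dist_self]; exact h3
  have hcirc := isCirc_reconnect φ S (by omega) h0 π hC (restLat_single j N) hfree hδ0 h3 hpos
    (fun s s' e e' y he => by
      rcases e with ⟨p, e⟩
      rcases e' with ⟨p', e'⟩
      have : p' = p := by
        rcases he with he | he | he
        · exact congrArg Sigma.fst he
        · exact congrArg Sigma.fst he
        · exact (congrArg Sigma.fst he).symm
      subst this
      exact hcl s s' p' e e' y) hP hP'
  have hlip : (Lat.prodPerm g j (restLat j N)).Lip pos (3 * h * δ + δ) :=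
    lip_reglue S h0 (Strips.full π) h3 hpos fun s e y => by
      rcases e with ⟨p, e⟩
      cases s
      · exact hcl false false p _ e y
      · exact hcl true true p _ e y
  -- the strands of the given lattice
  have hn : (N j : ℕ) = N j := rfl
  let e₁ : Site N → Strands (N j) P ℓ m × Rest j N := fun x =>
    let y := splitEquiv (N := N) Unit hn (fun _ _ => rfl) ((), x)
    (Sum.inl y.1, y.2)
  have he₁ : ∀ v x, e₁ ((Lat.torus N).act v x) =
      (Lat.prodPerm f j (restLat j N)).act v (e₁ x) := fun v x => by
    have h1 := splitEquiv_act (N := N) Unit hn (fun _ _ => rfl) v ((), x)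
    have h2 := strandPerm_zpow_inl (N j) P ℓ m (v j)
      (splitEquiv (N := N) Unit hn (fun _ _ => rfl) ((), x)).1
    exact Prod.ext ((congrArg Sum.inl (congrArg Prod.fst h1 :)).trans h2.symm)
      (congrArg Prod.snd h1 :)
  have inj₁ : Function.Injective e₁ := fun x x' hx => by
    have h1 := Sum.inl_injective (congrArg Prod.fst hx)
    have h2 := congrArg Prod.snd hx
    exact congrArg Prod.snd ((splitEquiv (N := N) Unit hn (fun _ _ => rfl)).injective
      (Prod.ext h1 h2))
  have hp₁ : ∀ x, pos (e₁ x) = torusPos N x := fun x => torusPos_split hn (fun _ _ => rfl) x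
  -- the inserted strands
  let Q := Σ p : Fin P, Bool × Fin ((p + 1) * s / P - p * s / P)
  have hNℓ : ∀ l, l ≠ j → Function.update N j ℓ l = N l := fun l hl => Function.update_of_ne hl _ _
  have hnℓ : (Function.update N j ℓ j : ℕ) = ℓ := by rw [Function.update_self]
  have hFℓ : (Lat.torus (Function.update N j ℓ)).Free (6 * r) :=
    torus_free_of_eq (by omega) hfr hNℓ hnℓ
  let sp := splitEquiv (Q × κ) hnℓ hNℓ
  let e₂ : (Q × κ) × Site (Function.update N j ℓ) → Strands (N j) P ℓ m × Rest j N := fun x =>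
    (Sum.inr ((loopsEquiv P s κ).symm (sp x).1.1, (sp x).1.2), (sp x).2)
  have he₂ : ∀ v x, e₂ (((Lat.torus (Function.update N j ℓ)).copies (Q × κ)).act v x) =
      (Lat.prodPerm f j (restLat j N)).act v (e₂ x) := fun v x => by
    have h1 := splitEquiv_act (Q × κ) hnℓ hNℓ v x
    have h2 := strandPerm_zpow_inr (N j) P ℓ m (v j)
      ((loopsEquiv P s κ).symm (sp x).1.1, (sp x).1.2)
    rw [Lat.prodPerm_act]
    refine Prod.ext ?_ (congrArg Prod.snd h1 :)
    refine Eq.trans ?_ h2.symm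
    rw [shiftPerm_zpow]
    have h4 := congrArg Prod.fst h1
    rw [Lat.prodPerm_act, shiftPerm_zpow] at h4
    exact congrArg Sum.inr (Prod.ext (congrArg (loopsEquiv P s κ).symm (congrArg Prod.fst h4 :))
      (congrArg Prod.snd h4 :))
  have inj₂ : Function.Injective e₂ := fun x x' hx => by
    have h1 := Sum.inr_injective (congrArg Prod.fst hx)
    have h2 := congrArg Prod.snd hx
    exact sp.injective (Prod.ext (Prod.ext ((loopsEquiv P s κ).symm.injective
      (congrArg Prod.fst h1 :)) (congrArg Prod.snd h1 :)) h2)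
  -- All cycles inserted at one place have the same position, so the copies of a group are at
  -- distance `0` from each other and the stack is stably a circuit.
  have hT := hS hFℓ Q (fun x => pos (e₂ x)) δ hδ0 (hpos.comp e₂ he₂) (fun x k k' z => by
    change dist (pos (e₂ ((x, k), z))) (pos (e₂ ((x, k), z))) ≤ δ
    rw [dist_self]; exact hδ0)
  -- Before the regluing the QCA is a product over the given torus and the stack of thin tori.
  have hmul := qca_eq_mul φ hP hF (hFℓ.copies (Q × κ)) e₁ inj₁ he₁ e₂ inj₂ he₂
    (fun x y e => by cases congrArg Prod.fst e) (by
      rintro ⟨x | x, y⟩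
      · left
        refine ⟨((splitEquiv (N := N) Unit hn (fun _ _ => rfl)).symm (x, y)).2, ?_⟩
        have := (splitEquiv (N := N) Unit hn (fun _ _ => rfl)).apply_symm_apply (x, y)
        exact Prod.ext (congrArg Sum.inl (congrArg Prod.fst this :)) (congrArg Prod.snd this :)
      · right
        refine ⟨sp.symm ((loopsEquiv P s κ x.1, x.2), y), ?_⟩
        simp only [e₂, Equiv.apply_symm_apply, Equiv.symm_apply_apply])
  have hcomm : Commute (amb (SiteEmb.const q e₁ inj₁) (qca φ hF))
      (amb (SiteEmb.const q e₂ inj₂) (qca φ (hFℓ.copies (Q × κ)))) :=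
    amb_commute _ _ (fun x y e => by cases congrArg Prod.fst e) _ _
  obtain ⟨ρ, hρ⟩ : ∃ ρ, ρ = ((2 * h + 1 + 4 * (d * r)) * (1 + 3 * h) + |C| +
    (15 * h + 2 * ℓ * Fintype.card κ : ℕ) + 2 * (d * r) * (3 * h + 1) + 2 * (d * r)) * δ := ⟨_, rfl⟩
  have p1 : 0 ≤ (2 * h + 1 + 4 * (d * r)) * (1 + 3 * h) * δ := by positivity
  have p2 : 0 ≤ |C| * δ := by positivity
  have p3 : 0 ≤ ((15 * h + 2 * ℓ * Fintype.card κ : ℕ) : ℝ) * δ := by positivity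
  have p4 : 0 ≤ 2 * (d * r) * (3 * h + 1) * δ := by positivity
  have p5 : 0 ≤ 2 * (d * r) * δ := by positivity
  have hC' : C * δ ≤ |C| * δ := mul_le_mul_of_nonneg_right (le_abs_self C) hδ0
  -- Regluing costs a circuit and so does removing the stack; what remains is the QCA on the given
  -- torus.
  have t1 : Triv pos (reconnectDepth d r + D) ρ
      (qca φ hP' * (amb (SiteEmb.const q e₁ inj₁) (qca φ hF))⁻¹) := by
    have := (hcirc.triv.mono le_rfl (ρ' := ρ) (by rw [hρ]; linarith)).mul
      ((hT.amb (pos' := pos) (SiteEmb.const q e₂ inj₂) fun _ => rfl).mono le_rfl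
        (ρ' := ρ) (by rw [hρ]; linarith))
    rwa [hmul, mul_inv_rev, hcomm.inv_inv.symm.eq, ← mul_assoc, inv_mul_cancel_right] at this
  have hX : (Lat.torus N).Lip (torusPos N) δ := fun l x => by
    have := (hpos.comp e₁ he₁) l x
    simpa only [hp₁] using this
  have t2 : Rel (torusPos N) (torusPos N) (swapDepth d r) ρ (qca φ hF) (qca φ hF) :=
    (rel_of_equiv φ hF hF (Equiv.refl _) (fun _ _ => rfl) hδ0 le_rfl hX
      (fun x => (dist_self _).le)).mono le_rfl (by rw [hρ]; linarith)
  have t3 := rel_of_mul_inv e₁ inj₁ hp₁ t1 t2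
  let e' : Strands (N j) P ℓ m × Rest j N ≃ Site N' :=
    (Equiv.prodCongr F (Equiv.refl (Rest j N))).trans
      ((splitEquiv Unit (rfl : (N' j : ℕ) = N' j) hN).symm.trans (Equiv.punitProd _))
  have he' : ∀ x, splitEquiv Unit (rfl : (N' j : ℕ) = N' j) hN ((), e' x) = (F x.1, x.2) := fun x =>
    (splitEquiv Unit (rfl : (N' j : ℕ) = N' j) hN).apply_symm_apply (F x.1, x.2)
  -- The reglued strands are the longer torus with slightly displaced positions; the swap trick
  -- absorbs the displacement.
  have t4 : Rel (torusPos N') pos (swapDepth d r) ρ (qca φ hF') (qca φ hP') := by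
    refine Rel.symm ((rel_of_equiv φ hP' hF' e' (fun v x => ?_) (add_nonneg h3 hδ0) p3 hlip
      fun x => ?_).mono le_rfl (by rw [hρ]; linarith))
    · have h1 := equiv_symm_act (splitEquiv Unit (rfl : (N' j : ℕ) = N' j) hN)
        (splitEquiv_act Unit (rfl : (N' j : ℕ) = N' j) hN) v (F x.1, x.2)
      have h2 := prodPerm_semiconj F hFg (i := j) (C := restLat j N) v x
      exact (congrArg (fun z => ((splitEquiv Unit (rfl : (N' j : ℕ) = N' j) hN).symm z).2) h2).trans
        (congrArg Prod.snd h1)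
    · rw [← torusPos_split (rfl : (N' j : ℕ) = N' j) hN, he']
      refine dist_mixPos_le ?_ fun l => by rw [dist_self]; exact p3
      refine (dist_strandPos_insVal h0 rfl hP0 hj x.1).trans ?_
      gcongr
      exact hδ j
  rw [← hρ]
  exact t4.trans t3

end Insert

/-! ### Automorphisms are inner -/

section Inner

/-- Every `*`-automorphism of a matrix algebra is inner. -/
theorem exists_unitary_conj {n : Type} [Fintype n] [DecidableEq n]
    (α : Matrix n n ℂ ≃⋆ₐ[ℂ] Matrix n n ℂ) :
    ∃ U ∈ unitary (Matrix n n ℂ), ∀ A, α A = U * A * star U := by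
  let e := Matrix.toEuclideanCLM (n := n) (𝕜 := ℂ)
  let f := (e.symm.trans α).trans e
  obtain ⟨u, hu⟩ := f.eq_linearIsometryEquivConjStarAlgEquiv
    (LinearMap.continuous_of_finiteDimensional f.toAlgEquiv.toLinearMap)
  rw [← Unitary.conjStarAlgAut_symm_unitaryLinearIsometryEquiv] at hu
  generalize Unitary.linearIsometryEquiv.symm u = W at hu
  refine ⟨e.symm W, Unitary.map_mem e.symm W.2, fun A => ?_⟩
  have h1 : f (e A) = e (α A) := by simp [f]
  rw [hu, Unitary.conjStarAlgAut_apply] at h1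
  have h2 : α A = e.symm (W * e A * star (W : EuclideanSpace ℂ n →L[ℂ] EuclideanSpace ℂ n)) := by
    rw [eq_comm, StarAlgEquiv.symm_apply_eq]
    exact h1
  have h3 : e.symm (star (W : EuclideanSpace ℂ n →L[ℂ] EuclideanSpace ℂ n)) = star (e.symm W) :=
    e.symm.map_star' _
  rw [h2, map_mul, map_mul, h3, StarAlgEquiv.symm_apply_apply]

theorem isCirc_of_dist_le {I X : Type} [Fintype I] [DecidableEq I] [PseudoMetricSpace X]
    {n : I → ℕ} {pos : I → X} {ρ : ℝ} (h : ∀ i k, dist (pos i) (pos k) ≤ ρ) (α : Aut n) :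
    IsCirc pos 1 ρ α := by
  obtain ⟨U, hU, h1⟩ := exists_unitary_conj α
  refine ⟨U, ⟨[U], rfl, fun u hu => ?_, by simp⟩, h1⟩
  rw [List.mem_singleton.1 hu]
  refine ⟨[(Finset.univ, U)], by simp, fun g hg => ?_, by simp⟩
  rw [List.mem_singleton.1 hg]
  exact ⟨fun i _ k _ => h i k, hU, supportedOn_iff.2 fun i hi => absurd (Finset.mem_univ i) hi⟩

theorem dist_torus_le {d : ℕ} (x y : Fin d → UnitAddCircle) : dist x y ≤ 1 := by
  rw [dist_pi_le_iff zero_le_one]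
  intro l
  rw [dist_eq_norm]
  have := AddCircle.norm_le_half_period (p := (1 : ℝ)) (x := x l - y l) one_ne_zero
  rw [abs_one] at this
  linarith

end Inner

/-! ### Deforming one cube into another -/

section Deform

variable {d r q : ℕ} [NeZero q] {φ : Rule d r q}

/-- The directions are lengthened one after the other; `N s` is the torus in which those in `s`
already have length `L'`. -/
theorem exists_rel_large (h : ∀ j : Fin d, ∃ ℓ : ℕ+, 12 * r + 12 ≤ ℓ ∧ ReductionTriv φ j ℓ) :
    ∃ (ℓ₀ : ℕ+) (D : ℕ) (C : ℝ) (T₁ : ℕ), 0 ≤ C ∧ ∀ L L' : ℕ+, T₁ ≤ L → L ≤ L' →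
      (ℓ₀ : ℕ) ∣ (L' : ℕ) - L → ∀ (hF : (Lat.torus (cube d L)).Free (6 * r))
        (hF' : (Lat.torus (cube d L')).Free (6 * r)),
        Rel (torusPos (cube d L)) (torusPos (cube d L')) D (C / L) (qca φ hF) (qca φ hF') := by
  choose ℓ hℓ h using h
  have hs := fun j => exists_stack_slab φ (Fin d → UnitAddCircle) (by have := hℓ j; omega) (h j)
  choose κ i1 i2 i3 D C T hS using hs
  -- Layers in direction `j` are inserted in multiples of `2 * ℓ j * card (κ j)`: two families of
  -- cuts, `ℓ j` layers in a thin torus, and whole groups. The product of these numbers serves all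
  -- directions.
  let st : Fin d → ℕ+ := fun j => ⟨2 * ℓ j * Fintype.card (κ j), by
    have := Fintype.card_pos (α := κ j)
    have := (ℓ j).pos
    positivity⟩
  let H : ℕ := 6 * r + 6
  let T₁ := 4 * H + ∑ j, T j
  let N : Finset (Fin d) → ℕ+ → ℕ+ → Fin d → ℕ+ := fun s L L' l => if l ∈ s then L' else L
  have key : ∀ s : Finset (Fin d), ∃ (D' : ℕ) (C' : ℝ), 0 ≤ C' ∧ ∀ L L' : ℕ+, T₁ ≤ L → L ≤ L' →
      ((∏ j, st j : ℕ+) : ℕ) ∣ (L' : ℕ) - L → ∀ (hF : (Lat.torus (cube d L)).Free (6 * r))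
        (hF' : (Lat.torus (N s L L')).Free (6 * r)),
        Rel (torusPos (N s L L')) (torusPos (cube d L)) D' (C' / L) (qca φ hF') (qca φ hF) := by
    intro s
    induction s using Finset.induction_on with
    | empty =>
      refine ⟨swapDepth d r, 2 * (d * r), by positivity, fun L L' _ _ _ hF hF' => ?_⟩
      have hX : (Lat.torus (cube d L)).Lip (torusPos (cube d L)) (1 / (L : ℕ)) := fun l x => by
        rw [dist_pi_le_iff (by positivity)]
        intro l'
        change dist (ZMod.toAddCircle (x l' + ((Pi.single l 1 : Fin d → ℤ) l' : ZMod L))) _ ≤ _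
        by_cases hl : l' = l
        · rw [hl, Pi.single_eq_same, Int.cast_one]
          exact dist_toAddCircle_add_one _
        · rw [Pi.single_eq_of_ne hl, Int.cast_zero, add_zero]
          exact (dist_self _).le.trans (by positivity)
      have := rel_of_equiv φ hF hF (Equiv.refl _) (fun _ _ => rfl) (by positivity) le_rfl hX
        (fun x => (dist_self (torusPos (cube d L) x)).le)
      have e : (0 : ℝ) + 2 * (d * r) * (1 / (L : ℕ)) = 2 * (d * r) / (L : ℕ) := by ring
      rw [e] at this
      exact this
    | insert j s hj ih =>
      obtain ⟨D', C', hC', ih⟩ := ih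
      let C₁ : ℝ := (2 * H + 1 + 4 * (d * r)) * (1 + 3 * H) + |C j| +
        (15 * H + 2 * ℓ j * Fintype.card (κ j) : ℕ) + 2 * (d * r) * (3 * H + 1) + 2 * (d * r)
      refine ⟨swapDepth d r + (reconnectDepth d r + D j + swapDepth d r) + D', C₁ + C',
        by positivity, fun L L' hL hLL hdvd hF hF' => ?_⟩
      have hTL : 4 * H + T j ≤ L := le_trans (Nat.add_le_add_left
        (Finset.single_le_sum (f := T) (fun _ _ => Nat.zero_le _) (Finset.mem_univ j)) _) hL
      have hNL : ∀ l, L ≤ N s L L' l := fun l => by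
        simp only [N]; split_ifs; exacts [hLL, le_rfl]
      have hNL' : ∀ l, (L : ℕ) ≤ N s L L' l := hNL
      have hfr : ∀ l, 6 * r < N s L L' l := fun l => by have := hNL' l; omega
      have hFs : (Lat.torus (N s L L')).Free (6 * r) := Lat.torus_free hfr
      have h1 := ih L L' hL hLL hdvd hF hFs
      obtain ⟨c, hc⟩ := (PNat.dvd_iff.1 (Finset.dvd_prod_of_mem st (Finset.mem_univ j))).trans hdvd
      have hNj : N s L L' j = L := if_neg hj
      have hNj' : N (insert j s) L L' j = L' := if_pos (Finset.mem_insert_self _ _)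
      have h2 := rel_insert (φ := φ) (j := j) (N := N s L L') (N' := N (insert j s) L L') (s := c)
        (h := H) (ℓ := ℓ j) (C := C j) rfl
        (fun l hl => by simp only [N, Finset.mem_insert, hl, false_or]) (by
          rw [hNj, hNj']
          have h3 : (L : ℕ) ≤ L' := hLL
          have h4 : (st j : ℕ) * c = 2 * ℓ j * (c * Fintype.card (κ j)) := by
            simp only [st, PNat.mk_coe]; ring
          omega)
        (hS j _ (by rw [Function.update_self]) fun i hi => by
          rw [Function.update_of_ne hi]
          have := hNL' i
          omega)
        (by rw [hNj]; omega) (by have := hℓ j; omega) hfr (δ := 1 / (L : ℕ)) (fun l => by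
          have h3 : ((L : ℕ) : ℝ) ≤ (N s L L' l : ℕ) := by exact_mod_cast hNL' l
          have h4 : (0 : ℝ) < (L : ℕ) := by exact_mod_cast L.pos
          exact one_div_le_one_div_of_le h4 h3) hFs hF'
      have hL0 : (0 : ℝ) < (L : ℕ) := by exact_mod_cast L.pos
      have hC₁ : 0 ≤ C₁ := by positivity
      refine Rel.trans (h2.mono le_rfl ?_) (h1.mono le_rfl ?_)
      · rw [mul_one_div]
        exact div_le_div_of_nonneg_right (le_add_of_nonneg_right hC') hL0.le
      · exact div_le_div_of_nonneg_right (le_add_of_nonneg_left hC₁) hL0.le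
  obtain ⟨D', C', hC', hkey⟩ := key Finset.univ
  refine ⟨∏ j, st j, D', C', T₁, hC', fun L L' hL hLL hdvd hF hF' => Rel.symm ?_⟩
  have hN : N Finset.univ L L' = cube d L' := funext fun l => if_pos (Finset.mem_univ l)
  have aux : ∀ N' : Fin d → ℕ+, N' = cube d L' → ∀ hN' : (Lat.torus N').Free (6 * r),
      Rel (torusPos N') (torusPos (cube d L)) D' (C' / L) (qca φ hN') (qca φ hF) →
      Rel (torusPos (cube d L')) (torusPos (cube d L)) D' (C' / L) (qca φ hF') (qca φ hF) := by
    rintro _ rfl _ h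
    exact h
  exact aux _ hN (by rw [hN]; exact hF') (hkey L L' hL hLL hdvd hF _)

/-- Removes the lower bound on `L`. For `L < T₁` the permitted diameter is at least `1`, so one gate
may cover the whole torus and implement any automorphism, since automorphisms are inner. -/
theorem exists_rel (h : ∀ j : Fin d, ∃ ℓ : ℕ+, 12 * r + 12 ≤ ℓ ∧ ReductionTriv φ j ℓ) :
    ∃ (ℓ₀ : ℕ+) (D : ℕ) (C : ℝ), 0 ≤ C ∧ ∀ L L' : ℕ+, L ≤ L' →
      (ℓ₀ : ℕ) ∣ (L' : ℕ) - L → ∀ (hF : (Lat.torus (cube d L)).Free (6 * r))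
        (hF' : (Lat.torus (cube d L')).Free (6 * r)),
        Rel (torusPos (cube d L)) (torusPos (cube d L')) D (C / L) (qca φ hF) (qca φ hF') := by
  obtain ⟨ℓ₀, D, C, T₁, hC, h⟩ := exists_rel_large h
  refine ⟨ℓ₀, D + 1, C + T₁, by positivity, fun L L' hLL hdvd hF hF' => ?_⟩
  have hL0 : (0 : ℝ) < (L : ℕ) := by exact_mod_cast L.pos
  by_cases hL : T₁ ≤ L
  · exact (h L L' hL hLL hdvd hF hF').mono (by omega)
      (div_le_div_of_nonneg_right (le_add_of_nonneg_right (Nat.cast_nonneg _)) hL0.le)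
  · refine (isCirc_of_dist_le (fun i k => (dist_torus_le _ _).trans ?_) _).triv.mono
      (Nat.le_add_left 1 D) le_rfl
    rw [le_div_iff₀ hL0, one_mul]
    have : ((L : ℕ) : ℝ) ≤ T₁ := by exact_mod_cast (not_le.1 hL).le
    linarith

end Deform

/-! ### Contracting unitaries -/

section Contract

theorem exists_mem_unitary_notMem {S : Set ℂ} (hS : S.Finite) : ∃ w ∈ unitary ℂ, w ∉ S := by
  have h : (Metric.sphere (0 : ℂ) 1).Infinite := by
    refine (isPreconnected_sphere (E := ℂ) (by simp [Complex.rank_real_complex]) 0 1).infinite_of_nontrivial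
      ⟨1, by simp, -1, by simp, fun h => ?_⟩
    have := congrArg Complex.re h
    norm_num at this
  obtain ⟨w, hw, hwS⟩ := h.exists_notMem_finite hS
  refine ⟨w, ?_, hwS⟩
  have h1 : ‖w‖ = 1 := by simpa using hw
  rw [Unitary.mem_iff_star_mul_self]
  simp [Complex.conj_mul', h1]

/-- Up to a phase, a unitary matrix is joined to the identity by a path of unitaries. -/
theorem exists_path_one {m : Type} [Fintype m] [DecidableEq m] {U : Matrix m m ℂ}
    (hU : U ∈ unitary (Matrix m m ℂ)) :
    ∃ z ∈ unitary ℂ, ∃ γ : unitInterval → Matrix m m ℂ, Continuous γ ∧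
      (∀ t, γ t ∈ unitary (Matrix m m ℂ)) ∧ γ 0 = z • U ∧ γ 1 = 1 := by
  let e := Matrix.toEuclideanCLM (n := m) (𝕜 := ℂ)
  -- A point `w` of the unit circle off the finite spectrum is rotated to `-1` by the phase `z`.
  -- Then `-1` is off the spectrum of `z • U`, which lies at distance less than `2` from the
  -- identity and is joined to it by a path.
  obtain ⟨w, hw, hwU⟩ := exists_mem_unitary_notMem U.finite_spectrum
  have hz : -(star w) ∈ unitary ℂ := by
    have := Unitary.star_mem hw
    rw [Unitary.mem_iff] at this ⊢
    simpa using this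
  have hzw : -(star w) * w = -1 := by
    rw [neg_mul, Unitary.star_mul_self_of_mem hw]
  generalize -(star w) = z at hz hzw
  have hz0 : z ≠ 0 := fun h => by simp [h] at hzw
  have hzU : z • U ∈ unitary (Matrix m m ℂ) := Unitary.smul_mem_of_mem hz hU
  have h1 : (-1 : ℂ) ∉ spectrum ℂ (z • U) := by
    rw [spectrum.notMem_iff] at hwU ⊢
    have : algebraMap ℂ (Matrix m m ℂ) (-1) - z • U =
        Units.mk0 z hz0 • (algebraMap ℂ (Matrix m m ℂ) w - U) := by
      rw [← hzw, Units.smul_mk0, smul_sub, map_mul, Algebra.smul_def z (algebraMap _ _ w)]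
    rw [this, isUnit_smul_iff]
    exact hwU
  have h2 : (-1 : ℂ) ∉ spectrum ℂ (e (z • U)) := by
    have := AlgEquiv.spectrum_eq (e.toAlgEquiv) (z • U)
    exact fun h => h1 (this ▸ h)
  have he : e (z • U) ∈ unitary _ := Unitary.map_mem e hzU
  have h3 : ‖(((1 : unitary (EuclideanSpace ℂ m →L[ℂ] EuclideanSpace ℂ m)) : _) - e (z • U) :
      EuclideanSpace ℂ m →L[ℂ] EuclideanSpace ℂ m)‖ < 2 := by
    rw [norm_sub_rev]
    exact (Unitary.norm_sub_one_lt_two_iff he).2 h2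
  let p := Unitary.path ⟨e (z • U), he⟩ 1 h3
  have hc : Continuous e.symm :=
    LinearMap.continuous_of_finiteDimensional e.symm.toAlgEquiv.toLinearMap
  refine ⟨z, hz, fun t => e.symm (p t), hc.comp (continuous_subtype_val.comp p.continuous),
    fun t => Unitary.map_mem e.symm (p t).2, ?_, ?_⟩
  · simp only [p.source]
    exact e.symm_apply_apply _
  · simp only [p.target]
    exact map_one e.symm

end Contract

/-! ### Contracting circuits gate by gate -/

section Paths

theorem list_prod_path {ι A : Type*} [Ring A] [Algebra ℂ A] [TopologicalSpace A]
    [ContinuousMul A] (l : List ι) {f : ι → A} {F : ι → unitInterval → A} {z : ι → ℂ}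
    (hz : ∀ i ∈ l, z i ∈ unitary ℂ) (hF : ∀ i ∈ l, Continuous (F i))
    (h0 : ∀ i ∈ l, F i 0 = z i • f i) (h1 : ∀ i ∈ l, F i 1 = 1) :
    ∃ w ∈ unitary ℂ, (Continuous fun t => (l.map fun i => F i t).prod) ∧
      (l.map fun i => F i 0).prod = w • (l.map f).prod ∧ (l.map fun i => F i 1).prod = 1 := by
  induction l with
  | nil => exact ⟨1, one_mem _, by simpa using continuous_const, by simp, by simp⟩
  | cons a l ih =>
    obtain ⟨w, hw, hc, e0, e1⟩ := ih (fun i hi => hz i (by simp [hi]))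
      (fun i hi => hF i (by simp [hi])) (fun i hi => h0 i (by simp [hi]))
      (fun i hi => h1 i (by simp [hi]))
    refine ⟨z a * w, mul_mem (hz a (by simp)) hw, ?_, ?_, ?_⟩
    · simp only [List.map_cons, List.prod_cons]
      exact (hF a (by simp)).mul hc
    · simp only [List.map_cons, List.prod_cons]
      rw [e0, h0 a (by simp), smul_mul_smul_comm]
    · simp only [List.map_cons, List.prod_cons]
      rw [e1, h1 a (by simp), one_mul]

variable {I X : Type} [Fintype I] [DecidableEq I] [PseudoMetricSpace X] {n : I → ℕ}

theorem continuous_emb {Z : Type} [Fintype Z] [DecidableEq Z] {z : Z → ℕ} (ε : SiteEmb n z) :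
    Continuous (emb ε) :=
  LinearMap.continuous_of_finiteDimensional (emb ε).toAlgHom.toLinearMap

/-- The path is taken in the operators on `J` alone, so that the support is kept all along. -/
theorem exists_gate_path [∀ i, NeZero (n i)] {J : Finset I} {U : Op n}
    (hU : U ∈ unitary (Op n)) (hJ : SupportedOn J U) :
    ∃ (z : ℂ) (γ : unitInterval → Op n), z ∈ unitary ℂ ∧ Continuous γ ∧
      (∀ t, γ t ∈ unitary (Op n) ∧ SupportedOn J (γ t)) ∧ γ 0 = z • U ∧ γ 1 = 1 := by
  obtain ⟨B, rfl⟩ := (supportedOn_iff.1 hJ).exists_emb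
  have hB : B ∈ unitary (Op fun i : J => n i) := by
    rw [Unitary.mem_iff] at hU ⊢
    constructor <;> apply emb_injective (SiteEmb.sub n J)
    · rw [map_mul, map_star, map_one, hU.1]
    · rw [map_mul, map_star, map_one, hU.2]
  obtain ⟨z, hz, γ, hc, hγ, h0, h1⟩ := exists_path_one hB
  refine ⟨z, fun t => emb (SiteEmb.sub n J) (γ t), hz, (continuous_emb _).comp hc,
    fun t => ⟨Unitary.map_mem _ (hγ t), ?_⟩, ?_, ?_⟩
  · rw [supportedOn_iff]
    refine (actsOn_emb (SiteEmb.sub n J) (γ t)).mono fun i hi => ?_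
    obtain ⟨k, _, rfl⟩ := Finset.mem_image.1 hi
    exact k.2
  · simp only [h0, map_smul]
  · simp only [h1, map_one]

theorem IsRound.exists_path [∀ i, NeZero (n i)] {pos : I → X} {ρ : ℝ} {U : Op n}
    (h : IsRound pos ρ U) :
    ∃ (z : ℂ) (γ : unitInterval → Op n), z ∈ _root_.unitary ℂ ∧ Continuous γ ∧
      (∀ t, IsRound pos ρ (γ t)) ∧ γ 0 = z • U ∧ γ 1 = 1 := by
  obtain ⟨G, hd, hG, rfl⟩ := h
  choose! z F hz hc hF h0 h1 using fun (g : Finset I × Op n)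
    (hg : g.2 ∈ _root_.unitary (Op n) ∧ SupportedOn g.1 g.2) => exists_gate_path hg.1 hg.2
  obtain ⟨w, hw, hc', e0, e1⟩ := list_prod_path G (f := Prod.snd) (F := F) (z := z)
    (fun g hg => hz g (hG g hg).2) (fun g hg => hc g (hG g hg).2)
    (fun g hg => h0 g (hG g hg).2) (fun g hg => h1 g (hG g hg).2)
  refine ⟨w, _, hw, hc', fun t => ⟨G.map fun g => (g.1, F g t), ?_, ?_, ?_⟩, e0, e1⟩
  · rw [List.pairwise_map]
    exact hd
  · intro g' hg'
    obtain ⟨g, hg, rfl⟩ := List.mem_map.1 hg'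
    exact ⟨(hG g hg).1, hF g (hG g hg).2 t⟩
  · rw [List.map_map]; rfl

/-- Up to a phase, a circuit is joined to the identity by a path of circuits. -/
theorem IsCircuit.exists_path [∀ i, NeZero (n i)] {pos : I → X} {D : ℕ} {ρ : ℝ} {U : Op n}
    (h : IsCircuit pos D ρ U) :
    ∃ (z : ℂ) (γ : unitInterval → Op n), z ∈ _root_.unitary ℂ ∧ Continuous γ ∧
      (∀ t, IsCircuit pos D ρ (γ t)) ∧ γ 0 = z • U ∧ γ 1 = 1 := by
  obtain ⟨l, hl, hr, rfl⟩ := h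
  choose! z F hz hc hF h0 h1 using fun (u : Op n) (hu : IsRound pos ρ u) => hu.exists_path
  obtain ⟨w, hw, hc', e0, e1⟩ := list_prod_path l (f := id) (F := F) (z := z)
    (fun g hg => hz g (hr g hg)) (fun g hg => hc g (hr g hg))
    (fun g hg => h0 g (hr g hg)) (fun g hg => h1 g (hr g hg))
  rw [List.map_id] at e0
  refine ⟨w, _, hw, hc', fun t => ⟨_, by simpa using hl, fun u hu => ?_, rfl⟩, e0, e1⟩
  obtain ⟨g, hg, rfl⟩ := List.mem_map.1 hu
  exact hF g (hr g hg) t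

end Paths

/-! ### Range, and from circuits to paths of QCA -/

section Range

variable {I Z X : Type} [Fintype I] [DecidableEq I] [Fintype Z] [DecidableEq Z]
  [PseudoMetricSpace X] {n : I → ℕ} {z : Z → ℕ}

/-- The sites at distance at most `R` from the site `i`. -/
def near (pos : I → X) (R : ℝ) (i : I) : Finset I :=
  open Classical in Finset.univ.filter fun k => dist (pos k) (pos i) ≤ R

theorem mem_near {pos : I → X} {R : ℝ} {i k : I} : k ∈ near pos R i ↔ dist (pos k) (pos i) ≤ R := by
  simp [near]

theorem hasRange_iff {pos : I → X} {R : ℝ} {α : Aut n} :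
    HasRange pos R α ↔ ∀ i a, ActsOn (near pos R i) (α (siteOp i a)) := by
  constructor
  · intro h i a
    exact supportedOn_iff.1 (h {i} (near pos R i) (fun k => by simp [mem_near]) _
      (supportedOn_iff.2 (actsOn_siteOp i a)))
  · intro h J J' hJ A hA
    refine supportedOn_iff.2 (((supportedOn_iff.1 hA).map_aut h).mono fun k hk => ?_)
    obtain ⟨i, hi, hk⟩ := Finset.mem_biUnion.1 hk
    exact (hJ k).2 ⟨i, hi, mem_near.1 hk⟩

theorem HasRange.mono {pos : I → X} {R R' : ℝ} {α : Aut n} (h : HasRange pos R α) (hR : R ≤ R') :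
    HasRange pos R' α := by
  rw [hasRange_iff] at h ⊢
  exact fun i a => (h i a).mono fun k hk => mem_near.2 ((mem_near.1 hk).trans hR)

theorem HasRange.one {pos : I → X} {R : ℝ} (hR : 0 ≤ R) : HasRange pos R (1 : Aut n) := by
  rw [hasRange_iff]
  refine fun i a => (actsOn_siteOp i a).mono fun k hk => ?_
  rw [Finset.mem_singleton.1 hk, mem_near, dist_self]
  exact hR

theorem HasRange.mul {pos : I → X} {R R' : ℝ} {α β : Aut n} (hα : HasRange pos R α)
    (hβ : HasRange pos R' β) : HasRange pos (R + R') (α * β) := by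
  rw [hasRange_iff] at hα hβ ⊢
  refine fun i a => ((hβ i a).map_aut hα).mono fun k hk => ?_
  obtain ⟨l, hl, hk⟩ := Finset.mem_biUnion.1 hk
  exact mem_near.2 ((dist_triangle _ (pos l) _).trans
    (add_le_add (mem_near.1 hk) (mem_near.1 hl)))

theorem HasRange.amb {pos : I → X} {pos' : Z → X} {R : ℝ} {α : Aut n} (hα : HasRange pos R α)
    (hR : 0 ≤ R) (ε : SiteEmb n z) (hε : ∀ i, pos' (ε i) = pos i) :
    HasRange pos' R (amb ε α) := by
  rw [hasRange_iff] at hα ⊢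
  intro y b
  by_cases h : ∃ i, ε i = y
  · obtain ⟨i, rfl⟩ := h
    have e : siteOp (ε i) b = emb ε (siteOp i (castM (ε.dim i).symm b)) := by simp
    rw [e, amb_emb]
    refine ((hα i _).emb ε).mono fun k hk => ?_
    obtain ⟨l, hl, rfl⟩ := Finset.mem_image.1 hk
    rw [mem_near, hε, hε]
    exact mem_near.1 hl
  · rw [amb_siteOp ε α (by simpa using h)]
    refine (actsOn_siteOp y b).mono fun k hk => ?_
    rw [Finset.mem_singleton.1 hk, mem_near, dist_self]
    exact hR

/-- Conjugation by a unitary operator. -/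
def conjAut (U : unitary (Op n)) : Aut n := Unitary.conjStarAlgAut ℂ (Op n) U

/-- At most one gate of a round contains the site; the other gates commute with everything that gate
can produce. -/
theorem actsOn_conj_gates (i : I) (a) : ∀ G : List (Finset I × Op n),
    G.Pairwise (fun g h => Disjoint g.1 h.1) →
    (∀ g ∈ G, g.2 ∈ _root_.unitary (Op n) ∧ ActsOn g.1 g.2) →
    ∃ J : Finset I, ActsOn J ((G.map Prod.snd).prod * siteOp i a * star (G.map Prod.snd).prod) ∧
      (J = {i} ∨ ∃ g ∈ G, i ∈ g.1 ∧ J = g.1)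
  | [], _, _ => ⟨{i}, by simpa using actsOn_siteOp i a, .inl rfl⟩
  | g :: G, hd, hG => by
    obtain ⟨hd1, hd2⟩ := List.pairwise_cons.1 hd
    obtain ⟨J, hJ, hJ'⟩ := actsOn_conj_gates i a G hd2 fun g hg => hG g (by simp [hg])
    have hg := hG g (by simp)
    have e : ((g :: G).map Prod.snd).prod * siteOp i a * star ((g :: G).map Prod.snd).prod =
        g.2 * ((G.map Prod.snd).prod * siteOp i a * star (G.map Prod.snd).prod) * star g.2 := by
      simp only [List.map_cons, List.prod_cons, star_mul, mul_assoc]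
    by_cases hi : i ∈ g.1
    · refine ⟨g.1, ?_, .inr ⟨g, by simp, hi, rfl⟩⟩
      have hJi : J = {i} := by
        refine hJ'.resolve_right ?_
        rintro ⟨h, hh, hih, _⟩
        exact Finset.disjoint_left.1 (hd1 h hh) hi hih
      rw [e]
      have h2 : ActsOn g.1 ((G.map Prod.snd).prod * siteOp i a * star (G.map Prod.snd).prod) :=
        hJ.mono (by simpa [hJi] using hi)
      exact (hg.2.mul h2).mul hg.2.star
    · refine ⟨J, ?_, ?_⟩
      · have hdis : Disjoint g.1 J := by
          rcases hJ' with rfl | ⟨h, hh, _, rfl⟩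
          · simpa using hi
          · exact hd1 h hh
        rw [e, (hg.2.commute hJ hdis).eq, mul_assoc, Unitary.mul_star_self_of_mem hg.1, mul_one]
        exact hJ
      · exact hJ'.imp_right fun ⟨h, hh, h'⟩ => ⟨h, by simp [hh], h'⟩

theorem IsRound.hasRange {pos : I → X} {ρ : ℝ} (hρ : 0 ≤ ρ) {U : Op n} (h : IsRound pos ρ U) :
    HasRange pos ρ (conjAut ⟨U, h.unitary⟩) := by
  rw [hasRange_iff]
  intro i a
  obtain ⟨G, hd, hG, e⟩ := id h
  obtain ⟨J, hJ, hJ'⟩ := actsOn_conj_gates i a G hd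
    fun g hg => ⟨(hG g hg).2.1, supportedOn_iff.1 (hG g hg).2.2⟩
  rw [← e] at hJ
  refine ActsOn.mono (fun k hk => mem_near.2 ?_) hJ
  rcases hJ' with rfl | ⟨g, hg, hi, rfl⟩
  · rw [Finset.mem_singleton.1 hk, dist_self]
    exact hρ
  · exact (hG g hg).1 k hk i hi

theorem IsCircuit.hasRange {pos : I → X} {D : ℕ} {ρ : ℝ} (hρ : 0 ≤ ρ) {U : Op n}
    (h : IsCircuit pos D ρ U) {α : Aut n} (hα : ∀ A, α A = U * A * Star.star U) :
    HasRange pos (D * ρ) α := by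
  obtain ⟨l, rfl, hl, rfl⟩ := h
  induction l generalizing α with
  | nil =>
    have : α = 1 := by
      refine StarAlgEquiv.ext fun A => ?_
      rw [hα, List.prod_nil, star_one, mul_one, one_mul]
      rfl
    rw [this]
    exact HasRange.one (by simp)
  | cons u l ih =>
    have hl' : l.prod ∈ _root_.unitary (Op n) :=
      Submonoid.list_prod_mem _ fun v hv => (hl v (by simp [hv])).unitary
    have hu := hl u (by simp)
    have h1 := hu.hasRange hρ
    have h2 := ih (fun v hv => hl v (by simp [hv])) (α := conjAut ⟨l.prod, hl'⟩) fun A => rfl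
    have : α = conjAut ⟨u, hu.unitary⟩ * conjAut ⟨l.prod, hl'⟩ := by
      refine StarAlgEquiv.ext fun A => ?_
      rw [hα]
      change _ = u * (l.prod * A * Star.star l.prod) * Star.star u
      rw [List.prod_cons, star_mul]
      simp only [mul_assoc]
    rw [this]
    refine HasRange.mono (h1.mul h2) ?_
    rw [List.length_cons]
    push_cast
    linarith

/-- The circuit is contracted through circuits of the same depth and gate size, whose range is at
most `D * ρ`. Its initial phase cancels under conjugation. -/
theorem CircuitEquiv.pathEquiv [∀ i, NeZero (n i)] {pos : I → X} {D : ℕ} {ρ R : ℝ} (hρ : 0 ≤ ρ)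
    {α β : Aut n} (h : CircuitEquiv pos D ρ α β) (hβ : HasRange pos R β) :
    PathEquiv pos (D * ρ + R) α β := by
  obtain ⟨U, hU, e⟩ := h
  obtain ⟨z, γ, hz, hc, hγ, h0, h1⟩ := hU.exists_path
  refine ⟨fun t => conjAut ⟨γ t, (hγ t).unitary⟩ * β, fun A => ?_, fun t => ?_, ?_, ?_⟩
  · change Continuous fun t => γ t * β A * star (γ t)
    exact (hc.mul continuous_const).mul hc.star
  · exact ((hγ t).hasRange hρ fun A => rfl).mul hβ
  · ext1 A
    change γ 0 * β A * star (γ 0) = α A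
    rw [h0, e, star_smul, smul_mul_assoc, smul_mul_smul_comm, Unitary.mul_star_self_of_mem hz,
      one_smul]
  · ext1 A
    change γ 1 * β A * star (γ 1) = β A
    rw [h1, star_one, mul_one, one_mul]

end Range

/-! ### The concrete stabilization and transport in terms of `amb` -/

section Stabilize

variable {I J K : Type} [Fintype I] [DecidableEq I] [Fintype J] [DecidableEq J] [Fintype K]
  [DecidableEq K] {n : I → ℕ} {m : J → ℕ}

theorem reindex_apply' {a b : Type} [Fintype a] [DecidableEq a] [Fintype b] [DecidableEq b]
    (e : a ≃ b) (A : Matrix a a ℂ) (s t : b) : reindex e A s t = A (e.symm s) (e.symm t) := rfl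

/-- The block of an operator given by fixed states of the ancillas. -/
def block (a : K → ℕ) (x y : Config a) (M : Op (Sum.elim n a)) : Op n :=
  Matrix.of fun s t => M (configSum n a (x, s)) (configSum n a (y, t))

theorem stabilize_eq_of_block {a : K → ℕ} {α : Aut n} {M M' : Op (Sum.elim n a)}
    (h : ∀ x y, α (block a x y M) = block a x y M') : stabilize a α M = M' := by
  ext σ τ
  obtain ⟨⟨x, s⟩, rfl⟩ := (configSum n a).surjective σ
  obtain ⟨⟨y, t⟩, rfl⟩ := (configSum n a).surjective τ
  exact congrFun (congrFun (h x y) s) t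

theorem block_emb (a : K → ℕ) (x y : Config a) (A : Op n) :
    block a x y (emb (SiteEmb.inl n a) A) = if x = y then A else 0 := by
  ext s t
  have h1 : block a x y (emb (SiteEmb.inl n a) A) s t =
    emb (SiteEmb.inl n a) A (configSum n a (x, s)) (configSum n a (y, t)) := rfl
  rw [h1, emb_apply]
  by_cases h : x = y
  · subst h
    rw [if_pos rfl, if_pos]
    · rfl
    · rintro (z | z) hz
      · exact absurd rfl (hz z)
      · rfl
  · rw [if_neg h, if_neg]
    · rfl
    · exact fun h' => h (funext fun k => h' (Sum.inr k) (by simp))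

theorem block_siteOp (a : K → ℕ) (x y : Config a) (k : K)
    (b : Matrix (Fin (Sum.elim n a (Sum.inr k))) (Fin (Sum.elim n a (Sum.inr k))) ℂ) :
    ∃ c : ℂ, block (n := n) a x y (siteOp (n := Sum.elim n a) (Sum.inr k) b) = c • 1 := by
  refine ⟨if ∀ l, l ≠ k → x l = y l then b (x k) (y k) else 0, ?_⟩
  ext s t
  have h1 : block a x y (siteOp (n := Sum.elim n a) (Sum.inr k) b) s t =
    siteOp (n := Sum.elim n a) (Sum.inr k) b (configSum n a (x, s)) (configSum n a (y, t)) := rfl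
  rw [h1, siteOp_apply, Matrix.smul_apply, Matrix.one_apply]
  by_cases hst : s = t
  · subst hst
    have : (∀ y', y' ≠ Sum.inr k → configSum n a (x, s) y' = configSum n a (y, s) y') ↔
        ∀ l, l ≠ k → x l = y l := by
      constructor
      · exact fun h l hl => h (Sum.inr l) (by simpa using hl)
      · rintro h (z | z) hz
        · rfl
        · exact h z (by simpa using hz)
    simp only [this, if_true, smul_eq_mul, mul_one]
    rfl
  · rw [if_neg hst, if_neg, smul_zero]
    exact fun h => hst (funext fun i => h (Sum.inl i) (by simp))

/-- `stabilize` applies `α` to each block given by two ancilla configurations. The blocks of `A ⊗ 1`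
are `A` or `0`, and those of an ancilla operator are scalars, which `α` fixes; so both automorphisms
agree on generators. -/
theorem stabilize_eq_amb (a : K → ℕ) (α : Aut n) :
    stabilize a α = amb (SiteEmb.inl n a) α := by
  refine aut_ext_emb (SiteEmb.inl n a) (fun i b => ?_) fun y hy b => ?_
  · rw [amb_emb]
    refine stabilize_eq_of_block fun x y => ?_
    rw [block_emb, block_emb]
    split_ifs
    · rfl
    · exact map_zero α
  · rw [amb_siteOp _ _ hy]
    rcases y with y | k
    · exact absurd rfl (hy y)
    · refine stabilize_eq_of_block fun x y => ?_
      obtain ⟨c, hc⟩ := block_siteOp (n := n) a x y k b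
      rw [hc, map_smul, map_one]

theorem reindex_eq_emb (e : I ≃ J) (h : ∀ i, n i = m (e i)) (A : Op n) :
    reindex (Equiv.piCongr e fun i => finCongr (h i)) A = emb (SiteEmb.ofEquiv e h) A := by
  ext σ τ
  rw [reindex_apply', emb_apply, if_pos fun y hy => absurd (e.apply_symm_apply y) (hy _)]
  rfl

theorem transport_eq_amb (e : I ≃ J) (h : ∀ i, n i = m (e i)) (α : Aut n) :
    transport e h α = amb (SiteEmb.ofEquiv e h) α := by
  have key : ∀ E : Op n ≃⋆ₐ[ℂ] Op m, (∀ A, E A = emb (SiteEmb.ofEquiv e h) A) →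
      (E.symm.trans α).trans E = amb (SiteEmb.ofEquiv e h) α := by
    intro E hE
    refine StarAlgEquiv.ext fun A => ?_
    obtain ⟨B, rfl⟩ : ∃ B, E B = A := ⟨E.symm A, E.apply_symm_apply A⟩
    rw [StarAlgEquiv.trans_apply, StarAlgEquiv.trans_apply, E.symm_apply_apply, hE, hE, amb_emb]
  exact key (reindex (Equiv.piCongr e fun i => finCongr (h i))) (reindex_eq_emb e h)

theorem autPow_eq_pow (α : Aut n) (k : ℕ) : autPow α k = α ^ k := by
  induction k with
  | zero => rfl
  | succ k ih => rw [pow_succ', ← ih]; rfl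

end Stabilize

/-! ### Translation between `Rel`, `Triv` and the stable relations -/

section Convert

variable {I J X : Type} [Fintype I] [DecidableEq I] [Fintype J] [DecidableEq J]
  [PseudoMetricSpace X] {n : I → ℕ} {m : J → ℕ}

/-- Stabilizing and transporting the identity gives the identity again, so the ancillas of the
second system play no role. -/
theorem StablyCircuitEquiv.triv {D : ℕ} {ρ : ℝ} {pos : I → X} {pos' : J → X} {α : Aut n}
    (h : StablyCircuitEquiv D ρ pos pos' α (StarAlgEquiv.refl ℂ (Op m))) : Triv pos D ρ α := by
  obtain ⟨K, K', fK, dK, fK', dK', a, a', p, p', e, he, ha, _, _, U, hU, h⟩ := h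
  refine ⟨K, fK, dK, a, p, ha, U, hU, fun A => ?_⟩
  have h1 : transport e he (stabilize a' (StarAlgEquiv.refl ℂ (Op m))) = 1 := by
    rw [transport_eq_amb, stabilize_eq_amb]
    have : StarAlgEquiv.refl ℂ (Op m) = 1 := rfl
    rw [this, map_one, map_one]
  rw [← stabilize_eq_amb, h, h1]
  rfl

/-- The form of stable circuit equivalence in which the two systems of qudits serve as ancillas for
each other. -/
theorem Rel.exists_circuitEquiv {q : ℕ} (hq : 0 < q) {posI : I → X} {posJ : J → X} {D : ℕ} {ρ : ℝ}
    {α : Aut fun _ : I => q} {β : Aut fun _ : J => q} (h : Rel posI posJ D ρ α β) :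
    ∃ (K K' : Type) (_ : Fintype K) (_ : DecidableEq K) (_ : Fintype K') (_ : DecidableEq K')
      (a : K → ℕ) (a' : K' → ℕ) (p : K → X) (p' : K' → X) (e : J ⊕ K' ≃ I ⊕ K)
      (he : ∀ s, Sum.elim (fun _ : J => q) a' s = Sum.elim (fun _ : I => q) a (e s)),
      (∀ k, 0 < a k) ∧ (∀ k, 0 < a' k) ∧ (∀ s, Sum.elim posJ p' s = Sum.elim posI p (e s)) ∧
      CircuitEquiv (Sum.elim posI p) D ρ (stabilize a α) (transport e he (stabilize a' β)) := by
  obtain ⟨K, fK, dK, a, p, ha, U, hU, h⟩ := h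
  -- Each system serves as an ancilla for the other, together with the common ancillas `K`.
  let e : J ⊕ (I ⊕ K) ≃ I ⊕ (J ⊕ K) :=
    { toFun := Sum.elim (fun y => .inr (.inl y)) (Sum.elim .inl fun k => .inr (.inr k))
      invFun := Sum.elim (fun x => .inr (.inl x)) (Sum.elim .inl fun k => .inr (.inr k))
      left_inv := by rintro (x | x | x) <;> rfl
      right_inv := by rintro (x | x | x) <;> rfl }
  have he : ∀ s, Sum.elim (fun _ : J => q) (Sum.elim (fun _ : I => q) a) s =
      Sum.elim (fun _ : I => q) (Sum.elim (fun _ : J => q) a) (e s) := by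
    rintro (x | x | x) <;> rfl
  refine ⟨J ⊕ K, I ⊕ K, inferInstance, inferInstance, inferInstance, inferInstance,
    Sum.elim (fun _ => q) a, Sum.elim (fun _ => q) a, Sum.elim posJ p, Sum.elim posI p, e, he,
    ?_, ?_, ?_, ?_⟩
  · rintro (k | k); exacts [hq, ha k]
  · rintro (k | k); exacts [hq, ha k]
  · rintro (x | x | x) <;> rfl
  let η : SiteEmb (Sum.elim (fun _ : I ⊕ J => q) a)
      (Sum.elim (fun _ : I => q) (Sum.elim (fun _ : J => q) a)) :=
    SiteEmb.ofEquiv (Equiv.sumAssoc I J K) (by rintro ((x | x) | x) <;> rfl)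
  have hc : IsCirc (Sum.elim posI (Sum.elim posJ p)) D ρ _ :=
    IsCirc.amb (pos' := Sum.elim posI (Sum.elim posJ p)) ⟨U, hU, h⟩ η
      (by rintro ((x | x) | x) <;> rfl)
  obtain ⟨V, hV, hVe⟩ := hc
  refine ⟨V, hV, fun A => ?_⟩
  rw [stabilize_eq_amb, stabilize_eq_amb, transport_eq_amb, ← hVe, map_mul, map_mul, map_inv,
    map_inv, ← amb_comp, ← amb_comp, ← amb_comp, ← amb_comp, ← amb_comp]
  have e1 : (η.comp (SiteEmb.inl (fun _ : I ⊕ J => q) a)).comp (injl q I J) =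
      SiteEmb.inl (fun _ : I => q) (Sum.elim (fun _ : J => q) a) := rfl
  have e2 : (η.comp (SiteEmb.inl (fun _ : I ⊕ J => q) a)).comp (injr q I J) =
      (SiteEmb.ofEquiv e he).comp (SiteEmb.inl (fun _ : J => q) (Sum.elim (fun _ : I => q) a)) :=
    rfl
  rw [e1, e2]
  have e3 : ∀ F G : Aut (Sum.elim (fun _ : I => q) (Sum.elim (fun _ : J => q) a)),
      F A = (F * G⁻¹) (G A) := by
    intro F G
    change _ = (F * G⁻¹ * G) A
    rw [inv_mul_cancel_right]
  exact e3 _ _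

end Convert

section Convert

variable {I J X : Type} [Fintype I] [DecidableEq I] [Fintype J] [DecidableEq J]
  [PseudoMetricSpace X] {q : ℕ}

theorem Rel.stablyCircuitEquiv (hq : 0 < q) {posI : I → X} {posJ : J → X} {D : ℕ} {ρ : ℝ}
    {α : Aut fun _ : I => q} {β : Aut fun _ : J => q} (h : Rel posI posJ D ρ α β) :
    StablyCircuitEquiv D ρ posI posJ α β := h.exists_circuitEquiv hq

theorem Rel.stablyPathEquiv (hq : 0 < q) {posI : I → X} {posJ : J → X} {D : ℕ} {ρ R : ℝ}
    (hρ : 0 ≤ ρ) (hR : 0 ≤ R) {α : Aut fun _ : I => q} {β : Aut fun _ : J => q}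
    (h : Rel posI posJ D ρ α β) (hβ : HasRange posJ R β) :
    StablyPathEquiv (D * ρ + R) posI posJ α β := by
  obtain ⟨K, K', fK, dK, fK', dK', a, a', p, p', e, he, ha, ha', hp, h⟩ := h.exists_circuitEquiv hq
  refine ⟨K, K', fK, dK, fK', dK', a, a', p, p', e, he, ha, ha', hp, ?_⟩
  have : ∀ s, NeZero (Sum.elim (fun _ : I => q) a s) := by
    rintro (s | s)
    exacts [⟨hq.ne'⟩, ⟨(ha s).ne'⟩]
  refine h.pathEquiv hρ ?_
  rw [transport_eq_amb, stabilize_eq_amb]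
  exact (hβ.amb hR (SiteEmb.inl _ a') (pos' := Sum.elim posJ p') fun _ => rfl).amb hR
    (SiteEmb.ofEquiv e he) fun s => (hp s).symm

end Convert

/-! ### Assembling the deformations and the coherent sequence -/

section Main

variable {d q r : ℕ}

theorem hasRange_qca [NeZero q] (φ : Rule d r q) {N : Fin d → ℕ+}
    (hF : (Lat.torus N).Free (6 * r)) {R : ℝ} (hR : 0 ≤ R) (h : ∀ j, (r : ℝ) / (N j : ℕ) ≤ R) :
    HasRange (n := qudits q N) (torusPos N) R (qca φ hF) := by
  rw [hasRange_iff]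
  refine fun x a => (actsOn_qca φ hF x a).mono fun k hk => ?_
  obtain ⟨w, _, rfl⟩ := Finset.mem_image.1 hk
  rw [mem_near, dist_pi_le_iff hR]
  intro j
  refine le_trans ?_ (h j)
  have h1 := dist_toAddCircle_le (n := N j) (n' := N j) ((x j).val + offset r w j) (x j).val
  have e : (((x j).val : ℤ) : ZMod (N j)) = x j := by rw [Int.cast_natCast, ZMod.natCast_zmod_val]
  rw [Int.cast_add, e] at h1
  refine le_trans h1 ?_
  rw [← sub_div, Int.cast_add, add_sub_cancel_left, abs_div, Nat.abs_cast]
  gcongr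
  exact_mod_cast abs_offset_le w j

theorem vanishing_of_latticeScale {ε : ℕ+ → ℝ} (h : LatticeScale ε) : Vanishing ε := by
  obtain ⟨c, hc⟩ := h
  have h2 : Tendsto (fun L : ℕ+ => (L : ℕ)) atTop atTop :=
    tendsto_atTop_atTop_of_monotone (fun _ _ h => h) fun b => ⟨b.succPNat, Nat.le_succ b⟩
  have h1 : Tendsto (fun L : ℕ+ => c / ((L : ℕ) : ℝ)) atTop (𝓝 0) :=
    (tendsto_const_div_atTop_nhds_zero_nat c).comp h2
  exact h1.congr fun L => (hc L).symm

theorem ReductionHasFiniteOrder.vanishing {L₀ : ℕ+} {α : ∀ N : Fin d → ℕ+, Aut (qudits q N)}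
    {j : Fin d} {ℓ : ℕ+} (h : ReductionHasFiniteOrder LatticeScale L₀ α j ℓ) :
    ReductionHasFiniteOrder Vanishing L₀ α j ℓ := by
  obtain ⟨k, hk, D, ε, hε, h⟩ := h
  exact ⟨k, hk, D, ε, vanishing_of_latticeScale hε, h⟩

theorem DeformsInSteps.vanishing {L₀ ℓ₀ : ℕ+} {α : ∀ N : Fin d → ℕ+, Aut (qudits q N)}
    (h : DeformsInSteps LatticeScale L₀ α ℓ₀) : DeformsInSteps Vanishing L₀ α ℓ₀ := by
  obtain ⟨D, ε, hε, h⟩ := h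
  exact ⟨D, ε, vanishing_of_latticeScale hε, h⟩

/-- If the dimensional reductions have finite order, then the QCA on the cubic tori deform into each
other at the lattice scale, and the sizes `a * 2 ^ i` form a coherent sequence. -/
theorem deformsInSteps_and_isCoherent (hq : 1 ≤ q) {L₀ : ℕ+}
    {α : ∀ N : Fin d → ℕ+, Aut (qudits q N)} (hα : IsObviousFamily r L₀ α)
    (h : ∀ j : Fin d, ∃ ℓ₁ : ℕ+, ∀ ℓ : ℕ+, ℓ₁ ≤ ℓ → ReductionHasFiniteOrder Vanishing L₀ α j ℓ) :
    ∃ ℓ₀ : ℕ+, DeformsInSteps LatticeScale L₀ α ℓ₀ ∧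
      ∀ a : ℕ+, L₀ ≤ a → (ℓ₀ : ℕ) ∣ (a : ℕ) →
        IsCoherent (fun i => torusPos (cube d (a * 2 ^ i))) (fun i => α (cube d (a * 2 ^ i))) := by
  obtain ⟨_, φ, hφ⟩ := exists_rule hq hα
  have hfree : ∀ L : ℕ+, L₀ ≤ L → (Lat.torus (cube d L)).Free (6 * r) := fun L hL =>
    Lat.torus_free fun _ => six_mul_lt hα.1 hL
  have hred : ∀ j : Fin d, ∃ ℓ : ℕ+, 12 * r + 12 ≤ ℓ ∧ ReductionTriv φ j ℓ := by
    intro j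
    obtain ⟨ℓ₁, h⟩ := h j
    -- Large enough for the hypothesis, for the rule to describe the thin torus, and for segments of
    -- half-length `6 * r + 6` to fit into a cycle of length `ℓ`.
    let ℓ : ℕ+ := max ℓ₁ (max L₀ ⟨12 * r + 12, by omega⟩)
    have h1 : ℓ₁ ≤ ℓ := le_max_left _ _
    have h2 : L₀ ≤ ℓ := (le_max_left _ _).trans (le_max_right _ _)
    have h3 : (⟨12 * r + 12, by omega⟩ : ℕ+) ≤ ℓ := (le_max_right _ _).trans (le_max_right _ _)
    obtain ⟨k, hk, D, ε, hε, h⟩ := h ℓ h1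
    refine ⟨ℓ, h3, k, hk, D, ε, hε, L₀, fun L hL hF => ?_⟩
    have h4 := (h L hL).triv
    rw [autPow_eq_pow, hφ _ (fun i => by dsimp only [slab]; split_ifs <;> assumption) hF] at h4
    exact h4
  obtain ⟨ℓ₀, D, C, hC, hrel⟩ := exists_rel hred
  refine ⟨ℓ₀, ⟨D, fun L => C / (L : ℕ), ⟨C, fun _ => rfl⟩, fun L L' hL hLL' hd => ?_⟩,
    fun a ha hdvd => ?_⟩
  · rw [hφ _ (fun _ => hL) (hfree L hL), hφ _ (fun _ => hL.trans hLL') (hfree L' (hL.trans hLL'))]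
    exact (hrel L L' hLL' hd _ _).stablyCircuitEquiv hq
  · have hL : ∀ i : ℕ, L₀ ≤ a * 2 ^ i := fun i => ha.trans (le_mul_of_one_le_right' one_le)
    have hcast : ∀ i : ℕ, ((a * 2 ^ i : ℕ+) : ℕ) = (a : ℕ) * 2 ^ i := fun i => by
      rw [PNat.mul_coe, PNat.pow_coe]; rfl
    have ha0 : (0 : ℝ) < (a : ℕ) := by exact_mod_cast a.pos
    have hR : ∀ i : ℕ, ((r : ℝ) + 1) / (a : ℕ) / 2 ^ i = (r + 1) / ((a * 2 ^ i : ℕ+) : ℕ) :=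
      fun i => by rw [hcast, div_div]; push_cast; rfl
    -- The numerator `r + 1` instead of `r` keeps the range positive when `r = 0`. The constant
    -- collects the range `D * C / L` of the circuit and the range `(r + 1) / L` used for the next
    -- QCA.
    refine ⟨((r : ℝ) + 1) / (a : ℕ), by positivity, fun i => ?_, D * C / (r + 1) + 1, fun i => ?_⟩
    · beta_reduce
      rw [hφ _ (fun _ => hL i) (hfree _ (hL i)), hR]
      refine hasRange_qca φ _ (by positivity) fun _ => ?_
      gcongr
      linarith
    · beta_reduce
      rw [hφ _ (fun _ => hL i) (hfree _ (hL i)), hφ _ (fun _ => hL (i + 1)) (hfree _ (hL (i + 1)))]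
      have hle : a * 2 ^ i ≤ a * 2 ^ (i + 1) := by
        rw [pow_succ, ← mul_assoc]
        exact le_mul_of_one_le_right' one_le
      -- The two sizes differ by `a * 2 ^ i`, a multiple of `ℓ₀` because `a` is one.
      have hdvd' : (ℓ₀ : ℕ) ∣ ((a * 2 ^ (i + 1) : ℕ+) : ℕ) - ((a * 2 ^ i : ℕ+) : ℕ) := by
        rw [hcast, hcast, ← Nat.mul_sub]
        exact hdvd.mul_right _
      have h1 := hrel _ _ hle hdvd' (hfree _ (hL i)) (hfree _ (hL (i + 1)))
      have h2 := h1.stablyPathEquiv hq (by positivity) (R := ((r : ℝ) + 1) / ((a * 2 ^ i : ℕ+) : ℕ))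
        (by positivity) (hasRange_qca φ _ (by positivity) fun _ => by
          have : (((a * 2 ^ i : ℕ+) : ℕ) : ℝ) ≤ ((a * 2 ^ (i + 1) : ℕ+) : ℕ) := by exact_mod_cast hle
          gcongr
          linarith)
      have e : (D : ℝ) * (C / ((a * 2 ^ i : ℕ+) : ℕ)) + ((r : ℝ) + 1) / ((a * 2 ^ i : ℕ+) : ℕ) =
          (D * C / (r + 1) + 1) * (((r : ℝ) + 1) / (a : ℕ) / 2 ^ i) := by
        rw [hR]
        field_simp
      rw [e] at h2
      exact h2

end Main

end QCA

end

theorem mainTheorem4 {d q : ℕ} (hq : 1 ≤ q) (r : ℕ) (L₀ : ℕ+)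
    (α : ∀ N : Fin d → ℕ+, QCA.Aut (QCA.qudits q N))
    (hα : QCA.IsObviousFamily r L₀ α) :
    ((∀ j : Fin d, ∃ ℓ₁ : ℕ+, ∀ ℓ : ℕ+, ℓ₁ ≤ ℓ →
        QCA.ReductionHasFiniteOrder QCA.Vanishing L₀ α j ℓ) →
      (∃ ℓ₀ : ℕ+, QCA.DeformsInSteps QCA.Vanishing L₀ α ℓ₀) ∧
      ∃ S : ℕ → ℕ+, StrictMono S ∧ L₀ ≤ S 0 ∧
        QCA.IsCoherent (fun i => QCA.torusPos (QCA.cube d (S i)))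
          (fun i => α (QCA.cube d (S i)))) ∧
    ((∀ j : Fin d, ∃ ℓ₁ : ℕ+, ∀ ℓ : ℕ+, ℓ₁ ≤ ℓ →
        QCA.ReductionHasFiniteOrder QCA.LatticeScale L₀ α j ℓ) →
      ∃ ℓ₀ : ℕ+, QCA.DeformsInSteps QCA.LatticeScale L₀ α ℓ₀ ∧
        ∀ a : ℕ+, L₀ ≤ a → (ℓ₀ : ℕ) ∣ (a : ℕ) →
          QCA.IsCoherent (fun i => QCA.torusPos (QCA.cube d (a * 2 ^ i)))
            (fun i => α (QCA.cube d (a * 2 ^ i)))) := by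
  -- Both parts come from one statement: vanishing gate size is the weaker hypothesis and the
  -- lattice scale is the stronger conclusion.
  refine ⟨fun h => ?_, fun h => QCA.deformsInSteps_and_isCoherent hq hα fun j => ?_⟩
  · obtain ⟨ℓ₀, h1, h2⟩ := QCA.deformsInSteps_and_isCoherent hq hα h
    have hL : L₀ ≤ ℓ₀ * L₀ := le_mul_of_one_le_left' one_le
    -- The starting size `ℓ₀ * L₀` is divisible by `ℓ₀` and at least `L₀`.
    refine ⟨⟨ℓ₀, h1.vanishing⟩, fun i => ℓ₀ * L₀ * 2 ^ i, strictMono_nat_of_lt_succ fun i => ?_,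
      ?_, h2 (ℓ₀ * L₀) hL ?_⟩
    · rw [pow_succ, ← mul_assoc]
      exact lt_mul_of_one_lt_right' _ (by decide)
    · beta_reduce
      rwa [pow_zero, mul_one]
    · rw [PNat.mul_coe]
      exact dvd_mul_right _ _
  · obtain ⟨ℓ₁, h⟩ := h j
    exact ⟨ℓ₁, fun ℓ hℓ => (h ℓ hℓ).vanishing⟩
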